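/- **Setting.** Let $G=\mathrm{GL}_2^+(\mathbb Q)$, $LR(x)=\begin{pmatrix}1&0\\0&x\end{pmatrix}$, $D(x)=\begin{pmatrix}x&0\\0&x\end{pmatrix}$. For a set $S$ of primes let $\mathbb Z_S\subset\mathbb Q$ be the ring of rationals integral at all primes of $S$, $G_S=\mathrm{GL}_2^+(\mathbb Z_S)$, $G_S(N)\subset G_S$ the subgroup of matrices upper triangular modulo $N$, and $\mathbb A^S$ the ring of finite adeles away from $S$. For $R=\mathbb A^S$ or $R=\mathbb Q_p$ let $\mathcal S(R^2)$ be the group of Schwartz–Bruhat functions $R^2\to\mathbb Z$ (locally constant with compact support) that vanish at $0$, $R^2$ being row vectors, and let $\mathcal D'(R^2,A)=\mathrm{Hom}(\mathcal S(R^2),A)$. $G$ acts by $(f|\gamma)(v)=f(v\gamma^{-1})$ and $(\gamma*\mu)(f)=\gamma\cdot\mu(f|\gamma)$; the action is trivial on $A=\mathbb Z$ and is $(\gamma\cdot F)(\tau)=F(\gamma^{-1}\tau)$ on the additive group $\mathcal O$ of holomorphic functions and the multiplicative group $\mathcal O^\times$ of nowhere vanishing holomorphic functions on the upper half plane. Extending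 test functions by the characteristic function of the integral vectors at the remaining primes gives pullbacks $\mathcal D'((\mathbb A^S)^2,A)\to\mathcal D'((\mathbb A^T)^2,A)$ for $S\subset T$, and $\to\mathcal D'(\mathbb Q_p^2,A)$ for $p\notin S$. Let $c>1$ be an integer coprime to $6$, $N\ge1$ an integer coprime to $c$, $p$ a prime with $p\nmid Nc$, and $\delta=\sum_{D\mid N}n_D[LR(D)]$ with $n_D\in\mathbb Z$ and $\sum_{D\mid N}n_D D=0$ (the sum $\sum n_D$ need not vanish). Let $\mathscr S$, $\mathscr N$, $\mathscr P$ be the sets of primes dividing $c$, dividing $cN$, and different from $p$. *The Dedekind–Rademacher class.* With $q=e^{2\pi i\tau}$, $t=e^{2\pi iu}$, put $$\Theta(u,\tau)=q^{1/12}(t^{1/2}-t^{-1/2})\prod_{n\ge1}(1-q^nt)(1-q^nt^{-1}),\qquad \vartheta_c(u,\tau)=(-1)^{(c-1)/2}\,\Theta(u,\tau)^{c^2}\,\Theta(cu,\tau)^{-1}.$$ The Kato–Siegel distribution $\mu_{KS}\in\mathcal D'((\mathbb A^{\mathscr S})^2,\mathcal O^\times)$ is the $G_{\mathscr S}$-invariant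 distribution whose value on the characteristic function of $(a,b)+\prod_{\ell\notin\mathscr S}\mathbb Z_\ell^2$ is $\tau\mapsto\vartheta_c(a\tau+b,\tau)$, for all $(a,b)\in\mathbb Z_{\mathscr S}^2\setminus\mathbb Z^2$. The Dedekind–Rademacher class $\mu_{DR}\in H^1(G_{\mathscr S},\mathcal D'((\mathbb A^{\mathscr S})^2,\mathbb Z))$ is the image of $\mu_{KS}$ under the connecting map of $$0\to\mathcal D'((\mathbb A^{\mathscr S})^2,\mathbb Z)\to\mathcal D'((\mathbb A^{\mathscr S})^2,\mathcal O)\xrightarrow{\exp(2\pi i\,\cdot)}\mathcal D'((\mathbb A^{\mathscr S})^2,\mathcal O^\times)\to1 .$$ Pull back a homogeneous cocycle $z$ of class $\mu_{DR}$ to values in $\mathcal D'((\mathbb A^{\mathscr N})^2,\mathbb Z)$ and put $(\delta*z)(g_0,g_1)=\sum_D n_D\,LR(D)*z(LR(D)^{-1}g_0,LR(D)^{-1}g_1)$, restricted to $G_{\mathscr N}(N)$; its class is $\mu_{DR}^\delta$. Let $\mu_{DR}^{p\delta}\in H^1(G_{\mathscr P}(N),\mathcal D'(\mathbb Q_p^2,\mathbb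 Z))$ be the restriction of $\mu_{DR}^\delta$ to $G_{\mathscr P}(N)$ and to $p$-adic distributions. *The Darmon–Dasgupta cocycle.* Let $\Gamma_0^p(N)=G_{\mathscr P}(N)\cap\mathrm{SL}_2(\mathbb Q)$, $\mathbb X_0=\mathbb Z_p^2\setminus p\mathbb Z_p^2$, and, for even $k\ge2$, $E_k(z)=-\frac{B_k}{2k}+\sum_{m\ge1}\sigma_{k-1}(m)e^{2\pi imz}$ and $E_k^\delta(z)=-24\sum_{D\mid N}n_D\,D\,E_k(Dz)$. Let $\tilde\mu_\delta\{r\to s\}$, for $r,s\in\Gamma_0^p(N)i\infty$, be the family of $\mathbb Z$-valued distributions on $\mathbb Q_p^2\setminus\{0\}$ (column vectors) such that 1. $\int_{\mathbb X_0}h\,d\tilde\mu_\delta\{r\to s\}=\mathrm{Re}\big((1-p^{k-2})\int_r^sh(z,1)E_k^\delta(z)\,dz\big)$ (a rational number) for all even $k\ge2$ and all homogeneous $h\in\mathbb Z[x,y]$ of degree $k-2$; for $k=2$ the right side is $0$; 2. $\tilde\mu_\delta\{\gamma r\to\gamma s\}(\gamma U)=\tilde\mu_\delta\{r\to s\}(U)$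 for all $\gamma\in\Gamma_0^p(N)$ and compact open $U$; 3. $\tilde\mu_\delta\{r\to s\}(pU)=\tilde\mu_\delta\{r\to s\}(U)$ for all compact open $U$. The Darmon–Dasgupta cocycle $\mu_{DD,\delta}$ is the homogeneous $1$-cocycle on $G_{\mathscr P}(N)$ with values in $\mathcal D'(\mathbb Q_p^2,\mathbb Z)$ whose value at $(\gamma_1,\gamma_2)\in\Gamma_0^p(N)^2$ is $\tilde\mu_\delta\{\gamma_1i\infty\to\gamma_2i\infty\}$, transported to row vectors by $v\mapsto\begin{pmatrix}0&-1\\1&0\end{pmatrix}v^T$. Its $c$-smoothing is $(\mu_{DD,\delta})_c=c^2\mu_{DD,\delta}-D(c)*\mu_{DD,\delta}$, the central element $D(c)$ acting on the values. **Theorem.** The class $\mu_{DR}$ and the cocycle $\mu_{DD,\delta}$ exist and are uniquely determined by the above, and $-(\mu_{DD,\delta})_c$ lies in the cohomology class $12\cdot\mu_{DR}^{p\delta}$ in $H^1(G_{\mathscr P}(N),\mathcal D'(\mathbb Q_p^2,\mathbb Z))$. -/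

import Mathlib

open scoped UpperHalfPlane MatrixGroups Manifold RestrictedProduct

namespace DedekindRademacher

noncomputable section

/-! ### The group `G = GL₂⁺(ℚ)`, its arithmetic subgroups and some elements -/

/-- `G = GL₂⁺(ℚ)`. -/
abbrev GQ : Type := Matrix.GLPos (Fin 2) ℚ

/-- The underlying rational matrix of an element of `GL₂⁺(ℚ)`. -/
def mat (γ : GQ) : Matrix (Fin 2) (Fin 2) ℚ := ((γ : GL (Fin 2) ℚ) : Matrix (Fin 2) (Fin 2) ℚ)

theorem mat_one : mat 1 = 1 := rfl

theorem mat_mul (γ γ' : GQ) : mat (γ * γ') = mat γ * mat γ' := rfl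

theorem mat_mul_inv (γ : GQ) : mat γ * mat γ⁻¹ = 1 := by
  rw [← mat_mul, mul_inv_cancel, mat_one]

theorem mat_inv_mul (γ : GQ) : mat γ⁻¹ * mat γ = 1 := by
  rw [← mat_mul, inv_mul_cancel, mat_one]

theorem mat_injective : Function.Injective mat := fun _ _ h => Subtype.ext (Units.ext h)

/-- An element of `GL₂⁺(ℚ)` from a matrix with positive determinant. -/
def ofMat (A : Matrix (Fin 2) (Fin 2) ℚ) (h : 0 < A.det) : GQ :=
  ⟨Matrix.GeneralLinearGroup.mkOfDetNeZero A h.ne', h⟩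

theorem mat_ofMat (A : Matrix (Fin 2) (Fin 2) ℚ) (h : 0 < A.det) : mat (ofMat A h) = A := rfl

/-- `LR(x)`, the diagonal matrix with entries `1, x`. -/
def LR (x : ℚ) (hx : 0 < x) : GQ :=
  ofMat !![1, 0; 0, x] (by simpa [Matrix.det_fin_two] using hx)

/-- `D(x)`, the scalar matrix with entries `x, x`. -/
def scalar (x : ℚ) (hx : x ≠ 0) : GQ :=
  ofMat !![x, 0; 0, x] (by simpa [Matrix.det_fin_two] using mul_self_pos.2 hx)

theorem scalar_comm (x : ℚ) (hx : x ≠ 0) (γ : GQ) : scalar x hx * γ = γ * scalar x hx := by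
  apply mat_injective
  rw [mat_mul, mat_mul, scalar, mat_ofMat]
  ext i j
  fin_cases i <;> fin_cases j <;> simp [Matrix.mul_apply, Fin.sum_univ_two, mul_comm]

/-- The set of primes dividing `n`. -/
def primesOf (n : ℕ) : Set Nat.Primes := {ℓ | (ℓ : ℕ) ∣ n}

/-- `ℤ_S`, the ring of rational numbers that are integral at all primes in `S`. -/
def ZS (S : Set Nat.Primes) : Subring ℚ where
  carrier := {x | ∀ ℓ ∈ S, ¬ (ℓ : ℕ) ∣ x.den}
  mul_mem' {x y} hx hy ℓ hℓ h :=
    ((ℓ.2.dvd_mul).1 (h.trans (Rat.mul_den_dvd x y))).elim (hx ℓ hℓ) (hy ℓ hℓ)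
  one_mem' ℓ _ h := ℓ.2.one_lt.ne' (Nat.dvd_one.1 (by simpa using h))
  add_mem' {x y} hx hy ℓ hℓ h :=
    ((ℓ.2.dvd_mul).1 (h.trans (Rat.add_den_dvd x y))).elim (hx ℓ hℓ) (hy ℓ hℓ)
  zero_mem' ℓ _ h := ℓ.2.one_lt.ne' (Nat.dvd_one.1 (by simpa using h))
  neg_mem' {x} hx ℓ hℓ h := hx ℓ hℓ (by simpa using h)

theorem ZS_anti {S T : Set Nat.Primes} (h : S ⊆ T) : ZS T ≤ ZS S :=
  fun _ hx ℓ hℓ => hx ℓ (h hℓ)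

theorem inv_natCast_mem_ZS {S : Set Nat.Primes} {D : ℕ} (hD : 0 < D)
    (h : ∀ ℓ ∈ S, ¬ (ℓ : ℕ) ∣ D) : ((D : ℚ)⁻¹) ∈ ZS S := by
  intro ℓ hℓ hd
  rw [Rat.inv_natCast_den_of_pos hD] at hd
  exact h ℓ hℓ hd

/-- `G_S = GL₂⁺(ℤ_S)`. -/
def GS (S : Set Nat.Primes) : Subgroup GQ where
  carrier := {γ | ∀ i j, mat γ i j ∈ ZS S ∧ mat γ⁻¹ i j ∈ ZS S}
  mul_mem' {a b} ha hb i j := by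
    rw [mul_inv_rev, mat_mul, mat_mul, Matrix.mul_apply, Matrix.mul_apply]
    exact ⟨sum_mem fun k _ => mul_mem (ha i k).1 (hb k j).1,
      sum_mem fun k _ => mul_mem (hb i k).2 (ha k j).2⟩
  one_mem' i j := by
    have h : ∀ i j, (1 : Matrix (Fin 2) (Fin 2) ℚ) i j ∈ ZS S := fun i j => by
      rw [Matrix.one_apply]; split_ifs
      · exact one_mem _
      · exact zero_mem _
    exact ⟨h i j, by rw [inv_one]; exact h i j⟩
  inv_mem' {a} ha i j := ⟨(ha i j).2, by rw [inv_inv]; exact (ha i j).1⟩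

theorem GS_anti {S T : Set Nat.Primes} (h : S ⊆ T) : GS T ≤ GS S :=
  fun _ hγ i j => ⟨ZS_anti h (hγ i j).1, ZS_anti h (hγ i j).2⟩

theorem mat_inv_one_zero (γ : GQ) : mat γ⁻¹ 1 0 = - (mat γ).det⁻¹ * mat γ 1 0 := by
  have h : mat γ⁻¹ = (mat γ)⁻¹ := (Matrix.inv_eq_right_inv (mat_mul_inv γ)).symm
  rw [h, Matrix.inv_def, Matrix.adjugate_fin_two, Ring.inverse_eq_inv']
  simp

/-- `G_S(N)`, the subgroup of the matrices in `G_S` that are upper triangular modulo `N`. -/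
def GSN (S : Set Nat.Primes) (N : ℕ) : Subgroup GQ where
  carrier := {γ | γ ∈ GS S ∧ ∃ x ∈ ZS S, mat γ 1 0 = N * x}
  mul_mem' {a b} := by
    rintro ⟨ha, x, hx, hax⟩ ⟨hb, y, hy, hby⟩
    refine ⟨mul_mem ha hb, x * mat b 0 0 + mat a 1 1 * y,
      add_mem (mul_mem hx (hb 0 0).1) (mul_mem (ha 1 1).1 hy), ?_⟩
    rw [mat_mul, Matrix.mul_apply, Fin.sum_univ_two, hax, hby]
    ring
  one_mem' := ⟨one_mem _, 0, zero_mem _, by simp [mat_one]⟩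
  inv_mem' {a} := by
    rintro ⟨ha, x, hx, hax⟩
    have hd : (mat a).det⁻¹ ∈ ZS S := by
      have h : (mat a).det⁻¹ = (mat a⁻¹).det :=
        inv_eq_of_mul_eq_one_right (by rw [← Matrix.det_mul, mat_mul_inv, Matrix.det_one])
      rw [h, Matrix.det_fin_two]
      exact sub_mem (mul_mem (ha 0 0).2 (ha 1 1).2) (mul_mem (ha 0 1).2 (ha 1 0).2)
    refine ⟨inv_mem ha, -(mat a).det⁻¹ * x, mul_mem (neg_mem hd) hx, ?_⟩
    rw [mat_inv_one_zero, hax]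
    ring

theorem GSN_le (S : Set Nat.Primes) (N : ℕ) : GSN S N ≤ GS S := fun _ h => h.1

theorem GSN_anti {S T : Set Nat.Primes} (h : S ⊆ T) (N : ℕ) : GSN T N ≤ GSN S N := by
  rintro γ ⟨hγ, x, hx, e⟩
  exact ⟨GS_anti h hγ, x, ZS_anti h hx, e⟩

theorem LR_mem_GS {S : Set Nat.Primes} {D : ℕ} (hD : 0 < D) (h : ∀ ℓ ∈ S, ¬ (ℓ : ℕ) ∣ D) :
    LR D (by exact_mod_cast hD) ∈ GS S := by
  have h0 : (D : ℚ) ≠ 0 := by exact_mod_cast hD.ne'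
  have hinv : mat (LR D (by exact_mod_cast hD))⁻¹ = !![1, 0; 0, (D : ℚ)⁻¹] := by
    have h1 : mat (LR D (by exact_mod_cast hD))⁻¹ = (mat (LR D (by exact_mod_cast hD)))⁻¹ :=
      (Matrix.inv_eq_right_inv (mat_mul_inv _)).symm
    rw [h1]
    apply Matrix.inv_eq_right_inv
    rw [LR, mat_ofMat]
    ext i j
    fin_cases i <;> fin_cases j <;> simp [Matrix.mul_apply, Fin.sum_univ_two, h0]
  intro i j
  rw [hinv, LR, mat_ofMat]
  fin_cases i <;> fin_cases j <;>
    simp [inv_natCast_mem_ZS hD h]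

/-! ### Test functions and distributions -/

section Distributions

variable {R : Type} [CommRing R] [Algebra ℚ R]

/-- `f : R² → ℤ` is supported on `m⁻¹ O²` and invariant under translation by `m O²`. -/
def IsTestWith (O : Subring R) (m : ℕ) (f : (Fin 2 → R) → ℤ) : Prop :=
  (∀ v, f v ≠ 0 → ∀ i, (m : R) * v i ∈ O) ∧
    ∀ v w : Fin 2 → R, (∀ i, w i ∈ O) → f (fun i => v i + (m : R) * w i) = f v

theorem IsTestWith.mul {O : Subring R} {m : ℕ} {f : (Fin 2 → R) → ℤ} (h : IsTestWith O m f)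
    (k : ℕ) : IsTestWith O (m * k) f := by
  refine ⟨fun v hv i => ?_, fun v w hw => ?_⟩
  · have := mul_mem (natCast_mem O k) (h.1 v hv i)
    convert this using 1
    push_cast; ring
  · rw [← h.2 v (fun i => (k : R) * w i) fun i => mul_mem (natCast_mem O k) (hw i)]
    congr 1
    funext i
    push_cast; ring

/-- The test functions on `R²` that vanish at the origin, for a `ℚ`-algebra `R` with ring of
integers `O`: the functions `f : R² → ℤ` such that, for some positive integer `m`, `f` is
supported on `m⁻¹ O²` and is invariant under translation by `m O²`, and with `f 0 = 0`.

For `R = ℚ_ℓ`, `O = ℤ_ℓ` the first two conditions say that `f` is locally constant with compact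
support. For the adeles away from a set `S` of primes and their integral subring, they say that
`f` lies in the restricted tensor product over `ℓ ∉ S` of the groups of locally constant functions
with compact support on `ℚ_ℓ²`, with respect to the characteristic functions of `ℤ_ℓ²`. A locally
constant function is supported away from the origin if and only if it vanishes there. -/
def TestFn (O : Subring R) : AddSubgroup ((Fin 2 → R) → ℤ) where
  carrier := {f | f 0 = 0 ∧ ∃ m : ℕ, 0 < m ∧ IsTestWith O m f}
  add_mem' {f g} := by
    rintro ⟨hf0, m, hm, hf⟩ ⟨hg0, k, hk, hg⟩
    refine ⟨by simp [hf0, hg0], m * k, Nat.mul_pos hm hk, ?_⟩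
    have hf' := hf.mul k
    have hg' : IsTestWith O (m * k) g := by rw [mul_comm]; exact hg.mul m
    refine ⟨fun v hv i => ?_, fun v w hw => ?_⟩
    · by_cases h : f v = 0
      · exact hg'.1 v (fun h' => hv (by simp [h, h'])) i
      · exact hf'.1 v h i
    · simp only [Pi.add_apply, hf'.2 v w hw, hg'.2 v w hw]
  zero_mem' := ⟨rfl, 1, one_pos, fun _ h => absurd rfl h, fun _ _ _ => rfl⟩
  neg_mem' {f} := by
    rintro ⟨hf0, m, hm, hf⟩
    refine ⟨by simp [hf0], m, hm, fun v hv => hf.1 v (by simpa using hv), fun v w hw => ?_⟩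
    simp only [Pi.neg_apply, hf.2 v w hw]

/-- The right action of `G` on row vectors turned into a left action: `γ ∗ v = v γ⁻¹`. -/
def actVec (R : Type) [CommRing R] [Algebra ℚ R] (γ : GQ) (v : Fin 2 → R) : Fin 2 → R :=
  Matrix.vecMul v ((mat γ⁻¹).map (algebraMap ℚ R))

theorem actVec_one (v : Fin 2 → R) : actVec R 1 v = v := by
  rw [actVec, inv_one, mat_one, Matrix.map_one _ (map_zero _) (map_one _), Matrix.vecMul_one]

theorem actVec_mul (γ γ' : GQ) (v : Fin 2 → R) :
    actVec R (γ * γ') v = actVec R γ (actVec R γ' v) := by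
  simp only [actVec, mul_inv_rev, mat_mul, Matrix.map_mul, Matrix.vecMul_vecMul]

theorem actVec_apply (γ : GQ) (v : Fin 2 → R) (j : Fin 2) :
    actVec R γ v j = ∑ i, v i * algebraMap ℚ R (mat γ⁻¹ i j) := by
  simp [actVec, Matrix.vecMul, dotProduct]

theorem actVec_zero (γ : GQ) : actVec R γ 0 = 0 := by
  rw [actVec, Matrix.zero_vecMul]

theorem exists_denominator (A : Matrix (Fin 2) (Fin 2) ℚ) :
    ∃ M : ℕ, 0 < M ∧ ∀ i j, ∃ z : ℤ, (M : ℚ) * A i j = z := by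
  refine ⟨∏ i, ∏ j, (A i j).den, Finset.prod_pos fun i _ => Finset.prod_pos fun j _ =>
    (A i j).den_pos, fun i j => ?_⟩
  have h : (A i j).den ∣ ∏ i, ∏ j, (A i j).den :=
    (Finset.dvd_prod_of_mem (fun j => (A i j).den) (Finset.mem_univ j)).trans
      (Finset.dvd_prod_of_mem (fun i => ∏ j, (A i j).den) (Finset.mem_univ i))
  obtain ⟨k, hk⟩ := h
  refine ⟨k * (A i j).num, ?_⟩
  rw [hk]
  push_cast
  have := Rat.den_mul_eq_num (A i j)
  linear_combination (k : ℚ) * this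

theorem exists_actVec_integral (O : Subring R) (γ : GQ) :
    ∃ M : ℕ, 0 < M ∧ ∀ v : Fin 2 → R, (∀ i, v i ∈ O) → ∀ j, (M : R) * actVec R γ v j ∈ O := by
  obtain ⟨M, hM, h⟩ := exists_denominator (mat γ⁻¹)
  refine ⟨M, hM, fun v hv j => ?_⟩
  rw [actVec_apply, Finset.mul_sum]
  refine sum_mem fun i _ => ?_
  obtain ⟨z, hz⟩ := h i j
  have e : (M : R) * (v i * algebraMap ℚ R (mat γ⁻¹ i j)) = v i * (z : R) := by
    have := congrArg (algebraMap ℚ R) hz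
    rw [map_mul, map_natCast, map_intCast] at this
    rw [← this]; ring
  rw [e]
  exact mul_mem (hv i) (intCast_mem O z)

theorem actVec_add_smul (γ : GQ) (m : R) (v w : Fin 2 → R) :
    actVec R γ (fun i => v i + m * w i) =
      fun i => actVec R γ v i + m * actVec R γ w i := by
  funext j
  simp only [actVec_apply, add_mul, Finset.sum_add_distrib, Finset.mul_sum, mul_assoc]

/-- The right action of `G` on test functions, `(f ∣ γ)(v) = f (γ ∗ v) = f (v γ⁻¹)`. -/
def slash (O : Subring R) (γ : GQ) : TestFn O →+ TestFn O where
  toFun f := ⟨fun v => f.1 (actVec R γ v), by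
    obtain ⟨f, hf0, m, hm, hf⟩ := f
    obtain ⟨A, hA, hA'⟩ := exists_actVec_integral O γ
    obtain ⟨B, hB, hB'⟩ := exists_actVec_integral O γ⁻¹
    refine ⟨by simp only [actVec_zero, hf0], m * (A * B), by positivity, fun v hv i => ?_,
      fun v w hw => ?_⟩
    · have h1 := hf.1 _ hv
      have h2 := hB' (fun i => (m : R) * actVec R γ v i) h1 i
      have e : actVec R γ⁻¹ (fun i => (m : R) * actVec R γ v i) i = (m : R) * v i := by
        have := actVec_add_smul γ⁻¹ (m : R) 0 (actVec R γ v)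
        simp only [Pi.zero_apply, zero_add, actVec_zero] at this
        rw [this]
        simp only [← actVec_mul, inv_mul_cancel, actVec_one]
      rw [e] at h2
      have := mul_mem (natCast_mem O A) h2
      convert this using 1
      push_cast; ring
    · simp only []
      rw [actVec_add_smul]
      rw [← hf.2 (actVec R γ v) (fun i => (B : R) * ((A : R) * actVec R γ w i))
        fun i => mul_mem (natCast_mem O B) (hA' w hw i)]
      congr 1
      funext i
      push_cast; ring⟩
  map_zero' := rfl
  map_add' _ _ := rfl

theorem slash_one (O : Subring R) (f : TestFn O) : slash O 1 f = f := by
  apply Subtype.ext; funext v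
  change f.1 (actVec R 1 v) = f.1 v
  rw [actVec_one]

theorem slash_mul (O : Subring R) (γ γ' : GQ) (f : TestFn O) :
    slash O (γ * γ') f = slash O γ' (slash O γ f) := by
  apply Subtype.ext; funext v
  change f.1 (actVec R (γ * γ') v) = f.1 (actVec R γ (actVec R γ' v))
  rw [actVec_mul]

/-- The `A`-valued distributions on `R²` away from the origin. -/
def Dist (O : Subring R) (A : Type) [AddCommGroup A] : Type := TestFn O →+ A

instance (O : Subring R) (A : Type) [AddCommGroup A] : AddCommGroup (Dist O A) :=
  inferInstanceAs (AddCommGroup (TestFn O →+ A))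

instance (O : Subring R) (A : Type) [AddCommGroup A] : FunLike (Dist O A) (TestFn O) A :=
  inferInstanceAs (FunLike (TestFn O →+ A) (TestFn O) A)

instance (O : Subring R) (A : Type) [AddCommGroup A] :
    AddMonoidHomClass (Dist O A) (TestFn O) A :=
  inferInstanceAs (AddMonoidHomClass (TestFn O →+ A) (TestFn O) A)

/-- The left action of `G` on distributions, `(γ ∗ μ)(f) = μ(f ∣ γ) ∣ γ⁻¹`. The right action on the
values is written as a left action: `γ • a` is `a ∣ γ⁻¹`. -/
instance (O : Subring R) (A : Type) [AddCommGroup A] [DistribMulAction GQ A] :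
    DistribMulAction GQ (Dist O A) where
  smul γ μ := ((DistribSMul.toAddMonoidHom A γ).comp
    ((show TestFn O →+ A from μ).comp (slash O γ)) : TestFn O →+ A)
  one_smul μ := DFunLike.ext _ _ fun f => by
    change (1 : GQ) • μ (slash O 1 f) = μ f
    rw [slash_one, one_smul]
  mul_smul γ γ' μ := DFunLike.ext _ _ fun f => by
    change (γ * γ') • μ (slash O (γ * γ') f) = γ • γ' • μ (slash O γ' (slash O γ f))
    rw [slash_mul, mul_smul]
  smul_zero γ := DFunLike.ext _ _ fun f => by
    change γ • (0 : A) = 0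
    rw [smul_zero]
  smul_add γ μ ν := DFunLike.ext _ _ fun f => by
    change γ • (μ (slash O γ f) + ν (slash O γ f)) = γ • μ (slash O γ f) + γ • ν (slash O γ f)
    rw [smul_add]

open Classical in
/-- The value of a distribution on a set `U` (on its characteristic function); `0` if the
characteristic function of `U` is not a test function vanishing at the origin. -/
def Dist.mass {O : Subring R} {A : Type} [AddCommGroup A] (μ : Dist O A) (U : Set (Fin 2 → R)) :
    A :=
  if h : U.indicator (fun _ => (1 : ℤ)) ∈ TestFn O then μ ⟨_, h⟩ else 0

end Distributions

section Extension

variable {R R' : Type} [CommRing R] [Algebra ℚ R] [CommRing R'] [Algebra ℚ R']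

open Classical in
/-- Extension of test functions by a standard characteristic function. If `R'` has ring of
integers `O'`, `π : R' → R` is a projection and `T` is the subring of the elements of `R'` that are
integral in the remaining directions, then `f` is sent to `f ⊗ [integral vectors]`, that is to
`v ↦ f (π v)` if `v ∈ T²` and `v ↦ 0` otherwise. -/
def extend (O : Subring R) (O' : Subring R') (π : R' →+* R) (T : Subring R')
    (h : ∀ x, x ∈ O' ↔ π x ∈ O ∧ x ∈ T) : TestFn O →+ TestFn O' where
  toFun f := ⟨fun v => if ∀ i, v i ∈ T then f.1 (fun i => π (v i)) else 0, by
    obtain ⟨f, hf0, m, hm, hf⟩ := f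
    refine ⟨?_, m, hm, fun v hv i => ?_, fun v w hw => ?_⟩
    · have : (fun i : Fin 2 => π ((0 : Fin 2 → R') i)) = 0 := by funext i; simp
      simp only [this, hf0, ite_self]
    · by_cases hT : ∀ i, v i ∈ T
      · simp only [hT, implies_true, if_true] at hv
        refine (h _).2 ⟨?_, mul_mem (natCast_mem T m) (hT i)⟩
        rw [map_mul, map_natCast]
        exact hf.1 _ hv i
      · simp only [hT, if_false] at hv
        exact absurd rfl hv
    · have hT : (∀ i, v i + (m : R') * w i ∈ T) ↔ ∀ i, v i ∈ T :=
        forall_congr' fun i =>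
          add_mem_cancel_right (mul_mem (natCast_mem T m) ((h _).1 (hw i)).2)
      simp only [hT]
      have := hf.2 (fun i => π (v i)) (fun i => π (w i)) fun i => ((h _).1 (hw i)).1
      simp only [map_add, map_mul, map_natCast, this]⟩
  map_zero' := by
    apply Subtype.ext; funext v
    change (if ∀ i, v i ∈ T then (0 : ℤ) else 0) = 0
    rw [ite_self]
  map_add' f g := by
    apply Subtype.ext; funext v
    change (if ∀ i, v i ∈ T then f.1 _ + g.1 _ else 0) =
      (if ∀ i, v i ∈ T then f.1 _ else 0) + (if ∀ i, v i ∈ T then g.1 _ else 0)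
    split_ifs <;> simp

open Classical in
theorem extend_slash (O : Subring R) (O' : Subring R') (π : R' →+* R) (T : Subring R')
    (h : ∀ x, x ∈ O' ↔ π x ∈ O ∧ x ∈ T) (γ : GQ)
    (hγ : ∀ i j, algebraMap ℚ R' (mat γ i j) ∈ T ∧ algebraMap ℚ R' (mat γ⁻¹ i j) ∈ T)
    (f : TestFn O) : extend O O' π T h (slash O γ f) = slash O' γ (extend O O' π T h f) := by
  have key : ∀ γ : GQ, (∀ i j, algebraMap ℚ R' (mat γ⁻¹ i j) ∈ T) → ∀ v : Fin 2 → R',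
      (∀ i, v i ∈ T) → ∀ i, actVec R' γ v i ∈ T := fun γ hγ v hv j => by
    rw [actVec_apply]
    exact sum_mem fun i _ => mul_mem (hv i) (hγ i j)
  apply Subtype.ext; funext v
  have hT : (∀ i, actVec R' γ v i ∈ T) ↔ ∀ i, v i ∈ T := by
    refine ⟨fun hv => ?_, key γ (fun i j => (hγ i j).2) v⟩
    have := key γ⁻¹ (fun i j => by rw [inv_inv]; exact (hγ i j).1) _ hv
    rwa [← actVec_mul, inv_mul_cancel, actVec_one] at this
  have hπ : (fun i => π (actVec R' γ v i)) = actVec R γ (fun i => π (v i)) := by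
    funext j
    rw [actVec_apply, actVec_apply, map_sum]
    refine Finset.sum_congr rfl fun i _ => ?_
    rw [map_mul]
    congr 1
    exact congrArg (fun φ : ℚ →+* R => φ (mat γ⁻¹ i j))
      (Subsingleton.elim (π.comp (algebraMap ℚ R')) (algebraMap ℚ R))
  change (if ∀ i, v i ∈ T then f.1 (actVec R γ fun i => π (v i)) else 0) =
    if ∀ i, actVec R' γ v i ∈ T then f.1 (fun i => π (actVec R' γ v i)) else 0
  simp only [hT, hπ]

/-- Pullback of distributions along `extend`. -/
def restrictDist (O : Subring R) (O' : Subring R') (π : R' →+* R) (T : Subring R')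
    (h : ∀ x, x ∈ O' ↔ π x ∈ O ∧ x ∈ T) (A : Type) [AddCommGroup A] :
    Dist O' A →+ Dist O A where
  toFun μ := (show TestFn O' →+ A from μ).comp (extend O O' π T h)
  map_zero' := rfl
  map_add' _ _ := rfl

theorem restrictDist_apply (O : Subring R) (O' : Subring R') (π : R' →+* R) (T : Subring R')
    (h : ∀ x, x ∈ O' ↔ π x ∈ O ∧ x ∈ T) (A : Type) [AddCommGroup A] (μ : Dist O' A)
    (f : TestFn O) : restrictDist O O' π T h A μ f = μ (extend O O' π T h f) := rfl

theorem restrictDist_smul (O : Subring R) (O' : Subring R') (π : R' →+* R) (T : Subring R')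
    (h : ∀ x, x ∈ O' ↔ π x ∈ O ∧ x ∈ T) (A : Type) [AddCommGroup A] [DistribMulAction GQ A]
    (γ : GQ)
    (hγ : ∀ i j, algebraMap ℚ R' (mat γ i j) ∈ T ∧ algebraMap ℚ R' (mat γ⁻¹ i j) ∈ T)
    (μ : Dist O' A) :
    restrictDist O O' π T h A (γ • μ) = γ • restrictDist O O' π T h A μ := by
  apply DFunLike.ext; intro f
  change γ • μ (slash O' γ (extend O O' π T h f)) = γ • μ (extend O O' π T h (slash O γ f))
  rw [extend_slash O O' π T h γ hγ]

end Extension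

/-! ### Adeles away from a set of primes -/

instance (p : Nat.Primes) : Fact (p : ℕ).Prime := ⟨p.2⟩

/-- The finite adeles `𝔸^S` away from the primes in `S`. -/
abbrev Adele (S : Set Nat.Primes) : Type :=
  Πʳ ℓ : {ℓ : Nat.Primes // ℓ ∉ S}, [ℚ_[(ℓ.1 : ℕ)], PadicInt.subring (ℓ.1 : ℕ)]

theorem rat_mem_padicInt {ℓ : Nat.Primes} {x : ℚ} (h : ¬ (ℓ : ℕ) ∣ x.den) :
    (x : ℚ_[(ℓ : ℕ)]) ∈ PadicInt.subring (ℓ : ℕ) :=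
  (PadicInt.mem_subring_iff _).2 (Padic.norm_rat_le_one h)

theorem eventually_rat_mem (S : Set Nat.Primes) (x : ℚ) :
    ∀ᶠ ℓ : {ℓ : Nat.Primes // ℓ ∉ S} in Filter.cofinite,
      (x : ℚ_[(ℓ.1 : ℕ)]) ∈ PadicInt.subring (ℓ.1 : ℕ) := by
  have hfin : {ℓ : {ℓ : Nat.Primes // ℓ ∉ S} | (ℓ.1 : ℕ) ∣ x.den}.Finite := by
    refine Set.Finite.of_finite_image (f := fun ℓ => (ℓ.1 : ℕ)) ?_
      ((Nat.Primes.coe_nat_injective.comp Subtype.val_injective).injOn)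
    refine (Nat.divisors x.den).finite_toSet.subset ?_
    rintro _ ⟨ℓ, hℓ, rfl⟩
    exact Nat.mem_divisors.2 ⟨hℓ, x.den_ne_zero⟩
  exact hfin.subset fun ℓ hℓ => by
    by_contra h
    exact hℓ (rat_mem_padicInt h)

/-- The diagonal embedding of `ℚ`. -/
instance (S : Set Nat.Primes) : Algebra ℚ (Adele S) :=
  RingHom.toAlgebra
    { toFun := fun x => ⟨fun ℓ => (x : ℚ_[(ℓ.1 : ℕ)]), eventually_rat_mem S x⟩
      map_one' := RestrictedProduct.ext _ _ fun _ => Rat.cast_one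
      map_zero' := RestrictedProduct.ext _ _ fun _ => Rat.cast_zero
      map_mul' := fun x y => RestrictedProduct.ext _ _ fun _ => Rat.cast_mul x y
      map_add' := fun x y => RestrictedProduct.ext _ _ fun _ => Rat.cast_add x y }

theorem algebraMap_adele_apply (S : Set Nat.Primes) (x : ℚ) (ℓ : {ℓ : Nat.Primes // ℓ ∉ S}) :
    (algebraMap ℚ (Adele S) x) ℓ = (x : ℚ_[(ℓ.1 : ℕ)]) := rfl

/-- The adeles that are integral at all primes satisfying `P`. -/
def integralAt (S : Set Nat.Primes) (P : Nat.Primes → Prop) : Subring (Adele S) where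
  carrier := {x | ∀ ℓ : {ℓ : Nat.Primes // ℓ ∉ S}, P ℓ.1 → x ℓ ∈ PadicInt.subring (ℓ.1 : ℕ)}
  mul_mem' hx hy ℓ h := mul_mem (hx ℓ h) (hy ℓ h)
  one_mem' _ _ := one_mem _
  add_mem' hx hy ℓ h := add_mem (hx ℓ h) (hy ℓ h)
  zero_mem' _ _ := zero_mem _
  neg_mem' hx ℓ h := neg_mem (hx ℓ h)

/-- The integral adeles `∏_{ℓ ∉ S} ℤ_ℓ`. -/
def integral (S : Set Nat.Primes) : Subring (Adele S) := integralAt S fun _ => True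

/-- The projection `𝔸^S → 𝔸^T` for `S ⊆ T`. -/
def projAdele {S T : Set Nat.Primes} (h : S ⊆ T) : Adele S →+* Adele T where
  toFun x := ⟨fun ℓ => x ⟨ℓ.1, fun hℓ => ℓ.2 (h hℓ)⟩, by
    have hinj : Function.Injective
        (fun ℓ : {ℓ : Nat.Primes // ℓ ∉ T} =>
          (⟨ℓ.1, fun hℓ => ℓ.2 (h hℓ)⟩ : {ℓ : Nat.Primes // ℓ ∉ S})) :=
      fun a b hab => Subtype.ext (congrArg (fun z => z.1) hab)
    exact hinj.tendsto_cofinite.eventually x.2⟩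
  map_one' := rfl
  map_zero' := rfl
  map_mul' _ _ := rfl
  map_add' _ _ := rfl

/-- The projection `𝔸^S → ℚ_p` for `p ∉ S`. -/
def projPadic {S : Set Nat.Primes} (p : Nat.Primes) (h : p ∉ S) : Adele S →+* ℚ_[(p : ℕ)] where
  toFun x := x ⟨p, h⟩
  map_one' := rfl
  map_zero' := rfl
  map_mul' _ _ := rfl
  map_add' _ _ := rfl

theorem integral_iff_adele {S T : Set Nat.Primes} (h : S ⊆ T) (x : Adele S) :
    x ∈ integral S ↔ projAdele h x ∈ integral T ∧ x ∈ integralAt S (· ∈ T) := by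
  refine ⟨fun hx => ⟨fun ℓ _ => hx ⟨ℓ.1, fun hℓ => ℓ.2 (h hℓ)⟩ trivial,
    fun ℓ _ => hx ℓ trivial⟩, fun hx ℓ _ => ?_⟩
  by_cases hℓ : ℓ.1 ∈ T
  · exact hx.2 ℓ hℓ
  · exact hx.1 ⟨ℓ.1, hℓ⟩ trivial

theorem integral_iff_padic {S : Set Nat.Primes} (p : Nat.Primes) (h : p ∉ S) (x : Adele S) :
    x ∈ integral S ↔
      projPadic p h x ∈ PadicInt.subring (p : ℕ) ∧ x ∈ integralAt S (· ≠ p) := by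
  refine ⟨fun hx => ⟨hx ⟨p, h⟩ trivial, fun ℓ _ => hx ℓ trivial⟩, fun hx ℓ _ => ?_⟩
  by_cases hℓ : ℓ.1 = p
  · obtain ⟨ℓ, hℓS⟩ := ℓ
    subst hℓ
    exact hx.1
  · exact hx.2 ℓ hℓ

theorem algebraMap_mem_integralAt {S T : Set Nat.Primes} {x : ℚ} (hx : x ∈ ZS T) :
    algebraMap ℚ (Adele S) x ∈ integralAt S (· ∈ T) :=
  fun ℓ hℓ => rat_mem_padicInt (hx ℓ.1 hℓ)

/-- Pullback of distributions along `f ↦ f ⊗ f⁰`, from `𝔸^S` to `𝔸^T` for `S ⊆ T`. -/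
def toAdele {S T : Set Nat.Primes} (h : S ⊆ T) (A : Type) [AddCommGroup A] :
    Dist (integral S) A →+ Dist (integral T) A :=
  restrictDist (integral T) (integral S) (projAdele h) (integralAt S (· ∈ T))
    (integral_iff_adele h) A

/-- Pullback of distributions along `f ↦ f ⊗ f⁰`, from `𝔸^S` to `ℚ_p` for `p ∉ S`. -/
def toPadic {S : Set Nat.Primes} (p : Nat.Primes) (h : p ∉ S) (A : Type) [AddCommGroup A] :
    Dist (integral S) A →+ Dist (PadicInt.subring (p : ℕ)) A :=
  restrictDist (PadicInt.subring (p : ℕ)) (integral S) (projPadic p h) (integralAt S (· ≠ p))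
    (integral_iff_padic p h) A

theorem toAdele_smul {S T : Set Nat.Primes} (h : S ⊆ T) (A : Type) [AddCommGroup A]
    [DistribMulAction GQ A] (γ : GQ) (hγ : γ ∈ GS T) (μ : Dist (integral S) A) :
    toAdele h A (γ • μ) = γ • toAdele h A μ :=
  restrictDist_smul _ _ _ _ _ _ _ (fun i j => ⟨algebraMap_mem_integralAt (hγ i j).1,
    algebraMap_mem_integralAt (hγ i j).2⟩) _

/-- The set of all primes different from `p`. -/
def primesNe (p : Nat.Primes) : Set Nat.Primes := {ℓ | ℓ ≠ p}

theorem toPadic_smul {S : Set Nat.Primes} (p : Nat.Primes) (h : p ∉ S) (A : Type)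
    [AddCommGroup A] [DistribMulAction GQ A] (γ : GQ) (hγ : γ ∈ GS (primesNe p))
    (μ : Dist (integral S) A) : toPadic p h A (γ • μ) = γ • toPadic p h A μ :=
  restrictDist_smul _ _ _ _ _ _ _ (fun i j =>
    ⟨algebraMap_mem_integralAt (T := primesNe p) (hγ i j).1,
      algebraMap_mem_integralAt (T := primesNe p) (hγ i j).2⟩) _

/-! ### The modules of values -/

/-- `ℤ` with the trivial action of `G`. -/
instance : DistribMulAction GQ ℤ where
  smul _ n := n
  one_smul _ := rfl
  mul_smul _ _ _ := rfl
  smul_zero _ := rfl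
  smul_add _ _ _ := rfl

/-- `GL₂⁺(ℚ) → GL₂(ℝ)`, through which `G` acts on the upper half plane. -/
def toReal : GQ →* GL (Fin 2) ℝ :=
  (Matrix.GeneralLinearGroup.map (algebraMap ℚ ℝ)).comp (Matrix.GLPos (Fin 2) ℚ).subtype

theorem toReal_det_pos (γ : GQ) : 0 < (toReal γ).det.val := by
  have h : (toReal γ).det.val = algebraMap ℚ ℝ (mat γ).det := by
    rw [RingHom.map_det]; rfl
  rw [h]
  have h2 : 0 < (mat γ).det := γ.2
  simpa using h2

/-- The ring of holomorphic functions on the upper half plane. -/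
def Hol : Subring (ℍ → ℂ) where
  carrier := {F | MDiff F}
  mul_mem' hf hg := hf.mul hg
  one_mem' := mdifferentiable_const
  add_mem' hf hg := hf.add hg
  zero_mem' := mdifferentiable_const
  neg_mem' hf := hf.neg

/-- The action of `G` on holomorphic functions, `F ∣ γ⁻¹ : τ ↦ F (γ⁻¹ τ)`. -/
def Hol.act (γ : GQ) : Hol →+* Hol where
  toFun F := ⟨fun τ => F.1 (toReal γ⁻¹ • τ),
    F.2.comp (UpperHalfPlane.mdifferentiable_smul (toReal_det_pos γ⁻¹))⟩
  map_one' := rfl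
  map_zero' := rfl
  map_mul' _ _ := rfl
  map_add' _ _ := rfl

theorem Hol.act_one (F : Hol) : Hol.act 1 F = F := by
  apply Subtype.ext; funext τ
  change F.1 (toReal 1⁻¹ • τ) = F.1 τ
  rw [inv_one, map_one, one_smul]

theorem Hol.act_mul (γ γ' : GQ) (F : Hol) : Hol.act (γ * γ') F = Hol.act γ (Hol.act γ' F) := by
  apply Subtype.ext; funext τ
  change F.1 (toReal (γ * γ')⁻¹ • τ) = F.1 (toReal γ'⁻¹ • toReal γ⁻¹ • τ)
  rw [mul_inv_rev, map_mul, mul_smul]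

instance : DistribMulAction GQ Hol where
  smul γ F := Hol.act γ F
  one_smul := Hol.act_one
  mul_smul := Hol.act_mul
  smul_zero γ := map_zero (Hol.act γ)
  smul_add γ := map_add (Hol.act γ)

/-- The multiplicative group of nowhere vanishing holomorphic functions on the upper half plane,
written additively. -/
def HolUnits : Type := Additive Holˣ

instance : AddCommGroup HolUnits := inferInstanceAs (AddCommGroup (Additive Holˣ))

/-- The underlying holomorphic function. -/
def HolUnits.fn (u : HolUnits) : Hol := ((Additive.toMul (show Additive Holˣ from u) : Holˣ) : Hol)

theorem HolUnits.fn_injective : Function.Injective HolUnits.fn := fun _ _ h => Units.ext h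

instance : DistribMulAction GQ HolUnits where
  smul γ u := (Additive.ofMul (Units.map (Hol.act γ : Hol →* Hol)
    (Additive.toMul (show Additive Holˣ from u))) : Additive Holˣ)
  one_smul u := HolUnits.fn_injective (Hol.act_one u.fn)
  mul_smul γ γ' u := HolUnits.fn_injective (Hol.act_mul γ γ' u.fn)
  smul_zero γ := HolUnits.fn_injective (map_one (Hol.act γ))
  smul_add γ u v := HolUnits.fn_injective (map_mul (Hol.act γ) u.fn v.fn)

/-! ### Group cohomology in degree one through homogeneous cochains -/

section Cohomology

variable (H : Subgroup GQ) (M : Type) [AddCommGroup M] [DistribMulAction GQ M]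

/-- Homogeneous `0`-cochains: equivariant functions `H → M`. -/
def C0 : AddSubgroup (H → M) where
  carrier := {b | ∀ h g : H, b (h * g) = (h : GQ) • b g}
  add_mem' ha hb h g := by simp only [Pi.add_apply, ha h g, hb h g, smul_add]
  zero_mem' h g := by simp
  neg_mem' ha h g := by simp only [Pi.neg_apply, ha h g, smul_neg]

/-- Homogeneous `1`-cocycles: equivariant functions `c` on `H²` with
`c(g₁,g₂) - c(g₀,g₂) + c(g₀,g₁) = 0`. -/
def Z1 : AddSubgroup (H → H → M) where
  carrier := {c | (∀ h g₀ g₁ : H, c (h * g₀) (h * g₁) = (h : GQ) • c g₀ g₁) ∧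
    ∀ g₀ g₁ g₂, c g₁ g₂ - c g₀ g₂ + c g₀ g₁ = 0}
  add_mem' {a b} ha hb := by
    refine ⟨fun h g₀ g₁ => by simp only [Pi.add_apply, ha.1 h, hb.1 h, smul_add],
      fun g₀ g₁ g₂ => ?_⟩
    have := congrArg₂ (· + ·) (ha.2 g₀ g₁ g₂) (hb.2 g₀ g₁ g₂)
    simp only [Pi.add_apply] at this ⊢
    rw [add_zero] at this
    rw [← this]; abel
  zero_mem' := ⟨fun h g₀ g₁ => by simp, fun _ _ _ => by simp⟩
  neg_mem' {a} ha := by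
    refine ⟨fun h g₀ g₁ => by simp only [Pi.neg_apply, ha.1 h, smul_neg], fun g₀ g₁ g₂ => ?_⟩
    have := congrArg (- ·) (ha.2 g₀ g₁ g₂)
    simp only [Pi.neg_apply, neg_zero] at this ⊢
    rw [← this]; abel

/-- Homogeneous `1`-coboundaries `c(g₀,g₁) = b(g₁) - b(g₀)`. -/
def B1 : AddSubgroup (Z1 H M) where
  carrier := {c | ∃ b ∈ C0 H M, ∀ g₀ g₁, c.1 g₀ g₁ = b g₁ - b g₀}
  add_mem' := by
    rintro x y ⟨a, ha, hx⟩ ⟨b, hb, hy⟩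
    refine ⟨a + b, add_mem ha hb, fun g₀ g₁ => ?_⟩
    change x.1 g₀ g₁ + y.1 g₀ g₁ = _
    rw [hx, hy]; simp only [Pi.add_apply]; abel
  zero_mem' := ⟨0, zero_mem _, fun _ _ => by simp⟩
  neg_mem' := by
    rintro x ⟨a, ha, hx⟩
    refine ⟨-a, neg_mem ha, fun g₀ g₁ => ?_⟩
    change -x.1 g₀ g₁ = _
    rw [hx]; simp only [Pi.neg_apply]; abel

/-- The first cohomology group `H¹(H, M)`. -/
abbrev H1 : Type := Z1 H M ⧸ B1 H M

variable {H M}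

/-- The cohomology class of a cocycle. -/
def cls (z : Z1 H M) : H1 H M := QuotientAddGroup.mk z

/-- Restriction to a subgroup, on cocycles. -/
def resZ1 {K : Subgroup GQ} (h : K ≤ H) : Z1 H M →+ Z1 K M where
  toFun z := ⟨fun g₀ g₁ => z.1 (Subgroup.inclusion h g₀) (Subgroup.inclusion h g₁),
    fun k g₀ g₁ => z.2.1 (Subgroup.inclusion h k) (Subgroup.inclusion h g₀)
      (Subgroup.inclusion h g₁),
    fun _ _ _ => z.2.2 _ _ _⟩
  map_zero' := rfl
  map_add' _ _ := rfl

/-- Restriction to a subgroup, on cohomology. -/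
def resH1 {K : Subgroup GQ} (h : K ≤ H) : H1 H M →+ H1 K M :=
  QuotientAddGroup.map _ _ (resZ1 h) (by
    rintro z ⟨b, hb, hz⟩
    refine ⟨fun g => b (Subgroup.inclusion h g), fun k g => hb (Subgroup.inclusion h k) (Subgroup.inclusion h g),
      fun g₀ g₁ => hz (Subgroup.inclusion h g₀) (Subgroup.inclusion h g₁)⟩)

/-- For `δ = ∑ n_g [g]` in the group ring of `G'` and a subgroup `H`, the subgroup
`H_δ = (⋂_{n_g ≠ 0} g H g⁻¹) ∩ H`. -/
def Hδ {G' : Subgroup GQ} (H : Subgroup GQ) (δ : G' →₀ ℤ) : Subgroup GQ :=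
  (⨅ g ∈ δ.support, H.map (MulAut.conj (g : GQ)).toMonoidHom) ⊓ H

theorem mem_Hδ {G' : Subgroup GQ} {H : Subgroup GQ} {δ : G' →₀ ℤ} {k : GQ} :
    k ∈ Hδ H δ ↔ (∀ g ∈ δ.support, (g : GQ)⁻¹ * k * (g : GQ) ∈ H) ∧ k ∈ H := by
  have key : ∀ g : GQ, k ∈ H.map (MulAut.conj g).toMonoidHom ↔ g⁻¹ * k * g ∈ H := fun g => by
    constructor
    · rintro ⟨h, hh, rfl⟩
      have : g⁻¹ * ((MulAut.conj g).toMonoidHom h) * g = h := by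
        change g⁻¹ * (g * h * g⁻¹) * g = h
        group
      rw [this]; exact hh
    · intro h
      refine ⟨_, h, ?_⟩
      change g * (g⁻¹ * k * g) * g⁻¹ = k
      group
  simp only [Hδ, Subgroup.mem_inf, Subgroup.mem_iInf, key]

theorem Hδ_le {G' : Subgroup GQ} (H : Subgroup GQ) (δ : G' →₀ ℤ) : Hδ H δ ≤ H := inf_le_right

variable {G' : Subgroup GQ} {N : Type} [AddCommGroup N] [DistribMulAction GQ N]

/-- The smoothing map `(δ, η)` on `1`-cocycles, for `δ = ∑ n_g [g]` in the group ring of `G'`, a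
subgroup `H ≤ G'` and an `H`-equivariant homomorphism `η : N → M`. It is the composite of `η`, the
action `(δ ∗ c)(g₀,g₁) = ∑ n_g g ∗ c(g⁻¹ g₀, g⁻¹ g₁)` of `δ` and the restriction to `H_δ`. -/
def smoothZ1 (H : Subgroup GQ) (hH : H ≤ G') (δ : G' →₀ ℤ) (η : N →+ M)
    (hη : ∀ h ∈ H, ∀ x, η (h • x) = h • η x) : Z1 G' N →+ Z1 (Hδ H δ) M where
  toFun c := ⟨fun k₀ k₁ => ∑ g ∈ δ.support, δ g • ((g : GQ) •
      η (c.1 (g⁻¹ * Subgroup.inclusion ((Hδ_le H δ).trans hH) k₀)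
        (g⁻¹ * Subgroup.inclusion ((Hδ_le H δ).trans hH) k₁))), by
    refine ⟨fun k k₀ k₁ => ?_, fun k₀ k₁ k₂ => ?_⟩
    · rw [Finset.smul_sum]
      refine Finset.sum_congr rfl fun g hg => ?_
      have hk := (mem_Hδ.1 k.2).1 g hg
      have e : ∀ k' : Hδ H δ,
          g⁻¹ * Subgroup.inclusion ((Hδ_le H δ).trans hH) (k * k') =
          (⟨_, hH hk⟩ : G') * (g⁻¹ * Subgroup.inclusion ((Hδ_le H δ).trans hH) k') := fun k' => by
        apply Subtype.ext
        change (g : GQ)⁻¹ * ((k : GQ) * (k' : GQ)) =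
          (g : GQ)⁻¹ * (k : GQ) * (g : GQ) * ((g : GQ)⁻¹ * (k' : GQ))
        group
      rw [e k₀, e k₁, c.2.1, hη _ hk, smul_comm (k : GQ) (δ g)]
      congr 1
      rw [← mul_smul, ← mul_smul]
      congr 1
      group
    · rw [← Finset.sum_sub_distrib, ← Finset.sum_add_distrib]
      refine Finset.sum_eq_zero fun g _ => ?_
      rw [← smul_sub, ← smul_add, ← smul_sub, ← smul_add, ← map_sub, ← map_add, c.2.2,
        map_zero, smul_zero, smul_zero]⟩
  map_zero' := by
    apply Subtype.ext; funext k₀ k₁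
    exact Finset.sum_eq_zero fun g _ => by
      change δ g • ((g : GQ) • η (0 : N)) = 0
      simp
  map_add' a b := by
    apply Subtype.ext; funext k₀ k₁
    change (∑ g ∈ δ.support, δ g • ((g : GQ) • η (_ + _))) = (∑ g ∈ δ.support, _) + ∑ g ∈ δ.support, _
    rw [← Finset.sum_add_distrib]
    exact Finset.sum_congr rfl fun g _ => by rw [map_add, smul_add, smul_add]

/-- The smoothing map `(δ, η)¹ : H¹(G', N) → H¹(H_δ, M)`. -/
def smoothH1 (H : Subgroup GQ) (hH : H ≤ G') (δ : G' →₀ ℤ) (η : N →+ M)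
    (hη : ∀ h ∈ H, ∀ x, η (h • x) = h • η x) : H1 G' N →+ H1 (Hδ H δ) M :=
  QuotientAddGroup.map _ _ (smoothZ1 H hH δ η hη) (by
    rintro c ⟨b, hb, hc⟩
    refine ⟨fun k => ∑ g ∈ δ.support, δ g • ((g : GQ) •
      η (b (g⁻¹ * Subgroup.inclusion ((Hδ_le H δ).trans hH) k))), fun k k' => ?_,
      fun k₀ k₁ => ?_⟩
    · rw [Finset.smul_sum]
      refine Finset.sum_congr rfl fun g hg => ?_
      have hk := (mem_Hδ.1 k.2).1 g hg
      have e : g⁻¹ * Subgroup.inclusion ((Hδ_le H δ).trans hH) (k * k') =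
          (⟨_, hH hk⟩ : G') * (g⁻¹ * Subgroup.inclusion ((Hδ_le H δ).trans hH) k') := by
        apply Subtype.ext
        change (g : GQ)⁻¹ * ((k : GQ) * (k' : GQ)) =
          (g : GQ)⁻¹ * (k : GQ) * (g : GQ) * ((g : GQ)⁻¹ * (k' : GQ))
        group
      rw [e, hb, hη _ hk, smul_comm (k : GQ) (δ g)]
      congr 1
      rw [← mul_smul, ← mul_smul]
      congr 1
      group
    · change (∑ g ∈ δ.support, δ g • ((g : GQ) • η (c.1 _ _))) = _
      rw [← Finset.sum_sub_distrib]
      refine Finset.sum_congr rfl fun g _ => ?_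
      rw [hc, map_sub, smul_sub, smul_sub])

/-- The graph of the connecting homomorphism `∂ : H⁰(H, C) → H¹(H, A)` of a short exact sequence
`0 → A → B → C → 0` of `G`-modules: `ξ = ∂ x` if `x` has a lift `e` to `B` such that `ξ` is the
class of the cocycle with values in `A` whose image in `B` is `(g₀,g₁) ↦ g₁ ∗ e - g₀ ∗ e`, the
differential of the `0`-cochain `g ↦ g ∗ e`. -/
def IsConnecting {A B C : Type} [AddCommGroup A] [DistribMulAction GQ A] [AddCommGroup B]
    [DistribMulAction GQ B] [AddCommGroup C] (H : Subgroup GQ) (ι : A →+ B) (π : B →+ C)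
    (x : C) (ξ : H1 H A) : Prop :=
  ∃ e : B, π e = x ∧ ∃ z : Z1 H A,
    (∀ g₀ g₁ : H, ι (z.1 g₀ g₁) = (g₁ : GQ) • e - (g₀ : GQ) • e) ∧ cls z = ξ

end Cohomology

/-! ### The Kato-Siegel distribution and the Dedekind-Rademacher class -/

/-- `Θ(u, τ) = q^{1/12} (t^{1/2} - t^{-1/2}) ∏_{n > 0} (1 - qⁿ t)(1 - qⁿ t⁻¹)` with
`q = exp(2πiτ)` and `t = exp(2πiu)`. -/
def Theta (u τ : ℂ) : ℂ :=
  Complex.exp (2 * Real.pi * Complex.I * τ / 12) *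
    (Complex.exp (Real.pi * Complex.I * u) - Complex.exp (-(Real.pi * Complex.I * u))) *
    ∏' n : ℕ, (1 - Complex.exp (2 * Real.pi * Complex.I * ((n + 1) * τ + u))) *
      (1 - Complex.exp (2 * Real.pi * Complex.I * ((n + 1) * τ - u)))

/-- The value at `τ` of the Kato-Siegel unit attached to `(a, b)`, that is `ϑ_c(aτ + b, τ)` with
`ϑ_c(u, τ) = (-1)^{(c-1)/2} Θ(u, τ)^{c²} Θ(cu, τ)⁻¹`. -/
def katoSiegelUnit (c : ℕ) (a b : ℚ) (τ : ℂ) : ℂ :=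
  (-1) ^ ((c - 1) / 2) * Theta (a * τ + b) τ ^ (c ^ 2) * (Theta (c * (a * τ + b)) τ)⁻¹

/-- The coset `(a, b) + Ô²` in `V ⊗ 𝔸^S`, where `Ô` is the ring of integral adeles. -/
def coset (S : Set Nat.Primes) (a b : ℚ) : Set (Fin 2 → Adele S) :=
  {v | v 0 - algebraMap ℚ (Adele S) a ∈ integral S ∧ v 1 - algebraMap ℚ (Adele S) b ∈ integral S}

/-- `κ` is the Kato-Siegel distribution: it is `G_S`-invariant, for the set `S` of primes dividing
`c`, and its value on a nonzero coset `(a, b) + ℤ²` in `ℤ_S² / ℤ²` is the Kato-Siegel unit. -/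
def IsKatoSiegel (c : ℕ) (κ : Dist (integral (primesOf c)) HolUnits) : Prop :=
  (∀ γ ∈ GS (primesOf c), γ • κ = κ) ∧
    ∀ a ∈ ZS (primesOf c), ∀ b ∈ ZS (primesOf c), ¬ (a.den = 1 ∧ b.den = 1) → ∀ τ : ℍ,
      (κ.mass (coset (primesOf c) a b)).fn.1 τ = katoSiegelUnit c a b τ

/-- The inclusion of the constants `ℤ → 𝓞_ℍ`. -/
def constHom : ℤ →+ Hol := (Int.castRingHom Hol).toAddMonoidHom

/-- The exponential map `𝓞_ℍ → 𝓞_ℍ^×`, `F ↦ exp(2πiF)`. -/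
def expHom : Hol →+ HolUnits where
  toFun F := (Additive.ofMul
    { val := ⟨fun τ => Complex.exp (2 * Real.pi * Complex.I * F.1 τ), by
        have h : Differentiable ℂ fun z : ℂ => Complex.exp (2 * Real.pi * Complex.I * z) := by
          fun_prop
        exact h.mdifferentiable.comp F.2⟩
      inv := ⟨fun τ => Complex.exp (-(2 * Real.pi * Complex.I * F.1 τ)), by
        have h : Differentiable ℂ fun z : ℂ => Complex.exp (-(2 * Real.pi * Complex.I * z)) := by
          fun_prop
        exact h.mdifferentiable.comp F.2⟩
      val_inv := Subtype.ext (funext fun τ => by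
        change Complex.exp _ * Complex.exp _ = 1
        rw [← Complex.exp_add, add_neg_cancel, Complex.exp_zero])
      inv_val := Subtype.ext (funext fun τ => by
        change Complex.exp _ * Complex.exp _ = 1
        rw [← Complex.exp_add, neg_add_cancel, Complex.exp_zero]) } : Additive Holˣ)
  map_zero' := HolUnits.fn_injective (Subtype.ext (funext fun τ => by
    change Complex.exp (2 * Real.pi * Complex.I * 0) = 1
    rw [mul_zero, Complex.exp_zero]))
  map_add' F F' := HolUnits.fn_injective (Subtype.ext (funext fun τ => by
    change Complex.exp (2 * Real.pi * Complex.I * (F.1 τ + F'.1 τ)) =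
      Complex.exp _ * Complex.exp _
    rw [← Complex.exp_add, mul_add]))

/-- Composition of distributions with a homomorphism of the groups of values. -/
def Dist.mapValues {R : Type} [CommRing R] [Algebra ℚ R] (O : Subring R) {A B : Type}
    [AddCommGroup A] [AddCommGroup B] (φ : A →+ B) : Dist O A →+ Dist O B where
  toFun μ := φ.comp (show TestFn O →+ A from μ)
  map_zero' := DFunLike.ext _ _ fun _ => map_zero φ
  map_add' _ _ := DFunLike.ext _ _ fun _ => map_add φ _ _

/-- `ξ` is the Dedekind-Rademacher class `μ_DR`, the image of the Kato-Siegel distribution under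
the boundary map of `0 → 𝒟'(ℤ) → 𝒟'(𝓞_ℍ) → 𝒟'(𝓞_ℍ^×) → 1`. -/
def IsDedekindRademacherClass (c : ℕ)
    (ξ : H1 (GS (primesOf c)) (Dist (integral (primesOf c)) ℤ)) : Prop :=
  ∃ κ : Dist (integral (primesOf c)) HolUnits, IsKatoSiegel c κ ∧
    IsConnecting (GS (primesOf c)) (Dist.mapValues _ constHom) (Dist.mapValues _ expHom) κ ξ

theorem not_dvd_of_coprime {c N D : ℕ} (hNc : N.Coprime c) (hD : D ∈ N.divisors) :
    ∀ ℓ ∈ primesOf c, ¬ (ℓ : ℕ) ∣ D := fun ℓ hℓ h =>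
  Nat.Prime.not_coprime_iff_dvd.2
    ⟨ℓ, ℓ.2, h.trans (Nat.dvd_of_mem_divisors hD), hℓ⟩ hNc

/-- `δ = ∑_{D ∣ N} n_D [LR(D)]` as an element of the group ring of `G_S`, where `S` is the set of
primes dividing `c`. -/
def delta (c N : ℕ) (hNc : N.Coprime c) (n : ℕ → ℤ) : GS (primesOf c) →₀ ℤ :=
  ∑ D ∈ N.divisors.attach, Finsupp.single
    ⟨LR (D.1 : ℕ) (by exact_mod_cast Nat.pos_of_mem_divisors D.2),
      LR_mem_GS (Nat.pos_of_mem_divisors D.2) (not_dvd_of_coprime hNc D.2)⟩ (n D.1)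

theorem primesOf_subset {c N : ℕ} : primesOf c ⊆ primesOf (c * N) :=
  fun _ h => h.trans (Nat.dvd_mul_right c N)

theorem GSN_le_Hδ (c N : ℕ) (hNc : N.Coprime c) (n : ℕ → ℤ) :
    GSN (primesOf (c * N)) N ≤ Hδ (GS (primesOf (c * N))) (delta c N hNc n) := by
  intro k hk
  refine mem_Hδ.2 ⟨fun g hg => ?_, hk.1⟩
  obtain ⟨D, -, hD⟩ := Finset.mem_biUnion.1 (Finsupp.support_finsetSum hg)
  have hg' := Finset.mem_singleton.1 (Finsupp.support_single_subset hD)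
  have hD0 : 0 < D.1 := Nat.pos_of_mem_divisors D.2
  have hDq : (D.1 : ℚ) ≠ 0 := by exact_mod_cast hD0.ne'
  have hLR : (g : GQ) = LR (D.1 : ℕ) (by exact_mod_cast hD0) := congrArg Subtype.val hg'
  have hinv : mat (g : GQ)⁻¹ = !![1, 0; 0, (D.1 : ℚ)⁻¹] := by
    have h1 : mat (g : GQ)⁻¹ = (mat (g : GQ))⁻¹ :=
      (Matrix.inv_eq_right_inv (mat_mul_inv _)).symm
    rw [h1]
    apply Matrix.inv_eq_right_inv
    rw [hLR, LR, mat_ofMat]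
    ext i j
    fin_cases i <;> fin_cases j <;> simp [Matrix.mul_apply, Fin.sum_univ_two, hDq]
  have hmat : mat (g : GQ) = !![1, 0; 0, (D.1 : ℚ)] := by rw [hLR, LR, mat_ofMat]
  have key : ∀ k ∈ GSN (primesOf (c * N)) N, ∀ i j,
      mat ((g : GQ)⁻¹ * k * (g : GQ)) i j ∈ ZS (primesOf (c * N)) := by
    rintro k ⟨hk, x, hx, hkx⟩ i j
    rw [mat_mul, mat_mul, hinv, hmat]
    obtain ⟨r, hr⟩ := Nat.dvd_of_mem_divisors D.2
    have h10 : (D.1 : ℚ)⁻¹ * mat k 1 0 = r * x := by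
      rw [hkx]
      have : (N : ℚ) = D.1 * r := by exact_mod_cast hr
      rw [this]; field_simp
    have h11 : (D.1 : ℚ)⁻¹ * mat k 1 1 * D.1 = mat k 1 1 := by field_simp
    have hrx := mul_mem (natCast_mem (ZS (primesOf (c * N))) r) hx
    have h01 := mul_mem (hk 0 1).1 (natCast_mem (ZS (primesOf (c * N))) D.1)
    have e : !![1, 0; 0, (D.1 : ℚ)⁻¹] * mat k * !![1, 0; 0, (D.1 : ℚ)] =
        !![mat k 0 0, mat k 0 1 * D.1; r * x, mat k 1 1] := by
      rw [← h10, ← h11]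
      ext i j
      fin_cases i <;> fin_cases j <;>
        simp [Matrix.mul_apply, Matrix.vecMul, dotProduct, Fin.sum_univ_two]
    rw [e]
    fin_cases i <;> fin_cases j
    · exact (hk 0 0).1
    · exact h01
    · exact hrx
    · exact (hk 1 1).1
  intro i j
  refine ⟨key k hk i j, ?_⟩
  have : ((g : GQ)⁻¹ * k * (g : GQ))⁻¹ = (g : GQ)⁻¹ * k⁻¹ * (g : GQ) := by group
  rw [this]
  exact key k⁻¹ (inv_mem hk) i j

/-- `μ ↦ μ^δ`: the smoothing map `(δ, i^*)¹` followed by restriction to `G_𝒩(N)`, where `𝒩` is the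
set of primes dividing `cN`. -/
def smoothDelta (c N : ℕ) (hNc : N.Coprime c) (n : ℕ → ℤ) :
    H1 (GS (primesOf c)) (Dist (integral (primesOf c)) ℤ) →+
      H1 (GSN (primesOf (c * N)) N) (Dist (integral (primesOf (c * N))) ℤ) :=
  (resH1 (GSN_le_Hδ c N hNc n)).comp
    (smoothH1 (GS (primesOf (c * N))) (GS_anti primesOf_subset) (delta c N hNc n)
      (toAdele primesOf_subset ℤ) fun γ hγ μ => toAdele_smul primesOf_subset ℤ γ hγ μ)

theorem primesOf_subset_primesNe {m : ℕ} {p : Nat.Primes} (hp : p ∉ primesOf m) :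
    primesOf m ⊆ primesNe p := fun _ hℓ h => hp (h ▸ hℓ)

theorem le_Hδ_one {G' H : Subgroup GQ} : H ≤ Hδ H (Finsupp.single (1 : G') (1 : ℤ)) := by
  intro k hk
  refine mem_Hδ.2 ⟨fun g hg => ?_, hk⟩
  rw [Finset.mem_singleton.1 (Finsupp.support_single_subset hg)]
  simpa using hk

/-- Restriction to `p`-adic distributions, `([Id], i^*)¹`, for a prime `p` not dividing `cN`. -/
def restrictPadic (c N : ℕ) (p : Nat.Primes) (hp : p ∉ primesOf (c * N)) :
    H1 (GSN (primesOf (c * N)) N) (Dist (integral (primesOf (c * N))) ℤ) →+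
      H1 (GSN (primesNe p) N) (Dist (PadicInt.subring (p : ℕ)) ℤ) :=
  (resH1 le_Hδ_one).comp
    (smoothH1 (GSN (primesNe p) N) (GSN_anti (primesOf_subset_primesNe hp) N)
      (Finsupp.single 1 1) (toPadic p hp ℤ)
      fun γ hγ μ => toPadic_smul p hp ℤ γ (GSN_le _ _ hγ) μ)

/-! ### The Darmon-Dasgupta cocycle -/

/-- `E_k(z) = -B_k/(2k) + ∑_{m ≥ 1} σ_{k-1}(m) e^{2πimz}`. -/
def eisenstein (k : ℕ) (z : ℂ) : ℂ :=
  -(bernoulli k : ℂ) / (2 * k) + ∑' m : ℕ, (ArithmeticFunction.sigma (k - 1) (m + 1) : ℂ) *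
    Complex.exp (2 * Real.pi * Complex.I * (m + 1) * z)

/-- `E_k^δ(z) = -24 ∑_{D ∣ N} n_D D E_k(Dz)`. -/
def eisensteinDelta (N : ℕ) (n : ℕ → ℤ) (k : ℕ) (z : ℂ) : ℂ :=
  -24 * ∑ D ∈ N.divisors, (n D : ℂ) * D * eisenstein k (D * z)

/-- `∫_r^{i∞} h(z,1) E_k^δ(z) dz` along the vertical line above `r ∈ ℚ`, and `0` for `r = ∞`. -/
def periodToInfty (N : ℕ) (n : ℕ → ℤ) (k : ℕ) (h : MvPolynomial (Fin 2) ℤ) : OnePoint ℚ → ℂ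
  | none => 0
  | some r => ∫ t in Set.Ioi (0 : ℝ),
      MvPolynomial.aeval ![(r : ℂ) + t * Complex.I, 1] h *
        eisensteinDelta N n k ((r : ℂ) + t * Complex.I) * Complex.I

/-- `∫_r^s h(z,1) E_k^δ(z) dz` for cusps `r, s`, along vertical lines through `i∞`. -/
def period (N : ℕ) (n : ℕ → ℤ) (k : ℕ) (h : MvPolynomial (Fin 2) ℤ) (r s : OnePoint ℚ) : ℂ :=
  periodToInfty N n k h r - periodToInfty N n k h s

/-- `Γ₀^p(N)`, the subgroup of the matrices in `SL₂(ℤ[1/p])` that are upper triangular mod `N`. -/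
def Gamma0p (p : Nat.Primes) (N : ℕ) : Subgroup GQ :=
  GSN (primesNe p) N ⊓ ((Matrix.GeneralLinearGroup.det).comp
    (Matrix.GLPos (Fin 2) ℚ).subtype : GQ →* ℚˣ).ker

/-- The cusps in the orbit `Γ₀^p(N) i∞`. -/
abbrev Cusps (p : Nat.Primes) (N : ℕ) : Type :=
  MulAction.orbit (Gamma0p p N) (OnePoint.infty : OnePoint ℚ)

/-- Multiplication of column vectors in `ℚ_p²` by `γ`. -/
def mulCol (p : Nat.Primes) (γ : GQ) (w : Fin 2 → ℚ_[(p : ℕ)]) : Fin 2 → ℚ_[(p : ℕ)] :=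
  Matrix.mulVec ((mat γ).map (algebraMap ℚ ℚ_[(p : ℕ)])) w

/-- The ball `(u, v) + pʲ ℤ_p²` in `ℚ_p²`. -/
def ball (p : Nat.Primes) (j : ℕ) (u v : ℕ) : Set (Fin 2 → ℚ_[(p : ℕ)]) :=
  {w | ‖w 0 - u‖ ≤ ((p : ℝ) ^ j)⁻¹ ∧ ‖w 1 - v‖ ≤ ((p : ℝ) ^ j)⁻¹}

/-- The `p`-adic integral `∫_{𝕏₀} h dμ` over the primitive vectors `𝕏₀ = ℤ_p² - pℤ_p²` equals `I`:
the Riemann sums over the balls of radius `p^{-j}` in `𝕏₀` converge to `I`. -/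
def HasPadicIntegral (p : Nat.Primes) (μ : Dist (PadicInt.subring (p : ℕ)) ℤ)
    (h : MvPolynomial (Fin 2) ℤ) (I : ℚ_[(p : ℕ)]) : Prop :=
  Filter.Tendsto (fun j : ℕ => ∑ x ∈ (Finset.range ((p : ℕ) ^ j) ×ˢ Finset.range ((p : ℕ) ^ j)) with
      ¬ ((p : ℕ) ∣ x.1 ∧ (p : ℕ) ∣ x.2),
    (MvPolynomial.eval ![(x.1 : ℤ), (x.2 : ℤ)] h : ℚ_[(p : ℕ)]) *
      (μ.mass (ball p j x.1 x.2) : ℚ_[(p : ℕ)])) Filter.atTop (nhds I)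

/-- `μ` is the Darmon-Dasgupta family of `p`-adic measures `μ̃_δ{r → s}` on `ℚ_p² - {0}`, a space of
column vectors, for `r, s ∈ Γ₀^p(N) i∞`. The three conditions are:
the moments on `𝕏₀` are the real parts of Eisenstein periods (these are rational numbers);
`μ̃{γr → γs}(γU) = μ̃{r → s}(U)` for `γ ∈ Γ₀^p(N)`; and `μ̃{r → s}(pU) = μ̃{r → s}(U)`.
The last two are stated through test functions: `f'` and `f` correspond if `f'(gw) = f(w)`. -/
def IsDarmonDasguptaFamily (p : Nat.Primes) (N : ℕ) (n : ℕ → ℤ)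
    (μ : Cusps p N → Cusps p N → Dist (PadicInt.subring (p : ℕ)) ℤ) : Prop :=
  (∀ r s : Cusps p N, ∀ k : ℕ, Even k → 2 ≤ k → ∀ h : MvPolynomial (Fin 2) ℤ,
    h.IsHomogeneous (k - 2) → ∃ q : ℚ,
      (q : ℝ) = ((1 - (p : ℂ) ^ (k - 2)) * period N n k h r s).re ∧
      HasPadicIntegral p (μ r s) h q) ∧
  (∀ γ : Gamma0p p N, ∀ r s : Cusps p N, ∀ f f' : TestFn (PadicInt.subring (p : ℕ)),
    (∀ w, f'.1 (mulCol p γ w) = f.1 w) → μ (γ • r) (γ • s) f' = μ r s f) ∧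
  (∀ r s : Cusps p N, ∀ f f' : TestFn (PadicInt.subring (p : ℕ)),
    (∀ w, f'.1 (fun i => ((p : ℕ) : ℚ_[(p : ℕ)]) * w i) = f.1 w) → μ r s f' = μ r s f)

/-- The isomorphism `v ↦ S vᵀ`, `S = [0, -1; 1, 0]`, from row vectors to column vectors. -/
def rowToCol {p : Nat.Primes} (v : Fin 2 → ℚ_[(p : ℕ)]) : Fin 2 → ℚ_[(p : ℕ)] := ![-v 1, v 0]

/-- `C` is the Darmon-Dasgupta cocycle `μ_{DD,δ}`: a cocycle on `G_𝒫(N)`, with `𝒫` the set of all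
primes other than `p`, whose restriction to `Γ₀^p(N)` is
`(γ₁, γ₂) ↦ μ̃_δ{γ₁ i∞ → γ₂ i∞}`, transported to row vectors. -/
def IsDarmonDasguptaCocycle (p : Nat.Primes) (N : ℕ) (n : ℕ → ℤ)
    (C : Z1 (GSN (primesNe p) N) (Dist (PadicInt.subring (p : ℕ)) ℤ)) : Prop :=
  ∃ μ : Cusps p N → Cusps p N → Dist (PadicInt.subring (p : ℕ)) ℤ,
    IsDarmonDasguptaFamily p N n μ ∧
    ∀ γ₁ γ₂ : Gamma0p p N, ∀ f f' : TestFn (PadicInt.subring (p : ℕ)),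
      (∀ v, f'.1 (rowToCol v) = f.1 v) →
      (resZ1 (inf_le_left : Gamma0p p N ≤ GSN (primesNe p) N) C).1 γ₁ γ₂ f =
        μ ⟨γ₁ • OnePoint.infty, MulAction.mem_orbit _ γ₁⟩
          ⟨γ₂ • OnePoint.infty, MulAction.mem_orbit _ γ₂⟩ f'

/-- The `c`-smoothing `C ↦ C_c`, by the central element `c² [Id] - [D(c)]` acting on the values. -/
def smoothC (c : ℕ) (hc : (c : ℚ) ≠ 0) {H : Subgroup GQ} {M : Type} [AddCommGroup M]
    [DistribMulAction GQ M] : Z1 H M →+ Z1 H M where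
  toFun C := ⟨fun g₀ g₁ => (c ^ 2 : ℤ) • C.1 g₀ g₁ - scalar c hc • C.1 g₀ g₁, by
    refine ⟨fun h g₀ g₁ => ?_, fun g₀ g₁ g₂ => ?_⟩
    · simp only []
      rw [C.2.1, smul_sub, ← mul_smul, scalar_comm, mul_smul, smul_comm (h : GQ) (c ^ 2 : ℤ)]
    · have h := C.2.2 g₀ g₁ g₂
      have h1 := congrArg (fun x => (c ^ 2 : ℤ) • x) h
      have h2 := congrArg (fun x => scalar c hc • x) h
      simp only [smul_add, smul_sub, smul_zero] at h1 h2
      have := congrArg₂ (· - ·) h1 h2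
      rw [sub_zero] at this
      simp only []
      rw [← this]
      generalize (c ^ 2 : ℤ) • C.1 g₁ g₂ = x₁
      generalize (c ^ 2 : ℤ) • C.1 g₀ g₂ = x₂
      generalize (c ^ 2 : ℤ) • C.1 g₀ g₁ = x₃
      abel⟩
  map_zero' := by
    apply Subtype.ext; funext g₀ g₁
    change (c ^ 2 : ℤ) • (0 : M) - scalar c hc • (0 : M) = 0
    simp
  map_add' C C' := by
    apply Subtype.ext; funext g₀ g₁
    change (c ^ 2 : ℤ) • (C.1 g₀ g₁ + C'.1 g₀ g₁) - scalar c hc • (C.1 g₀ g₁ + C'.1 g₀ g₁) =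
      ((c ^ 2 : ℤ) • C.1 g₀ g₁ - scalar c hc • C.1 g₀ g₁) +
        ((c ^ 2 : ℤ) • C'.1 g₀ g₁ - scalar c hc • C'.1 g₀ g₁)
    rw [smul_add, smul_add]; abel

end

end DedekindRademacher

namespace DedekindRademacher

noncomputable section

open scoped Real Topology
open Finset (range sum_congr mul_sum mem_range prod_congr sum_mul sum_sub_distrib sum_add_distrib
  sum_comm sum_eq_zero prod_mul_distrib sum_range_succ prod_pow mem_filter card_range
  sum_eq_single_of_mem sum_neg_distrib mem_product sum_range_succ' smul_sum sum_const prod_comm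
  sum_mul_sum)
open Complex (I log re_ofReal_mul im_ofReal_mul Gamma ofReal_natCast ofReal_im add_im exp_nat_mul
  I_sq normSq exp_add ofReal_mul im_sum two_pi_I_ne_zero cpow_neg norm_real ofReal_pow cpow_natCast
  re_sum neg_im exp_neg exp_log ofReal_sin ofReal_exp ofReal_cos I_im continuous_re continuous_im
  sub_re norm_I)
open ModularGroup (T S coe_T_zpow)
open Real (exp sinh pi_pos cosh sin norm_eq_abs pi_ne_zero)
open Nat (Primes pos_of_mem_divisors cast_sub succ_pos cast_nonneg succ_ne_zero cast_zero
  dvd_of_mem_divisors Coprime)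
open Filter (Tendsto atTop univ_mem tendsto_id)
open ModularForm (eta eta_q eta_ne_zero)
open OnePoint (infty)
open Int (fract cast_natCast induction_on toNat_of_nonneg castRingHom)
open Set (Ioi indicator_of_notMem indicator_of_mem mem_ofPred_eq)
open Matrix.SpecialLinearGroup (mapGL coe_mul coe_inv map toGLPos coe_one coe_neg)
open Matrix (det_fin_two det_mul of_apply inv_eq_right_inv)
open Function.Periodic (qParam)
open Function (Injective comp_apply comp Surjective)
open UpperHalfPlane (ext_iff denom ofComplex num upperHalfPlaneSet coe_smul_of_det_pos)
open Polynomial (eval_C mem_nthRootsFinset eval_finsetSum eval_X eval_sub eval_mul eval_add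
  eval_comp derivative_C)
open Rat (cast_mul cast_sum den_mul_eq_num)
open PadicInt (mem_subring_iff coe_natCast coe_sub)
open MvPolynomial (aeval mem_support_iff isHomogeneous_X)
open Subgroup (mem_top)
open Padic (nonarchimedean)

local notation "Z_[" p "]" => PadicInt.subring p
local notation "bernP" => Polynomial.bernoulli
local notation "IsBal(" n "," N ")" => ∑ D ∈ Nat.divisors N, n D * (D : ℤ) = 0

/-! Test functions of finite level and distributions from norm-compatible functions -/

@[to_additive]
theorem prod_range_digits {A : Type*} [CommMonoid A] (a b : ℕ) (g : ℕ → A) :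
    ∏ I ∈ range (a * b), g I = ∏ i ∈ range a, ∏ j ∈ range b, g (i + a * j) := by
  induction b with
  | zero => simp
  | succ b ih =>
    rw [mul_add, mul_one, Finset.prod_range_add, ih, ← prod_mul_distrib]
    refine prod_congr rfl fun i _ => ?_
    rw [Finset.prod_range_succ, add_comm i (a * b)]

theorem sum_range_mul_of_dvd {A : Type*} [AddCommMonoid A] {k b : ℕ} (hk : 0 < k) (g : ℕ → A)
    (hg : ∀ I, ¬ k ∣ I → g I = 0) : ∑ I ∈ range (k * b), g I = ∑ j ∈ range b, g (k * j) := by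
  rw [sum_range_digits, sum_eq_single_of_mem 0 (mem_range.2 hk)]
  · simp
  · intro i hi hi0; refine sum_eq_zero fun j _ => hg _ fun h => ?_
    rw [← Nat.dvd_add_iff_left (Dvd.intro _ rfl)] at h
    exact hi0 (Nat.eq_zero_of_dvd_of_lt h (mem_range.1 hi))

/-- A multiplicative set `L` of positive integers such that `O / mO = ℤ / m` for `m ∈ L` and every
positive integer is the product of an element of `L` and a unit of `O`. -/
structure LevelSystem {R : Type} [CommRing R] (O : Subring R) (L : Set ℕ) : Prop where
  one_mem : 1 ∈ L
  mul_mem : ∀ {a b}, a ∈ L → b ∈ L → a * b ∈ L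
  pos : ∀ {m}, m ∈ L → 0 < m
  exists_unit : ∀ m, 0 < m → ∃ k ∈ L, ∃ s : ℕ, m = k * s ∧ ∃ t ∈ O, (s : R) * t = 1
  approx : ∀ {m}, m ∈ L → ∀ y ∈ O, ∃ i : ℕ, i < m ∧ ∃ w ∈ O, y = i + m * w
  sep : ∀ {m}, m ∈ L → ∀ i : ℤ, ∀ w ∈ O, (i : R) = m * w → (m : ℤ) ∣ i

variable {m k c N D d j l : ℕ} {a b x y : ℚ} {τ Q X : ℂ} {t : ℝ} {n : ℕ → ℤ} {p : Primes} {γ : GQ}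
  {S : Set Primes} {H : Subgroup GQ} {R : Type} [CommRing R] [Algebra ℚ R] {O : Subring R} {L : Set ℕ}
  {f : TestFn O} {A : Type} [AddCommGroup A]

/-- A rational vector. -/
def ratVec (R : Type) [CommRing R] [Algebra ℚ R] (a b : ℚ) : Fin 2 → R :=
  ![algebraMap ℚ R a, algebraMap ℚ R b]

theorem ratVec_zero : ratVec R 0 0 = 0 := by funext i; fin_cases i <;> simp [ratVec]

/-- The coset `(a, b) + m O²`. -/
def cell (O : Subring R) (m : ℕ) (a b : ℚ) : Set (Fin 2 → R) :=
  {v | (∃ w ∈ O, v 0 = algebraMap ℚ R a + m * w) ∧ ∃ w ∈ O, v 1 = algebraMap ℚ R b + m * w}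

theorem isTestWith_indicator_cell (O : Subring R) (ha : ∃ z : ℤ, (d : ℚ) * a = z)
    (hb : ∃ z : ℤ, (d : ℚ) * b = z) :
    IsTestWith O (m * d) ((cell O m a b).indicator fun _ => (1 : ℤ)) := by
  refine ⟨fun v hv => ?_, fun v w hw => ?_⟩
  · obtain ⟨⟨w, hw, e0⟩, w', hw', e1⟩ := Set.mem_of_indicator_ne_zero hv
    have key : ∀ (x : ℚ) (y u : R), (∃ z : ℤ, (d : ℚ) * x = z) → u ∈ O →
        y = algebraMap ℚ R x + m * u → ((m * d : ℕ) : R) * y ∈ O := by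
      rintro x y u ⟨z, hz⟩ hu rfl; have := congrArg (algebraMap ℚ R) hz
      rw [map_mul, map_natCast, map_intCast] at this
      have e : ((m * d : ℕ) : R) * (algebraMap ℚ R x + m * u) = m * (z + d * m * u) := by
        rw [← this]; push_cast; ring
      rw [e]
      exact mul_mem (natCast_mem O _) (add_mem (intCast_mem O _) (mul_mem (mul_mem
        (natCast_mem O _) (natCast_mem O _)) hu))
    intro i
    fin_cases i
    · exact key a _ w ha hw e0
    · exact key b _ w' hb hw' e1
  · have key : ∀ (x : ℚ) (y u : R), u ∈ O →
        ((∃ w ∈ O, y + ((m * d : ℕ) : R) * u = algebraMap ℚ R x + m * w) ↔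
          ∃ w ∈ O, y = algebraMap ℚ R x + m * w) := fun x y u hu => by
      have hu' := mul_mem (natCast_mem O d) hu
      constructor <;> rintro ⟨w, hw, e⟩
      · exact ⟨w - d * u, sub_mem hw hu', by rw [eq_sub_of_add_eq e]; push_cast; ring⟩
      · exact ⟨w + d * u, add_mem hw hu', by rw [e]; push_cast; ring⟩
    simp only [Set.indicator, cell, mem_ofPred_eq]; congr 1
    exact propext (and_congr (key _ _ _ (hw 0)) (key _ _ _ (hw 1)))

open Classical in
/-- The characteristic function of a coset that does not contain the origin, and `0` otherwise. -/
def cellFn (O : Subring R) (m : ℕ) (a b : ℚ) : TestFn O :=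
  if h : (cell O m a b).indicator (fun _ => (1 : ℤ)) ∈ TestFn O then ⟨_, h⟩ else 0

theorem mass_cell (μ : Dist O A) (m : ℕ) (a b : ℚ) : μ.mass (cell O m a b) = μ (cellFn O m a b) := by
  unfold Dist.mass cellFn
  split_ifs with h
  · rfl
  · exact (map_zero μ).symm

theorem eq_of_mem_cell {f : (Fin 2 → R) → ℤ} (hf : IsTestWith O m f) {v : Fin 2 → R}
    (hv : v ∈ cell O m a b) : f v = f (ratVec R a b) := by
  obtain ⟨⟨w, hw, h0⟩, w', hw', h1⟩ := hv
  rw [← hf.2 (ratVec R a b) ![w, w'] (by intro i; fin_cases i <;> assumption)]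
  congr 1
  funext i; fin_cases i
  · exact h0
  · exact h1

theorem cell_mem_testFn (O : Subring R) (hm : 0 < m) (a b : ℚ)
    (h0 : (0 : Fin 2 → R) ∉ cell O m a b) : (cell O m a b).indicator (fun _ => (1 : ℤ)) ∈ TestFn O := by
  refine ⟨indicator_of_notMem h0 _, m * (a.den * b.den),
    Nat.mul_pos hm (Nat.mul_pos a.den_pos b.den_pos), isTestWith_indicator_cell O
      ⟨b.den * a.num, ?_⟩ ⟨a.den * b.num, ?_⟩⟩
  · push_cast; rw [← den_mul_eq_num]; ring
  · push_cast; rw [← den_mul_eq_num]; ring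

theorem isTestWith_cell (O : Subring R) (a b : ℚ) (ha : ∃ z : ℤ, (d : ℚ) * a = z)
    (hb : ∃ z : ℤ, (d : ℚ) * b = z) : IsTestWith O (m * d) (cellFn O m a b).1 := by
  unfold cellFn
  split_ifs with h
  · exact isTestWith_indicator_cell O ha hb
  · exact ⟨fun v hv => absurd rfl hv, fun _ _ _ => rfl⟩

theorem cellFn_apply (O : Subring R) (hm : 0 < m) (a b : ℚ) (h0 : (0 : Fin 2 → R) ∉ cell O m a b) :
    (cellFn O m a b).1 = (cell O m a b).indicator (fun _ => (1 : ℤ)) := by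
  unfold cellFn
  rw [dif_pos (cell_mem_testFn O hm a b h0)]

theorem cellFn_eq_zero (O : Subring R) (a b : ℚ) (h0 : (0 : Fin 2 → R) ∈ cell O m a b) :
    cellFn O m a b = 0 := by
  unfold cellFn
  rw [dif_neg]
  rintro ⟨h, -⟩
  rw [indicator_of_mem h0] at h
  exact one_ne_zero h

theorem algebraMap_div (i m : ℕ) (hm : 0 < m) : (m : R) * algebraMap ℚ R ((i : ℚ) / m) = i := by
  have hm' : (m : ℚ) ≠ 0 := mod_cast hm.ne'
  rw [← map_natCast (algebraMap ℚ R), ← map_mul, mul_div_cancel₀ _ hm', map_natCast]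

theorem natCast_mul_cancel (hm : 0 < m) {x y : R} (h : (m : R) * x = m * y) : x = y := by
  have hm' : (m : ℚ) ≠ 0 := mod_cast hm.ne'
  have e : algebraMap ℚ R ((m : ℚ)⁻¹) * (m : R) = 1 := by
    rw [← map_natCast (algebraMap ℚ R) m, ← map_mul, inv_mul_cancel₀ hm', map_one]
  have := congrArg (fun z => algebraMap ℚ R ((m : ℚ)⁻¹) * z) h
  simpa only [← mul_assoc, e, one_mul] using this

theorem LevelSystem.exists_level (hL : LevelSystem O L) (f : TestFn O) : ∃ m ∈ L, IsTestWith O m f.1 := by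
  obtain ⟨f, -, m, hm, hf⟩ := f
  obtain ⟨k, hk, s, rfl, t, ht, hst⟩ := hL.exists_unit m hm
  refine ⟨k, hk, fun v hv i => ?_, fun v w hw => ?_⟩
  · have := O.mul_mem ht (hf.1 v hv i)
    have e : t * (((k * s : ℕ) : R) * v i) = (k : R) * v i := by
      push_cast; linear_combination (k : R) * v i * hst
    rwa [e] at this
  · refine (congrArg f ?_).trans (hf.2 v (fun i => t * w i) fun i => O.mul_mem ht (hw i))
    funext i
    push_cast; linear_combination -(k : R) * w i * hst

theorem LevelSystem.eq_of_sub_eq (hL : LevelSystem O L) {i : ℕ} (hm : m ∈ L) (hi : i < m)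
    (hj : j < m) {w : R} (hw : w ∈ O) (h : (i : R) - j = m * w) : i = j := by
  have h' := Int.eq_zero_of_abs_lt_dvd (hL.sep hm (i - j) w hw (by push_cast; exact h))
    (by rw [abs_lt]; constructor <;> omega)
  omega

theorem indicator_congr {α β : Type*} {s : Set α} {t : Set β} {a : α} {b : β} (h : a ∈ s ↔ b ∈ t) :
    s.indicator (fun _ => (1 : ℤ)) a = t.indicator (fun _ => 1) b := by
  classical simp only [Set.indicator_apply, h]

theorem LevelSystem.sum_indicator (hL : LevelSystem O L) (hm : m ∈ L) (v : Fin 2 → R)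
    (hv : ∀ i, (m : R) * v i ∈ O) : ∑ i ∈ range (m * m), ∑ j ∈ range (m * m),
      (cell O m ((i : ℚ) / m) ((j : ℚ) / m)).indicator (fun _ => (1 : ℤ)) v = 1 := by
  have hmm := hL.mul_mem hm hm
  have hm0 := hL.pos hm
  have iff : ∀ (x : R) (i₀ i : ℕ), i₀ < m * m → i < m * m →
      (∃ w ∈ O, (m : R) * x = i₀ + ((m * m : ℕ) : R) * w) →
      ((∃ w ∈ O, x = algebraMap ℚ R ((i : ℚ) / m) + m * w) ↔ i = i₀) := by
    rintro x i₀ i hi₀ hi ⟨w, hw, e⟩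
    constructor
    · rintro ⟨w', hw', rfl⟩; rw [mul_add, algebraMap_div _ _ hm0] at e
      exact hL.eq_of_sub_eq hmm hi hi₀ (sub_mem hw hw') (by push_cast at e ⊢; linear_combination e)
    · rintro rfl; refine ⟨w, hw, natCast_mul_cancel hm0 ?_⟩
      rw [e, mul_add, algebraMap_div _ _ hm0]; push_cast; ring
  obtain ⟨i₀, hi₀, hw₀⟩ := hL.approx hmm _ (hv 0)
  obtain ⟨j₀, hj₀, hw₁⟩ := hL.approx hmm _ (hv 1)
  rw [sum_eq_single_of_mem i₀ (mem_range.2 hi₀), sum_eq_single_of_mem j₀ (mem_range.2 hj₀)]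
  · have h : v ∈ cell O m ((i₀ : ℚ) / m) ((j₀ : ℚ) / m) :=
      ⟨(iff _ _ _ hi₀ hi₀ hw₀).2 rfl, (iff _ _ _ hj₀ hj₀ hw₁).2 rfl⟩
    exact indicator_of_mem h _
  · intro j hj hne
    exact indicator_of_notMem (fun h => hne ((iff _ _ _ hj₀ (mem_range.1 hj) hw₁).1 h.2)) _
  · intro i hi hne; refine sum_eq_zero fun j _ => ?_
    exact indicator_of_notMem (fun h => hne ((iff _ _ _ hi₀ (mem_range.1 hi) hw₀).1 h.1)) _

theorem smul_cellFn_apply (hm : 0 < m) (hf : IsTestWith O m f.1) (a b : ℚ) (v : Fin 2 → R) :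
    f.1 (ratVec R a b) * (cellFn O m a b).1 v =
      f.1 v * (cell O m a b).indicator (fun _ => (1 : ℤ)) v := by
  by_cases h0 : (0 : Fin 2 → R) ∈ cell O m a b
  · have e : f.1 (ratVec R a b) = 0 := by rw [← eq_of_mem_cell hf h0]; exact f.2.1
    rw [e, zero_mul]
    by_cases hv : v ∈ cell O m a b
    · rw [eq_of_mem_cell hf hv, e, zero_mul]
    · rw [indicator_of_notMem hv, mul_zero]
  · rw [cellFn_apply O hm a b h0]
    by_cases hv : v ∈ cell O m a b
    · rw [eq_of_mem_cell hf hv]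
    · rw [indicator_of_notMem hv, mul_zero, mul_zero]

/-- The sum of the values of a test function at the points of level `m`, with weights `G`. -/
def weightedSum (O : Subring R) (m : ℕ) (G : ℕ → ℕ → A) : TestFn O →+ A where
  toFun f := ∑ i ∈ range (m * m), ∑ j ∈ range (m * m),
    f.1 (ratVec R ((i : ℚ) / m) ((j : ℚ) / m)) • G i j
  map_zero' := sum_eq_zero fun i _ => sum_eq_zero fun j _ => zero_smul ℤ _
  map_add' f g := by simp only [← sum_add_distrib, ← add_smul]; rfl

/-- The sampling operator at level `m`: a combination of characteristic functions of cosets. -/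
def sample (O : Subring R) (m : ℕ) : TestFn O →+ TestFn O :=
  weightedSum O m fun i j => cellFn O m ((i : ℚ) / m) ((j : ℚ) / m)

theorem LevelSystem.sample_eq (hL : LevelSystem O L) (hm : m ∈ L) (hf : IsTestWith O m f.1) :
    sample O m f = f := by
  apply Subtype.ext; funext v
  have e : (sample O m f).1 v = ∑ i ∈ range (m * m), ∑ j ∈ range (m * m),
      f.1 (ratVec R ((i : ℚ) / m) ((j : ℚ) / m)) *
        (cellFn O m ((i : ℚ) / m) ((j : ℚ) / m)).1 v := by
    simp [sample, weightedSum, Finset.sum_apply]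
  rw [e]
  simp only [smul_cellFn_apply (hL.pos hm) hf, ← mul_sum]
  by_cases hv : f.1 v = 0
  · rw [hv, zero_mul]
  · rw [hL.sum_indicator hm v (hf.1 v hv), mul_one]

theorem Dist.apply_sample (μ : Dist O A) (m : ℕ) (f : TestFn O) :
    μ (sample O m f) = ∑ i ∈ range (m * m), ∑ j ∈ range (m * m),
      f.1 (ratVec R ((i : ℚ) / m) ((j : ℚ) / m)) • μ (cellFn O m ((i : ℚ) / m) ((j : ℚ) / m)) := by
  simp only [sample, weightedSum, AddMonoidHom.coe_mk, ZeroHom.coe_mk, map_sum, map_zsmul]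

theorem LevelSystem.dist_ext (hL : LevelSystem O L) {μ ν : Dist O A}
    (h : ∀ m ∈ L, ∀ i j : ℕ, μ (cellFn O m ((i : ℚ) / m) ((j : ℚ) / m)) =
      ν (cellFn O m ((i : ℚ) / m) ((j : ℚ) / m))) : μ = ν := by
  refine DFunLike.ext _ _ fun f => ?_
  obtain ⟨m, hm, hf⟩ := hL.exists_level f
  rw [← hL.sample_eq hm hf, Dist.apply_sample, Dist.apply_sample]
  simp only [h m hm]

/-- A function on `ℚ²/ℤ²` that satisfies the norm relations of level in `L`. -/
structure NormCompatible (L : Set ℕ) (U : ℚ → ℚ → A) : Prop where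
  periodic : ∀ (a b : ℚ) (i j : ℤ), U (a + i) (b + j) = U a b
  norm : ∀ k ∈ L, ∀ d ∈ L, ∀ a b : ℚ, (∃ z : ℤ, (d : ℚ) * a = z) → (∃ z : ℤ, (d : ℚ) * b = z) →
    ¬ ((∃ z : ℤ, a = z) ∧ ∃ z : ℤ, b = z) →
    ∑ i ∈ range k, ∑ j ∈ range k, U ((a + i) / k) ((b + j) / k) = U a b

/-- The Riemann sum of level `m` of a test function. -/
def levelSum (O : Subring R) (U : ℚ → ℚ → A) (m : ℕ) : TestFn O →+ A :=
  weightedSum O m fun i j => U ((i : ℚ) / (m * m)) ((j : ℚ) / (m * m))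

theorem levelSum_apply (U : ℚ → ℚ → A) (m : ℕ) (f : TestFn O) : levelSum O U m f =
    ∑ i ∈ range (m * m), ∑ j ∈ range (m * m),
      f.1 (ratVec R ((i : ℚ) / m) ((j : ℚ) / m)) • U ((i : ℚ) / (m * m)) ((j : ℚ) / (m * m)) := rfl

theorem LevelSystem.dvd_of_mem (hL : LevelSystem O L) {I : ℕ} (hk : k ∈ L) (hm : m ∈ L)
    (h : (m : R) * algebraMap ℚ R ((I : ℚ) / (m * k : ℕ)) ∈ O) : k ∣ I := by
  have e := algebraMap_div (R := R) I (m * k) (hL.pos (hL.mul_mem hm hk))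
  have := hL.sep hk I _ h (by rw [cast_natCast, ← e]; push_cast; ring)
  exact_mod_cast this

theorem zero_mem_cell_of_int (hm : 0 < m) (h : (∃ z : ℤ, a / m = z) ∧
    ∃ z : ℤ, b / m = z) : (0 : Fin 2 → R) ∈ cell O m a b := by
  obtain ⟨⟨z, hz⟩, z', hz'⟩ := h
  have hm' : (m : ℚ) ≠ 0 := mod_cast hm.ne'
  refine ⟨⟨-(z : R), neg_mem (intCast_mem O _), ?_⟩, ⟨-(z' : R), neg_mem (intCast_mem O _), ?_⟩⟩
  · have e : a = m * z := by rw [← hz]; field_simp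
    rw [e, map_mul, map_natCast, map_intCast]; simp
  · have e : b = m * z' := by rw [← hz']; field_simp
    rw [e, map_mul, map_natCast, map_intCast]; simp

theorem LevelSystem.levelSum_mul (hL : LevelSystem O L) {U : ℚ → ℚ → A} (hU : NormCompatible L U)
    (hm : m ∈ L) (hk : k ∈ L) (hf : IsTestWith O m f.1) : levelSum O U (m * k) f = levelSum O U m f := by
  have hm0 := hL.pos hm
  have hk0 := hL.pos hk
  have hm' : (m : ℚ) ≠ 0 := mod_cast hm0.ne'
  have hk' : (k : ℚ) ≠ 0 := mod_cast hk0.ne'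
  have hz0 : ∀ I J : ℕ, ¬ k ∣ I →
      f.1 (ratVec R ((I : ℚ) / (m * k : ℕ)) ((J : ℚ) / (m * k : ℕ))) = 0 := fun I J hI => by
    by_contra h
    exact hI (hL.dvd_of_mem hk hm (hf.1 _ h 0))
  have hz1 : ∀ I J : ℕ, ¬ k ∣ J →
      f.1 (ratVec R ((I : ℚ) / (m * k : ℕ)) ((J : ℚ) / (m * k : ℕ))) = 0 := fun I J hI => by
    by_contra h
    exact hI (hL.dvd_of_mem hk hm (hf.1 _ h 1))
  have er : (m * k) * (m * k) = k * ((m * m) * k) := by ring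
  rw [levelSum_apply, levelSum_apply, er, sum_range_mul_of_dvd hk0 _ fun I hI =>
    sum_eq_zero fun J _ => by rw [hz0 I J hI, zero_smul]]
  have e1 : ∀ I : ℕ, ((k * I : ℕ) : ℚ) / (m * k : ℕ) = (I : ℚ) / m := fun I => by
    push_cast; field_simp
  have e2 : ∀ I : ℕ, ((k * I : ℕ) : ℚ) / ((m * k : ℕ) * (m * k : ℕ)) =
      (I : ℚ) / ((m * m) * k) := fun I => by
    push_cast; field_simp
  have step : ∀ I ∈ range ((m * m) * k), ∑ J ∈ range (k * ((m * m) * k)),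
      f.1 (ratVec R (((k * I : ℕ) : ℚ) / (m * k : ℕ)) ((J : ℚ) / (m * k : ℕ))) •
        U (((k * I : ℕ) : ℚ) / ((m * k : ℕ) * (m * k : ℕ))) ((J : ℚ) / ((m * k : ℕ) * (m * k : ℕ)))
      = ∑ J ∈ range ((m * m) * k), f.1 (ratVec R ((I : ℚ) / m) ((J : ℚ) / m)) •
        U ((I : ℚ) / ((m * m) * k)) ((J : ℚ) / ((m * m) * k)) := fun I _ => by
    rw [sum_range_mul_of_dvd hk0 _ fun J hJ => by rw [hz1 _ J hJ, zero_smul]]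
    simp only [e1, e2]
  rw [sum_congr rfl step, sum_range_digits]
  refine sum_congr rfl fun i _ => ?_
  simp only [sum_range_digits (m * m) k]
  rw [sum_comm]
  refine sum_congr rfl fun j _ => ?_
  have hconst : ∀ i' j' : ℕ,
      f.1 (ratVec R (((i + m * m * i' : ℕ) : ℚ) / m) (((j + m * m * j' : ℕ) : ℚ) / m)) =
        f.1 (ratVec R ((i : ℚ) / m) ((j : ℚ) / m)) := fun i' j' => by
    refine eq_of_mem_cell hf ⟨⟨(i' : R), natCast_mem O _, ?_⟩, ⟨(j' : R), natCast_mem O _, ?_⟩⟩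
    all_goals
      simp only [ratVec, Matrix.cons_val_zero, Matrix.cons_val_one]; apply natCast_mul_cancel hm0
      rw [mul_add, algebraMap_div _ _ hm0, algebraMap_div _ _ hm0]; push_cast; ring
  have e3 : ∀ i i' : ℕ, ((i + m * m * i' : ℕ) : ℚ) / ((m * m) * k) =
      ((i : ℚ) / (m * m) + i') / k := fun i i' => by
    push_cast; field_simp
  simp only [hconst, e3, ← smul_sum]
  by_cases h0 : f.1 (ratVec R ((i : ℚ) / m) ((j : ℚ) / m)) = 0
  · rw [h0, zero_smul, zero_smul]
  congr 1
  refine hU.norm k hk (m * m) (hL.mul_mem hm hm) _ _ ⟨i, by push_cast; field_simp⟩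
    ⟨j, by push_cast; field_simp⟩ ?_
  rintro ⟨⟨z, hz⟩, z', hz'⟩
  refine h0 ?_
  rw [← eq_of_mem_cell hf (zero_mem_cell_of_int (b := (j : ℚ) / m) hm0 ⟨⟨z, ?_⟩, z', ?_⟩), f.2.1]
  · rw [← hz]; field_simp
  · rw [← hz']; field_simp

/-- The distribution attached to a norm-compatible function. -/
def LevelSystem.distOf (hL : LevelSystem O L) {U : ℚ → ℚ → A} (hU : NormCompatible L U) : Dist O A :=
  (AddMonoidHom.mk' (fun f => levelSum O U (hL.exists_level f).choose f) (by
    have key : ∀ (f : TestFn O) (k : ℕ), k ∈ L → levelSum O U (hL.exists_level f).choose f =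
        levelSum O U ((hL.exists_level f).choose * k) f := fun f k hk =>
      (hL.levelSum_mul hU (hL.exists_level f).choose_spec.1 hk
        (hL.exists_level f).choose_spec.2).symm
    intro f g; obtain ⟨hf, -⟩ := (hL.exists_level f).choose_spec
    obtain ⟨hg, -⟩ := (hL.exists_level g).choose_spec
    obtain ⟨hfg, -⟩ := (hL.exists_level (f + g)).choose_spec
    rw [key f _ (hL.mul_mem hg hfg), key g _ (hL.mul_mem hf hfg),
      key (f + g) _ (hL.mul_mem hf hg), map_add]
    congr 2 <;> ring_nf) : TestFn O →+ A)

theorem LevelSystem.distOf_apply (hL : LevelSystem O L) {U : ℚ → ℚ → A} (hU : NormCompatible L U)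
    (hm : m ∈ L) (hf : IsTestWith O m f.1) : hL.distOf hU f = levelSum O U m f := by
  change levelSum O U (hL.exists_level f).choose f = _
  rw [← hL.levelSum_mul hU (hL.exists_level f).choose_spec.1 hm (hL.exists_level f).choose_spec.2,
    ← hL.levelSum_mul hU hm (hL.exists_level f).choose_spec.1 hf, mul_comm]

theorem LevelSystem.distOf_cellFn (hL : LevelSystem O L) {U : ℚ → ℚ → A} (hU : NormCompatible L U)
    (hm : m ∈ L) (hd : d ∈ L) (ha : ∃ z : ℤ, (d : ℚ) * a = z) (hb : ∃ z : ℤ, (d : ℚ) * b = z)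
    (h0 : (0 : Fin 2 → R) ∉ cell O m a b) : hL.distOf hU (cellFn O m a b) = U (a / m) (b / m) := by
  have hm0 := hL.pos hm
  have hd0 := hL.pos hd
  have hmd := hL.mul_mem hm hd
  have hm' : (m : ℚ) ≠ 0 := mod_cast hm0.ne'
  have hd' : (d : ℚ) ≠ 0 := mod_cast hd0.ne'
  rw [hL.distOf_apply hU hmd (isTestWith_cell O a b ha hb), levelSum_apply,
    cellFn_apply O hm0 a b h0]
  set M := m * d * m with hM
  have hML : M ∈ L := hL.mul_mem hmd hm
  have hM0 : 0 < M := hL.pos hML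
  have hM' : (M : ℚ) ≠ 0 := mod_cast hM0.ne'
  have key : ∀ x : ℚ, (∃ z : ℤ, (d : ℚ) * x = z) → ∃ x₀ < M,
      (∀ i i' : ℕ, i < M → ((∃ w ∈ O, algebraMap ℚ R (((i + M * i' : ℕ) : ℚ) / (m * d : ℕ)) =
        algebraMap ℚ R x + m * w) ↔ i = x₀)) ∧ ∃ z : ℤ, (x₀ : ℚ) / M = x / m + z := by
    rintro x ⟨ξ, hx⟩; have hMz : (M : ℤ) ≠ 0 := mod_cast hM0.ne'
    have hx₀ := toNat_of_nonneg (Int.emod_nonneg (m * ξ) hMz)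
    have hlt := Int.emod_lt_of_pos (m * ξ) (mod_cast hM0 : (0 : ℤ) < M)
    set x₀ := ((m * ξ) % M).toNat
    refine ⟨x₀, by omega, fun i i' hi => ?_, -((m * ξ) / M), ?_⟩
    · have e1 : ((m * d : ℕ) : R) * algebraMap ℚ R x = m * ξ := by
        have := congrArg (algebraMap ℚ R) hx; rw [map_mul, map_natCast, map_intCast] at this
        push_cast; rw [mul_assoc, this]
      have e2 := algebraMap_div (R := R) (i + M * i') (m * d) (hL.pos hmd)
      trans (M : ℤ) ∣ ((i + M * i' : ℕ) : ℤ) - m * ξ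
      · constructor
        · rintro ⟨w, hw, e⟩; refine hL.sep hML _ w hw ?_; rw [e, mul_add, e1] at e2
          push_cast [hM] at e2 ⊢
          linear_combination -e2
        · rintro ⟨w, hw⟩; refine ⟨w, intCast_mem O _, natCast_mul_cancel (hL.pos hmd) ?_⟩
          rw [e2, mul_add, e1]; have := congrArg (Int.cast : ℤ → R) hw; push_cast [hM] at this ⊢
          linear_combination this
      · rw [← Int.modEq_iff_dvd, Int.modEq_comm, Int.ModEq, ← hx₀]; push_cast
        rw [Int.add_mul_emod_self_left, Int.emod_eq_of_lt (by positivity) (mod_cast hi)]; norm_cast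
    · have h1 := Int.emod_add_mul_ediv (m * ξ) M
      rw [← hx₀] at h1; have h2 : (x₀ : ℚ) + M * ((m * ξ / M : ℤ) : ℚ) = m * ξ := mod_cast h1
      have h3 : (M : ℚ) = m * d * m := by rw [hM]; push_cast; ring
      have h4 : x / m = m * ξ / M := by rw [← hx, h3]; field_simp
      rw [h4, ← h2]; push_cast; field_simp; ring
  obtain ⟨i₀, hi₀, hi, z, hz⟩ := key a ha
  obtain ⟨j₀, hj₀, hj, z', hz'⟩ := key b hb
  have eU : ∀ i i' : ℕ, ((i + M * i' : ℕ) : ℚ) / ((m * d : ℕ) * (m * d : ℕ)) =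
      ((i : ℚ) / M + i') / d := fun i i' => by
    push_cast [hM]; field_simp
  have mem : ∀ i j i' j' : ℕ, i < M → j < M →
      (ratVec R (((i + M * i' : ℕ) : ℚ) / (m * d : ℕ)) (((j + M * j' : ℕ) : ℚ) / (m * d : ℕ)) ∈
        cell O m a b ↔ i = i₀ ∧ j = j₀) := fun i j i' j' h h' =>
    and_congr (hi i i' h) (hj j j' h')
  rw [show (m * d) * (m * d) = M * d by rw [hM]; ring, sum_range_digits]
  simp only [sum_range_digits M d]
  rw [sum_eq_single_of_mem i₀ (mem_range.2 hi₀)]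
  swap
  · intro i hi hne
    refine sum_eq_zero fun i' _ => sum_eq_zero fun j hj => sum_eq_zero fun j' _ => ?_
    rw [indicator_of_notMem fun h =>
      hne ((mem i j i' j' (mem_range.1 hi) (mem_range.1 hj)).1 h).1, zero_smul]
  rw [sum_comm, sum_eq_single_of_mem j₀ (mem_range.2 hj₀)]
  swap
  · intro j hj hne; refine sum_eq_zero fun i' _ => sum_eq_zero fun j' _ => ?_
    rw [indicator_of_notMem fun h => hne ((mem i₀ j i' j' hi₀ (mem_range.1 hj)).1 h).2, zero_smul]
  have one : ∀ i' j' : ℕ, (cell O m a b).indicator (fun _ => (1 : ℤ))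
      (ratVec R (((i₀ + M * i' : ℕ) : ℚ) / (m * d : ℕ)) (((j₀ + M * j' : ℕ) : ℚ) / (m * d : ℕ))) =
      1 := fun i' j' => indicator_of_mem ((mem i₀ j₀ i' j' hi₀ hj₀).2 ⟨rfl, rfl⟩) _
  simp only [one, one_smul, eU]
  rw [hU.norm d hd M hML _ _ ⟨i₀, by field_simp; simp⟩ ⟨j₀, by field_simp; simp⟩, hz, hz', hU.periodic]
  rintro ⟨⟨y, hy⟩, y', hy'⟩
  refine h0 (zero_mem_cell_of_int hm0 ⟨⟨y - z, ?_⟩, ⟨y' - z', ?_⟩⟩)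
  · push_cast; linear_combination hy - hz
  · push_cast; linear_combination hy' - hz'

/-! Lifting distributions along surjections -/

theorem isTestWith_of_dvd {f : (Fin 2 → R) → ℤ} (hf : IsTestWith O m f) (h : m ∣ k) :
    IsTestWith O k f := by
  obtain ⟨c, rfl⟩ := h
  exact hf.mul c

theorem isTestWith_sample (m : ℕ) (hm : 0 < m) (f : TestFn O) :
    IsTestWith O (m * m) (sample O m f).1 := by
  have hm' : (m : ℚ) ≠ 0 := mod_cast hm.ne'
  have key : ∀ (s : Finset ℕ) (g : ℕ → TestFn O), (∀ i ∈ s, IsTestWith O (m * m) (g i).1) →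
      IsTestWith O (m * m) (∑ i ∈ s, g i).1 := fun s g hg => by
    have e : ∀ v, (∑ i ∈ s, g i).1 v = ∑ i ∈ s, (g i).1 v := fun v => by simp [Finset.sum_apply]
    refine ⟨fun v hv => ?_, fun v w hw => ?_⟩
    · rw [e] at hv; obtain ⟨i, hi, h⟩ := Finset.exists_ne_zero_of_sum_ne_zero hv
      exact (hg i hi).1 v h
    · rw [e, e]; exact sum_congr rfl fun i hi => (hg i hi).2 v w hw
  refine key _ _ fun i _ => key _ _ fun j _ => ?_
  have := isTestWith_cell O (m := m) (d := m) ((i : ℚ) / m) ((j : ℚ) / m) ⟨i, by field_simp; simp⟩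
    ⟨j, by field_simp; simp⟩
  refine ⟨fun v hv => this.1 v fun h => hv ?_, fun v w hw => ?_⟩
  · change _ * (cellFn O m ((i : ℚ) / m) ((j : ℚ) / m)).1 v = 0
    rw [h, mul_zero]
  · change _ * (cellFn O m ((i : ℚ) / m) ((j : ℚ) / m)).1 _ =
      _ * (cellFn O m ((i : ℚ) / m) ((j : ℚ) / m)).1 v
    rw [this.2 v w hw]

theorem LevelSystem.exists_lift (hL : LevelSystem O L) {B : Type} [AddCommGroup B] (q : A →+ B)
    (hq : Surjective q) (κ : Dist O B) : ∃ e : Dist O A, ∀ f, q (e f) = κ f := by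
  classical
  obtain ⟨m, hmL, hdvd, hcof⟩ : ∃ m : ℕ → ℕ, (∀ j, m j ∈ L) ∧ (∀ j, m j * m j ∣ m (j + 1)) ∧
      ∀ k ∈ L, ∃ j, ∀ i ≥ j, k ∣ m i := by
    let m : ℕ → ℕ := Nat.rec 1 fun k M => M * M * if k ∈ L then k else 1
    have hm : ∀ k, m (k + 1) = m k * m k * if k ∈ L then k else 1 := fun k => rfl
    refine ⟨m, fun j => ?_, fun j => ⟨_, hm j⟩, fun k hk => ⟨k + 1, fun i hi => ?_⟩⟩
    · induction j with
      | zero => exact hL.one_mem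
      | succ j ih =>
        rw [hm]; refine hL.mul_mem (hL.mul_mem ih ih) ?_
        split_ifs with h
        exacts [h, hL.one_mem]
    · induction i, hi using Nat.le_induction with
      | base => rw [hm, if_pos hk]; exact dvd_mul_left _ _
      | succ i _ ih => rw [hm, mul_assoc]; exact ih.mul_right _
  have hlift : ∀ j, ∃ g : TestFn O →+ A, ∀ f, q (g f) = κ (sample O (m j) f) := fun j => by
    choose lam hlam using fun i i' : ℕ => hq (κ (cellFn O (m j) ((i : ℚ) / m j) ((i' : ℚ) / m j)))
    refine ⟨weightedSum O (m j) lam, fun f => ?_⟩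
    simp only [Dist.apply_sample, weightedSum, AddMonoidHom.coe_mk, ZeroHom.coe_mk, map_sum,
      map_zsmul, hlam]
  choose g hg using hlift
  have hev : ∀ f : TestFn O, ∃ j, ∀ i ≥ j, sample O (m i) f = f := fun f => by
    obtain ⟨k, hk, hf⟩ := hL.exists_level f; obtain ⟨j, hj⟩ := hcof k hk
    exact ⟨j, fun i hi => hL.sample_eq (hmL i) (isTestWith_of_dvd hf (hj i hi))⟩
  have hfin : ∀ f : TestFn O,
      (Function.support fun j => g (j + 1) (f - sample O (m j) f)).Finite := fun f => by
    obtain ⟨j, hj⟩ := hev f; refine (Set.finite_lt_nat j).subset fun i hi => ?_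
    by_contra h
    refine hi ?_
    simp only []; rw [hj i (not_lt.1 h), sub_self, map_zero]
  refine ⟨(AddMonoidHom.mk' (fun f => g 0 f + ∑ᶠ j, g (j + 1) (f - sample O (m j) f))
    (fun f f' => ?_) : TestFn O →+ A), fun f => ?_⟩
  · have : ∀ j, g (j + 1) (f + f' - sample O (m j) (f + f')) =
        g (j + 1) (f - sample O (m j) f) + g (j + 1) (f' - sample O (m j) f') := fun j => by
      rw [← map_add, map_add (sample O (m j))]; congr 1; abel
    simp only [this]; rw [finsum_add_distrib (hfin f) (hfin f'), map_add]; abel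
  · change q (g 0 f + ∑ᶠ j, g (j + 1) (f - sample O (m j) f)) = κ f
    obtain ⟨J, hJ⟩ := hev f
    rw [finsum_eq_sum_of_support_subset (s := range J) _ (fun i hi => by
      by_contra h
      refine hi ?_
      simp only []
      rw [hJ i (not_lt.1 fun h' => h (by simpa using h')), sub_self, map_zero]), map_add, map_sum]
    simp only [hg, map_sub]
    have e : ∀ j, sample O (m (j + 1)) (sample O (m j) f) = sample O (m j) f := fun j =>
      hL.sample_eq (hmL _) (isTestWith_of_dvd (isTestWith_sample _ (hL.pos (hmL j)) f) (hdvd j))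
    simp only [e]; rw [Finset.sum_range_sub (fun j => κ (sample O (m j) f)), hJ J le_rfl]
    abel

/-! Infinite products -/

/-- The infinite product `(X; Q)_∞ = ∏ (1 - X Qⁿ)`. -/
def qPoch (X Q : ℂ) : ℂ := ∏' n : ℕ, (1 - X * Q ^ n)

theorem summable_qPoch (X : ℂ) (hQ : ‖Q‖ < 1) : Summable fun n : ℕ => ‖-(X * Q ^ n)‖ := by
  simp only [norm_neg, norm_mul, norm_pow]
  exact (summable_geometric_of_lt_one (norm_nonneg _) hQ).mul_left _

theorem multipliable_qPoch (X : ℂ) (hQ : ‖Q‖ < 1) : Multipliable fun n : ℕ => 1 - X * Q ^ n := by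
  simp only [sub_eq_add_neg]
  exact multipliable_one_add_of_summable (summable_qPoch X hQ)

theorem tendsto_qPoch (X : ℂ) (hQ : ‖Q‖ < 1) :
    Tendsto (fun N => ∏ n ∈ range N, (1 - X * Q ^ n)) atTop (𝓝 (qPoch X Q)) :=
  (multipliable_qPoch X hQ).hasProd.tendsto_prod_nat

theorem qPoch_ne_zero (hQ : ‖Q‖ < 1) (h : ∀ n : ℕ, X * Q ^ n ≠ 1) : qPoch X Q ≠ 0 := by
  unfold qPoch
  simp only [sub_eq_add_neg]
  refine tprod_one_add_ne_zero_of_summable (fun n => ?_) (summable_qPoch X hQ)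
  rw [← sub_eq_add_neg, sub_ne_zero]
  exact (h n).symm

theorem qPoch_succ (X : ℂ) (hQ : ‖Q‖ < 1) : qPoch X Q = (1 - X) * qPoch (X * Q) Q := by
  have h1 := (tendsto_qPoch X hQ).comp (Filter.tendsto_add_atTop_nat 1)
  have h2 := (tendsto_qPoch (X * Q) hQ).const_mul (1 - X)
  refine tendsto_nhds_unique h1 (h2.congr fun N => ?_)
  simp only [comp_apply]
  rw [Finset.prod_range_succ', mul_comm]
  simp only [pow_zero, mul_one, pow_succ']
  simp only [mul_assoc]

theorem norm_pow_lt_one (hQ : ‖Q‖ < 1) (hk : 0 < k) : ‖Q ^ k‖ < 1 := by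
  rw [norm_pow]; exact pow_lt_one₀ (norm_nonneg _) hQ hk.ne'

theorem prod_qPoch_mul_pow (X : ℂ) (hQ : ‖Q‖ < 1) (hk : 0 < k) :
    ∏ i ∈ range k, qPoch (X * Q ^ i) (Q ^ k) = qPoch X Q := by
  have h1 := (tendsto_qPoch X hQ).comp (tendsto_id.const_mul_atTop' hk)
  have h2 := tendsto_finsetProd (range k)
    fun i _ => tendsto_qPoch (X * Q ^ i) (norm_pow_lt_one hQ hk)
  refine tendsto_nhds_unique h2 (h1.congr fun N => ?_)
  simp only [comp_apply, id]
  rw [prod_range_digits]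
  refine prod_congr rfl fun i _ => prod_congr rfl fun j _ => ?_
  rw [pow_add, pow_mul, mul_assoc]

theorem prod_one_sub_rootsOfUnity {ζ : ℂ} (hk : 0 < k) (hζ : IsPrimitiveRoot ζ k) (Y : ℂ) :
    ∏ j ∈ range k, (1 - ζ ^ j * Y) = 1 - Y ^ k := by
  have := NeZero.of_pos hk
  have h := hζ.pow_sub_pow_eq_prod_sub_mul 1 Y hk
  rw [one_pow] at h
  rw [h]
  refine (Finset.prod_bij (fun j _ => ζ ^ j) (fun j _ => ?_) (fun i hi j hj =>
    hζ.pow_inj (mem_range.1 hi) (mem_range.1 hj)) (fun x hx => ?_) fun _ _ => rfl)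
  · rw [mem_nthRootsFinset hk, ← pow_mul, mul_comm, pow_mul, hζ.pow_eq_one, one_pow]
  · obtain ⟨i, hi, e⟩ := hζ.eq_pow_of_pow_eq_one ((mem_nthRootsFinset hk _).1 hx)
    exact ⟨i, mem_range.2 hi, e⟩

theorem prod_qPoch_rootsOfUnity (X : ℂ) {ζ : ℂ} (hQ : ‖Q‖ < 1) (hk : 0 < k)
    (hζ : IsPrimitiveRoot ζ k) : ∏ j ∈ range k, qPoch (ζ ^ j * X) Q = qPoch (X ^ k) (Q ^ k) := by
  have h1 := tendsto_qPoch (X ^ k) (norm_pow_lt_one hQ hk)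
  have h2 := tendsto_finsetProd (range k) fun j _ => tendsto_qPoch (ζ ^ j * X) hQ
  refine tendsto_nhds_unique h2 (h1.congr fun N => ?_)
  rw [prod_comm]
  refine prod_congr rfl fun n _ => ?_
  rw [← pow_mul, mul_comm k n, pow_mul, ← mul_pow, ← prod_one_sub_rootsOfUnity hk hζ]
  simp only [mul_assoc]

theorem differentiableOn_qPoch {s : Set ℂ} (hs : IsOpen s) {X Q : ℂ → ℂ}
    (hX : DifferentiableOn ℂ X s) (hQ : DifferentiableOn ℂ Q s) (h : ∀ z ∈ s, ‖Q z‖ < 1) :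
    DifferentiableOn ℂ (fun z => qPoch (X z) (Q z)) s := by
  have key : HasProdLocallyUniformlyOn (fun n z => 1 - X z * Q z ^ n)
      (fun z => qPoch (X z) (Q z)) s := by
    simp_rw [qPoch, sub_eq_add_neg]
    apply hasProdLocallyUniformlyOn_of_forall_compact hs
    intro K hK hcK; rcases K.eq_empty_or_nonempty with hN | hN
    · simpa [hasProdUniformlyOn_iff_tendstoUniformlyOn, hN] using tendstoUniformlyOn_empty
    · obtain ⟨q₀, hq₀, _, HB⟩ := hcK.exists_sSup_image_eq_and_ge hN
        (show ContinuousOn (fun z : ℂ ↦ ‖Q z‖) K from (hQ.continuousOn.mono hK).norm)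
      obtain ⟨x₀, hx₀, _, HX⟩ := hcK.exists_sSup_image_eq_and_ge hN
        (show ContinuousOn (fun z : ℂ ↦ ‖X z‖) K from (hX.continuousOn.mono hK).norm)
      refine ((summable_geometric_of_lt_one (norm_nonneg _)
        (h q₀ (hK hq₀))).mul_left ‖X x₀‖).hasProdUniformlyOn_nat_one_add
        hcK (.of_forall fun n x hx ↦ ?_) (fun n ↦ ?_)
      · rw [norm_neg, norm_mul, norm_pow]
        exact mul_le_mul (HX x hx) (pow_le_pow_left₀ (norm_nonneg _) (HB x hx) n)
          (by positivity) (norm_nonneg _)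
      · exact ((hX.continuousOn.mono hK).mul ((hQ.continuousOn.mono hK).pow n)).neg
  exact key.differentiableOn (.of_forall fun t => by
    simpa [Finset.prod_fn] using DifferentiableOn.finsetProd (s := s)
      (fun n (_ : n ∈ t) => (differentiableOn_const 1).sub (hX.mul (hQ.pow n)))) hs

/-! The theta function -/

/-- `exp(2πiz)`. -/
def ex (z : ℂ) : ℂ := Complex.exp (2 * π * I * z)

theorem ex_add (z w : ℂ) : ex (z + w) = ex z * ex w := by rw [ex, ex, ex, ← exp_add]; ring_nf

theorem ex_zero : ex 0 = 1 := by simp [ex]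

theorem ex_neg (z : ℂ) : ex (-z) = (ex z)⁻¹ := by rw [ex, ex, ← exp_neg]; ring_nf

theorem ex_ne_zero (z : ℂ) : ex z ≠ 0 := Complex.exp_ne_zero _

theorem ex_int (n : ℤ) : ex n = 1 := by rw [ex, mul_comm]; exact Complex.exp_int_mul_two_pi_mul_I n

theorem ex_nat (n : ℕ) : ex n = 1 := mod_cast ex_int n

theorem ex_one : ex 1 = 1 := mod_cast ex_int 1

theorem ex_half : ex (1 / 2) = -1 := by rw [ex, ← Complex.exp_pi_mul_I]; ring_nf

theorem ex_nat_mul (n : ℕ) (z : ℂ) : ex (n * z) = ex z ^ n := by rw [ex, ex, ← exp_nat_mul]; ring_nf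

theorem ex_eq_one_iff {z : ℂ} : ex z = 1 ↔ ∃ n : ℤ, z = n := by
  rw [ex, Complex.exp_eq_one_iff]
  have : (2 * π * I : ℂ) ≠ 0 := two_pi_I_ne_zero
  refine exists_congr fun n => ⟨fun h => mul_left_cancel₀ this ?_, fun h => ?_⟩
  · rw [h]; ring
  · rw [h]; ring

theorem norm_ex (z : ℂ) : ‖ex z‖ = exp (-(2 * π * z.im)) := by
  rw [ex, Complex.norm_exp]
  congr 1
  simp [Complex.mul_re, Complex.mul_im]

theorem norm_ex_lt_one {z : ℂ} (hz : 0 < z.im) : ‖ex z‖ < 1 := by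
  rw [norm_ex, Real.exp_lt_one_iff]
  have := pi_pos
  have : 0 < 2 * π * z.im := by positivity
  linarith

theorem differentiable_ex : Differentiable ℂ ex := by unfold ex; fun_prop

theorem isPrimitiveRoot_ex (hk : 0 < k) : IsPrimitiveRoot (ex (1 / k)) k := by
  have := Complex.isPrimitiveRoot_exp k hk.ne'
  convert this using 1
  rw [ex]; ring_nf

theorem Theta_eq (u : ℂ) (hτ : 0 < τ.im) :
    Theta u τ = -(ex (τ / 12 - u / 2) * qPoch (ex u) (ex τ) * qPoch (ex (τ - u)) (ex τ)) := by
  have hQ := norm_ex_lt_one hτ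
  have e1 : ∀ n : ℕ, 1 - Complex.exp (2 * π * I * ((n + 1) * τ + u)) =
      1 - ex (u + τ) * ex τ ^ n := fun n => by
    rw [← ex_nat_mul, ← ex_add, ex]; ring_nf
  have e2 : ∀ n : ℕ, 1 - Complex.exp (2 * π * I * ((n + 1) * τ - u)) =
      1 - ex (τ - u) * ex τ ^ n := fun n => by
    rw [← ex_nat_mul, ← ex_add, ex]; ring_nf
  have e3 : Complex.exp (π * I * u) - Complex.exp (-(π * I * u)) = -(ex (-u / 2) * (1 - ex u)) := by
    rw [mul_sub, ← ex_add, mul_one, ex, ex]; ring_nf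
  have e4 : Complex.exp (2 * π * I * τ / 12) = ex (τ / 12) := by rw [ex]; ring_nf
  rw [Theta]
  simp only [e1, e2]
  rw [(multipliable_qPoch _ hQ).tprod_mul (multipliable_qPoch _ hQ), e3, e4, qPoch_succ (ex u) hQ,
    ← ex_add u τ, sub_eq_add_neg (τ / 12), ex_add (τ / 12), ← neg_div]
  simp only [qPoch]
  ring

theorem Theta_add_one (u : ℂ) (hτ : 0 < τ.im) : Theta (u + 1) τ = -Theta u τ := by
  rw [Theta_eq _ hτ, Theta_eq _ hτ, ex_add u 1, ex_one, mul_one]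
  have e1 : ex (τ / 12 - (u + 1) / 2) = -ex (τ / 12 - u / 2) := by
    have : τ / 12 - u / 2 = τ / 12 - (u + 1) / 2 + 1 / 2 := by ring
    rw [this, ex_add, ex_half]; ring
  have e2 : ex (τ - (u + 1)) = ex (τ - u) := by
    have : τ - u = τ - (u + 1) + 1 := by ring
    rw [this, ex_add, ex_one, mul_one]
  rw [e1, e2]; ring

theorem Theta_add_tau (u : ℂ) (hτ : 0 < τ.im) : Theta (u + τ) τ = -(ex (-τ / 2 - u) * Theta u τ) := by
  have hQ := norm_ex_lt_one hτ
  rw [Theta_eq _ hτ, Theta_eq _ hτ, qPoch_succ (ex u) hQ, ← ex_add u τ, sub_add_cancel_right,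
    qPoch_succ (ex (-u)) hQ, ← ex_add (-u) τ, neg_add_eq_sub]
  have e1 : ex (τ / 12 - (u + τ) / 2) = ex (τ / 12 - u / 2) * ex (-τ / 2 - u) * ex u := by
    rw [← ex_add, ← ex_add]; ring_nf
  rw [e1, ex_neg]
  field_simp [ex_ne_zero u]
  ring

theorem Theta_neg (u : ℂ) (hτ : 0 < τ.im) : Theta (-u) τ = -Theta u τ := by
  have hQ := norm_ex_lt_one hτ
  rw [Theta_eq _ hτ, Theta_eq _ hτ, qPoch_succ (ex u) hQ, ← ex_add u τ, sub_neg_eq_add,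
    qPoch_succ (ex (-u)) hQ, ← ex_add (-u) τ, neg_add_eq_sub, add_comm τ u]
  have e1 : ex (τ / 12 - -u / 2) = ex (τ / 12 - u / 2) * ex u := by rw [← ex_add]; ring_nf
  rw [e1, ex_neg]
  field_simp [ex_ne_zero u]
  ring

theorem Theta_add_int (u : ℂ) (hτ : 0 < τ.im) (n : ℤ) : Theta (u + n) τ = (-1) ^ n * Theta u τ := by
  induction n using induction_on generalizing u with
  | zero => simp
  | succ n ih =>
    push_cast at ih ⊢; rw [← add_assoc, Theta_add_one _ hτ, ih, zpow_add_one₀ (by norm_num)]; ring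
  | pred n ih =>
    have h := Theta_add_one (u + ((-n - 1 : ℤ) : ℂ)) hτ
    have e : u + ((-n - 1 : ℤ) : ℂ) + 1 = u + ((-n : ℤ) : ℂ) := by push_cast; ring
    rw [e, ih] at h; rw [← neg_eq_iff_eq_neg.2 h, zpow_sub_one₀ (by norm_num)]; norm_num

theorem Theta_add_int_mul (u : ℂ) (hτ : 0 < τ.im) (n : ℤ) :
    Theta (u + n * τ) τ = (-1) ^ n * ex (-(n ^ 2 * τ / 2) - n * u) * Theta u τ := by
  induction n using induction_on with
  | zero => simp [ex_zero]
  | succ n ih =>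
    have e : u + ((n + 1 : ℤ) : ℂ) * τ = u + ((n : ℤ) : ℂ) * τ + τ := by push_cast; ring
    rw [e, Theta_add_tau _ hτ, ih, zpow_add_one₀ (by norm_num)]
    have e2 : ex (-(((n + 1 : ℤ) : ℂ) ^ 2 * τ / 2) - ((n + 1 : ℤ) : ℂ) * u) =
      ex (-τ / 2 - (u + ((n : ℤ) : ℂ) * τ)) * ex (-(((n : ℤ) : ℂ) ^ 2 * τ / 2) - ((n : ℤ) : ℂ) * u) := by
      rw [← ex_add]; push_cast; ring_nf
    rw [e2]; ring
  | pred n ih =>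
    have h := Theta_add_tau (u + ((-n - 1 : ℤ) : ℂ) * τ) hτ
    have e : u + ((-n - 1 : ℤ) : ℂ) * τ + τ = u + ((-n : ℤ) : ℂ) * τ := by push_cast; ring
    rw [e, ih] at h
    have e2 : ex (-(((-n : ℤ) : ℂ) ^ 2 * τ / 2) - ((-n : ℤ) : ℂ) * u) =
      ex (-τ / 2 - (u + ((-n - 1 : ℤ) : ℂ) * τ)) *
        ex (-(((-n - 1 : ℤ) : ℂ) ^ 2 * τ / 2) - ((-n - 1 : ℤ) : ℂ) * u) := by
      rw [← ex_add]; push_cast; ring_nf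
    rw [e2] at h; refine mul_left_cancel₀ (ex_ne_zero (-τ / 2 - (u + ((-n - 1 : ℤ) : ℂ) * τ))) ?_
    rw [zpow_sub_one₀ (by norm_num)]
    linear_combination h

theorem Theta_eq_zero_iff {u : ℂ} (hτ : 0 < τ.im) : Theta u τ = 0 ↔ ∃ m n : ℤ, u = m * τ + n := by
  have hQ := norm_ex_lt_one hτ
  constructor
  · intro h; rw [Theta_eq _ hτ, neg_eq_zero, mul_eq_zero, mul_eq_zero] at h
    have key : ∀ v : ℂ, qPoch (ex v) (ex τ) = 0 → ∃ m n : ℤ, v = m * τ + n := fun v hv => by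
      by_contra hne
      refine qPoch_ne_zero hQ (fun n h1 => hne ?_) hv
      rw [← ex_nat_mul, ← ex_add, ex_eq_one_iff] at h1; obtain ⟨k, hk⟩ := h1
      exact ⟨-n, k, by push_cast; linear_combination hk⟩
    rcases h with (h | h) | h
    · exact absurd h (ex_ne_zero _)
    · exact key _ h
    · obtain ⟨m, n, e⟩ := key _ h; exact ⟨1 - m, -n, by push_cast; linear_combination -e⟩
  · rintro ⟨m, n, rfl⟩; have h0 : Theta 0 τ = 0 := by simp [Theta]
    rw [Theta_add_int _ hτ, ← zero_add ((m : ℂ) * τ), Theta_add_int_mul _ hτ, h0]; simp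

theorem differentiableOn_Theta {s : Set ℂ} (hs : IsOpen s) {u t : ℂ → ℂ}
    (hu : DifferentiableOn ℂ u s) (ht : DifferentiableOn ℂ t s) (h : ∀ z ∈ s, 0 < (t z).im) :
    DifferentiableOn ℂ (fun z => Theta (u z) (t z)) s := by
  have e : ∀ w : ℂ → ℂ, DifferentiableOn ℂ w s → DifferentiableOn ℂ (fun z => ex (w z)) s :=
    fun w hw => differentiable_ex.comp_differentiableOn hw
  refine DifferentiableOn.congr (f := fun z => -(ex (t z / 12 - u z / 2) * qPoch (ex (u z))
    (ex (t z)) * qPoch (ex (t z - u z)) (ex (t z)))) ?_ fun z hz => Theta_eq _ (h z hz)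
  exact (((e _ ((ht.div_const _).sub (hu.div_const _))).mul
    (differentiableOn_qPoch hs (e _ hu) (e _ ht) fun z hz => norm_ex_lt_one (h z hz))).mul
    (differentiableOn_qPoch hs (e _ (ht.sub hu)) (e _ ht) fun z hz => norm_ex_lt_one (h z hz))).neg

theorem differentiable_Theta (hτ : 0 < τ.im) : Differentiable ℂ fun u => Theta u τ :=
  differentiableOn_univ.1 (differentiableOn_Theta isOpen_univ differentiableOn_id
    (differentiableOn_const τ) fun _ _ => hτ)

theorem Theta_tau_add_one (u : ℂ) (hτ : 0 < τ.im) : Theta u (τ + 1) = ex (1 / 12) * Theta u τ := by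
  have hτ' : 0 < (τ + 1).im := by simpa using hτ
  rw [Theta_eq _ hτ, Theta_eq _ hτ', ex_add τ 1, ex_one, mul_one]
  have e1 : ex ((τ + 1) / 12 - u / 2) = ex (1 / 12) * ex (τ / 12 - u / 2) := by
    rw [← ex_add]; ring_nf
  have e2 : ex (τ + 1 - u) = ex (τ - u) := by
    have : τ + 1 - u = τ - u + 1 := by ring
    rw [this, ex_add, ex_one, mul_one]
  rw [e1, e2]; ring

theorem prod_neg_eq (f : ℕ → ℂ) : ∏ i ∈ range k, -f i = (-1) ^ k * ∏ i ∈ range k, f i := by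
  rw [Finset.prod_neg, card_range]

theorem sum_range_cast (k : ℕ) : ∑ i ∈ range k, (i : ℂ) = k * (k - 1) / 2 := by
  induction k with
  | zero => simp
  | succ k ih => rw [sum_range_succ, ih]; push_cast; ring

theorem prod_ex (s : Finset ℕ) (f : ℕ → ℂ) : ∏ i ∈ s, ex (f i) = ex (∑ i ∈ s, f i) := by
  simp only [ex, ← Complex.exp_sum, mul_sum]

theorem prod_Theta_add_div {u : ℂ} (hτ : 0 < τ.im) (hk : 0 < k) :
    ∏ j ∈ range k, Theta (u + j / k) τ =
      (-1) ^ (k + 1) * ex (-((k - 1) / 4)) * Theta (k * u) (k * τ) := by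
  have hQ := norm_ex_lt_one hτ
  have hk' : (k : ℂ) ≠ 0 := mod_cast hk.ne'
  have hkτ : 0 < ((k : ℂ) * τ).im := by
    rw [← ofReal_natCast, im_ofReal_mul]; exact mul_pos (mod_cast hk) hτ
  have hζ := isPrimitiveRoot_ex hk
  simp only [Theta_eq _ hτ, prod_neg_eq, prod_mul_distrib]
  have h1 : ∏ j ∈ range k, qPoch (ex (u + j / k)) (ex τ) = qPoch (ex (k * u)) (ex (k * τ)) := by
    rw [ex_nat_mul, ex_nat_mul, ← prod_qPoch_rootsOfUnity _ hQ hk hζ]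
    refine prod_congr rfl fun j _ => ?_
    rw [← ex_nat_mul, ← ex_add]; ring_nf
  have h2 : ∏ j ∈ range k, qPoch (ex (τ - (u + j / k))) (ex τ) =
      qPoch (ex (k * τ - k * u)) (ex (k * τ)) := by
    have : (k : ℂ) * τ - k * u = k * (τ - u) := by ring
    rw [this, ex_nat_mul, ex_nat_mul, ← prod_qPoch_rootsOfUnity _ hQ hk (IsPrimitiveRoot.inv hζ)]
    refine prod_congr rfl fun j _ => ?_
    rw [← ex_neg, ← ex_nat_mul, ← ex_add]; ring_nf
  have h3 : ∏ j ∈ range k, ex (τ / 12 - (u + j / k) / 2) =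
      ex (-((k - 1) / 4)) * ex (k * τ / 12 - k * u / 2) := by
    rw [prod_ex, ← ex_add]; congr 1
    have : ∀ j ∈ range k, τ / 12 - (u + (j : ℂ) / k) / 2 =
      (τ / 12 - u / 2) - (j : ℂ) * (1 / (2 * k)) := fun j _ => by field_simp; ring
    rw [sum_congr rfl this, sum_sub_distrib, ← sum_mul, sum_range_cast]
    simp only [sum_const, card_range, nsmul_eq_mul]; field_simp; ring
  rw [h1, h2, h3, Theta_eq _ hkτ, pow_succ]; ring

theorem prod_Theta_add_mul {u : ℂ} (hτ : 0 < τ.im) (hk : 0 < k) :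
    ∏ i ∈ range k, Theta (u + i * τ) (k * τ) =
      (-1) ^ (k + 1) * ex ((k ^ 2 - 1) * τ / 12 - (k - 1) * u / 2 - k * (k - 1) * τ / 4) * Theta u τ := by
  have hQ := norm_ex_lt_one hτ
  have hk' : (k : ℂ) ≠ 0 := mod_cast hk.ne'
  have hkτ : 0 < ((k : ℂ) * τ).im := by
    rw [← ofReal_natCast, im_ofReal_mul]; exact mul_pos (mod_cast hk) hτ
  simp only [Theta_eq _ hkτ, prod_neg_eq, prod_mul_distrib]
  have h1 : ∏ i ∈ range k, qPoch (ex (u + i * τ)) (ex (k * τ)) = qPoch (ex u) (ex τ) := by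
    rw [ex_nat_mul, ← prod_qPoch_mul_pow _ hQ hk]; refine prod_congr rfl fun j _ => ?_
    rw [← ex_nat_mul j τ, ← ex_add]
  have h2 : ∏ i ∈ range k, qPoch (ex (k * τ - (u + i * τ))) (ex (k * τ)) =
      qPoch (ex (τ - u)) (ex τ) := by
    rw [ex_nat_mul, ← prod_qPoch_mul_pow _ hQ hk, ← Finset.prod_range_reflect]
    refine prod_congr rfl fun j hj => ?_
    rw [← ex_nat_mul j τ, ← ex_add]; have h := mem_range.1 hj
    rw [cast_sub (by omega), cast_sub (by omega)]; push_cast; ring_nf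
  have h3 : ∏ i ∈ range k, ex (k * τ / 12 - (u + i * τ) / 2) =
      ex ((k ^ 2 - 1) * τ / 12 - (k - 1) * u / 2 - k * (k - 1) * τ / 4) * ex (τ / 12 - u / 2) := by
    rw [prod_ex, ← ex_add]; congr 1
    have : ∀ j ∈ range k, k * τ / 12 - (u + (j : ℂ) * τ) / 2 =
      (k * τ / 12 - u / 2) - (j : ℂ) * (τ / 2) := fun j _ => by ring
    rw [sum_congr rfl this, sum_sub_distrib, ← sum_mul, sum_range_cast]
    simp only [sum_const, card_range, nsmul_eq_mul]; ring
  rw [h1, h2, h3, Theta_eq _ hτ, pow_succ]; ring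

/-! Modularity of the theta function -/

/-- The period pair `(1, τ)`. -/
def pairOfIm (hτ : 0 < τ.im) : PeriodPair where
  ω₁ := 1
  ω₂ := τ
  indep := by
    rw [LinearIndependent.pair_iff]; intro s t h; have h1 := congrArg Complex.im h
    have h2 := congrArg Complex.re h
    simp at h1 h2
    have ht : t = 0 := h1.resolve_right hτ.ne'
    subst ht; exact ⟨by simpa using h2, rfl⟩

/-- The regular part of the theta function at the origin. -/
def thetaUnit (u τ : ℂ) : ℂ :=
  -(ex (τ / 12 - u / 2) * qPoch (ex (u + τ)) (ex τ) * qPoch (ex (τ - u)) (ex τ))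

theorem Theta_eq_thetaUnit (u : ℂ) (hτ : 0 < τ.im) : Theta u τ = (1 - ex u) * thetaUnit u τ := by
  rw [Theta_eq u hτ, qPoch_succ (ex u) (norm_ex_lt_one hτ), thetaUnit, ex_add u τ]
  ring

theorem differentiable_thetaUnit (hτ : 0 < τ.im) : Differentiable ℂ (thetaUnit · τ) := by
  have hQ := norm_ex_lt_one hτ
  have e : ∀ w : ℂ → ℂ, Differentiable ℂ w → DifferentiableOn ℂ (fun z => ex (w z)) Set.univ :=
    fun w hw => (differentiable_ex.comp hw).differentiableOn
  rw [← differentiableOn_univ]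
  exact (((e _ (by fun_prop)).mul (differentiableOn_qPoch isOpen_univ (e _ (by fun_prop))
    (differentiableOn_const _) fun _ _ => hQ)).mul (differentiableOn_qPoch isOpen_univ
      (e _ (by fun_prop)) (differentiableOn_const _) fun _ _ => hQ)).neg

theorem thetaUnit_zero : thetaUnit 0 τ = -(eta τ) ^ 2 := by
  have e1 : ∀ z : ℂ, qParam 1 z = ex z := fun z => by rw [qParam, ex]; simp
  have e2 : qParam 24 τ ^ 2 = ex (τ / 12) := by
    rw [qParam, ex, ← exp_nat_mul]; congr 1; push_cast; ring
  rw [thetaUnit, eta, mul_pow, e2]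
  have e3 : ∏' n : ℕ, (1 - eta_q n τ) = qPoch (ex τ) (ex τ) := by
    rw [qPoch]; refine tprod_congr fun n => ?_
    rw [eta_q, e1, pow_succ']
  rw [e3]; simp only [zero_div, sub_zero, zero_add]; ring

theorem hasDerivAt_ex (z : ℂ) : HasDerivAt ex (2 * π * I * ex z) z := by
  have := ((hasDerivAt_id z).const_mul (2 * π * I : ℂ)).cexp
  simp only [id, mul_one] at this
  rw [mul_comm]; exact this

theorem hasDerivAt_Theta_zero (hτ : 0 < τ.im) : HasDerivAt (Theta · τ) (2 * π * I * eta τ ^ 2) 0 := by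
  have h := ((hasDerivAt_const (0 : ℂ) (1 : ℂ)).sub (hasDerivAt_ex 0)).mul
    (differentiable_thetaUnit hτ 0).hasDerivAt
  rw [show (Theta · τ) = ((fun _ => (1 : ℂ)) - ex) * (thetaUnit · τ) from
    funext fun u => Theta_eq_thetaUnit u hτ]
  exact h.congr_deriv (by simp only [Pi.sub_apply, ex_zero, thetaUnit_zero]; ring)

theorem eq_const_mul_Theta (hτ : 0 < τ.im) {f : ℂ → ℂ} (hf : Differentiable ℂ f) (h0 : f 0 = 0)
    (h1 : ∀ u, f (u + 1) = -f u) (h2 : ∀ u, f (u + τ) = -(ex (-τ / 2 - u) * f u)) :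
    ∀ u, f u = deriv f 0 / (2 * π * I * eta τ ^ 2) * Theta u τ := by
  have hη : (2 * π * I * eta τ ^ 2 : ℂ) ≠ 0 :=
    mul_ne_zero two_pi_I_ne_zero (pow_ne_zero _ (eta_ne_zero hτ))
  set T' : ℂ := 2 * π * I * eta τ ^ 2 with hT'
  have hT := differentiable_Theta hτ
  have hΘ0 : Theta 0 τ = 0 := by simp [Theta]
  let R : ℂ → ℂ := fun u => if Theta u τ = 0 then deriv f 0 / T' else f u / Theta u τ
  have R1 : ∀ u, R (u + 1) = R u := fun u => by
    simp only [R, Theta_add_one u hτ, h1, neg_eq_zero, neg_div_neg_eq]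
  have R2 : ∀ u, R (u + τ) = R u := fun u => by
    simp only [R, Theta_add_tau u hτ, h2, neg_eq_zero, neg_div_neg_eq, mul_eq_zero, ex_ne_zero,
      false_or, mul_div_mul_left _ _ (ex_ne_zero _)]
  have Rint : ∀ (n : ℤ) u, R (u + n) = R u := fun n u => by
    simpa using Function.Periodic.int_mul R1 n u
  have Rtau : ∀ (n : ℤ) u, R (u + n * τ) = R u := fun n => Function.Periodic.int_mul R2 n
  have hne : ∀ u, Theta u τ ≠ 0 → DifferentiableAt ℂ R u := fun u hu => by
    have hev : ∀ᶠ z in 𝓝 u, Theta z τ ≠ 0 := hT.continuous.continuousAt.eventually_ne hu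
    refine ((hf u).div (hT u) hu).congr_of_eventuallyEq ?_
    filter_upwards [hev] with z hz
    simp only [R, if_neg hz, Pi.div_apply]
  have hzero : DifferentiableAt ℂ R 0 := by
    have d1 : DifferentiableAt ℂ (dslope f 0) 0 :=
      ((Complex.differentiableOn_dslope univ_mem).2 hf.differentiableOn).differentiableAt univ_mem
    have d2 : DifferentiableAt ℂ (dslope (Theta · τ) 0) 0 :=
      ((Complex.differentiableOn_dslope univ_mem).2 hT.differentiableOn).differentiableAt univ_mem
    have d3 : dslope (Theta · τ) 0 0 ≠ 0 := by
      rw [dslope_same, (hasDerivAt_Theta_zero hτ).deriv]; exact hη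
    refine (d1.div d2 d3).congr_of_eventuallyEq ?_
    filter_upwards [d2.continuousAt.eventually_ne d3] with z hz
    by_cases hz0 : z = 0
    · subst hz0
      simp only [R, if_pos hΘ0, Pi.div_apply, dslope_same, (hasDerivAt_Theta_zero hτ).deriv, hT']
    · rw [dslope_of_ne _ hz0, slope_def_field, hΘ0, sub_zero, sub_zero] at hz
      have hz' : Theta z τ ≠ 0 := fun h => hz (by rw [h, zero_div])
      simp only [R, if_neg hz', Pi.div_apply]
      rw [dslope_of_ne _ hz0, dslope_of_ne _ hz0, slope_def_field, slope_def_field, h0, hΘ0,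
        sub_zero, sub_zero, sub_zero, div_div_div_cancel_right₀ hz0]
  have hR : Differentiable ℂ R := fun u => by
    by_cases hu : Theta u τ = 0
    · obtain ⟨m, n, rfl⟩ := (Theta_eq_zero_iff hτ).1 hu
      have e : R = fun z => R (z - (m * τ + n)) := by
        funext z
        calc R z = R (z - (m * τ + n) + m * τ + n) := by congr 1; ring
          _ = _ := by rw [Rint, Rtau]
      rw [e]
      have : DifferentiableAt ℂ R ((m * τ + n) - (m * τ + n)) := by rw [sub_self]; exact hzero
      exact this.comp (f := fun z : ℂ => z - (m * τ + n)) _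
        (differentiableAt_id.sub (differentiableAt_const _))
    · exact hne u hu
  have hconst : ∀ u, R u = R 0 := fun u => by
    refine hR.apply_eq_apply_of_bounded (IsZLattice.isCompact_range_of_periodic
      (pairOfIm hτ).lattice R hR.continuous fun z w hw => ?_).isBounded u 0
    obtain ⟨m, n, rfl⟩ := PeriodPair.mem_lattice.1 hw
    change R (z + (m * 1 + n * τ)) = R z
    rw [mul_one, ← add_assoc, Rtau, Rint]
  have hR0 : R 0 = deriv f 0 / T' := if_pos hΘ0
  have hmain : ∀ u, Theta u τ ≠ 0 → f u = deriv f 0 / T' * Theta u τ := fun u hu => by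
    have := hconst u; rw [hR0] at this; simp only [R, if_neg hu] at this
    rw [← this, div_mul_cancel₀ _ hu]
  intro u
  by_cases hu : Theta u τ = 0
  · rw [hu, mul_zero]; obtain ⟨m, n, rfl⟩ := (Theta_eq_zero_iff hτ).1 hu
    have p1 : Function.Periodic (fun u => f u = 0) 1 := fun u => by simp [h1]
    have p2 : Function.Periodic (fun u => f u = 0) τ := fun u => by simp [h2, ex_ne_zero]
    have e1 := p1.int_mul n (m * τ)
    have e2 := p2.int_mul m 0
    simp only [mul_one, zero_add, eq_iff_iff] at e1 e2; exact e1.2 (e2.2 h0)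
  · exact hmain u hu

theorem eta_neg_inv_pow (hτ : 0 < τ.im) : eta (-1 / τ) ^ 24 = τ ^ 12 * eta τ ^ 24 := by
  have h := ModularForm.eta_comp_eq_csqrt_I_inv (show τ ∈ upperHalfPlaneSet from hτ)
  have hs : ∀ z : ℂ, z ≠ 0 → Complex.sqrt z ^ 24 = z ^ 12 := fun z hz => by
    rw [_root_.sqrt_eq_exp hz, ← exp_nat_mul]
    have : ((24 : ℕ) : ℂ) * (log z / 2) = (12 : ℕ) * log z := by push_cast; ring
    rw [this, exp_nat_mul, exp_log hz]
  have hτ0 : τ ≠ 0 := fun h => by simp [h] at hτ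
  simp only [comp_apply, Pi.smul_apply, Pi.mul_apply, smul_eq_mul] at h
  rw [h, mul_pow, mul_pow, inv_pow, hs _ Complex.I_ne_zero, hs _ hτ0]
  have : I ^ 12 = 1 := by rw [show 12 = 4 * 3 by norm_num, pow_mul, Complex.I_pow_four, one_pow]
  rw [this]; ring

theorem im_neg_inv_pos (hτ : 0 < τ.im) : 0 < (-1 / τ).im := by
  have hτ0 : τ ≠ 0 := fun h => by simp [h] at hτ
  have h : (-1 / τ).im = τ.im / normSq τ := by rw [neg_div, one_div, neg_im, Complex.inv_im]; ring
  rw [h]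
  exact div_pos hτ (Complex.normSq_pos.2 hτ0)

theorem Theta_neg_inv (hτ : 0 < τ.im) : ∃ C : ℂ, C ^ 12 = 1 ∧
    ∀ u, Theta (u / τ) (-1 / τ) = C * ex (u ^ 2 / (2 * τ)) * Theta u τ := by
  have hτ0 : τ ≠ 0 := fun h => by simp [h] at hτ
  have hτ' := im_neg_inv_pos hτ
  have hη := eta_ne_zero (show τ ∈ upperHalfPlaneSet from hτ)
  let f : ℂ → ℂ := fun u => Theta (u / τ) (-1 / τ) * ex (-(u ^ 2 / (2 * τ)))
  have hd : ∀ u, HasDerivAt (fun u : ℂ => u / τ) (1 / τ) u := fun u => (hasDerivAt_id u).div_const τ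
  have hexd : Differentiable ℂ fun u : ℂ => ex (-(u ^ 2 / (2 * τ))) :=
    differentiable_ex.comp (by fun_prop)
  have hf : Differentiable ℂ f :=
    ((differentiable_Theta hτ').comp (fun u => (hd u).differentiableAt)).mul hexd
  have hΘ0 : Theta 0 (-1 / τ) = 0 := by simp [Theta]
  have h0 : f 0 = 0 := by simp [f, hΘ0]
  have h1 : ∀ u, f (u + 1) = -f u := fun u => by
    have e : u / τ = (u + 1) / τ + -1 / τ := by field_simp; ring
    simp only [f]; have h := Theta_add_tau ((u + 1) / τ) hτ'; rw [← e] at h; rw [h]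
    have e2 : ex (-((u + 1) ^ 2 / (2 * τ))) =
        ex (-(-1 / τ) / 2 - (u + 1) / τ) * ex (-(u ^ 2 / (2 * τ))) := by
      rw [← ex_add]; congr 1; field_simp; ring
    rw [e2]; ring
  have h2 : ∀ u, f (u + τ) = -(ex (-τ / 2 - u) * f u) := fun u => by
    simp only [f]; have e : (u + τ) / τ = u / τ + 1 := by field_simp
    have e2 : ex (-((u + τ) ^ 2 / (2 * τ))) = ex (-τ / 2 - u) * ex (-(u ^ 2 / (2 * τ))) := by
      rw [← ex_add]; congr 1; field_simp; ring
    rw [e, Theta_add_one _ hτ', e2]; ring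
  have hder : HasDerivAt f (2 * π * I * eta (-1 / τ) ^ 2 / τ) 0 := by
    have k1 : HasDerivAt (fun u : ℂ => Theta (u / τ) (-1 / τ))
        (2 * π * I * eta (-1 / τ) ^ 2 * (1 / τ)) 0 := by
      have := hasDerivAt_Theta_zero hτ'
      exact HasDerivAt.comp (h₂ := (Theta · (-1 / τ))) (0 : ℂ) (by rwa [zero_div]) (hd 0)
    have := k1.mul (hexd 0).hasDerivAt; refine this.congr_deriv ?_
    simp only [zero_div, hΘ0, ne_eq, OfNat.ofNat_ne_zero, not_false_eq_true, zero_pow, neg_zero,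
      ex_zero]
    ring
  have key := eq_const_mul_Theta hτ hf h0 h1 h2
  rw [hder.deriv] at key
  refine ⟨2 * π * I * eta (-1 / τ) ^ 2 / τ / (2 * π * I * eta τ ^ 2), ?_, fun u => ?_⟩
  · have e : 2 * π * I * eta (-1 / τ) ^ 2 / τ /
      (2 * π * I * eta τ ^ 2) = eta (-1 / τ) ^ 2 / (τ * eta τ ^ 2) := by
      have := two_pi_I_ne_zero; field_simp
    rw [e, div_pow, ← pow_mul, eta_neg_inv_pow hτ, mul_pow, ← pow_mul, div_self]
    exact mul_ne_zero (pow_ne_zero _ hτ0) (pow_ne_zero _ hη)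
  · have := key u; simp only [f] at this
    have e : ex (-(u ^ 2 / (2 * τ))) * ex (u ^ 2 / (2 * τ)) = 1 := by
      rw [← ex_add, neg_add_cancel, ex_zero]
    calc _ = Theta (u / τ) (-1 / τ) * ex (-(u ^ 2 / (2 * τ))) * ex (u ^ 2 / (2 * τ)) := by
          rw [mul_assoc, e, mul_one]
      _ = _ := by rw [this]; ring

/-! The function `ϑ_c` -/

/-- `ϑ_c(u, τ) = (-1)^{(c-1)/2} Θ(u, τ)^{c²} Θ(cu, τ)⁻¹`. -/
def thetaC (c : ℕ) (u τ : ℂ) : ℂ := (-1) ^ ((c - 1) / 2) * Theta u τ ^ (c ^ 2) * (Theta (c * u) τ)⁻¹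

theorem katoSiegelUnit_eq (c : ℕ) (a b : ℚ) (τ : ℂ) :
    katoSiegelUnit c a b τ = thetaC c (a * τ + b) τ := rfl

theorem exists_sq_eq (hc6 : c.Coprime 6) : (∃ s, c = 2 * s + 1) ∧ ∃ t, c ^ 2 = 24 * t + 1 := by
  have h2 : c.Coprime 2 := Coprime.coprime_dvd_right (by norm_num) hc6
  have h3 : c.Coprime 3 := Coprime.coprime_dvd_right (by norm_num) hc6
  have h2' : c % 2 = 1 := by
    rw [Nat.coprime_comm, Nat.coprime_two_left, Nat.odd_iff] at h2; exact h2
  have h3' : c % 3 ≠ 0 := fun h => by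
    have := (Nat.prime_three.coprime_iff_not_dvd).1 h3.symm; exact this (Nat.dvd_of_mod_eq_zero h)
  refine ⟨⟨c / 2, by omega⟩, c ^ 2 / 24, ?_⟩
  have h : c ^ 2 % 24 = 1 := by
    rw [Nat.pow_mod]; have h24 : c % 24 < 24 := Nat.mod_lt _ (by norm_num)
    have a2 : (c % 24) % 2 = 1 := by omega
    have a3 : (c % 24) % 3 ≠ 0 := by omega
    generalize c % 24 = r at *
    interval_cases r <;> simp_all
  omega

theorem neg_one_pow_sq {s : ℕ} (hs : c = 2 * s + 1) : ((-1 : ℂ)) ^ (c ^ 2) = -1 :=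
  Odd.neg_one_pow (Odd.pow ⟨s, hs⟩)

theorem pow_sq_eq {z : ℂ} {t : ℕ} (ht : c ^ 2 = 24 * t + 1) (hz : z ^ 24 = 1) : z ^ (c ^ 2) = z := by
  rw [ht, pow_succ, pow_mul, hz, one_pow, one_mul]

theorem thetaC_add_one (hc6 : c.Coprime 6) (u : ℂ) (hτ : 0 < τ.im) :
    thetaC c (u + 1) τ = thetaC c u τ := by
  obtain ⟨⟨s, hs⟩, -⟩ := exists_sq_eq hc6
  have e : (c : ℂ) * (u + 1) = c * u + ((c : ℤ) : ℂ) := by push_cast; ring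
  have e2 : ((-1 : ℂ)) ^ (c : ℤ) = -1 := by rw [zpow_natCast]; exact Odd.neg_one_pow ⟨s, hs⟩
  rw [thetaC, thetaC, Theta_add_one u hτ, e, Theta_add_int _ hτ, e2, neg_pow (Theta u τ),
    neg_one_pow_sq hs, mul_inv]
  norm_num

theorem thetaC_add_tau (hc6 : c.Coprime 6) (u : ℂ) (hτ : 0 < τ.im) :
    thetaC c (u + τ) τ = thetaC c u τ := by
  obtain ⟨⟨s, hs⟩, -⟩ := exists_sq_eq hc6
  have e : (c : ℂ) * (u + τ) = c * u + ((c : ℤ) : ℂ) * τ := by push_cast; ring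
  have e2 : ((-1 : ℂ)) ^ (c : ℤ) = -1 := by rw [zpow_natCast]; exact Odd.neg_one_pow ⟨s, hs⟩
  have e3 : ex (-(((c : ℤ) : ℂ) ^ 2 * τ / 2) - ((c : ℤ) : ℂ) * (c * u)) =
      ex (-τ / 2 - u) ^ (c ^ 2) := by
    rw [← ex_nat_mul]; push_cast; ring_nf
  rw [thetaC, thetaC, Theta_add_tau u hτ, e, Theta_add_int_mul _ hτ, e2,
    neg_pow (ex (-τ / 2 - u) * Theta u τ), neg_one_pow_sq hs, e3, mul_pow]
  have := pow_ne_zero (c ^ 2) (ex_ne_zero (-τ / 2 - u))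
  rw [mul_inv, mul_inv]
  generalize ex (-τ / 2 - u) ^ (c ^ 2) = x at *
  field_simp

theorem thetaC_neg (hc6 : c.Coprime 6) (u : ℂ) (hτ : 0 < τ.im) : thetaC c (-u) τ = thetaC c u τ := by
  obtain ⟨⟨s, hs⟩, -⟩ := exists_sq_eq hc6
  rw [thetaC, thetaC, Theta_neg u hτ, mul_neg, Theta_neg _ hτ, neg_pow (Theta u τ),
    neg_one_pow_sq hs, inv_neg]
  ring

theorem thetaC_tau_add_one (hc6 : c.Coprime 6) (u : ℂ) (hτ : 0 < τ.im) :
    thetaC c u (τ + 1) = thetaC c u τ := by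
  obtain ⟨-, t, ht⟩ := exists_sq_eq hc6
  rw [thetaC, thetaC, Theta_tau_add_one u hτ, Theta_tau_add_one _ hτ, mul_pow, pow_sq_eq ht, mul_inv]
  · have := ex_ne_zero (1 / 12); field_simp
  · rw [← ex_nat_mul]; have : ((24 : ℕ) : ℂ) * (1 / 12) = (2 : ℕ) := by push_cast; norm_num
    rw [this, ex_nat]

theorem thetaC_neg_inv (hc6 : c.Coprime 6) (u : ℂ) (hτ : 0 < τ.im) :
    thetaC c (u / τ) (-1 / τ) = thetaC c u τ := by
  obtain ⟨-, t, ht⟩ := exists_sq_eq hc6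
  obtain ⟨C, hC, h⟩ := Theta_neg_inv hτ
  have hC0 : C ≠ 0 := fun h0 => by simp [h0] at hC
  have e : (c : ℂ) * (u / τ) = (c * u) / τ := by ring
  have e2 : ex ((c * u) ^ 2 / (2 * τ)) = ex (u ^ 2 / (2 * τ)) ^ (c ^ 2) := by
    rw [← ex_nat_mul]; push_cast; ring_nf
  have hC24 : C ^ 24 = 1 := by rw [show 24 = 12 * 2 by norm_num, pow_mul, hC, one_pow]
  rw [thetaC, thetaC, e, h, h, mul_pow, mul_pow, e2, pow_sq_eq ht hC24, mul_inv, mul_inv]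
  have := pow_ne_zero (c ^ 2) (ex_ne_zero (u ^ 2 / (2 * τ)))
  field_simp

theorem image_mul_mod (hk : 0 < k) (h : c.Coprime k) :
    (range k).image (fun j => c * j % k) = range k ∧ Set.InjOn (fun j => c * j % k) (range k) := by
  have hinj : Set.InjOn (fun j => c * j % k) (range k) := fun i hi j hj e => by
    have : i ≡ j [MOD k] := Nat.ModEq.cancel_left_of_coprime (c := c) (by rw [Nat.gcd_comm]; exact h) e
    rw [Nat.ModEq, Nat.mod_eq_of_lt (mem_range.1 hi), Nat.mod_eq_of_lt (mem_range.1 hj)] at this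
    exact this
  refine ⟨Finset.eq_of_subset_of_card_le (fun x hx => ?_) ?_, hinj⟩
  · obtain ⟨j, -, rfl⟩ := Finset.mem_image.1 hx; exact mem_range.2 (Nat.mod_lt _ hk)
  · rw [Finset.card_image_of_injOn hinj]

@[to_additive]
theorem prod_coprime_mod {A : Type*} [CommMonoid A] (hk : 0 < k) (h : c.Coprime k) (g : ℕ → A) :
    ∏ j ∈ range k, g (c * j % k) = ∏ j ∈ range k, g j := by
  obtain ⟨h1, h2⟩ := image_mul_mod hk h
  conv_rhs => rw [← h1]
  rw [Finset.prod_image h2]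

theorem sum_mul_div {s : ℕ} (hs : c = 2 * s + 1) (hk : 0 < k) (h : c.Coprime k) :
    ∑ j ∈ range k, c * j / k = s * (k - 1) := by
  have h1 := sum_coprime_mod hk h fun j => j
  have h2 : ∑ j ∈ range k, c * j = ∑ j ∈ range k, c * j % k + k * ∑ j ∈ range k, c * j / k := by
    rw [mul_sum, ← sum_add_distrib]; exact sum_congr rfl fun j _ => (Nat.mod_add_div _ _).symm
  rw [h1, ← mul_sum] at h2
  have h3 := Finset.sum_range_id_mul_two k
  refine Nat.eq_of_mul_eq_mul_left hk ?_
  have h4 : k * ∑ j ∈ range k, c * j / k = 2 * s * ∑ j ∈ range k, j := by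
    rw [hs, add_mul, one_mul] at h2; rw [hs]; omega
  rw [h4]
  calc _ = s * ((∑ j ∈ range k, j) * 2) := by ring
    _ = _ := by rw [h3]; ring

theorem prod_thetaC_add_div (hc6 : c.Coprime 6) (u : ℂ) (hτ : 0 < τ.im) (hk : 0 < k)
    (hck : c.Coprime k) : ∏ j ∈ range k, thetaC c (u + j / k) τ = thetaC c (k * u) (k * τ) := by
  obtain ⟨⟨s, hs⟩, t, ht⟩ := exists_sq_eq hc6
  have hk' : (k : ℂ) ≠ 0 := mod_cast hk.ne'
  have hden : ∏ j ∈ range k, Theta (c * (u + j / k)) τ =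
      (-1) ^ (s * (k - 1)) * ((-1) ^ (k + 1) * ex (-((k - 1) / 4)) *
        Theta (k * (c * u)) (k * τ)) := by
    rw [← prod_Theta_add_div hτ hk, ← sum_mul_div hs hk hck, ← Finset.prod_pow_eq_pow_sum,
      ← prod_coprime_mod hk hck fun j => Theta (c * u + j / k) τ, ← prod_mul_distrib]
    refine prod_congr rfl fun j _ => ?_
    have e : (c : ℂ) * (u + j / k) = c * u + ((c * j % k : ℕ) : ℂ) / k + ((c * j / k : ℕ) : ℤ) := by
      have : ((c * j : ℕ) : ℂ) = (c * j % k : ℕ) + k * (c * j / k : ℕ) := by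
        exact_mod_cast (Nat.mod_add_div _ _).symm
      rw [Nat.cast_mul] at this; rw [cast_natCast]; field_simp
      linear_combination this
    rw [e, Theta_add_int _ hτ, zpow_natCast]
  have hA : ((-1 : ℂ) ^ (k + 1) * ex (-((k - 1) / 4))) ^ 24 = 1 := by
    rw [mul_pow, ← pow_mul, mul_comm (k + 1), pow_mul, ← ex_nat_mul]
    have : ((24 : ℕ) : ℂ) * (-((k - 1) / 4)) = ((6 - 6 * k : ℤ) : ℂ) := by push_cast; ring
    rw [this, ex_int]; norm_num
  simp only [thetaC, prod_mul_distrib, Finset.prod_inv_distrib, prod_pow]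
  rw [hden, prod_Theta_add_div hτ hk, mul_pow, pow_sq_eq ht hA]
  have hs' : (c - 1) / 2 = s := by omega
  have e4 : (k : ℂ) * (c * u) = c * (k * u) := by ring
  rw [hs', Finset.prod_const, card_range, mul_inv, mul_inv, e4]
  have h1 : ((-1 : ℂ) ^ (k + 1) * ex (-((k - 1) / 4))) ≠ 0 :=
    mul_ne_zero (pow_ne_zero _ (by norm_num)) (ex_ne_zero _)
  have h2 : ((-1 : ℂ) ^ k) ^ s = (-1) ^ s * (-1) ^ (s * (k - 1)) := by
    rw [← pow_mul, ← pow_add]; congr 1; obtain ⟨k', rfl⟩ := Nat.exists_eq_succ_of_ne_zero hk.ne'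
    simp; ring
  rw [h2]
  generalize (-1 : ℂ) ^ (k + 1) * ex (-((k - 1) / 4)) = A at *
  have h3 : (-1 : ℂ) ^ (s * (k - 1)) ≠ 0 := pow_ne_zero _ (by norm_num)
  field_simp

theorem prod_thetaC_add_mul (hc6 : c.Coprime 6) (u : ℂ) (hτ : 0 < τ.im) (hk : 0 < k)
    (hck : c.Coprime k) : ∏ i ∈ range k, thetaC c (u + i * τ) (k * τ) = thetaC c u τ := by
  have hk' : (k : ℂ) ≠ 0 := mod_cast hk.ne'
  have hτ0 : τ ≠ 0 := fun h => by simp [h] at hτ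
  have hkτ : 0 < ((k : ℂ) * τ).im := by
    rw [← ofReal_natCast, im_ofReal_mul]; exact mul_pos (mod_cast hk) hτ
  have h := prod_thetaC_add_div hc6 (u / (k * τ)) (im_neg_inv_pos hkτ) hk hck
  rw [show (k : ℂ) * (u / (k * τ)) = u / τ by field_simp,
    show (k : ℂ) * (-1 / (k * τ)) = -1 / τ by field_simp, thetaC_neg_inv hc6 u hτ] at h
  rw [← h]
  refine prod_congr rfl fun i _ => ?_
  rw [← thetaC_neg_inv hc6 _ hkτ, show (u + i * τ) / (k * τ) = u / (k * τ) + i / k by field_simp]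

/-! Level systems for the adeles and for the `p`-adic numbers -/

/-- The positive integers all of whose prime factors satisfy `P`. -/
def primeProducts (P : ℕ → Prop) : Set ℕ := {m | 0 < m ∧ ∀ ℓ, ℓ.Prime → ℓ ∣ m → P ℓ}

theorem primeProducts_induction {P : ℕ → Prop} {Q : ℕ → Prop} (h1 : Q 1)
    (h : ∀ ℓ m, ℓ.Prime → P ℓ → Q m → Q (ℓ * m)) (hm : m ∈ primeProducts P) : Q m := by
  induction m using induction_on_primes with
  | zero => exact absurd hm.1 (lt_irrefl 0)
  | one => exact h1
  | prime_mul ℓ m hℓ ih =>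
    exact h ℓ m hℓ (hm.2 ℓ hℓ (dvd_mul_right _ _))
      (ih ⟨Nat.pos_of_mul_pos_left hm.1, fun q hq hqm => hm.2 q hq (hqm.mul_left _)⟩)

theorem LevelSystem.of_primes {P : ℕ → Prop}
    (happrox : ∀ ℓ, ℓ.Prime → P ℓ → ∀ y ∈ O, ∃ i : ℕ, i < ℓ ∧ ∃ w ∈ O, y = i + ℓ * w)
    (hsep : ∀ ℓ, ℓ.Prime → P ℓ → ∀ i : ℤ, ∀ w ∈ O, (i : R) = ℓ * w → (ℓ : ℤ) ∣ i)
    (hunit : ∀ ℓ, ℓ.Prime → ¬ P ℓ → ∃ t ∈ O, (ℓ : R) * t = 1) :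
    LevelSystem O (primeProducts P) where
  one_mem := ⟨one_pos, fun ℓ hℓ h => absurd (Nat.dvd_one.1 h) hℓ.one_lt.ne'⟩
  mul_mem ha hb := ⟨Nat.mul_pos ha.1 hb.1, fun ℓ hℓ h =>
    ((hℓ.dvd_mul).1 h).elim (ha.2 ℓ hℓ) (hb.2 ℓ hℓ)⟩
  pos h := h.1
  exists_unit m hm := by
    induction m using induction_on_primes with
    | zero => exact absurd hm (lt_irrefl 0)
    | one => exact ⟨1, ⟨one_pos, fun ℓ hℓ h => absurd (Nat.dvd_one.1 h) hℓ.one_lt.ne'⟩, 1, rfl, 1,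
        O.one_mem, by simp⟩
    | prime_mul ℓ m hℓ ih =>
      obtain ⟨k, hk, s, rfl, t, ht, hst⟩ := ih (Nat.pos_of_mul_pos_left hm)
      by_cases hP : P ℓ
      · refine ⟨ℓ * k, ⟨Nat.mul_pos hℓ.pos hk.1, fun q hq hqm => ?_⟩, s, by ring, t, ht, hst⟩
        rcases (hq.dvd_mul).1 hqm with h | h
        · rwa [(Nat.prime_dvd_prime_iff_eq hq hℓ).1 h]
        · exact hk.2 q hq h
      · obtain ⟨t', ht', hst'⟩ := hunit ℓ hℓ hP
        refine ⟨k, hk, ℓ * s, by ring, t' * t, O.mul_mem ht' ht, ?_⟩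
        push_cast
        linear_combination (s : R) * t * hst' + hst
  approx {m} hm := by
    refine primeProducts_induction (P := P)
      (Q := fun m => ∀ y ∈ O, ∃ i : ℕ, i < m ∧ ∃ w ∈ O, y = i + m * w) ?_ ?_ hm
    · exact fun y hy => ⟨0, one_pos, y, hy, by simp⟩
    · intro ℓ m hℓ hP ih y hy; obtain ⟨i, hi, w, hw, rfl⟩ := happrox ℓ hℓ hP y hy
      obtain ⟨i', hi', w', hw', rfl⟩ := ih w hw
      refine ⟨i + ℓ * i', ?_, w', hw', by push_cast; ring⟩
      calc i + ℓ * i' < ℓ + ℓ * i' := by omega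
        _ = ℓ * (i' + 1) := by ring
        _ ≤ ℓ * m := Nat.mul_le_mul_left _ hi'
  sep {m} hm := by
    refine primeProducts_induction (P := P)
      (Q := fun m => ∀ i : ℤ, ∀ w ∈ O, (i : R) = m * w → (m : ℤ) ∣ i) ?_ ?_ hm
    · exact fun i _ _ _ => by simp
    · intro ℓ m hℓ hP ih i w hw h
      obtain ⟨i', rfl⟩ := hsep ℓ hℓ hP i (m * w) (O.mul_mem (natCast_mem O m) hw)
        (by rw [h]; push_cast; ring)
      have := natCast_mul_cancel (R := R) hℓ.pos (x := (i' : R)) (y := m * w)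
        (by rw [Int.cast_mul, cast_natCast] at h; rw [h]; push_cast; ring)
      push_cast; exact mul_dvd_mul_left _ (ih i' w hw this)

theorem padicInt_approx (p : Primes) (y : ℚ_[p]) (hy : y ∈ Z_[p]) :
    ∃ i : ℕ, i < p.1 ∧ (p.1 : ℚ_[p])⁻¹ * (y - i) ∈ Z_[p] := by
  obtain ⟨Y, rfl⟩ : ∃ Y : ℤ_[p], (Y : ℚ_[p]) = y := ⟨⟨y, hy⟩, rfl⟩
  obtain ⟨i, hi, h⟩ := PadicInt.exists_mem_range Y
  refine ⟨i, hi, ?_⟩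
  rw [PadicInt.maximalIdeal_eq_span_p, Ideal.mem_span_singleton] at h
  obtain ⟨w, hw⟩ := h
  have := congrArg (fun z : ℤ_[p] => (z : ℚ_[p])) hw
  rw [coe_sub, PadicInt.coe_mul, coe_natCast, coe_natCast] at this
  rw [this, inv_mul_cancel_left₀ (mod_cast p.2.ne_zero)]
  exact w.2

theorem padicInt_sep (p : Primes) (i : ℤ) (w : ℚ_[p]) (hw : w ∈ Z_[p]) (h : (i : ℚ_[p]) = p.1 * w) :
    (p.1 : ℤ) ∣ i := by
  rw [← Padic.norm_intCast_lt_one_iff, h, norm_mul]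
  have h1 := (mem_subring_iff _).1 hw
  calc _ ≤ ‖(p.1 : ℚ_[p])‖ * 1 := by gcongr
    _ < 1 := by rw [mul_one]; exact Padic.norm_p_lt_one

theorem natCast_inv_mem_padicInt (p : Primes) (h : ¬ p.1 ∣ m) : ((m : ℚ_[p]))⁻¹ ∈ Z_[p] := by
  rw [mem_subring_iff, norm_inv, Padic.norm_natCast_eq_one_iff.2
    ((p.2.coprime_iff_not_dvd).2 h), inv_one]

theorem levelSystem_padic (p : Primes) : LevelSystem Z_[p] (primeProducts (· = p.1)) := by
  refine LevelSystem.of_primes ?_ ?_ ?_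
  · rintro _ - rfl y hy; obtain ⟨i, hi, h⟩ := padicInt_approx p y hy; refine ⟨i, hi, _, h, ?_⟩
    rw [mul_inv_cancel_left₀ (mod_cast p.2.ne_zero)]; ring
  · rintro _ - rfl i w hw h; exact padicInt_sep p i w hw h
  · intro ℓ hℓ h
    refine ⟨_, natCast_inv_mem_padicInt p fun h' => h ((Nat.prime_dvd_prime_iff_eq p.2 hℓ).1 h').symm,
      mul_inv_cancel₀ (mod_cast hℓ.ne_zero)⟩

theorem pow_mem_primeProducts (p : Primes) (j : ℕ) : p.1 ^ j ∈ primeProducts (· = p.1) :=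
  ⟨pow_pos p.2.pos j, fun _ hℓ h => (Nat.prime_dvd_prime_iff_eq hℓ p.2).1 (hℓ.dvd_of_dvd_pow h)⟩

theorem eq_pow_of_mem_primeProducts (h : m ∈ primeProducts (· = (p : ℕ))) : ∃ j, m = (p : ℕ) ^ j := by
  refine primeProducts_induction (P := (· = (p : ℕ))) (Q := fun m => ∃ j, m = (p : ℕ) ^ j)
    ⟨0, rfl⟩ ?_ h
  rintro _ m - rfl ⟨j, rfl⟩
  exact ⟨j + 1, by rw [pow_succ']⟩

/-- The positive integers prime to `c`. -/
abbrev coprimeLevels (c : ℕ) : Set ℕ := primeProducts fun ℓ => ¬ ℓ ∣ c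

theorem mem_coprimeLevels : m ∈ coprimeLevels c ↔ 0 < m ∧ m.Coprime c := by
  refine and_congr_right fun _ => ⟨fun h => ?_, fun h ℓ hℓ hm hc => ?_⟩
  · exact Coprime.symm (Nat.coprime_of_dvd fun k hk hkc hkm => h k hk hkm hkc)
  · exact Nat.Prime.not_coprime_iff_dvd.2 ⟨ℓ, hℓ, hm, hc⟩ h

theorem algebraMap_inv_mem_integral (h : ∀ ℓ : Primes, ℓ ∉ S → ¬ (ℓ : ℕ) ∣ m) :
    algebraMap ℚ (Adele S) ((m : ℚ)⁻¹) ∈ integral S := by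
  intro ℓ _
  rw [algebraMap_adele_apply, Rat.cast_inv, Rat.cast_natCast]
  exact natCast_inv_mem_padicInt ℓ.1 (h ℓ.1 ℓ.2)

theorem adele_mul_apply (x y : Adele S) (q : {ℓ : Primes // ℓ ∉ S}) : (x * y) q = x q * y q := rfl

theorem adele_sub_apply (x y : Adele S) (q : {ℓ : Primes // ℓ ∉ S}) : (x - y) q = x q - y q := rfl

theorem adele_natCast_apply (n : ℕ) (q : {ℓ : Primes // ℓ ∉ S}) : (n : Adele S) q = (n : ℚ_[q.1]) := map_natCast (projPadic q.1 q.2) n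

theorem adele_intCast_apply (n : ℤ) (q : {ℓ : Primes // ℓ ∉ S}) : (n : Adele S) q = (n : ℚ_[q.1]) := map_intCast (projPadic q.1 q.2) n

theorem mem_integral {x : Adele S} :
    x ∈ integral S ↔ ∀ q : {ℓ : Primes // ℓ ∉ S}, x q ∈ PadicInt.subring q.1 :=
  ⟨fun h q => h q trivial, fun h q _ => h q⟩

theorem levelSystem_adele (c : ℕ) : LevelSystem (integral (primesOf c)) (coprimeLevels c) := by
  have cancel : ∀ {ℓ : ℕ}, ℓ.Prime → (ℓ : Adele (primesOf c)) *
      algebraMap ℚ (Adele (primesOf c)) ((ℓ : ℚ)⁻¹) = 1 := fun {ℓ} hℓ => by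
    rw [← map_natCast (algebraMap ℚ (Adele (primesOf c))), ← map_mul,
      mul_inv_cancel₀ (mod_cast hℓ.ne_zero), map_one]
  refine LevelSystem.of_primes ?_ ?_ ?_
  · intro ℓ hℓ hP y hy; rw [mem_integral] at hy
    obtain ⟨i, hi, h⟩ := padicInt_approx (⟨⟨ℓ, hℓ⟩, hP⟩ : {q : Primes // q ∉ primesOf c}).1 _
      (hy ⟨⟨ℓ, hℓ⟩, hP⟩)
    refine ⟨i, hi, algebraMap ℚ (Adele (primesOf c)) ((ℓ : ℚ)⁻¹) * (y - i),
      mem_integral.2 fun q => ?_, ?_⟩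
    · rw [adele_mul_apply, adele_sub_apply, adele_natCast_apply, algebraMap_adele_apply,
        Rat.cast_inv, Rat.cast_natCast]
      by_cases hq : (q.1 : ℕ) = ℓ
      · obtain ⟨⟨q, hq'⟩, hq''⟩ := q; obtain rfl : q = ℓ := hq; exact h
      · exact mul_mem (natCast_inv_mem_padicInt q.1 fun h' =>
          hq ((Nat.prime_dvd_prime_iff_eq q.1.2 hℓ).1 h'))
          (sub_mem (hy q) (natCast_mem _ i))
    · linear_combination (i - y) * cancel hℓ
  · intro ℓ hℓ hP i w hw h; have := congrArg (fun z : Adele (primesOf c) => z ⟨⟨ℓ, hℓ⟩, hP⟩) h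
    simp only [adele_mul_apply, adele_natCast_apply, adele_intCast_apply] at this
    exact padicInt_sep (⟨⟨ℓ, hℓ⟩, hP⟩ : {q : Primes // q ∉ primesOf c}).1 i _
      (mem_integral.1 hw ⟨⟨ℓ, hℓ⟩, hP⟩) this
  · intro ℓ hℓ hP
    exact ⟨_, algebraMap_inv_mem_integral fun q hq h =>
      hP fun h' => hq (((Nat.prime_dvd_prime_iff_eq q.2 hℓ).1 h).symm ▸ h' : (q : ℕ) ∣ c), cancel hℓ⟩

/-! The action of the group on cosets -/

theorem testFn_eq_cellFn
    (hf : ∀ v, f.1 v = (cell O m a b).indicator (fun _ => (1 : ℤ)) v) : f = cellFn O m a b := by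
  have e : f.1 = (cell O m a b).indicator (fun _ => (1 : ℤ)) := funext hf
  have h : (cell O m a b).indicator (fun _ => (1 : ℤ)) ∈ TestFn O := e ▸ f.2
  rw [cellFn, dif_pos h]
  exact Subtype.ext e

theorem zero_mem_cell_iff_of_actVec {m' : ℕ} {a' b' : ℚ}
    (h : ∀ v : Fin 2 → R, actVec R γ v ∈ cell O m a b ↔ v ∈ cell O m' a' b') :
    (0 : Fin 2 → R) ∈ cell O m a b ↔ (0 : Fin 2 → R) ∈ cell O m' a' b' := by
  rw [← h 0, actVec_zero]

theorem slash_cellFn_of_forall {m' : ℕ} (hm : 0 < m) {a' b' : ℚ}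
    (h : ∀ v : Fin 2 → R, actVec R γ v ∈ cell O m a b ↔ v ∈ cell O m' a' b') :
    slash O γ (cellFn O m a b) = cellFn O m' a' b' := by
  by_cases h0 : (0 : Fin 2 → R) ∈ cell O m a b
  · rw [cellFn_eq_zero O a b h0, cellFn_eq_zero O a' b' ((zero_mem_cell_iff_of_actVec h).1 h0), map_zero]
  · refine testFn_eq_cellFn fun v => ?_
    change (cellFn O m a b).1 (actVec R γ v) = _
    rw [cellFn_apply O hm a b h0]; exact indicator_congr (h v)

theorem actVec_two (γ : GQ) (v : Fin 2 → R) (j : Fin 2) :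
    actVec R γ v j = v 0 * algebraMap ℚ R (mat γ⁻¹ 0 j) + v 1 * algebraMap ℚ R (mat γ⁻¹ 1 j) := by
  rw [actVec_apply, Fin.sum_univ_two]

theorem mem_cell_actVec (hγ : ∀ i j, algebraMap ℚ R (mat γ i j) ∈ O) {v : Fin 2 → R}
    (h : actVec R γ v ∈ cell O m a b) :
    v ∈ cell O m (a * mat γ 0 0 + b * mat γ 1 0) (a * mat γ 0 1 + b * mat γ 1 1) := by
  obtain ⟨⟨w, hw, e⟩, w', hw', e'⟩ := h
  have hv : v = actVec R γ⁻¹ (actVec R γ v) := by rw [← actVec_mul, inv_mul_cancel, actVec_one]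
  have hj : ∀ j, v j = actVec R γ v 0 * algebraMap ℚ R (mat γ 0 j) +
      actVec R γ v 1 * algebraMap ℚ R (mat γ 1 j) := fun j => by
    conv_lhs => rw [hv]
    rw [actVec_two, inv_inv]
  refine ⟨⟨w * algebraMap ℚ R (mat γ 0 0) + w' * algebraMap ℚ R (mat γ 1 0),
    O.add_mem (O.mul_mem hw (hγ 0 0)) (O.mul_mem hw' (hγ 1 0)), ?_⟩,
    ⟨w * algebraMap ℚ R (mat γ 0 1) + w' * algebraMap ℚ R (mat γ 1 1),
    O.add_mem (O.mul_mem hw (hγ 0 1)) (O.mul_mem hw' (hγ 1 1)), ?_⟩⟩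
  · rw [hj, e, e']; simp only [map_add, map_mul]; ring
  · rw [hj, e, e']; simp only [map_add, map_mul]; ring

theorem slash_cellFn (hm : 0 < m) (a b : ℚ)
    (hγ : ∀ i j, algebraMap ℚ R (mat γ i j) ∈ O ∧ algebraMap ℚ R (mat γ⁻¹ i j) ∈ O) :
    slash O γ (cellFn O m a b) =
      cellFn O m (a * mat γ 0 0 + b * mat γ 1 0) (a * mat γ 0 1 + b * mat γ 1 1) := by
  refine slash_cellFn_of_forall hm fun v => ⟨mem_cell_actVec fun i j => (hγ i j).1, fun h => ?_⟩
  have hv : v = actVec R γ⁻¹ (actVec R γ v) := by rw [← actVec_mul, inv_mul_cancel, actVec_one]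
  rw [hv] at h
  have := mem_cell_actVec (fun i j => (hγ i j).2) h
  have e : ∀ i j, mat γ i 0 * mat γ⁻¹ 0 j + mat γ i 1 * mat γ⁻¹ 1 j = if i = j then 1 else 0 :=
    fun i j => by
      have := congrFun (congrFun (mat_mul_inv γ) i) j
      rwa [Matrix.mul_apply, Fin.sum_univ_two, Matrix.one_apply] at this
  have e00 := e 0 0
  have e01 := e 0 1
  have e10 := e 1 0
  have e11 := e 1 1
  simp only [Fin.isValue, if_true, zero_ne_one, one_ne_zero, if_false] at e00 e01 e10 e11
  have ea : (a * mat γ 0 0 + b * mat γ 1 0) * mat γ⁻¹ 0 0 +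
      (a * mat γ 0 1 + b * mat γ 1 1) * mat γ⁻¹ 1 0 = a := by linear_combination a * e00 + b * e10
  have eb : (a * mat γ 0 0 + b * mat γ 1 0) * mat γ⁻¹ 0 1 +
      (a * mat γ 0 1 + b * mat γ 1 1) * mat γ⁻¹ 1 1 = b := by linear_combination a * e01 + b * e11
  rwa [ea, eb] at this

theorem mat_scalar (x : ℚ) (hx : x ≠ 0) : mat (scalar x hx) = !![x, 0; 0, x] := rfl

theorem mat_scalar_inv (x : ℚ) (hx : x ≠ 0) : mat (scalar x hx)⁻¹ = !![x⁻¹, 0; 0, x⁻¹] := by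
  rw [← inv_eq_right_inv (mat_mul_inv (scalar x hx))]
  refine inv_eq_right_inv ?_
  rw [mat_scalar]
  ext i j
  fin_cases i <;> fin_cases j <;> simp [Matrix.mul_apply, Fin.sum_univ_two, hx]

theorem mat_LR (x : ℚ) (hx : 0 < x) : mat (LR x hx) = !![1, 0; 0, x] := rfl

theorem mat_LR_inv (x : ℚ) (hx : 0 < x) : mat (LR x hx)⁻¹ = !![1, 0; 0, x⁻¹] := by
  rw [← inv_eq_right_inv (mat_mul_inv (LR x hx))]
  refine inv_eq_right_inv ?_
  rw [mat_LR]
  ext i j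
  fin_cases i <;> fin_cases j <;> simp [Matrix.mul_apply, Fin.sum_univ_two, hx.ne']

theorem actVec_scalar (x : ℚ) (hx : x ≠ 0) (v : Fin 2 → R) (j : Fin 2) :
    actVec R (scalar x hx) v j = algebraMap ℚ R x⁻¹ * v j := by
  rw [actVec_two, mat_scalar_inv]
  fin_cases j <;> simp [mul_comm]

theorem algebraMap_inv_mul (hk : (k : ℚ) ≠ 0) {x y : R} :
    algebraMap ℚ R (k : ℚ)⁻¹ * x = y ↔ x = k * y := by
  have e : (k : R) * algebraMap ℚ R (k : ℚ)⁻¹ = 1 := by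
    rw [← map_natCast (algebraMap ℚ R), ← map_mul, mul_inv_cancel₀ hk, map_one]
  constructor
  · rintro rfl; rw [← mul_assoc, e, one_mul]
  · rintro rfl; rw [← mul_assoc, mul_comm (algebraMap ℚ R _), e, one_mul]

theorem slash_scalar_cellFn (O : Subring R) (hm : 0 < m) (hk : (k : ℚ) ≠ 0) (a b : ℚ) :
    slash O (scalar k hk) (cellFn O m a b) = cellFn O (k * m) (k * a) (k * b) := by
  refine slash_cellFn_of_forall hm fun v => ?_
  simp only [cell, mem_ofPred_eq, actVec_scalar, algebraMap_inv_mul hk, map_mul, map_natCast,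
    Nat.cast_mul, mul_add, mul_assoc]

/-! Generators of `G_S` -/

/-- The inclusion `SL₂(ℤ) → GL₂⁺(ℚ)`. -/
def ofSL : SL(2, ℤ) →* GQ := toGLPos.comp (map (castRingHom ℚ))

theorem mat_ofSL (σ : SL(2, ℤ)) (i j : Fin 2) : mat (ofSL σ) i j = (σ.1 i j : ℚ) := rfl

theorem den_mem_coprimeLevels (hx : x ∈ ZS (primesOf c)) : x.den ∈ coprimeLevels c :=
  ⟨x.den_pos, fun ℓ hℓ h hc => hx ⟨ℓ, hℓ⟩ hc h⟩

theorem mem_ZS_of_mul (hd : d ∈ coprimeLevels c) (h : ∃ z : ℤ, (d : ℚ) * x = z) :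
    x ∈ ZS (primesOf c) := by
  obtain ⟨z, hz⟩ := h
  have hd0 : (d : ℚ) ≠ 0 := mod_cast hd.1.ne'
  have e : x = z * (d : ℚ)⁻¹ := by field_simp; rw [mul_comm, hz]
  rw [e]
  exact mul_mem (intCast_mem _ z) (inv_natCast_mem_ZS hd.1 fun ℓ hℓ h => hd.2 ℓ ℓ.2 h hℓ)

theorem exists_upper_triangular (A : Matrix (Fin 2) (Fin 2) ℤ) (hA : 0 < A.det) :
    ∃ σ : SL(2, ℤ), ∃ a d : ℕ, ∃ b : ℤ, 0 < a ∧ 0 < d ∧ (a * d : ℤ) = A.det ∧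
      σ.1 * A = !![(a : ℤ), b; 0, (d : ℤ)] := by
  obtain ⟨σ, h10⟩ : ∃ σ : SL(2, ℤ), (σ.1 * A) 1 0 = 0 := by
    have hg : 0 < Int.gcd (A 1 0) (A 0 0) := by
      rw [Int.gcd_pos_iff]
      by_contra! h
      rw [det_fin_two, h.1, h.2] at hA; simp at hA
    obtain ⟨x, y, hxy, hx, hy⟩ := Int.exists_gcd_one hg
    have hco : IsCoprime (-x) y := by
      rw [IsCoprime.neg_left_iff]; exact Int.isCoprime_iff_gcd_eq_one.2 hxy
    obtain ⟨σ, -, hσ⟩ := ModularGroup.bottom_row_surj (R := ℤ) (show ![-x, y] ∈ _ from hco)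
    refine ⟨σ, ?_⟩
    have e0 : σ.1 1 0 = -x := congrFun hσ 0
    have e1 : σ.1 1 1 = y := congrFun hσ 1
    rw [Matrix.mul_apply, Fin.sum_univ_two, e0, e1]
    linear_combination -x * hy + y * hx
  have hdet : ∀ σ : SL(2, ℤ), (σ.1 * A) 1 0 = 0 → (σ.1 * A) 0 0 * (σ.1 * A) 1 1 = A.det :=
    fun σ h => by
      have := det_mul σ.1 A; rw [σ.2, one_mul, det_fin_two, h, mul_zero, sub_zero] at this
      exact this
  have main : ∀ σ : SL(2, ℤ), (σ.1 * A) 1 0 = 0 → 0 < (σ.1 * A) 0 0 →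
      ∃ σ : SL(2, ℤ), ∃ a d : ℕ, ∃ b : ℤ, 0 < a ∧ 0 < d ∧ (a * d : ℤ) = A.det ∧
      σ.1 * A = !![(a : ℤ), b; 0, (d : ℤ)] := fun σ h0 hpos => by
    have hd := hdet σ h0
    have hpos' : 0 < (σ.1 * A) 1 1 := by rw [← hd] at hA; exact (pos_iff_pos_of_mul_pos hA).1 hpos
    refine ⟨σ, ((σ.1 * A) 0 0).toNat, ((σ.1 * A) 1 1).toNat, (σ.1 * A) 0 1, by omega, by omega, ?_, ?_⟩
    · rw [toNat_of_nonneg hpos.le, toNat_of_nonneg hpos'.le, hd]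
    · rw [toNat_of_nonneg hpos.le, toNat_of_nonneg hpos'.le, ← h0]; exact Matrix.eta_fin_two _
  rcases lt_trichotomy ((σ.1 * A) 0 0) 0 with h | h | h
  · have e : (-σ).1 * A = -(σ.1 * A) := by rw [coe_neg, Matrix.neg_mul]
    refine main (-σ) ?_ ?_
    · rw [e, Matrix.neg_apply, h10, neg_zero]
    · rw [e, Matrix.neg_apply]; omega
  · have := hdet σ h10; rw [h, zero_mul] at this; omega
  · exact main σ h10 h

theorem primeProducts_mul_mem {P : ℕ → Prop} {a b : ℕ} (ha : a ∈ primeProducts P)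
    (hb : b ∈ primeProducts P) : a * b ∈ primeProducts P :=
  ⟨Nat.mul_pos ha.1 hb.1, fun ℓ hℓ h => ((hℓ.dvd_mul).1 h).elim (ha.2 ℓ hℓ) (hb.2 ℓ hℓ)⟩

theorem primeProducts_of_dvd {P : ℕ → Prop} (hm : m ∈ primeProducts P) (h : d ∣ m) :
    d ∈ primeProducts P :=
  ⟨Nat.pos_of_dvd_of_pos h hm.1, fun ℓ hℓ hd => hm.2 ℓ hℓ (hd.trans h)⟩

theorem den_mem_primeProducts {P : ℕ → Prop} (hP : ∀ ℓ : Primes, P ℓ ↔ ℓ ∉ S) (hx : x ∈ ZS S) :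
    x.den ∈ primeProducts P :=
  ⟨x.den_pos, fun ℓ hℓ h => (hP ⟨ℓ, hℓ⟩).2 fun hS => hx _ hS h⟩

theorem exists_factorization {P : ℕ → Prop} (hP : ∀ ℓ : Primes, P ℓ ↔ ℓ ∉ S) (hγ : γ ∈ GS S) :
    ∃ (σ : SL(2, ℤ)) (n a d : ℕ) (b : ℤ) (hn0 : (n : ℚ) ≠ 0) (ha0 : (0 : ℚ) < a)
      (hd0 : (0 : ℚ) < d), n ∈ primeProducts P ∧ a ∈ primeProducts P ∧ d ∈ primeProducts P ∧
      ofSL σ * (scalar n hn0 * γ) * LR a ha0 = LR d hd0 * ofSL (T ^ b) * scalar a ha0.ne' := by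
  have hden := fun i j => den_mem_primeProducts hP (hγ i j).1
  set n : ℕ := (mat γ 0 0).den * (mat γ 0 1).den * ((mat γ 1 0).den * (mat γ 1 1).den) with hn
  have hnL : n ∈ primeProducts P := primeProducts_mul_mem
    (primeProducts_mul_mem (hden 0 0) (hden 0 1)) (primeProducts_mul_mem (hden 1 0) (hden 1 1))
  have hn0 : (n : ℚ) ≠ 0 := mod_cast hnL.1.ne'
  have hint : ∀ i j, ∃ z : ℤ, (n : ℚ) * mat γ i j = z := fun i j => by
    have hdv : (mat γ i j).den ∣ n := by
      fin_cases i <;> fin_cases j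
      · exact Dvd.dvd.mul_right (Dvd.intro _ rfl) _
      · exact Dvd.dvd.mul_right (Dvd.intro_left _ rfl) _
      · exact Dvd.dvd.mul_left (Dvd.intro _ rfl) _
      · exact Dvd.dvd.mul_left (Dvd.intro_left _ rfl) _
    obtain ⟨k, hk⟩ := hdv; refine ⟨k * (mat γ i j).num, ?_⟩; rw [hk]; push_cast
    have := den_mul_eq_num (mat γ i j)
    linear_combination (k : ℚ) * this
  choose A hA using hint
  have hdetγ : 0 < (mat γ).det := γ.2
  have hdetA : ((Matrix.of A).det : ℚ) = n ^ 2 * (mat γ).det := by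
    rw [det_fin_two, det_fin_two]; push_cast; simp only [of_apply, ← hA]; ring
  have hdpos : 0 < (Matrix.of A).det := by
    have : (0 : ℚ) < ((Matrix.of A).det : ℚ) := by rw [hdetA]; positivity
    exact_mod_cast this
  obtain ⟨σ, a, d, b, ha, hd, had, hσ⟩ := exists_upper_triangular (Matrix.of A) hdpos
  have hadL : a * d ∈ primeProducts P := by
    refine ⟨Nat.mul_pos ha hd, fun ℓ hℓ hdv => (hP ⟨ℓ, hℓ⟩).2 fun hc => ?_⟩
    have hx : (mat γ⁻¹).det ∈ ZS S := by
      rw [det_fin_two]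
      exact sub_mem (mul_mem (hγ 0 0).2 (hγ 1 1).2) (mul_mem (hγ 0 1).2 (hγ 1 0).2)
    have h1 : (mat γ).det * (mat γ⁻¹).det = 1 := by rw [← det_mul, mat_mul_inv, Matrix.det_one]
    have h2 : ((n ^ 2 * (mat γ⁻¹).det.den : ℕ) : ℤ) = (a * d : ℕ) * (mat γ⁻¹).det.num := by
      have h3 : ((a * d : ℕ) : ℚ) = n ^ 2 * (mat γ).det := by rw [← hdetA, ← had]; push_cast; ring
      have : ((n ^ 2 * (mat γ⁻¹).det.den : ℕ) : ℚ) = (a * d : ℕ) * (mat γ⁻¹).det.num := by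
        rw [h3, ← den_mul_eq_num (mat γ⁻¹).det]; push_cast
        linear_combination -(n : ℚ) ^ 2 * (mat γ⁻¹).det.den * h1
      exact_mod_cast this
    have h4 : (ℓ : ℤ) ∣ (n ^ 2 * (mat γ⁻¹).det.den : ℕ) := by
      rw [h2]; exact Dvd.dvd.mul_right (mod_cast hdv) _
    have h5 : ℓ ∣ n ^ 2 * (mat γ⁻¹).det.den := mod_cast h4
    rcases (hℓ.dvd_mul).1 h5 with h | h
    · exact (hP ⟨ℓ, hℓ⟩).1 (hnL.2 ℓ hℓ (hℓ.dvd_of_dvd_pow h)) hc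
    · exact hx ⟨ℓ, hℓ⟩ hc h
  have haL := primeProducts_of_dvd hadL (Dvd.intro _ rfl)
  have hdL := primeProducts_of_dvd hadL (Dvd.intro_left _ rfl)
  have ha0 : (0 : ℚ) < a := mod_cast ha
  have hd0 : (0 : ℚ) < d := mod_cast hd
  refine ⟨σ, n, a, d, b, hn0, ha0, hd0, hnL, haL, hdL, ?_⟩
  · apply mat_injective
    have e : mat (ofSL σ) * mat (scalar n hn0 * γ) = !![(a : ℚ), b; 0, d] := by
      have h1 : mat (scalar n hn0 * γ) = (Matrix.of A).map (castRingHom ℚ) := by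
        ext i j; refine Eq.trans ?_ (hA i j)
        rw [mat_mul, mat_scalar, Matrix.mul_apply, Fin.sum_univ_two]
        fin_cases i <;> simp
      have h2 : mat (ofSL σ) = σ.1.map (castRingHom ℚ) := rfl
      rw [h1, h2, ← Matrix.map_mul, hσ]
      ext i j
      fin_cases i <;> fin_cases j <;> simp
    have eT : mat (ofSL (T ^ b)) = !![1, (b : ℚ); 0, 1] := by
      ext i j; rw [mat_ofSL, coe_T_zpow]
      fin_cases i <;> fin_cases j <;> simp
    rw [mat_mul, mat_mul, e, mat_mul, mat_mul, eT, mat_LR, mat_LR, mat_scalar]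
    ext i j
    fin_cases i <;> fin_cases j <;> simp [Matrix.mul_apply, Fin.sum_univ_two, mul_comm]

theorem ofSL_mem_of_generators {K : Subgroup GQ} (hS : ofSL ModularGroup.S ∈ K) (hT : ofSL T ∈ K)
    (σ : SL(2, ℤ)) : ofSL σ ∈ K := by
  have h : Subgroup.closure {S, T} ≤ K.comap ofSL := by
    rw [Subgroup.closure_le]; rintro x (rfl | rfl)
    · exact hS
    · exact hT
  rw [_root_.SpecialLinearGroup.SL2Z_generators] at h
  exact h (mem_top σ)

theorem mem_of_factorization {K : Subgroup GQ} {g₁ g₂ g₃ g₄ g₅ g₆ : GQ} (h₁ : g₁ ∈ K) (h₂ : g₂ ∈ K)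
    (h₃ : g₃ ∈ K) (h₄ : g₄ ∈ K) (h₅ : g₅ ∈ K) (h₆ : g₆ ∈ K)
    (h : g₁ * (g₂ * γ) * g₃ = g₄ * g₅ * g₆) : γ ∈ K := by
  have h' : g₁ * (g₂ * γ) * g₃ ∈ K := h ▸ mul_mem (mul_mem h₄ h₅) h₆
  exact (K.mul_mem_cancel_left h₂).1 ((K.mul_mem_cancel_left h₁).1
    ((K.mul_mem_cancel_right h₃).1 h'))

theorem GS_le_of_generators {K : Subgroup GQ} (hS : ofSL ModularGroup.S ∈ K) (hT : ofSL T ∈ K)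
    (hLR : ∀ k ∈ coprimeLevels c, ∀ hk : 0 < (k : ℚ), LR k hk ∈ K)
    (hsc : ∀ k ∈ coprimeLevels c, ∀ hk : (k : ℚ) ≠ 0, scalar k hk ∈ K) : GS (primesOf c) ≤ K := by
  intro γ hγ
  obtain ⟨σ, n, a, d, b, hn0, ha0, hd0, hn, ha, hd, h⟩ :=
    exists_factorization (P := fun ℓ => ¬ ℓ ∣ c) (fun _ => Iff.rfl) hγ
  exact mem_of_factorization (ofSL_mem_of_generators hS hT σ) (hsc n hn hn0) (hLR a ha ha0)
    (hLR d hd hd0) (ofSL_mem_of_generators hS hT _) (hsc a ha ha0.ne') h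

/-! Holomorphic functions and their units -/

theorem mdifferentiable_of_differentiableOn {f : ℂ → ℂ} (hf : DifferentiableOn ℂ f {z | 0 < z.im}) :
    MDiff (fun τ : ℍ => f τ) := by
  rw [UpperHalfPlane.mdifferentiable_iff]
  refine hf.congr fun z hz => ?_
  simp only [comp_apply, UpperHalfPlane.ofComplex_apply_of_im_pos hz]

theorem differentiableOn_of_mdifferentiable {F : ℍ → ℂ} (hF : MDiff F) :
    DifferentiableOn ℂ (F ∘ ofComplex) {z | 0 < z.im} :=
  UpperHalfPlane.mdifferentiable_iff.1 hF

/-- The unit given by a nowhere vanishing holomorphic function. -/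
def holUnit (f : ℂ → ℂ) (hf : DifferentiableOn ℂ f {z | 0 < z.im})
    (h0 : ∀ z : ℂ, 0 < z.im → f z ≠ 0) : HolUnits :=
  (Additive.ofMul
    { val := ⟨fun τ => f τ, mdifferentiable_of_differentiableOn hf⟩
      inv := ⟨fun τ => (f τ)⁻¹, mdifferentiable_of_differentiableOn (f := fun z => (f z)⁻¹)
        (hf.inv fun z hz => h0 z hz)⟩
      val_inv := Subtype.ext (funext fun τ => mul_inv_cancel₀ (h0 τ τ.im_pos))
      inv_val := Subtype.ext (funext fun τ => inv_mul_cancel₀ (h0 τ τ.im_pos)) } : Additive Holˣ)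

theorem holUnit_fn (f : ℂ → ℂ) (hf : DifferentiableOn ℂ f {z | 0 < z.im})
    (h0 : ∀ z : ℂ, 0 < z.im → f z ≠ 0) (τ : ℍ) : (holUnit f hf h0).fn.1 τ = f τ := rfl

theorem HolUnits.ext {u v : HolUnits} (h : ∀ τ : ℍ, u.fn.1 τ = v.fn.1 τ) : u = v :=
  HolUnits.fn_injective (Subtype.ext (funext h))

theorem HolUnits.fn_zero (τ : ℍ) : (0 : HolUnits).fn.1 τ = 1 := rfl

theorem HolUnits.fn_add (u v : HolUnits) (τ : ℍ) : (u + v).fn.1 τ = u.fn.1 τ * v.fn.1 τ := rfl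

theorem HolUnits.fn_sum {ι : Type*} (s : Finset ι) (u : ι → HolUnits) (τ : ℍ) :
    (∑ i ∈ s, u i).fn.1 τ = ∏ i ∈ s, (u i).fn.1 τ := by
  classical
  induction s using Finset.induction_on with
  | empty => rfl
  | insert i s hi ih => rw [Finset.sum_insert hi, Finset.prod_insert hi, fn_add, ih]

theorem HolUnits.fn_ne_zero (u : HolUnits) (τ : ℍ) : u.fn.1 τ ≠ 0 := fun h => by
  have : (u + -u).fn.1 τ = 1 := by rw [add_neg_cancel]; rfl
  rw [fn_add, h, zero_mul] at this
  exact zero_ne_one this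

theorem HolUnits.fn_smul (γ : GQ) (u : HolUnits) (τ : ℍ) : (γ • u).fn.1 τ = u.fn.1 (toReal γ⁻¹ • τ) := rfl

theorem Hol.smul_apply (γ : GQ) (F : Hol) (τ : ℍ) : (γ • F).1 τ = F.1 (toReal γ⁻¹ • τ) := rfl

theorem coe_toReal_smul (γ : GQ) (τ : ℍ) : ((toReal γ • τ : ℍ) : ℂ) =
    (mat γ 0 0 * τ + mat γ 0 1) / (mat γ 1 0 * τ + mat γ 1 1) := by
  rw [coe_smul_of_det_pos (toReal_det_pos γ)]
  have e : ∀ i j, ((toReal γ).1 i j : ℂ) = (mat γ i j : ℂ) := fun i j => by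
    change ((algebraMap ℚ ℝ (mat γ i j) : ℝ) : ℂ) = _
    simp
  rw [num, denom]
  simp only [e]

theorem expHom_fn (F : Hol) (τ : ℍ) : (expHom F).fn.1 τ = ex (F.1 τ) := rfl

theorem expHom_smul (γ : GQ) (F : Hol) : expHom (γ • F) = γ • expHom F := HolUnits.ext fun _ => rfl

theorem constHom_apply (n : ℤ) (τ : ℍ) : (constHom n).1 τ = n := by
  change ((n : Hol) : ℍ → ℂ) τ = n
  rw [SubringClass.coe_intCast]; rfl

theorem constHom_smul (γ : GQ) (n : ℤ) : constHom (γ • n) = γ • constHom n := by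
  refine Subtype.ext (funext fun τ => ?_)
  rw [Hol.smul_apply, constHom_apply, constHom_apply]; rfl

theorem constHom_injective : Injective constHom := fun a b h => by
  have := congrArg (fun F : Hol => F.1 UpperHalfPlane.I) h
  simp only [constHom_apply] at this
  exact_mod_cast this

theorem eq_const_of_integer_values {F : Hol} (h : ∀ τ, ∃ n : ℤ, F.1 τ = n) : ∃ n : ℤ, F = constHom n := by
  choose g hg using h
  have hc : Continuous g := by
    rw [Int.isClosedEmbedding_coe_real.isEmbedding.continuous_iff]
    have : (Int.cast ∘ g : ℍ → ℝ) = fun τ => (F.1 τ).re := by funext τ; simp [hg]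
    rw [this]; exact continuous_re.comp F.2.continuous
  refine ⟨g UpperHalfPlane.I, Subtype.ext (funext fun τ => ?_)⟩
  rw [constHom_apply, hg, PreconnectedSpace.constant inferInstance hc (x := τ) (y := UpperHalfPlane.I)]

theorem expHom_eq_zero {F : Hol} (h : expHom F = 0) : ∃ n : ℤ, F = constHom n :=
  eq_const_of_integer_values fun τ => by
    refine ex_eq_one_iff.1 ?_
    rw [← expHom_fn, h, HolUnits.fn_zero]

theorem exists_log_ball {f : ℂ → ℂ} (hf : DifferentiableOn ℂ f (Metric.ball 0 1))
    (h0 : ∀ z ∈ Metric.ball (0 : ℂ) 1, f z ≠ 0) :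
    ∃ L : ℂ → ℂ, DifferentiableOn ℂ L (Metric.ball 0 1) ∧
      ∀ z ∈ Metric.ball (0 : ℂ) 1, Complex.exp (L z) = f z := by
  have ho : IsOpen (Metric.ball (0 : ℂ) 1) := Metric.isOpen_ball
  have h0' : (0 : ℂ) ∈ Metric.ball (0 : ℂ) 1 := Metric.mem_ball_self one_pos
  obtain ⟨L, hL0, hL⟩ := ((hf.deriv ho).div hf h0).isExactOn_ball.with_val_at 0 (log (f 0))
  refine ⟨L, fun z hz => (hL z hz).differentiableAt.differentiableWithinAt, fun z hz => ?_⟩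
  have hd : ∀ z ∈ Metric.ball (0 : ℂ) 1,
      HasDerivAt (fun z => Complex.exp (-L z) * f z) 0 z := fun z hz => by
    have h1 := ((hL z hz).neg.cexp).mul ((hf.differentiableAt (ho.mem_nhds hz)).hasDerivAt)
    refine h1.congr_deriv ?_
    have := h0 z hz; simp only [Pi.neg_apply, Pi.div_apply]; field_simp; ring
  have hc := (convex_ball (0 : ℂ) 1).is_const_of_fderivWithin_eq_zero (𝕜 := ℂ)
    (f := fun z => Complex.exp (-L z) * f z)
    (fun z hz => (hd z hz).differentiableAt.differentiableWithinAt) (fun z hz => by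
      rw [fderivWithin_of_isOpen ho hz, (hd z hz).hasFDerivAt.fderiv]
      ext; simp) hz h0'
  simp only [hL0, exp_neg, exp_log (h0 0 h0'), inv_mul_cancel₀ (h0 0 h0')] at hc
  have := Complex.exp_ne_zero (L z)
  field_simp at hc
  exact hc.symm

theorem expHom_surjective : Surjective expHom := by
  intro u
  let φ : ℂ → ℂ := fun w => I * (1 + w) / (1 - w)
  let ψ : ℂ → ℂ := fun z => (z - I) / (z + I)
  have hne : ∀ w ∈ Metric.ball (0 : ℂ) 1, 1 - w ≠ 0 := fun w hw h => by
    rw [← sub_eq_zero.1 h] at hw; simp at hw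
  have hne' : ∀ z : ℂ, 0 < z.im → z + I ≠ 0 := fun z hz h => by
    have := congrArg Complex.im h; simp at this; linarith
  have hφim : ∀ w ∈ Metric.ball (0 : ℂ) 1, 0 < (φ w).im := fun w hw => by
    have h1 := hne w hw
    have h2 : 0 < normSq (1 - w) := Complex.normSq_pos.2 h1
    have h3 : normSq w < 1 := by
      rw [Metric.mem_ball, dist_zero_right] at hw; rw [Complex.normSq_eq_norm_sq]
      nlinarith [norm_nonneg w]
    have e : (φ w).im = (1 - normSq w) / normSq (1 - w) := by
      simp only [φ, Complex.div_im]; rw [← sub_div]; congr 1; simp [Complex.normSq_apply]; ring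
    rw [e]; exact div_pos (by linarith) h2
  have hψ : ∀ z : ℂ, 0 < z.im → ψ z ∈ Metric.ball (0 : ℂ) 1 := fun z hz => by
    rw [Metric.mem_ball, dist_zero_right, norm_div, div_lt_one (norm_pos_iff.2 (hne' z hz))]
    rw [Complex.norm_def, Complex.norm_def]; refine Real.sqrt_lt_sqrt (Complex.normSq_nonneg _) ?_
    simp [Complex.normSq_apply]; nlinarith
  have hφψ : ∀ z : ℂ, 0 < z.im → φ (ψ z) = z := fun z hz => by
    have h1 := hne' z hz
    simp only [φ, ψ]; have h2 : 1 - (z - I) / (z + I) = 2 * I / (z + I) := by field_simp; ring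
    rw [h2]; field_simp; ring
  have hu := differentiableOn_of_mdifferentiable u.fn.2
  obtain ⟨L, hL, hL'⟩ := exists_log_ball (f := (u.fn.1 ∘ ofComplex) ∘ φ)
    (hu.comp (DifferentiableOn.div (by fun_prop) (by fun_prop) hne) fun w hw => hφim w hw)
    (fun w _ => u.fn_ne_zero _)
  refine ⟨⟨fun τ => L (ψ τ) / (2 * π * I), mdifferentiable_of_differentiableOn
    (f := fun z => L (ψ z) / (2 * π * I)) ?_⟩, HolUnits.ext fun τ => ?_⟩
  · exact (hL.comp (DifferentiableOn.div (by fun_prop) (by fun_prop) fun z hz => hne' z hz)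
      fun z hz => hψ z hz).div_const _
  · rw [expHom_fn, ex, mul_div_cancel₀ _ two_pi_I_ne_zero, hL' _ (hψ τ τ.im_pos)]
    simp only [comp_apply, hφψ _ τ.im_pos, UpperHalfPlane.ofComplex_apply]

/-! The Kato-Siegel distribution -/

theorem thetaC_add_int (hc6 : c.Coprime 6) (n : ℤ) (u : ℂ) (hτ : 0 < τ.im) :
    thetaC c (u + n) τ = thetaC c u τ := by
  induction n using induction_on with
  | zero => simp
  | succ n ih =>
    push_cast at ih ⊢; rw [← add_assoc, thetaC_add_one hc6 _ hτ, ih]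
  | pred n ih =>
    rw [← ih, ← thetaC_add_one hc6 _ hτ]; congr 1; push_cast; ring

theorem thetaC_add_int_mul (hc6 : c.Coprime 6) (n : ℤ) (u : ℂ) (hτ : 0 < τ.im) :
    thetaC c (u + n * τ) τ = thetaC c u τ := by
  induction n using induction_on with
  | zero => simp
  | succ n ih =>
    push_cast at ih ⊢; rw [add_mul, one_mul, ← add_assoc, thetaC_add_tau hc6 _ hτ, ih]
  | pred n ih =>
    rw [← ih, ← thetaC_add_tau hc6 _ hτ]; congr 1; push_cast; ring

theorem int_of_mul_int (ha : a ∈ ZS (primesOf c)) (h : ∃ m : ℤ, c * a = m) : ∃ m : ℤ, a = m := by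
  obtain ⟨m, hm⟩ := h
  have hd : a.den ∣ c := by
    have h1 : (c : ℤ) * a.num = m * a.den := by
      have : (c : ℚ) * a.num = m * a.den := by rw [← hm, ← Rat.mul_den_eq_num]; ring
      exact_mod_cast this
    have h2 : (a.den : ℤ) ∣ c * a.num := ⟨m, by rw [h1]; ring⟩
    have h3 : IsCoprime (a.den : ℤ) a.num := by
      rw [Int.isCoprime_iff_gcd_eq_one]; have := a.reduced; rw [Int.gcd_comm]; exact this
    exact_mod_cast h3.dvd_of_dvd_mul_right h2
  have hden : a.den = 1 := by
    by_contra h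
    obtain ⟨ℓ, hℓ, hdv⟩ := Nat.exists_prime_and_dvd h; exact ha ⟨ℓ, hℓ⟩ (hdv.trans hd) hdv
  exact ⟨a.num, ((Rat.den_eq_one_iff a).1 hden).symm⟩

theorem rat_eq_of_lattice (hτ : 0 < τ.im) {m n : ℤ} (h : (a : ℂ) * τ + b = m * τ + n) :
    a = m ∧ b = n := by
  have h1 := congrArg Complex.im h
  have e : ∀ q : ℚ, (q : ℂ) = ((q : ℝ) : ℂ) := fun q => by push_cast; rfl
  have e' : ∀ q : ℤ, (q : ℂ) = ((q : ℝ) : ℂ) := fun q => by push_cast; rfl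
  rw [e, e, e', e'] at h1
  simp only [add_im, im_ofReal_mul, ofReal_im, add_zero] at h1
  have h2 : (a : ℝ) = m := mul_right_cancel₀ hτ.ne' h1
  have h3 : a = m := mod_cast h2
  refine ⟨h3, ?_⟩
  rw [h3] at h
  push_cast at h
  have := add_left_cancel h
  exact_mod_cast this

/-- The rational points at which the Kato-Siegel units are defined. -/
def KSPoint (c : ℕ) (a b : ℚ) : Prop :=
  a ∈ ZS (primesOf c) ∧ b ∈ ZS (primesOf c) ∧ ¬ ((∃ z : ℤ, a = z) ∧ ∃ z : ℤ, b = z)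

theorem thetaC_ne_zero (h : KSPoint c a b) (hτ : 0 < τ.im) : thetaC c (a * τ + b) τ ≠ 0 := by
  refine mul_ne_zero (mul_ne_zero (pow_ne_zero _ (by norm_num)) (pow_ne_zero _ fun h0 => ?_))
    (inv_ne_zero fun h0 => ?_)
  · obtain ⟨m, n, e⟩ := (Theta_eq_zero_iff hτ).1 h0; obtain ⟨ha, hb⟩ := rat_eq_of_lattice hτ e
    exact h.2.2 ⟨⟨m, ha⟩, n, hb⟩
  · obtain ⟨m, n, e⟩ := (Theta_eq_zero_iff hτ).1 h0
    have e' : ((c * a : ℚ) : ℂ) * τ + (c * b : ℚ) = m * τ + n := by rw [← e]; push_cast; ring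
    obtain ⟨ha, hb⟩ := rat_eq_of_lattice hτ e'
    exact h.2.2 ⟨int_of_mul_int h.1 ⟨m, ha⟩, int_of_mul_int h.2.1 ⟨n, hb⟩⟩

theorem isOpen_im_pos : IsOpen {z : ℂ | 0 < z.im} := isOpen_lt continuous_const continuous_im

theorem differentiableOn_thetaC (h : KSPoint c a b) :
    DifferentiableOn ℂ (fun τ => thetaC c (a * τ + b) τ) {z | 0 < z.im} := by
  refine DifferentiableOn.mul (DifferentiableOn.const_mul (DifferentiableOn.pow
    (differentiableOn_Theta isOpen_im_pos (by fun_prop) differentiableOn_id fun z hz => hz) _) _)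
    (DifferentiableOn.inv (differentiableOn_Theta isOpen_im_pos (by fun_prop) differentiableOn_id
      fun z hz => hz) fun z hz h0 => ?_)
  have := thetaC_ne_zero h hz
  rw [thetaC, h0, inv_zero, mul_zero] at this
  exact this rfl

open Classical in
/-- The Kato-Siegel unit of a rational point; `0` where it is not defined. -/
def ksUnit (c : ℕ) (a b : ℚ) : HolUnits :=
  if h : KSPoint c a b then holUnit (fun τ => thetaC c (a * τ + b) τ) (differentiableOn_thetaC h)
    fun _ hz => thetaC_ne_zero h hz
  else 0

theorem ksUnit_fn (h : KSPoint c a b) (τ : ℍ) : (ksUnit c a b).fn.1 τ = thetaC c (a * τ + b) τ := by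
  rw [ksUnit, dif_pos h, holUnit_fn]

theorem ksUnit_of_not (h : ¬ KSPoint c a b) : ksUnit c a b = 0 := dif_neg h

theorem exists_int_add_int {i : ℤ} : (∃ z : ℤ, a + i = z) ↔ ∃ z : ℤ, a = z :=
  ⟨fun ⟨z, h⟩ => ⟨z - i, by push_cast; linarith⟩, fun ⟨z, h⟩ => ⟨z + i, by push_cast; rw [h]⟩⟩

theorem KSPoint_add_int {i j : ℤ} : KSPoint c (a + i) (b + j) ↔ KSPoint c a b := by
  have e : ∀ {a : ℚ} {i : ℤ}, a + i ∈ ZS (primesOf c) ↔ a ∈ ZS (primesOf c) := fun {a i} =>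
    ⟨fun h => by simpa using sub_mem h (intCast_mem (ZS (primesOf c)) i),
      fun h => add_mem h (intCast_mem _ i)⟩
  rw [KSPoint, KSPoint, e, e, exists_int_add_int, exists_int_add_int]

theorem normCompatible_ksUnit (hc6 : c.Coprime 6) :
    NormCompatible (coprimeLevels c) (ksUnit c) where
  periodic a b i j := by
    by_cases h : KSPoint c a b
    · refine HolUnits.ext fun τ => ?_
      rw [ksUnit_fn h, ksUnit_fn (KSPoint_add_int.2 h)]
      have e : ((a + i : ℚ) : ℂ) * τ + (b + j : ℚ) = a * τ + b + j + i * τ := by push_cast; ring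
      rw [e, thetaC_add_int_mul hc6 _ _ τ.im_pos, thetaC_add_int hc6 _ _ τ.im_pos]
    · rw [ksUnit_of_not h, ksUnit_of_not (mt KSPoint_add_int.1 h)]
  norm k hk d hd a b ha hb hab := by
    have hk0 : (k : ℚ) ≠ 0 := mod_cast hk.1.ne'
    have hkc := (mem_coprimeLevels.1 hk).2.symm
    have ha' := mem_ZS_of_mul hd ha
    have hb' := mem_ZS_of_mul hd hb
    have hdiv : ∀ {x : ℚ} {i : ℕ}, x ∈ ZS (primesOf c) → (x + i) / k ∈ ZS (primesOf c) :=
      fun hx => mul_mem (add_mem hx (natCast_mem _ _))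
        (inv_natCast_mem_ZS hk.1 fun ℓ hℓ h => hk.2 ℓ ℓ.2 h hℓ)
    have hint : ∀ {x : ℚ} {i : ℕ}, (∃ z : ℤ, (x + i) / k = z) → ∃ z : ℤ, x = z :=
      fun {x i} ⟨z, hz⟩ => ⟨k * z - i, by
        rw [div_eq_iff hk0] at hz; push_cast; linear_combination hz⟩
    have hpt : ∀ i j : ℕ, KSPoint c ((a + i) / k) ((b + j) / k) := fun i j =>
      ⟨hdiv ha', hdiv hb', fun h => hab ⟨hint h.1, hint h.2⟩⟩
    refine HolUnits.ext fun τ => ?_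
    rw [HolUnits.fn_sum, ksUnit_fn ⟨ha', hb', hab⟩]; have hk0' : (k : ℂ) ≠ 0 := mod_cast hk.1.ne'
    have e1 : ∀ i : ℕ, (∑ j ∈ range k, ksUnit c ((a + i) / k) ((b + j) / k)).fn.1 τ =
        thetaC c (a * τ + b + i * τ) (k * τ) := fun i => by
      rw [HolUnits.fn_sum]
      have := prod_thetaC_add_div hc6 (((a + i) / k * τ + b / k : ℂ)) τ.im_pos hk.1 hkc
      have e : (k : ℂ) * ((a + i) / k * τ + b / k) = a * τ + b + i * τ := by field_simp; ring
      rw [e] at this; rw [← this]; refine prod_congr rfl fun j _ => ?_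
      rw [ksUnit_fn (hpt i j)]; congr 1; push_cast; ring
    simp only [e1]; exact prod_thetaC_add_mul hc6 _ τ.im_pos hk.1 hkc

/-- The Kato-Siegel distribution. -/
def katoSiegel (hc6 : c.Coprime 6) : Dist (integral (primesOf c)) HolUnits :=
  (levelSystem_adele c).distOf (normCompatible_ksUnit hc6)

theorem LevelSystem.int_of_zero_mem_cell (hL : LevelSystem O L) (hm : m ∈ L) (hd : d ∈ L)
    (ha : ∃ z : ℤ, (d : ℚ) * a = z) (hb : ∃ z : ℤ, (d : ℚ) * b = z)
    (h0 : (0 : Fin 2 → R) ∈ cell O m a b) : (∃ z : ℤ, a / m = z) ∧ ∃ z : ℤ, b / m = z := by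
  have key : ∀ x : ℚ, (∃ z : ℤ, (d : ℚ) * x = z) → (∃ w ∈ O, (0 : R) = algebraMap ℚ R x + m * w) →
      ∃ z : ℤ, x / m = z := by
    rintro x ⟨z, hz⟩ ⟨w, hw, e⟩; have h1 := congrArg (algebraMap ℚ R) hz
    rw [map_mul, map_natCast, map_intCast] at h1
    obtain ⟨t, rfl⟩ := hL.sep (hL.mul_mem hd hm) z (-w) (neg_mem hw)
      (by rw [← h1]; push_cast; linear_combination -(d : R) * e)
    have hm0 : (m : ℚ) ≠ 0 := mod_cast (hL.pos hm).ne'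
    have hd0 : (d : ℚ) ≠ 0 := mod_cast (hL.pos hd).ne'
    refine ⟨t, ?_⟩
    rw [div_eq_iff hm0]; refine mul_left_cancel₀ hd0 ?_; rw [hz]; push_cast; ring
  exact ⟨key a ha h0.1, key b hb h0.2⟩

theorem exists_common_den (ha : a ∈ ZS (primesOf c)) (hb : b ∈ ZS (primesOf c)) :
    ∃ d ∈ coprimeLevels c, (∃ z : ℤ, (d : ℚ) * a = z) ∧ ∃ z : ℤ, (d : ℚ) * b = z := by
  refine ⟨a.den * b.den, (levelSystem_adele c).mul_mem (den_mem_coprimeLevels ha)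
    (den_mem_coprimeLevels hb), ⟨b.den * a.num, ?_⟩, ⟨a.den * b.num, ?_⟩⟩
  · push_cast; rw [← den_mul_eq_num a]; ring
  · push_cast; rw [← den_mul_eq_num b]; ring

theorem katoSiegel_cellFn (hc6 : c.Coprime 6) (hm : m ∈ coprimeLevels c)
    (ha : a ∈ ZS (primesOf c)) (hb : b ∈ ZS (primesOf c)) :
    katoSiegel hc6 (cellFn (integral (primesOf c)) m a b) = ksUnit c (a / m) (b / m) := by
  obtain ⟨d, hd, had, hbd⟩ := exists_common_den ha hb
  by_cases h0 : (0 : Fin 2 → Adele (primesOf c)) ∈ cell (integral (primesOf c)) m a b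
  · rw [cellFn_eq_zero _ _ _ h0, map_zero, ksUnit_of_not]
    exact fun h => h.2.2 ((levelSystem_adele c).int_of_zero_mem_cell hm hd had hbd h0)
  · exact (levelSystem_adele c).distOf_cellFn _ hm hd had hbd h0

theorem div_mem_ZS (hm : m ∈ coprimeLevels c) (hx : x ∈ ZS (primesOf c)) : x / m ∈ ZS (primesOf c) :=
  mul_mem hx (inv_natCast_mem_ZS hm.1 fun ℓ hℓ h => hm.2 ℓ ℓ.2 h hℓ)

theorem ksUnit_S (hc6 : c.Coprime 6) (a b : ℚ) :
    ofSL ModularGroup.S • ksUnit c b (-a) = ksUnit c a b := by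
  have hpt : KSPoint c b (-a) ↔ KSPoint c a b := by
    have e : (∃ z : ℤ, -a = z) ↔ ∃ z : ℤ, a = z :=
      ⟨fun ⟨z, h⟩ => ⟨-z, by push_cast; rw [← h, neg_neg]⟩, fun ⟨z, h⟩ => ⟨-z, by push_cast; rw [h]⟩⟩
    rw [KSPoint, KSPoint, neg_mem_iff, e]
    tauto
  by_cases h : KSPoint c a b
  · refine HolUnits.ext fun τ => ?_
    rw [HolUnits.fn_smul, ksUnit_fn (hpt.2 h), ksUnit_fn h, ← map_inv, coe_toReal_smul]
    have hτ0 : (τ : ℂ) ≠ 0 := UpperHalfPlane.ne_zero τ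
    have e : ((mat (ofSL ModularGroup.S⁻¹) 0 0 : ℚ) * (τ : ℂ) + (mat (ofSL ModularGroup.S⁻¹) 0 1 : ℚ)) /
        ((mat (ofSL ModularGroup.S⁻¹) 1 0 : ℚ) * τ + (mat (ofSL ModularGroup.S⁻¹) 1 1 : ℚ)) = -1 / τ := by
      have hS : (S⁻¹).1 = !![0, 1; -1, 0] := by
        rw [coe_inv, ModularGroup.coe_S, Matrix.adjugate_fin_two_of]; simp
      simp only [mat_ofSL, hS]; simp; field_simp
    rw [e]
    have e2 : (b : ℂ) * (-1 / τ) + ((-a : ℚ) : ℂ) = (-(a * τ + b)) / τ := by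
      push_cast; field_simp; ring
    rw [e2, thetaC_neg_inv hc6 _ τ.im_pos, thetaC_neg hc6 _ τ.im_pos]
  · rw [ksUnit_of_not h, ksUnit_of_not (mt hpt.1 h), smul_zero]

theorem ksUnit_T (hc6 : c.Coprime 6) (a b : ℚ) : ofSL T • ksUnit c a (a + b) = ksUnit c a b := by
  have hpt : KSPoint c a (a + b) ↔ KSPoint c a b := by
    refine and_congr_right fun ha => ?_
    have e1 : a + b ∈ ZS (primesOf c) ↔ b ∈ ZS (primesOf c) := by rw [add_mem_cancel_left ha]
    rw [e1]; refine and_congr_right fun hb => not_congr (and_congr_right fun ⟨z, hz⟩ => ?_)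
    rw [hz, add_comm]; exact exists_int_add_int
  by_cases h : KSPoint c a b
  · refine HolUnits.ext fun τ => ?_
    rw [HolUnits.fn_smul, ksUnit_fn (hpt.2 h), ksUnit_fn h, ← map_inv, coe_toReal_smul]
    have e : ((mat (ofSL T⁻¹) 0 0 : ℚ) * (τ : ℂ) + (mat (ofSL T⁻¹) 0 1 : ℚ)) /
        ((mat (ofSL T⁻¹) 1 0 : ℚ) * τ + (mat (ofSL T⁻¹) 1 1 : ℚ)) = τ - 1 := by
      have hT : (T⁻¹).1 = !![1, -1; 0, 1] := by
        rw [coe_inv, ModularGroup.coe_T, Matrix.adjugate_fin_two_of]; simp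
      simp only [mat_ofSL, hT]; simp; ring
    rw [e]; have h1 : 0 < ((τ : ℂ) - 1).im := by simpa using τ.im_pos
    have := thetaC_tau_add_one hc6 (a * τ + b) h1; rw [sub_add_cancel] at this; rw [this]
    congr 1; push_cast; ring
  · rw [ksUnit_of_not h, ksUnit_of_not (mt hpt.1 h), smul_zero]

theorem toReal_scalar_inv_smul (hx : x ≠ 0) (τ : ℍ) : toReal (scalar x hx)⁻¹ • τ = τ := by
  apply ext_iff.2
  rw [coe_toReal_smul, mat_scalar_inv]
  have : (x : ℂ) ≠ 0 := mod_cast hx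
  simp
  field_simp

theorem HolUnits.scalar_smul (hx : x ≠ 0) (u : HolUnits) : scalar x hx • u = u :=
  HolUnits.ext fun τ => by rw [HolUnits.fn_smul, toReal_scalar_inv_smul]

theorem Hol.scalar_smul (hx : x ≠ 0) (F : Hol) : scalar x hx • F = F :=
  Subtype.ext (funext fun τ => by rw [Hol.smul_apply, toReal_scalar_inv_smul])

theorem coe_LR_inv_smul (hk : 0 < (k : ℚ)) (τ : ℍ) : ((toReal (LR k hk)⁻¹ • τ : ℍ) : ℂ) = k * τ := by
  rw [coe_toReal_smul, mat_LR_inv]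
  have : (k : ℂ) ≠ 0 := mod_cast hk.ne'
  simp
  ring

theorem ksUnit_LR (hc6 : c.Coprime 6) (hk : k ∈ coprimeLevels c) (hk0 : 0 < (k : ℚ))
    (hab : KSPoint c a b) : LR k hk0 • ∑ i ∈ range k, ksUnit c ((a + i) / k) b = ksUnit c a b := by
  refine HolUnits.ext fun τ => ?_
  have hpt : ∀ i : ℕ, KSPoint c ((a + i) / k) b := fun i =>
    ⟨div_mem_ZS hk (add_mem hab.1 (natCast_mem _ i)), hab.2.1, fun ⟨⟨z, hz⟩, h2⟩ =>
      hab.2.2 ⟨⟨k * z - i, by rw [div_eq_iff hk0.ne'] at hz; push_cast; linear_combination hz⟩, h2⟩⟩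
  rw [HolUnits.fn_smul, HolUnits.fn_sum, ksUnit_fn hab,
    ← prod_thetaC_add_mul hc6 _ τ.im_pos hk.1 (mem_coprimeLevels.1 hk).2.symm]
  refine prod_congr rfl fun i _ => ?_
  rw [ksUnit_fn (hpt i), coe_LR_inv_smul]
  have : (k : ℂ) ≠ 0 := mod_cast hk0.ne'
  congr 1
  push_cast; field_simp; ring

theorem LevelSystem.slash_LR_cellFn (hL : LevelSystem O L) (hm : 0 < m) (hk : k ∈ L)
    (hk0 : 0 < (k : ℚ)) (h0 : (0 : Fin 2 → R) ∉ cell O m a b) :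
    slash O (LR k hk0) (cellFn O m a b) = ∑ i ∈ range k, cellFn O (m * k) (a + m * i) (k * b) := by
  have hactv : ∀ v : Fin 2 → R, actVec R (LR k hk0) v 0 = v 0 ∧
      actVec R (LR k hk0) v 1 = algebraMap ℚ R (k : ℚ)⁻¹ * v 1 := fun v => by
    rw [actVec_two, actVec_two, mat_LR_inv]; simp [mul_comm]
  have hsub : ∀ (i : ℕ) (v : Fin 2 → R), v ∈ cell O (m * k) (a + m * i) (k * b) →
      actVec R (LR k hk0) v ∈ cell O m a b := by
    rintro i v ⟨⟨w, hw, e⟩, w', hw', e'⟩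
    refine ⟨⟨i + k * w, O.add_mem (natCast_mem O i) (O.mul_mem (natCast_mem O k) hw), ?_⟩,
      ⟨w', hw', ?_⟩⟩
    · rw [(hactv v).1, e]; simp only [map_add, map_mul, map_natCast]; push_cast; ring
    · rw [(hactv v).2, algebraMap_inv_mul hk0.ne', e']
      simp only [map_mul, map_natCast]; push_cast; ring
  have h0' : ∀ i : ℕ, (0 : Fin 2 → R) ∉ cell O (m * k) (a + m * i) (k * b) := fun i h => by
    have := hsub i 0 h; rw [actVec_zero] at this; exact h0 this
  have hmk := Nat.mul_pos hm (hL.pos hk)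
  apply Subtype.ext; funext v
  have e : (∑ i ∈ range k, cellFn O (m * k) (a + m * i) (k * b)).1 v =
      ∑ i ∈ range k, (cell O (m * k) (a + m * i) (k * b)).indicator (fun _ => (1 : ℤ)) v := by
    have : ∀ s : Finset ℕ, (∑ i ∈ s, cellFn O (m * k) (a + m * i) (k * b)).1 v =
        ∑ i ∈ s, (cellFn O (m * k) (a + m * i) (k * b)).1 v := fun s => by simp [Finset.sum_apply]
    rw [this]; exact sum_congr rfl fun i _ => by rw [cellFn_apply O hmk _ _ (h0' i)]
  rw [e]
  change (cellFn O m a b).1 (actVec R (LR k hk0) v) = _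
  rw [cellFn_apply O hm a b h0]
  by_cases hv : actVec R (LR k hk0) v ∈ cell O m a b
  · rw [indicator_of_mem hv]; obtain ⟨⟨w, hw, e⟩, w', hw', e'⟩ := hv; rw [(hactv v).1] at e
    rw [(hactv v).2, algebraMap_inv_mul hk0.ne'] at e'
    obtain ⟨i₀, hi₀, w₀, hw₀, rfl⟩ := hL.approx hk w hw
    have hiff : ∀ i ∈ range k, v ∈ cell O (m * k) (a + m * i) (k * b) ↔ i = i₀ := by
      intro i hi
      constructor
      · rintro ⟨⟨w₁, hw₁, e₁⟩, -⟩; rw [e] at e₁; simp only [map_add, map_mul, map_natCast] at e₁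
        refine hL.eq_of_sub_eq hk (mem_range.1 hi) hi₀ (sub_mem hw₀ hw₁) (natCast_mul_cancel hm ?_)
        push_cast at e₁ ⊢
        linear_combination -e₁
      · rintro rfl; refine ⟨⟨w₀, hw₀, ?_⟩, w', hw', ?_⟩
        · rw [e]; simp only [map_add, map_mul, map_natCast]; push_cast; ring
        · rw [e']; simp only [map_mul, map_natCast]; push_cast; ring
    rw [sum_eq_single_of_mem i₀ (mem_range.2 hi₀) fun i hi hne =>
      indicator_of_notMem (fun h => hne ((hiff i hi).1 h)) _,
      indicator_of_mem ((hiff i₀ (mem_range.2 hi₀)).2 rfl)]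
  · rw [indicator_of_notMem hv]
    exact (sum_eq_zero fun i _ => indicator_of_notMem (fun h => hv (hsub i v h)) _).symm

theorem Dist.smul_apply {A : Type}
    [AddCommGroup A] [DistribMulAction GQ A] (γ : GQ) (μ : Dist O A) (f : TestFn O) :
    (γ • μ) f = γ • μ (slash O γ f) := rfl

theorem slash_ofSL_cellFn (O : Subring R) (hm : 0 < m) (a b : ℚ) (σ : SL(2, ℤ)) :
    slash O (ofSL σ) (cellFn O m a b) =
      cellFn O m (a * σ.1 0 0 + b * σ.1 1 0) (a * σ.1 0 1 + b * σ.1 1 1) := by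
  refine slash_cellFn hm a b fun i j => ⟨?_, ?_⟩
  · rw [mat_ofSL, map_intCast]; exact intCast_mem O _
  · rw [← map_inv, mat_ofSL, map_intCast]; exact intCast_mem O _

theorem katoSiegel_invariant (hc6 : c.Coprime 6) :
    ∀ γ ∈ GS (primesOf c), γ • katoSiegel hc6 = katoSiegel hc6 := by
  have hnat : ∀ i : ℕ, (i : ℚ) ∈ ZS (primesOf c) := fun i => natCast_mem _ i
  have key : GS (primesOf c) ≤ MulAction.stabilizer GQ (katoSiegel hc6) := by
    refine GS_le_of_generators ?_ ?_ (fun k hk hk0 => ?_) (fun k hk hk0 => ?_) <;>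
      rw [MulAction.mem_stabilizer_iff] <;>
      refine (levelSystem_adele c).dist_ext fun m hm i j => ?_ <;>
      have hi := div_mem_ZS hm (hnat i) <;> have hj := div_mem_ZS hm (hnat j) <;>
      rw [Dist.smul_apply, katoSiegel_cellFn hc6 hm hi hj]
    · rw [slash_ofSL_cellFn _ hm.1]
      have e0 : ((i : ℚ) / m) * (S.1 0 0 : ℤ) + ((j : ℚ) / m) * (S.1 1 0 : ℤ) =
        (j : ℚ) / m := by simp [S]
      have e1 : ((i : ℚ) / m) * (S.1 0 1 : ℤ) + ((j : ℚ) / m) * (S.1 1 1 : ℤ) =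
        -((i : ℚ) / m) := by simp [S]
      rw [e0, e1, katoSiegel_cellFn hc6 hm hj (neg_mem hi), neg_div]; exact ksUnit_S hc6 _ _
    · rw [slash_ofSL_cellFn _ hm.1]
      have e0 : ((i : ℚ) / m) * (T.1 0 0 : ℤ) + ((j : ℚ) / m) * (T.1 1 0 : ℤ) =
        (i : ℚ) / m := by simp [T]
      have e1 : ((i : ℚ) / m) * (T.1 0 1 : ℤ) + ((j : ℚ) / m) * (T.1 1 1 : ℤ) =
        (i : ℚ) / m + (j : ℚ) / m := by simp [T]
      rw [e0, e1, katoSiegel_cellFn hc6 hm hi (add_mem hi hj), add_div]; exact ksUnit_T hc6 _ _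
    · by_cases h0 : (0 : Fin 2 → Adele (primesOf c)) ∈
        cell (integral (primesOf c)) m ((i : ℚ) / m) ((j : ℚ) / m)
      · obtain ⟨d, hd, had, hbd⟩ := exists_common_den hi hj
        rw [cellFn_eq_zero _ _ _ h0, map_zero, map_zero, smul_zero, ksUnit_of_not]
        exact fun h => h.2.2 ((levelSystem_adele c).int_of_zero_mem_cell hm hd had hbd h0)
      · have hpt : KSPoint c ((i : ℚ) / m / m) ((j : ℚ) / m / m) :=
          ⟨div_mem_ZS hm hi, div_mem_ZS hm hj, fun h => h0 (zero_mem_cell_of_int hm.1 h)⟩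
        rw [(levelSystem_adele c).slash_LR_cellFn hm.1 hk hk0 h0, map_sum,
          ← ksUnit_LR hc6 hk hk0 hpt]
        congr 1
        refine sum_congr rfl fun r _ => ?_
        rw [katoSiegel_cellFn hc6 ((levelSystem_adele c).mul_mem hm hk)
          (add_mem hi (mul_mem (hnat m) (hnat r))) (mul_mem (hnat k) hj)]
        have hm0 : (m : ℚ) ≠ 0 := mod_cast hm.1.ne'
        have hk0' := hk0.ne'
        congr 1
        · push_cast; field_simp
        · push_cast; field_simp
    · have hm0 : (m : ℚ) ≠ 0 := mod_cast hm.1.ne'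
      rw [slash_scalar_cellFn _ hm.1 hk0, HolUnits.scalar_smul,
        katoSiegel_cellFn hc6 ((levelSystem_adele c).mul_mem hk hm) (mul_mem (hnat k) hi)
          (mul_mem (hnat k) hj)]
      congr 1
      · push_cast; field_simp
      · push_cast; field_simp
  exact fun γ hγ => MulAction.mem_stabilizer_iff.1 (key hγ)

theorem coset_eq_cell (S : Set Primes) (a b : ℚ) : coset S a b = cell (integral S) 1 a b := by
  have e : ∀ (x y : Adele S), x - y ∈ integral S ↔ ∃ w ∈ integral S, x = y + ((1 : ℕ) : Adele S) * w :=
    fun x y => ⟨fun h => ⟨_, h, by rw [Nat.cast_one, one_mul]; ring⟩, by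
      rintro ⟨w, hw, rfl⟩
      rwa [Nat.cast_one, one_mul, add_sub_cancel_left]⟩
  ext v
  simp only [coset, cell, mem_ofPred_eq, e]

theorem den_eq_one_iff_exists : a.den = 1 ↔ ∃ z : ℤ, a = z :=
  ⟨fun h => ⟨a.num, ((Rat.den_eq_one_iff a).1 h).symm⟩, by rintro ⟨z, rfl⟩; simp⟩

theorem isKatoSiegel_katoSiegel (hc6 : c.Coprime 6) : IsKatoSiegel c (katoSiegel hc6) := by
  refine ⟨katoSiegel_invariant hc6, fun a ha b hb hab τ => ?_⟩
  rw [coset_eq_cell, mass_cell, katoSiegel_cellFn hc6 (levelSystem_adele c).one_mem ha hb,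
    Nat.cast_one, div_one, div_one, katoSiegelUnit_eq]
  refine ksUnit_fn ⟨ha, hb, ?_⟩ τ
  rwa [den_eq_one_iff_exists, den_eq_one_iff_exists] at hab

theorem inv_natCast_scalar_mem_GS (hm : m ∈ coprimeLevels c) (hm0 : (m : ℚ) ≠ 0) :
    scalar m hm0 ∈ GS (primesOf c) := by
  have h := inv_natCast_mem_ZS (S := primesOf c) hm.1 fun ℓ hℓ h => hm.2 ℓ ℓ.2 h hℓ
  intro i j
  rw [mat_scalar_inv, mat_scalar]
  fin_cases i <;> fin_cases j <;> simp [h]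

theorem IsKatoSiegel.eq (hc6 : c.Coprime 6) {κ : Dist (integral (primesOf c)) HolUnits}
    (h : IsKatoSiegel c κ) : κ = katoSiegel hc6 := by
  refine (levelSystem_adele c).dist_ext fun m hm i j => ?_
  have hnat : ∀ i : ℕ, (i : ℚ) ∈ ZS (primesOf c) := fun i => natCast_mem _ i
  have hi := div_mem_ZS hm (hnat i)
  have hj := div_mem_ZS hm (hnat j)
  have hm0 : (m : ℚ) ≠ 0 := mod_cast hm.1.ne'
  rw [katoSiegel_cellFn hc6 hm hi hj]
  have e : slash (integral (primesOf c)) (scalar m hm0) (cellFn (integral (primesOf c)) 1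
      ((i : ℚ) / m / m) ((j : ℚ) / m / m)) =
      cellFn (integral (primesOf c)) m ((i : ℚ) / m) ((j : ℚ) / m) := by
    rw [slash_scalar_cellFn _ one_pos, mul_one, mul_div_cancel₀ _ hm0, mul_div_cancel₀ _ hm0]
  have e2 := congrArg (fun μ : Dist (integral (primesOf c)) HolUnits => μ (cellFn _ 1
      ((i : ℚ) / m / m) ((j : ℚ) / m / m))) (h.1 _ (inv_natCast_scalar_mem_GS hm hm0))
  simp only [Dist.smul_apply, e, HolUnits.scalar_smul] at e2
  rw [e2, ← mass_cell, ← coset_eq_cell]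
  have hi' := div_mem_ZS hm hi
  have hj' := div_mem_ZS hm hj
  by_cases hpt : KSPoint c ((i : ℚ) / m / m) ((j : ℚ) / m / m)
  · refine HolUnits.ext fun τ => ?_
    rw [h.2 _ hi' _ hj' (by rw [den_eq_one_iff_exists, den_eq_one_iff_exists]; exact hpt.2.2),
      ksUnit_fn hpt, katoSiegelUnit_eq]
  · have hint := not_not.1 fun hne => hpt ⟨hi', hj', hne⟩
    rw [ksUnit_of_not hpt, coset_eq_cell, mass_cell, cellFn_eq_zero, map_zero]
    exact zero_mem_cell_of_int one_pos (by rwa [Nat.cast_one, div_one, div_one])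

/-! The connecting homomorphism -/

section Connecting

variable {A B C : Type} [AddCommGroup A] [DistribMulAction GQ A] [AddCommGroup B]
  [DistribMulAction GQ B] [AddCommGroup C] [DistribMulAction GQ C] {ι : A →+ B}
  {q : B →+ C}

theorem exists_cocycle_of_lift (hι : Injective ι) (hιγ : ∀ (γ : GQ) x, ι (γ • x) = γ • ι x)
    (hex : ∀ y, q y = 0 → ∃ x, ι x = y) (hqγ : ∀ (γ : GQ) y, q (γ • y) = γ • q y) {x : C}
    (hx : ∀ γ ∈ H, γ • x = x) {e : B} (he : q e = x) :
    ∃ z : Z1 H A, ∀ g₀ g₁ : H, ι (z.1 g₀ g₁) = (g₁ : GQ) • e - (g₀ : GQ) • e := by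
  have h : ∀ g₀ g₁ : H, ∃ a, ι a = (g₁ : GQ) • e - (g₀ : GQ) • e := fun g₀ g₁ => hex _ (by
    rw [map_sub, hqγ, hqγ, he, hx _ g₀.2, hx _ g₁.2, sub_self])
  choose z hz using h
  refine ⟨⟨z, fun h g₀ g₁ => hι ?_, fun g₀ g₁ g₂ => hι ?_⟩, hz⟩
  · rw [hιγ, hz, hz, smul_sub, ← mul_smul, ← mul_smul]; rfl
  · rw [map_add, map_sub, hz, hz, hz, map_zero]; abel

theorem cls_eq_of_potential (hι : Injective ι) (hιγ : ∀ (γ : GQ) x, ι (γ • x) = γ • ι x) {z z' : Z1 H A} {e e' : B} {a : A}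
    (he : e' = e + ι a) (hz : ∀ g₀ g₁ : H, ι (z.1 g₀ g₁) = (g₁ : GQ) • e - (g₀ : GQ) • e)
    (hz' : ∀ g₀ g₁ : H, ι (z'.1 g₀ g₁) = (g₁ : GQ) • e' - (g₀ : GQ) • e') : cls z = cls z' := by
  refine QuotientAddGroup.eq.2 ⟨fun g => (g : GQ) • a, fun h g => mul_smul _ _ _, fun g₀ g₁ => hι ?_⟩
  change ι (-(z.1 g₀ g₁) + z'.1 g₀ g₁) = _
  rw [map_add, map_neg, hz, hz', map_sub, hιγ, hιγ, he, smul_add, smul_add]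
  abel

theorem existsUnique_isConnecting (hι : Injective ι) (hιγ : ∀ (γ : GQ) x, ι (γ • x) = γ • ι x)
    (hex : ∀ y, q y = 0 → ∃ x, ι x = y) (hq : Surjective q)
    (hqγ : ∀ (γ : GQ) y, q (γ • y) = γ • q y) {x : C} (hx : ∀ γ ∈ H, γ • x = x) :
    ∃! ξ, IsConnecting H ι q x ξ := by
  obtain ⟨e, he⟩ := hq x
  obtain ⟨z, hz⟩ := exists_cocycle_of_lift hι hιγ hex hqγ hx he
  refine ⟨cls z, ⟨e, he, z, hz, rfl⟩, ?_⟩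
  rintro _ ⟨e', he', z', hz', rfl⟩
  obtain ⟨a, ha⟩ := hex (e - e') (by rw [map_sub, he, he', sub_self])
  exact cls_eq_of_potential hι hιγ (by rw [ha, add_sub_cancel]) hz' hz

end Connecting

theorem exists_mapValues_constHom
    {μ : Dist O Hol} (h : Dist.mapValues _ expHom μ = 0) : ∃ ν, Dist.mapValues _ constHom ν = μ := by
  have h' : ∀ f, ∃ n, μ f = constHom n := fun f =>
    expHom_eq_zero (congrArg (fun ρ : Dist O HolUnits => ρ f) h)
  choose ν hν using h'
  refine ⟨(AddMonoidHom.mk' ν fun f g => constHom_injective ?_ : TestFn O →+ ℤ),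
    DFunLike.ext _ _ fun f => (hν f).symm⟩
  rw [map_add, ← hν, ← hν, ← hν, map_add]

theorem mapValues_constHom_injective : Injective (Dist.mapValues O constHom) := fun _ _ h =>
  DFunLike.ext _ _ fun f => constHom_injective (congrArg (fun ρ : Dist O Hol => ρ f) h)

theorem mapValues_constHom_smul (γ : GQ) (μ : Dist O ℤ) :
    Dist.mapValues O constHom (γ • μ) = γ • Dist.mapValues O constHom μ :=
  DFunLike.ext _ _ fun _ => constHom_smul γ _

theorem existsUnique_isConnecting_exp (hL : LevelSystem O L) {κ : Dist O HolUnits}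
    (hκ : ∀ γ ∈ H, γ • κ = κ) :
    ∃! ξ, IsConnecting H (Dist.mapValues O constHom) (Dist.mapValues O expHom) κ ξ := by
  refine existsUnique_isConnecting mapValues_constHom_injective mapValues_constHom_smul
    (fun μ => exists_mapValues_constHom) (fun κ => ?_)
    (fun γ μ => DFunLike.ext _ _ fun f => expHom_smul γ _) hκ
  obtain ⟨e, he⟩ := hL.exists_lift expHom expHom_surjective κ
  exact ⟨e, DFunLike.ext _ _ he⟩

theorem existsUnique_dedekindRademacherClass (hc6 : c.Coprime 6) :
    ∃! ξ, IsDedekindRademacherClass c ξ := by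
  obtain ⟨ξ, hξ, huniq⟩ := existsUnique_isConnecting_exp (levelSystem_adele c)
    (katoSiegel_invariant hc6)
  refine ⟨ξ, ⟨_, isKatoSiegel_katoSiegel hc6, hξ⟩, ?_⟩
  rintro ξ' ⟨κ, hκ, hξ'⟩
  rw [hκ.eq hc6] at hξ'
  exact huniq ξ' hξ'

/-! The transformation law of `Θ ^ 12` under `SL₂(ℤ)` -/

/-- The automorphy factor `cτ + d`. -/
def autFactor (σ : SL(2, ℤ)) (τ : ℂ) : ℂ := (σ.1 1 0 : ℂ) * τ + (σ.1 1 1 : ℂ)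

theorem autFactor_ne_zero (σ : SL(2, ℤ)) (τ : ℍ) : autFactor σ τ ≠ 0 := by
  have := UpperHalfPlane.denom_ne_zero (σ : GL (Fin 2) ℝ) τ
  rwa [ModularGroup.denom_apply] at this

theorem coe_SL_smul (σ : SL(2, ℤ)) (τ : ℍ) :
    ((σ • τ : ℍ) : ℂ) = ((σ.1 0 0 : ℂ) * τ + (σ.1 0 1 : ℂ)) / autFactor σ τ := by
  rw [UpperHalfPlane.specialLinearGroup_apply, autFactor]
  simp

theorem autFactor_mul (σ σ' : SL(2, ℤ)) (τ : ℍ) : autFactor (σ * σ') τ =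
    autFactor σ ((σ' • τ : ℍ) : ℂ) * autFactor σ' τ := by
  have h := autFactor_ne_zero σ' τ
  rw [autFactor, coe_SL_smul, autFactor, coe_mul, Matrix.mul_apply,
    Matrix.mul_apply, Fin.sum_univ_two, Fin.sum_univ_two]
  field_simp
  rw [autFactor]
  push_cast
  ring

/-- The transformation law of `Θ ^ 12` under `σ`. -/
def ThetaLaw (σ : SL(2, ℤ)) : Prop := ∀ (u : ℂ) (τ : ℍ),
  Theta (u / autFactor σ τ) ((σ • τ : ℍ) : ℂ) ^ 12 =
    ex (6 * (σ.1 1 0 : ℂ) * u ^ 2 / autFactor σ τ) * Theta u τ ^ 12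

theorem ThetaLaw.mul {σ σ' : SL(2, ℤ)} (h : ThetaLaw σ) (h' : ThetaLaw σ') : ThetaLaw (σ * σ') := by
  intro u τ
  have e := autFactor_mul σ σ' τ
  have h0 := autFactor_ne_zero (σ * σ') τ
  have h1 := autFactor_ne_zero σ (σ' • τ)
  have h2 := autFactor_ne_zero σ' τ
  have e10 : ((σ * σ').1 1 0 : ℤ) = σ.1 1 0 * σ'.1 0 0 + σ.1 1 1 * σ'.1 1 0 := by
    rw [coe_mul, Matrix.mul_apply, Fin.sum_univ_two]
  have e11 : ((σ * σ').1 1 1 : ℤ) = σ.1 1 0 * σ'.1 0 1 + σ.1 1 1 * σ'.1 1 1 := by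
    rw [coe_mul, Matrix.mul_apply, Fin.sum_univ_two]
  have hdet : (σ'.1 0 0 : ℂ) * σ'.1 1 1 - σ'.1 0 1 * σ'.1 1 0 = 1 := by
    have := σ'.2; rw [det_fin_two] at this; exact_mod_cast this
  have key : (σ.1 1 0 : ℂ) + σ'.1 1 0 * autFactor (σ * σ') τ =
      ((σ * σ').1 1 0 : ℤ) * autFactor σ' τ := by
    rw [autFactor, autFactor, e10, e11]; push_cast
    linear_combination -(σ.1 1 0 : ℂ) * hdet
  have a1 := h (u / autFactor σ' τ) (σ' • τ)
  rw [h' u τ, div_div, mul_comm (autFactor σ' τ), ← e, ← mul_smul, ← mul_assoc, ← ex_add] at a1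
  rw [a1]
  congr 2
  rw [e] at key ⊢
  field_simp
  linear_combination u ^ 2 * key

theorem ThetaLaw.inv {σ : SL(2, ℤ)} (h : ThetaLaw σ) : ThetaLaw σ⁻¹ := by
  intro u τ
  have e := autFactor_mul σ σ⁻¹ τ
  rw [mul_inv_cancel] at e
  have e1 : autFactor 1 (τ : ℂ) = 1 := by rw [autFactor]; simp
  rw [e1] at e
  have h1 := autFactor_ne_zero σ (σ⁻¹ • τ)
  have h2 := autFactor_ne_zero σ⁻¹ τ
  have a1 := h (u / autFactor σ⁻¹ τ) (σ⁻¹ • τ)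
  rw [smul_inv_smul, div_div, mul_comm (autFactor σ⁻¹ τ), ← e, div_one] at a1
  have e10 : (σ⁻¹.1 1 0 : ℤ) = -σ.1 1 0 := by rw [coe_inv, Matrix.adjugate_fin_two]; rfl
  rw [a1, ← mul_assoc, ← ex_add, e10]
  have e2 : (6 * ((-σ.1 1 0 : ℤ) : ℂ) * u ^ 2 / autFactor σ⁻¹ τ +
      6 * (σ.1 1 0 : ℂ) * (u / autFactor σ⁻¹ τ) ^ 2 / autFactor σ ((σ⁻¹ • τ : ℍ) : ℂ)) = 0 := by
    have e3 : autFactor σ ((σ⁻¹ • τ : ℍ) : ℂ) = (autFactor σ⁻¹ τ)⁻¹ :=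
      eq_inv_of_mul_eq_one_left e.symm
    rw [e3]; push_cast; field_simp; ring
  rw [e2, ex_zero, one_mul]

theorem thetaLaw (σ : SL(2, ℤ)) : ThetaLaw σ := by
  have hone : ThetaLaw 1 := fun u τ => by
    have e1 : autFactor 1 (τ : ℂ) = 1 := by rw [autFactor]; simp
    rw [e1, one_smul, div_one, coe_one]; simp [ex_zero]
  let K : Subgroup SL(2, ℤ) :=
    { carrier := {σ | ThetaLaw σ}, mul_mem' := ThetaLaw.mul, one_mem' := hone,
      inv_mem' := ThetaLaw.inv }
  have hS : ThetaLaw S := fun u τ => by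
    obtain ⟨C, hC, h⟩ := Theta_neg_inv τ.im_pos
    have e1 : autFactor S τ = τ := by rw [autFactor]; simp [S]
    have e2 : ((S • τ : ℍ) : ℂ) = -1 / τ := by rw [UpperHalfPlane.modular_S_smul]; simp [neg_div]
    have e3 : (S.1 1 0 : ℤ) = 1 := by simp [S]
    rw [e1, e2, h u, mul_pow, mul_pow, hC, one_mul, ← ex_nat_mul, e3]; congr 2; push_cast; ring
  have hT : ThetaLaw T := fun u τ => by
    have e1 : autFactor T τ = 1 := by rw [autFactor]; simp [T]
    have e2 : ((T • τ : ℍ) : ℂ) = τ + 1 := by rw [UpperHalfPlane.modular_T_smul]; simp [add_comm]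
    have e3 : (T.1 1 0 : ℤ) = 0 := by simp [T]
    rw [e1, e2, div_one, Theta_tau_add_one u τ.im_pos, mul_pow, ← ex_nat_mul, e3]
    have e4 : (((12 : ℕ) : ℂ) * (1 / 12)) = 1 := by norm_num
    rw [e4, ex_one]; simp [ex_zero]
  have h : Subgroup.closure {S, T} ≤ K := by
    rw [Subgroup.closure_le]; rintro x (rfl | rfl)
    · exact hS
    · exact hT
  rw [_root_.SpecialLinearGroup.SL2Z_generators] at h
  exact h (mem_top σ)

/-! The Siegel units attached to `δ` -/

theorem prod_ex_mul_zpow (hn : IsBal(n, N)) (z : ℂ) (g : ℕ → ℂ) :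
    ∏ D ∈ N.divisors, (ex (D * z) * g D) ^ n D = ∏ D ∈ N.divisors, g D ^ n D := by
  simp only [mul_zpow]
  rw [prod_mul_distrib]
  have e : ∀ D : ℕ, ex (D * z) ^ n D = ex (((n D * (D : ℤ) : ℤ) : ℂ) * z) := fun D => by
    rw [ex, ex, ← Complex.exp_int_mul]; congr 1; push_cast; ring
  simp only [e]
  have : ∀ s : Finset ℕ, ∏ D ∈ s, ex (((n D * (D : ℤ) : ℤ) : ℂ) * z) =
      ex (((∑ D ∈ s, n D * (D : ℤ) : ℤ) : ℂ) * z) := fun s => by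
    induction s using Finset.cons_induction with
    | empty => simp [ex_zero]
    | cons a s ha ih => rw [Finset.prod_cons, ih, Finset.sum_cons, ← ex_add]; push_cast; ring_nf
  rw [this, hn, Int.cast_zero, zero_mul, ex_zero, one_mul]

/-- `∏_{D ∣ N} Θ(D (aτ + b), Dτ)^{12 n_D}`. -/
def siegelFn (N : ℕ) (n : ℕ → ℤ) (a b : ℚ) (τ : ℂ) : ℂ :=
  ∏ D ∈ N.divisors, (Theta (D * (a * τ + b)) (D * τ) ^ 12) ^ n D

/-- The points at which `siegelFn` has no zeros and poles. -/
def SiegelPoint (N : ℕ) (a b : ℚ) : Prop :=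
  ∀ D ∈ N.divisors, ¬ ((∃ z : ℤ, a = z) ∧ ∃ z : ℤ, D * b = z)

theorem natCast_mul_im_pos (hD : 0 < D) (hτ : 0 < τ.im) : 0 < ((D : ℂ) * τ).im := by
  have : (D : ℂ) = ((D : ℝ) : ℂ) := by push_cast; rfl
  rw [this, im_ofReal_mul]
  have : (0 : ℝ) < D := mod_cast hD
  positivity

theorem Theta_ne_zero_of_siegelPoint (h : SiegelPoint N a b) (hτ : 0 < τ.im) (hD : D ∈ N.divisors) :
    Theta (D * (a * τ + b)) (D * τ) ≠ 0 := by
  have hD0 := pos_of_mem_divisors hD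
  intro h0
  obtain ⟨x, y, e⟩ := (Theta_eq_zero_iff (natCast_mul_im_pos hD0 hτ)).1 h0
  have hDq : (D : ℚ) ≠ 0 := mod_cast hD0.ne'
  have e' : ((D * a : ℚ) : ℂ) * τ + (D * b : ℚ) = ((x * D : ℤ) : ℂ) * τ + y := by
    push_cast
    linear_combination e
  obtain ⟨ha, hb⟩ := rat_eq_of_lattice hτ e'
  refine h D hD ⟨⟨x, mul_left_cancel₀ hDq ?_⟩, y, hb⟩
  rw [ha]; push_cast; ring

theorem siegelFn_ne_zero (n : ℕ → ℤ) (h : SiegelPoint N a b) (hτ : 0 < τ.im) :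
    siegelFn N n a b τ ≠ 0 :=
  Finset.prod_ne_zero_iff.2 fun _ hD =>
    zpow_ne_zero _ (pow_ne_zero _ (Theta_ne_zero_of_siegelPoint h hτ hD))

theorem differentiableOn_siegelFn (n : ℕ → ℤ) (h : SiegelPoint N a b) :
    DifferentiableOn ℂ (siegelFn N n a b) {z | 0 < z.im} := by
  unfold siegelFn
  refine DifferentiableOn.fun_finsetProd fun D hD => ?_
  intro z hz
  refine DifferentiableWithinAt.zpow ?_ (Or.inl (pow_ne_zero _ (Theta_ne_zero_of_siegelPoint h hz hD)))
  exact (DifferentiableOn.pow (differentiableOn_Theta isOpen_im_pos (by fun_prop) (by fun_prop)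
    fun z hz => natCast_mul_im_pos (pos_of_mem_divisors hD) hz) 12) z hz

open Classical in
/-- The Siegel unit of a rational point attached to `δ`; `0` where it is not defined. -/
def siegelUnit (N : ℕ) (n : ℕ → ℤ) (a b : ℚ) : HolUnits :=
  if h : SiegelPoint N a b then holUnit (siegelFn N n a b) (differentiableOn_siegelFn n h)
    fun _ hz => siegelFn_ne_zero n h hz
  else 0

theorem siegelUnit_fn (n : ℕ → ℤ) (h : SiegelPoint N a b) (τ : ℍ) :
    (siegelUnit N n a b).fn.1 τ = siegelFn N n a b τ := by
  rw [siegelUnit, dif_pos h, holUnit_fn]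

theorem siegelUnit_of_not (n : ℕ → ℤ) (h : ¬ SiegelPoint N a b) : siegelUnit N n a b = 0 := dif_neg h

theorem siegelPoint_add_int {i j : ℤ} : SiegelPoint N (a + i) (b + j) ↔ SiegelPoint N a b := by
  refine forall₂_congr fun D _ => ?_
  have : (D : ℚ) * (b + j) = D * b + ((D * j : ℤ) : ℚ) := by push_cast; ring
  rw [exists_int_add_int, this, exists_int_add_int]

theorem not_siegelPoint_of_int (hN : 0 < N) (h : (∃ z : ℤ, a = z) ∧ ∃ z : ℤ, b = z) :
    ¬ SiegelPoint N a b := fun h' =>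
  h' 1 (Nat.one_mem_divisors.2 hN.ne') (by simpa using h)

theorem siegelPoint_of_coprime (hd : d.Coprime N) (hb : ∃ z : ℤ, (d : ℚ) * b = z)
    (h : ¬ ((∃ z : ℤ, a = z) ∧ ∃ z : ℤ, b = z)) : SiegelPoint N a b := by
  rintro D hD ⟨ha, x, hx⟩
  obtain ⟨y, hy⟩ := hb
  have hc : IsCoprime (d : ℤ) D :=
    Nat.isCoprime_iff_coprime.2 (hd.coprime_dvd_right (dvd_of_mem_divisors hD))
  obtain ⟨s, t, hst⟩ := hc
  refine h ⟨ha, s * y + t * x, ?_⟩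
  have : ((s * d + t * D : ℤ) : ℚ) = 1 := by rw [hst]; simp
  push_cast at this ⊢
  rw [← hx, ← hy]
  linear_combination -b * this

theorem neg_one_zpow_pow (i : ℤ) : (((-1 : ℂ) ^ i) ^ 12) = 1 := by
  rw [← zpow_natCast, ← zpow_mul, mul_comm, zpow_mul]; norm_num

theorem Theta_pow_add_int (u : ℂ) (hτ : 0 < τ.im) (i : ℤ) : Theta (u + i) τ ^ 12 = Theta u τ ^ 12 := by
  rw [Theta_add_int u hτ, mul_pow, neg_one_zpow_pow, one_mul]

theorem siegelFn_add_int (hn : IsBal(n, N)) (a b : ℚ) (i j : ℤ) (hτ : 0 < τ.im) :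
    siegelFn N n (a + i) (b + j) τ = siegelFn N n a b τ := by
  refine Eq.trans ?_ (prod_ex_mul_zpow hn (12 * (-(i ^ 2 * τ / 2) - i * (a * τ + b))) _)
  refine prod_congr rfl fun D hD => ?_
  have hτ' := natCast_mul_im_pos (pos_of_mem_divisors hD) hτ
  have e : (D : ℂ) * (((a + i : ℚ) : ℂ) * τ + (b + j : ℚ)) =
      D * (a * τ + b) + i * (D * τ) + ((D * j : ℤ) : ℂ) := by push_cast; ring
  rw [e, Theta_pow_add_int _ hτ', Theta_add_int_mul _ hτ', mul_pow, mul_pow, ← ex_nat_mul]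
  rw [neg_one_zpow_pow, one_mul]
  have e2 : (D : ℂ) * (12 * (-((i : ℂ) ^ 2 * τ / 2) - i * (a * τ + b))) =
      ((12 : ℕ) : ℂ) * (-((i : ℂ) ^ 2 * (D * τ) / 2) - i * (D * (a * τ + b))) := by push_cast; ring
  rw [e2]

theorem prod_Theta_pow_add_div (u : ℂ) (hτ : 0 < τ.im) (hk : 0 < k) (hD : D.Coprime k) :
    ∏ j ∈ range k, Theta (u + D * (j / k)) τ ^ 12 = Theta (k * u) (k * τ) ^ 12 := by
  have hk0 : (k : ℂ) ≠ 0 := mod_cast hk.ne'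
  have h1 : ∀ j : ℕ, Theta (u + D * (j / k)) τ ^ 12 = Theta (u + ((D * j % k : ℕ) : ℂ) / k) τ ^ 12 := by
    intro j; rw [← Theta_pow_add_int (u + ((D * j % k : ℕ) : ℂ) / k) hτ ((D * j / k : ℕ) : ℤ)]
    congr 2
    have : ((D * j : ℕ) : ℂ) = ((D * j % k : ℕ) : ℂ) + k * ((D * j / k : ℕ) : ℂ) := by
      exact_mod_cast (Nat.mod_add_div _ _).symm
    rw [← mul_div_assoc, ← Nat.cast_mul, this]; field_simp; rw [cast_natCast]; ring
  simp only [h1]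
  rw [prod_coprime_mod hk hD fun j => Theta (u + (j : ℂ) / k) τ ^ 12, prod_pow,
    prod_Theta_add_div hτ hk, mul_pow, mul_pow, ← ex_nat_mul, ← pow_mul]
  have e : ((12 : ℕ) : ℂ) * -(((k : ℂ) - 1) / 4) = ((-(3 * ((k : ℤ) - 1)) : ℤ) : ℂ) := by
    push_cast; ring
  rw [e, ex_int, mul_comm (k + 1), pow_mul]
  norm_num

theorem prod_Theta_pow_add_mul (u : ℂ) (hτ : 0 < τ.im) (hk : 0 < k) :
    ∏ i ∈ range k, Theta (u + i * τ) (k * τ) ^ 12 =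
      ex ((k ^ 2 - 1) * τ - 6 * (k - 1) * u - 3 * k * (k - 1) * τ) * Theta u τ ^ 12 := by
  rw [prod_pow, prod_Theta_add_mul hτ hk, mul_pow, mul_pow, ← ex_nat_mul, ← pow_mul,
    mul_comm (k + 1), pow_mul]
  have : ((-1 : ℂ) ^ 12) = 1 := by norm_num
  rw [this, one_pow, one_mul]
  congr 2
  push_cast; ring

/-- The Siegel functions along the vectors `(a + i, b) / k`. -/
theorem prod_siegelFn_add_div (hn : IsBal(n, N)) (a b : ℚ) (hτ : 0 < τ.im) (hk : 0 < k) :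
    ∏ i ∈ range k, siegelFn N n ((a + i) / k) b (k * τ) = siegelFn N n a b τ := by
  unfold siegelFn
  rw [prod_comm]
  refine Eq.trans ?_ (prod_ex_mul_zpow hn
    ((k ^ 2 - 1) * τ - 6 * (k - 1) * (a * τ + b) - 3 * k * (k - 1) * τ) _)
  refine prod_congr rfl fun D hD => ?_
  have hτ' := natCast_mul_im_pos (pos_of_mem_divisors hD) hτ
  have hk0 : (k : ℂ) ≠ 0 := mod_cast hk.ne'
  rw [Finset.prod_zpow]
  congr 1
  have := prod_Theta_pow_add_mul (D * (a * τ + b)) hτ' hk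
  refine Eq.trans (prod_congr rfl fun i _ => ?_) (this.trans ?_)
  · congr 2
    · push_cast; field_simp; ring
    · ring
  · congr 2
    ring

theorem prod_siegelFn_div (a b : ℚ) (hτ : 0 < τ.im) (hk : 0 < k) (hkN : k.Coprime N) :
    ∏ j ∈ range k, siegelFn N n a ((b + j) / k) τ = siegelFn N n a b (k * τ) := by
  unfold siegelFn
  rw [prod_comm]
  refine prod_congr rfl fun D hD => ?_
  have hτ' := natCast_mul_im_pos (pos_of_mem_divisors hD) hτ
  have hk0 : (k : ℂ) ≠ 0 := mod_cast hk.ne'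
  rw [Finset.prod_zpow]
  congr 1
  have := prod_Theta_pow_add_div (D * (a * τ + b / k)) hτ' hk
    (hkN.coprime_dvd_right (dvd_of_mem_divisors hD)).symm
  refine Eq.trans (prod_congr rfl fun i _ => ?_) (this.trans ?_)
  · congr 2
    push_cast; field_simp; ring
  · congr 2
    · field_simp
    · ring

theorem normCompatible_siegelUnit (hn : IsBal(n, N))
    (hL : ∀ k ∈ L, 0 < k ∧ k.Coprime N) : NormCompatible L (siegelUnit N n) where
  periodic a b i j := by
    by_cases h : SiegelPoint N a b
    · refine HolUnits.ext fun τ => ?_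
      rw [siegelUnit_fn n h, siegelUnit_fn n (siegelPoint_add_int.2 h),
        siegelFn_add_int hn _ _ _ _ τ.im_pos]
    · rw [siegelUnit_of_not n h, siegelUnit_of_not n (mt siegelPoint_add_int.1 h)]
  norm k hk d hd a b ha hb hab := by
    obtain ⟨hk0', hkN⟩ := hL k hk; obtain ⟨hd0', hdN⟩ := hL d hd
    have hk0 : (k : ℚ) ≠ 0 := mod_cast hk0'.ne'
    have hint : ∀ {x : ℚ} {i : ℕ}, (∃ z : ℤ, (x + i) / k = z) → ∃ z : ℤ, x = z :=
      fun {x i} ⟨z, hz⟩ => ⟨k * z - i, by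
        rw [div_eq_iff hk0] at hz; push_cast; linear_combination hz⟩
    have hpt : ∀ i j : ℕ, SiegelPoint N ((a + i) / k) ((b + j) / k) := fun i j => by
      refine siegelPoint_of_coprime (d := k * d) (hkN.mul_left hdN) ?_
        fun h => hab ⟨hint h.1, hint h.2⟩
      obtain ⟨z, hz⟩ := hb; refine ⟨z + d * j, ?_⟩; push_cast; rw [← hz]; field_simp
    refine HolUnits.ext fun τ => ?_
    rw [HolUnits.fn_sum, siegelUnit_fn n (siegelPoint_of_coprime hdN hb hab),
      ← prod_siegelFn_add_div hn a b τ.im_pos hk0']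
    refine prod_congr rfl fun i _ => ?_
    rw [HolUnits.fn_sum, ← prod_siegelFn_div _ _ τ.im_pos hk0' hkN]
    exact prod_congr rfl fun j _ => siegelUnit_fn n (hpt i j) τ

/-! The distribution of the Siegel units and its invariance -/

theorem Theta_pow_SL (hD : 0 < D) {σ : SL(2, ℤ)} (hσ : (D : ℤ) ∣ σ.1 1 0) (v : ℂ) (τ : ℍ) :
    Theta (D * (v / autFactor σ τ)) (D * ((σ • τ : ℍ) : ℂ)) ^ 12 =
      ex (D * (6 * (σ.1 1 0 : ℂ) * v ^ 2 / autFactor σ τ)) * Theta (D * v) (D * τ) ^ 12 := by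
  obtain ⟨g, hg⟩ := hσ
  have hdet : σ.1 0 0 * σ.1 1 1 - σ.1 0 1 * σ.1 1 0 = 1 := by
    have := σ.2
    rwa [det_fin_two] at this
  obtain ⟨σD, h00, h01, h10, h11⟩ : ∃ σD : SL(2, ℤ), σD.1 0 0 = σ.1 0 0 ∧
      σD.1 0 1 = D * σ.1 0 1 ∧ σD.1 1 0 = g ∧ σD.1 1 1 = σ.1 1 1 :=
    ⟨⟨!![σ.1 0 0, D * σ.1 0 1; g, σ.1 1 1], by
      rw [Matrix.det_fin_two_of]; linear_combination hdet + σ.1 0 1 * hg⟩, rfl, rfl, rfl, rfl⟩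
  obtain ⟨τD, hτD⟩ : ∃ τD : ℍ, (τD : ℂ) = D * τ := ⟨⟨D * τ, natCast_mul_im_pos hD τ.im_pos⟩, rfl⟩
  have hg' : (σ.1 1 0 : ℂ) = D * g := by rw [hg]; push_cast; ring
  have e1 : autFactor σD τD = autFactor σ τ := by
    rw [autFactor, autFactor, h10, h11, hg', hτD]; ring
  have h := thetaLaw σD (D * v) τD
  rw [e1, coe_SL_smul, e1, hτD, h00, h01, h10] at h
  rw [coe_SL_smul, hg']
  push_cast at h
  convert h using 2
  · congr 1 <;> ring
  · congr 1; ring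

theorem siegelFn_SL (hn : IsBal(n, N)) (a b : ℚ) {σ : SL(2, ℤ)} (hσ : (N : ℤ) ∣ σ.1 1 0) (τ : ℍ) :
    siegelFn N n a b ((σ • τ : ℍ) : ℂ) =
      siegelFn N n (a * σ.1 0 0 + b * σ.1 1 0) (a * σ.1 0 1 + b * σ.1 1 1) τ := by
  have hj := autFactor_ne_zero σ τ
  set v : ℂ := ((a * σ.1 0 0 + b * σ.1 1 0) * τ + (a * σ.1 0 1 + b * σ.1 1 1)) with hv
  refine Eq.trans ?_ (prod_ex_mul_zpow hn (6 * (σ.1 1 0 : ℂ) * v ^ 2 / autFactor σ τ) _)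
  refine prod_congr rfl fun D hD => ?_
  have e3 : (a * ((σ • τ : ℍ) : ℂ) + b) = v / autFactor σ τ := by
    rw [coe_SL_smul, hv]; field_simp; rw [autFactor]; ring
  rw [e3, Theta_pow_SL (pos_of_mem_divisors hD)
    ((Int.natCast_dvd_natCast.2 (dvd_of_mem_divisors hD)).trans hσ)]
  push_cast
  rfl

abbrev pPowers (p : Primes) : Set ℕ := primeProducts (· = p.1)

theorem coprime_of_mem_pPowers (hpN : ¬ p.1 ∣ N) (hk : k ∈ pPowers p) : k.Coprime N := by
  obtain ⟨e, rfl⟩ := eq_pow_of_mem_primeProducts hk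
  exact Coprime.pow_left _ ((Nat.Prime.coprime_iff_not_dvd p.2).2 hpN)

theorem pPowers_pos_coprime (hpN : ¬ p.1 ∣ N) : ∀ k ∈ pPowers p, 0 < k ∧ k.Coprime N := fun _ hk => ⟨hk.1, coprime_of_mem_pPowers hpN hk⟩

theorem mem_primesNe_iff (p : Primes) (ℓ : Primes) : (ℓ : ℕ) = p ↔ ℓ ∉ primesNe p := by
  simp [primesNe, Primes.coe_nat_inj]

theorem mat_det_mem_ZS (hγ : γ ∈ GS S) : (mat γ).det ∈ ZS S ∧ (mat γ).det⁻¹ ∈ ZS S := by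
  have h : (mat γ).det⁻¹ = (mat γ⁻¹).det :=
    inv_eq_of_mul_eq_one_right (by rw [← det_mul, mat_mul_inv, Matrix.det_one])
  rw [h, det_fin_two, det_fin_two]
  exact ⟨sub_mem (mul_mem (hγ 0 0).1 (hγ 1 1).1) (mul_mem (hγ 0 1).1 (hγ 1 0).1),
    sub_mem (mul_mem (hγ 0 0).2 (hγ 1 1).2) (mul_mem (hγ 0 1).2 (hγ 1 0).2)⟩

theorem natCast_dvd_of_mem_ZS (hpN : ¬ p.1 ∣ N) {x : ℤ} (hy : y ∈ ZS (primesNe p))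
    (h : (x : ℚ) = N * y) : (N : ℤ) ∣ x := by
  have hden := coprime_of_mem_pPowers hpN (den_mem_primeProducts (mem_primesNe_iff p) hy)
  have h1 : (y.den : ℤ) * x = N * y.num := by
    have : (y.den : ℚ) * x = N * y.num := by rw [h, ← den_mul_eq_num y]; ring
    exact_mod_cast this
  have hc : IsCoprime (N : ℤ) y.den := Nat.isCoprime_iff_coprime.2 hden.symm
  exact hc.dvd_of_dvd_mul_left (Dvd.intro _ h1.symm)

theorem GSN_le_of_generators (hpN : ¬ p.1 ∣ N) {K : Subgroup GQ}
    (hSL : ∀ σ : SL(2, ℤ), (N : ℤ) ∣ σ.1 1 0 → ofSL σ ∈ K)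
    (hLR : ∀ k ∈ pPowers p, ∀ hk : 0 < (k : ℚ), LR k hk ∈ K)
    (hsc : ∀ k ∈ pPowers p, ∀ hk : (k : ℚ) ≠ 0, scalar k hk ∈ K) : GSN (primesNe p) N ≤ K := by
  rintro γ ⟨hγ, x, hx, hγx⟩
  obtain ⟨σ, n, a, d, b, hn0, ha0, hd0, hn, ha, hd, h⟩ :=
    exists_factorization (P := (· = p.1)) (mem_primesNe_iff p) hγ
  refine mem_of_factorization (hSL σ ?_) (hsc n hn hn0) (hLR a ha ha0)
    (hLR d hd hd0) (hSL _ ?_) (hsc a ha ha0.ne') h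
  · have h10 := congrArg (fun g => mat g 1 0) h
    simp only [mat_mul, mat_scalar, mat_LR, Matrix.mul_apply, Fin.sum_univ_two, mat_ofSL,
      coe_T_zpow] at h10
    simp at h10
    have h1 : (σ.1 1 0 : ℚ) * mat γ 0 0 + σ.1 1 1 * mat γ 1 0 = 0 := by
      refine mul_left_cancel₀ hn0 ?_
      linear_combination h10
    obtain ⟨-, hdet⟩ := mat_det_mem_ZS hγ
    have hdet0 : (mat γ).det ≠ 0 := (show 0 < (mat γ).det from γ.2).ne'
    refine natCast_dvd_of_mem_ZS hpN (y := (mat γ).det⁻¹ *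
      (-(σ.1 1 1 : ℚ) * x * mat γ 1 1 - σ.1 1 0 * mat γ 0 1 * x))
      (mul_mem hdet (sub_mem (mul_mem (mul_mem (neg_mem (intCast_mem _ _)) hx) (hγ 1 1).1)
        (mul_mem (mul_mem (intCast_mem _ _) (hγ 0 1).1) hx))) ?_
    rw [← mul_assoc, mul_comm (N : ℚ), mul_assoc, eq_inv_mul_iff_mul_eq₀ hdet0, det_fin_two]
    rw [hγx] at h1 ⊢
    linear_combination mat γ 1 1 * h1
  · rw [coe_T_zpow]; simp

/-- The distribution of the Siegel units attached to `δ`. -/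
def siegelDist (hpN : ¬ p.1 ∣ N) (hn : IsBal(n, N)) : Dist Z_[p] HolUnits :=
  (levelSystem_padic p).distOf (normCompatible_siegelUnit hn (pPowers_pos_coprime hpN))

theorem siegelDist_cellFn (hN : 0 < N) (hpN : ¬ p.1 ∣ N) (hn : IsBal(n, N)) (hm : m ∈ pPowers p)
    (hd : d ∈ pPowers p) (ha : ∃ z : ℤ, (d : ℚ) * a = z) (hb : ∃ z : ℤ, (d : ℚ) * b = z) :
    siegelDist hpN hn (cellFn Z_[p] m a b) = siegelUnit N n (a / m) (b / m) := by
  by_cases h0 : (0 : Fin 2 → ℚ_[p]) ∈ cell Z_[p] m a b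
  · rw [cellFn_eq_zero _ _ _ h0, map_zero, siegelUnit_of_not]
    exact not_siegelPoint_of_int hN ((levelSystem_padic p).int_of_zero_mem_cell hm hd ha hb h0)
  · exact (levelSystem_padic p).distOf_cellFn _ hm hd ha hb h0

theorem siegelPoint_div (hpN : ¬ p.1 ∣ N) (hm : m ∈ pPowers p) (hd : d ∈ pPowers p)
    (hb : ∃ z : ℤ, (d : ℚ) * b = z) (h0 : (0 : Fin 2 → ℚ_[p]) ∉ cell Z_[p] m a b) :
    SiegelPoint N (a / m) (b / m) := by
  have hm0 : (m : ℚ) ≠ 0 := mod_cast hm.1.ne'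
  refine siegelPoint_of_coprime (d := d * m)
    ((coprime_of_mem_pPowers hpN hd).mul_left (coprime_of_mem_pPowers hpN hm)) ?_
    fun h => h0 (zero_mem_cell_of_int hm.1 h)
  obtain ⟨z, hz⟩ := hb
  exact ⟨z, by rw [← hz]; push_cast; field_simp⟩

theorem toReal_ofSL_smul (σ : SL(2, ℤ)) (τ : ℍ) : toReal (ofSL σ) • τ = σ • τ := by
  apply ext_iff.2
  rw [coe_toReal_smul, coe_SL_smul, autFactor]
  simp only [mat_ofSL]
  push_cast
  rfl

theorem siegelDist_invariant (hN : 0 < N) (hpN : ¬ p.1 ∣ N) (hn : IsBal(n, N)) :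
    ∀ γ ∈ GSN (primesNe p) N, γ • siegelDist hpN hn = siegelDist hpN hn := by
  have hden : ∀ {m : ℕ} (i : ℕ), m ∈ pPowers p → ∃ z : ℤ, (m : ℚ) * ((i : ℚ) / m) = z :=
    fun {m} i hm => ⟨i, by
      have hm0 : (m : ℚ) ≠ 0 := mod_cast hm.1.ne'
      push_cast; field_simp⟩
  have key : GSN (primesNe p) N ≤ MulAction.stabilizer GQ (siegelDist hpN hn) := by
    refine GSN_le_of_generators hpN (fun σ hσ => ?_) (fun k hk hk0 => ?_) (fun k hk hk0 => ?_) <;>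
      rw [MulAction.mem_stabilizer_iff] <;>
      refine (levelSystem_padic p).dist_ext fun m hm i j => ?_ <;>
      have hi := hden i hm <;> have hj := hden j hm <;>
      have hm0 : (m : ℚ) ≠ 0 := mod_cast hm.1.ne'
    all_goals
      by_cases h0 : (0 : Fin 2 → ℚ_[p]) ∈ cell Z_[p] m ((i : ℚ) / m) ((j : ℚ) / m)
      · rw [Dist.smul_apply, cellFn_eq_zero _ _ _ h0, map_zero, map_zero, smul_zero]
    all_goals rw [Dist.smul_apply, siegelDist_cellFn hN hpN hn hm hm hi hj]
    · set a : ℚ := (i : ℚ) / m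
      set b : ℚ := (j : ℚ) / m
      obtain ⟨x, hx⟩ := hi; obtain ⟨y, hy⟩ := hj
      have hx' : ∃ z : ℤ, (m : ℚ) * (a * σ.1 0 0 + b * σ.1 1 0) = z :=
        ⟨x * σ.1 0 0 + y * σ.1 1 0, by push_cast; rw [← hx, ← hy]; ring⟩
      have hy' : ∃ z : ℤ, (m : ℚ) * (a * σ.1 0 1 + b * σ.1 1 1) = z :=
        ⟨x * σ.1 0 1 + y * σ.1 1 1, by push_cast; rw [← hx, ← hy]; ring⟩
      rw [slash_ofSL_cellFn _ hm.1, siegelDist_cellFn hN hpN hn hm hm hx' hy']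
      have hpt := siegelPoint_div hpN hm hm ⟨y, hy⟩ h0
      have hpt' : SiegelPoint N ((a * σ.1 0 0 + b * σ.1 1 0) / m)
          ((a * σ.1 0 1 + b * σ.1 1 1) / m) := by
        refine siegelPoint_div hpN hm hm hy' fun h => h0 ?_
        obtain ⟨⟨s, hs⟩, t, ht⟩ := (levelSystem_padic p).int_of_zero_mem_cell hm hm hx' hy' h
        have hdet : (σ.1 0 0 : ℚ) * σ.1 1 1 - σ.1 0 1 * σ.1 1 0 = 1 := by
          have := σ.2; rw [det_fin_two] at this; exact_mod_cast this
        rw [div_eq_iff hm0] at hs ht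
        refine zero_mem_cell_of_int hm.1 ⟨⟨s * σ.1 1 1 - t * σ.1 1 0, ?_⟩,
          ⟨t * σ.1 0 0 - s * σ.1 0 1, ?_⟩⟩
        · rw [div_eq_iff hm0]; push_cast
          linear_combination -a * hdet + (σ.1 1 1 : ℚ) * hs - (σ.1 1 0 : ℚ) * ht
        · rw [div_eq_iff hm0]; push_cast
          linear_combination -b * hdet + (σ.1 0 0 : ℚ) * ht - (σ.1 0 1 : ℚ) * hs
      refine HolUnits.ext fun τ => ?_
      rw [HolUnits.fn_smul, siegelUnit_fn n hpt', siegelUnit_fn n hpt, ← map_inv, toReal_ofSL_smul]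
      have := siegelFn_SL hn (a / m) (b / m) hσ (σ⁻¹ • τ); rw [smul_inv_smul] at this; rw [this]
      congr 1 <;> ring
    · rw [(levelSystem_padic p).slash_LR_cellFn hm.1 hk hk0 h0, map_sum]
      have hpt := siegelPoint_div hpN hm hm hj h0
      refine HolUnits.ext fun τ => ?_
      rw [HolUnits.fn_smul, HolUnits.fn_sum, siegelUnit_fn n hpt,
        ← prod_siegelFn_add_div hn _ _ τ.im_pos hk.1]
      refine prod_congr rfl fun r _ => ?_
      obtain ⟨x, hx⟩ := hi; obtain ⟨y, hy⟩ := hj; have hk0' := hk0.ne'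
      rw [siegelDist_cellFn hN hpN hn (primeProducts_mul_mem hm hk) hm
        ⟨x + m * (m * r), by push_cast; rw [← hx]; ring⟩ ⟨k * y, by push_cast; rw [← hy]; ring⟩]
      have e1 : ((i : ℚ) / m + m * r) / (m * k : ℕ) = ((i : ℚ) / m / m + r) / k := by
        push_cast; field_simp
      have e2 : (k * ((j : ℚ) / m)) / (m * k : ℕ) = (j : ℚ) / m / m := by push_cast; field_simp
      rw [e1, e2, siegelUnit_fn n, coe_LR_inv_smul]; intro D hD h; refine hpt D hD ⟨?_, h.2⟩
      obtain ⟨z, hz⟩ := h.1; rw [div_eq_iff hk0'] at hz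
      exact ⟨z * k - r, by push_cast; linear_combination hz⟩
    · obtain ⟨x, hx⟩ := hi; obtain ⟨y, hy⟩ := hj
      rw [slash_scalar_cellFn _ hm.1 hk0, HolUnits.scalar_smul,
        siegelDist_cellFn hN hpN hn (primeProducts_mul_mem hk hm) hm
          ⟨k * x, by push_cast; rw [← hx]; ring⟩ ⟨k * y, by push_cast; rw [← hy]; ring⟩]
      congr 1
      · push_cast; field_simp
      · push_cast; field_simp
  exact fun γ hγ => MulAction.mem_stabilizer_iff.1 (key hγ)

/-! Logarithms of infinite products as Lambert series -/

/-- The logarithm of `qPoch X Q` as a Lambert series. -/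
def logPoch (X Q : ℂ) : ℂ := -∑' m : ℕ, X ^ (m + 1) / ((m + 1) * (1 - Q ^ (m + 1)))

theorem norm_logPoch_term_le {x q : ℝ} (hX : ‖X‖ ≤ x) (hQ : ‖Q‖ ≤ q) (hq : q < 1) (m : ℕ) :
    ‖X ^ (m + 1) / ((m + 1) * (1 - Q ^ (m + 1)))‖ ≤ x ^ (m + 1) / (1 - q) := by
  have hq0 : 0 ≤ q := (norm_nonneg _).trans hQ
  have hx0 : 0 ≤ x := (norm_nonneg _).trans hX
  have h1 : 1 - q ≤ ‖1 - Q ^ (m + 1)‖ := by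
    have h2 := norm_sub_norm_le 1 (Q ^ (m + 1))
    rw [norm_one, norm_pow] at h2
    have h3 : ‖Q‖ ^ (m + 1) ≤ q ^ (m + 1) := pow_le_pow_left₀ (norm_nonneg _) hQ _
    have h4 : q ^ (m + 1) ≤ q := pow_le_of_le_one hq0 hq.le (succ_ne_zero m)
    linarith
  have h5 : (1 : ℝ) ≤ ‖(m + 1 : ℂ)‖ := by
    have : (m + 1 : ℂ) = ((m + 1 : ℕ) : ℂ) := by push_cast; rfl
    rw [this, Complex.norm_natCast]; exact_mod_cast succ_pos m
  rw [norm_div, norm_mul, norm_pow]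
  refine div_le_div₀ (pow_nonneg hx0 _) (pow_le_pow_left₀ (norm_nonneg _) hX _) (by linarith) ?_
  nlinarith [norm_nonneg (1 - Q ^ (m + 1))]

theorem summable_logPoch (hX : ‖X‖ < 1) (hQ : ‖Q‖ < 1) :
    Summable fun m : ℕ => X ^ (m + 1) / ((m + 1) * (1 - Q ^ (m + 1))) := by
  refine Summable.of_norm_bounded (g := fun m : ℕ => ‖X‖ ^ (m + 1) / (1 - ‖Q‖)) ?_
    (norm_logPoch_term_le le_rfl le_rfl hQ)
  exact ((summable_nat_add_iff 1).2 (summable_geometric_of_lt_one (norm_nonneg _) hX)).div_const _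

theorem norm_logPoch_le (hX : ‖X‖ < 1) (hQ : ‖Q‖ < 1) :
    ‖logPoch X Q‖ ≤ ‖X‖ * (1 - ‖X‖)⁻¹ / (1 - ‖Q‖) := by
  rw [logPoch, norm_neg]
  refine tsum_of_norm_bounded ?_ (norm_logPoch_term_le le_rfl le_rfl hQ)
  refine HasSum.div_const ?_ _
  simp only [pow_succ']
  exact (hasSum_geometric_of_lt_one (norm_nonneg _) hX).mul_left _

theorem logPoch_eq (hX : ‖X‖ < 1) (hQ : ‖Q‖ < 1) : logPoch X Q = log (1 - X) + logPoch (X * Q) Q := by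
  have hXQ : ‖X * Q‖ < 1 := by rw [norm_mul]; nlinarith [norm_nonneg X, norm_nonneg Q]
  have h1 := (hasSum_nat_add_iff' 1).2 (Complex.hasSum_taylorSeries_neg_log hX)
  have h2 := h1.tsum_eq
  simp only [Finset.range_one, Finset.sum_singleton, pow_zero, cast_zero, div_zero, sub_zero] at h2
  have h3 := (summable_logPoch hX hQ).tsum_sub (summable_logPoch hXQ hQ)
  rw [logPoch, logPoch]
  have h4 : log (1 - X) = -∑' m : ℕ, X ^ (m + 1) / ((m + 1 : ℕ) : ℂ) := by rw [h2]; ring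
  rw [h4]
  have h5 : ∑' m : ℕ, X ^ (m + 1) / ((m + 1 : ℕ) : ℂ) =
      ∑' m : ℕ, (X ^ (m + 1) / ((m + 1) * (1 - Q ^ (m + 1))) -
        (X * Q) ^ (m + 1) / ((m + 1) * (1 - Q ^ (m + 1)))) := by
    refine tsum_congr fun m => ?_
    have hm : (m + 1 : ℂ) ≠ 0 := mod_cast succ_ne_zero m
    have hQm : (1 - Q ^ (m + 1)) ≠ 0 := fun h => by
      have h6 := norm_pow_lt_one hQ (succ_pos m)
      rw [← sub_eq_zero.1 h] at h6; simp at h6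
    rw [mul_pow]; push_cast; field_simp
  rw [h5, h3]; ring

theorem exp_logPoch (hX : ‖X‖ < 1) (hQ : ‖Q‖ < 1) : Complex.exp (logPoch X Q) = qPoch X Q := by
  have hK : ∀ K : ℕ, ‖X * Q ^ K‖ < 1 := fun K => by
    rw [norm_mul, norm_pow]
    exact mul_lt_one_of_nonneg_of_lt_one_left (norm_nonneg _) hX (pow_le_one₀ (norm_nonneg _) hQ.le)
  have h1 : ∀ K : ℕ, Complex.exp (logPoch X Q) = (∏ i ∈ range K, (1 - X * Q ^ i)) *
      Complex.exp (logPoch (X * Q ^ K) Q) := fun K => by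
    induction K with
    | zero => simp
    | succ K ih =>
      have h0 : 1 - X * Q ^ K ≠ 0 := fun h => by
        have := hK K; rw [← sub_eq_zero.1 h] at this; simp at this
      rw [ih, logPoch_eq (hK K) hQ, exp_add, exp_log h0, Finset.prod_range_succ, pow_succ]; ring_nf
  have hX0 : Tendsto (fun K : ℕ => ‖X * Q ^ K‖) atTop (𝓝 0) := by
    have := ((tendsto_pow_atTop_nhds_zero_of_norm_lt_one hQ).const_mul X).norm; simpa using this
  have h2 : Tendsto (fun K : ℕ => logPoch (X * Q ^ K) Q) atTop (𝓝 0) := by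
    refine squeeze_zero_norm (fun K => norm_logPoch_le (hK K) hQ) ?_
    have := ((hX0.mul ((hX0.const_sub 1).inv₀ (by norm_num))).div_const (1 - ‖Q‖)); simpa using this
  have h3 := (tendsto_qPoch X hQ).mul h2.cexp
  rw [Complex.exp_zero, mul_one] at h3
  refine tendsto_nhds_unique ?_ h3
  simp only [← h1]
  exact tendsto_const_nhds

theorem differentiableOn_logPoch {s : Set ℂ} (hs : IsOpen s) {X Q : ℂ → ℂ}
    (hX : DifferentiableOn ℂ X s) (hQ : DifferentiableOn ℂ Q s) (hX1 : ∀ z ∈ s, ‖X z‖ < 1)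
    (hQ1 : ∀ z ∈ s, ‖Q z‖ < 1) : DifferentiableOn ℂ (fun z => logPoch (X z) (Q z)) s := by
  intro z hz
  obtain ⟨x, hx, hx1⟩ := exists_between (hX1 z hz)
  obtain ⟨q, hq, hq1⟩ := exists_between (hQ1 z hz)
  set s' := (s ∩ X ⁻¹' Metric.ball 0 x) ∩ (s ∩ Q ⁻¹' Metric.ball 0 q)
  have hs' : IsOpen s' := (hX.continuousOn.isOpen_inter_preimage hs Metric.isOpen_ball).inter
    (hQ.continuousOn.isOpen_inter_preimage hs Metric.isOpen_ball)
  have hz' : z ∈ s' := ⟨⟨hz, by simpa using hx⟩, hz, by simpa using hq⟩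
  have hss : s' ⊆ s := fun w hw => hw.1.1
  have hx0 : 0 ≤ x := (norm_nonneg _).trans hx.le
  have key : DifferentiableOn ℂ
      (fun z => ∑' m : ℕ, X z ^ (m + 1) / ((m + 1) * (1 - Q z ^ (m + 1)))) s' := by
    refine Complex.differentiableOn_tsum_of_summable_norm (u := fun m : ℕ => x ^ (m + 1) / (1 - q))
      (((summable_nat_add_iff 1).2 (summable_geometric_of_lt_one hx0 hx1)).div_const _)
      (fun m => ?_) hs' fun m w hw => ?_
    · refine ((hX.mono hss).pow _).div
        (((differentiableOn_const 1).sub ((hQ.mono hss).pow _)).const_mul _) fun w hw h => ?_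
      have hm : (m + 1 : ℂ) ≠ 0 := mod_cast succ_ne_zero m
      have h6 := norm_pow_lt_one (hQ1 w (hss hw)) (succ_pos m)
      rw [← sub_eq_zero.1 ((mul_eq_zero.1 h).resolve_left hm)] at h6; simp at h6
    · have h1 : ‖X w‖ < x := by simpa using hw.1.2
      have h2 : ‖Q w‖ < q := by simpa using hw.2.2
      exact norm_logPoch_term_le h1.le h2.le hq1 m
  exact ((key.differentiableAt (hs'.mem_nhds hz')).neg).differentiableWithinAt

/-! Real parts on vertical lines -/

/-- The point `r + it` of the upper half plane. -/
def vert (r t : ℝ) : ℍ := ofComplex (r + t * I)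

theorem coe_vert (r : ℝ) (ht : 0 < t) : (vert r t : ℂ) = r + t * I := by
  rw [vert, UpperHalfPlane.ofComplex_apply_of_im_pos (by simpa using ht)]

theorem im_vert (r : ℝ) (ht : 0 < t) : (vert r t).im = t := by
  change (vert r t : ℂ).im = t
  rw [coe_vert r ht]; simp

/-- The holomorphic functions whose real part tends to `0` at `i∞` along all vertical lines. -/
def reVanishing : AddSubgroup Hol where
  carrier := {F | ∀ r : ℝ, Tendsto (fun t => (F.1 (vert r t)).re) atTop (𝓝 0)}
  add_mem' {F G} hF hG r := by have := (hF r).add (hG r); simpa using this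
  zero_mem' r := by
    change Tendsto (fun _ => (0 : ℂ).re) atTop (𝓝 0)
    simp
  neg_mem' {F} hF r := by have := (hF r).neg; simpa using this

theorem eq_of_expHom_eq {F G : Hol} (hF : F ∈ reVanishing) (hG : G ∈ reVanishing)
    (h : expHom F = expHom G) : F = G := by
  obtain ⟨m, hm⟩ := expHom_eq_zero (F := F - G) (by rw [map_sub, h, sub_self])
  have h1 := (sub_mem hF hG : F - G ∈ reVanishing) 0
  rw [hm] at h1
  simp only [constHom_apply, Complex.intCast_re] at h1
  have h2 : (m : ℝ) = 0 := tendsto_nhds_unique tendsto_const_nhds h1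
  have h3 : m = 0 := mod_cast h2
  rw [h3, map_zero, sub_eq_zero] at hm
  exact hm

/-! Logarithms of the Siegel units -/

/-- The exponents of the two Lambert series. -/
def leadExp (x : ℚ) : ℚ := if x = 0 then 1 else x

theorem leadExp_pos (hx : 0 ≤ x) : 0 < leadExp x := by
  rw [leadExp]; split_ifs with h
  · exact one_pos
  · exact lt_of_le_of_ne hx (Ne.symm h)

/-- The logarithm of the `D`-th factor of the Siegel unit, up to a constant. -/
def siegelLogTerm (D : ℕ) (x y : ℚ) (τ : ℂ) : ℂ :=
  logPoch (ex (D * (leadExp x * τ + y))) (ex (D * τ)) +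
    logPoch (ex (D * ((1 - x) * τ - y))) (ex (D * τ))

/-- The constant omitted in `siegelLogTerm`. -/
def siegelLogConst (D : ℕ) (x y : ℚ) : ℝ := if x = 0 then Real.log ‖1 - ex (D * y)‖ else 0

/-- The logarithm of the inverse of the Siegel unit, for `0 ≤ x < 1`. -/
def siegelLogFn (N : ℕ) (n : ℕ → ℤ) (x y : ℚ) (τ : ℂ) : ℂ :=
  -(12 / (2 * π * I)) * ∑ D ∈ N.divisors, (n D : ℂ) * (siegelLogTerm D x y τ + siegelLogConst D x y)

theorem norm_ex_natCast_mul (D : ℕ) {a : ℝ} (b : ℝ) (τ : ℂ) :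
    ‖ex (D * (a * τ + b))‖ = exp (-(2 * π * (D * a * τ.im))) := by
  rw [norm_ex]
  congr 3
  have : (D : ℂ) * (a * τ + b) = ((D * a : ℝ) : ℂ) * τ + ((D * b : ℝ) : ℂ) := by push_cast; ring
  rw [this, add_im, im_ofReal_mul, ofReal_im, add_zero]

theorem norm_ex_lead (D : ℕ) (x y : ℚ) (τ : ℂ) : ‖ex (D * (leadExp x * τ + y))‖ =
    exp (-(2 * π * (D * (leadExp x : ℝ) * τ.im))) := by
  rw [← norm_ex_natCast_mul D (y : ℝ)]; push_cast; rfl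

theorem norm_ex_trail (D : ℕ) (x y : ℚ) (τ : ℂ) : ‖ex (D * ((1 - x) * τ - y))‖ =
    exp (-(2 * π * (D * (1 - x : ℝ) * τ.im))) := by
  rw [← norm_ex_natCast_mul D (-(y : ℝ))]; push_cast; rw [sub_eq_add_neg]

theorem exp_neg_lt_one (hD : 0 < D) {a : ℝ} (ha : 0 < a) (ht : 0 < t) :
    exp (-(2 * π * (D * a * t))) < 1 := by
  rw [Real.exp_lt_one_iff, neg_lt_zero]
  have : (0 : ℝ) < D := mod_cast hD
  have := pi_pos
  positivity

theorem norm_ex_mul_lt_one (hD : 0 < D) (hτ : 0 < τ.im) : ‖ex (D * τ)‖ < 1 :=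
  norm_ex_lt_one (natCast_mul_im_pos hD hτ)

theorem norm_lead_lt_one (hD : 0 < D) (hx : 0 ≤ x) (y : ℚ) (hτ : 0 < τ.im) :
    ‖ex (D * (leadExp x * τ + y))‖ < 1 := by
  rw [norm_ex_lead]
  exact exp_neg_lt_one hD (mod_cast leadExp_pos hx) hτ

theorem norm_trail_lt_one (hD : 0 < D) (hx : x < 1) (y : ℚ) (hτ : 0 < τ.im) :
    ‖ex (D * ((1 - x) * τ - y))‖ < 1 := by
  rw [norm_ex_trail]
  exact exp_neg_lt_one hD (sub_pos.2 (mod_cast hx)) hτ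

theorem differentiableOn_siegelLogFn (N : ℕ) (n : ℕ → ℤ) (hx : 0 ≤ x) (hx1 : x < 1) (y : ℚ) :
    DifferentiableOn ℂ (siegelLogFn N n x y) {z | 0 < z.im} := by
  unfold siegelLogFn
  refine DifferentiableOn.const_mul (DifferentiableOn.fun_sum fun D hD => ?_) _
  have hD0 := pos_of_mem_divisors hD
  have e : ∀ w : ℂ → ℂ, Differentiable ℂ w → DifferentiableOn ℂ (fun z => ex (w z)) {z | 0 < z.im} :=
    fun w hw => (differentiable_ex.comp hw).differentiableOn
  refine DifferentiableOn.const_mul (DifferentiableOn.add_const _ (DifferentiableOn.add ?_ ?_)) _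
  · exact differentiableOn_logPoch isOpen_im_pos (e _ (by fun_prop)) (e _ (by fun_prop))
      (fun z hz => norm_lead_lt_one hD0 hx y hz) fun z hz => norm_ex_mul_lt_one hD0 hz
  · exact differentiableOn_logPoch isOpen_im_pos (e _ (by fun_prop)) (e _ (by fun_prop))
      (fun z hz => norm_trail_lt_one hD0 hx1 y hz) fun z hz => norm_ex_mul_lt_one hD0 hz

theorem one_sub_pow_twelve {z : ℂ} (hz : ‖z‖ = 1) : (1 - z) ^ 12 = (‖1 - z‖ : ℂ) ^ 12 * z ^ 6 := by
  have h1 : z * (starRingEnd ℂ) z = 1 := by rw [Complex.mul_conj']; simp [hz]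
  have h2 : (‖1 - z‖ : ℂ) ^ 2 = (1 - z) * (1 - (starRingEnd ℂ) z) := by
    rw [← Complex.mul_conj', map_sub, map_one]
  have h3 : (1 - z) ^ 2 = -((‖1 - z‖ : ℂ) ^ 2 * z) := by rw [h2]; linear_combination (-1 + z) * h1
  calc (1 - z) ^ 12 = ((1 - z) ^ 2) ^ 6 := by ring
    _ = _ := by rw [h3]; ring

theorem Theta_pow_eq (hD : 0 < D) (hx : 0 ≤ x) (hx1 : x < 1) (h : ¬ (x = 0 ∧ ∃ z : ℤ, D * y = z))
    (hτ : 0 < τ.im) : Theta (D * (x * τ + y)) (D * τ) ^ 12 =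
      ex (D * (τ - 6 * (x * τ + y) + if x = 0 then 6 * y else 0)) *
      Complex.exp (siegelLogTerm D x y τ + siegelLogConst D x y) ^ 12 := by
  have hDτ := natCast_mul_im_pos hD hτ
  have hQ := norm_ex_mul_lt_one hD hτ
  rw [Theta_eq _ hDτ, siegelLogTerm, exp_add, exp_add,
    exp_logPoch (norm_lead_lt_one hD hx y hτ) hQ, exp_logPoch (norm_trail_lt_one hD hx1 y hτ) hQ]
  have e1 : (D : ℂ) * τ - D * (x * τ + y) = D * ((1 - x) * τ - y) := by ring
  rw [e1, Even.neg_pow (by decide), mul_pow, mul_pow, ← ex_nat_mul, mul_pow, mul_pow]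
  by_cases hx0 : x = 0
  · subst hx0
    have h2 : 1 - ex (D * y) ≠ 0 := fun h0 => by
      obtain ⟨z, hz⟩ := ex_eq_one_iff.1 (sub_eq_zero.1 h0).symm; exact h ⟨rfl, z, mod_cast hz⟩
    have h3 : ‖ex ((D : ℂ) * y)‖ = 1 := by
      rw [norm_ex]; have : (D : ℂ) * y = ((D * y : ℝ) : ℂ) := by push_cast; rfl
      rw [this, ofReal_im]; simp
    have e2 : ex (D * (((0 : ℚ) : ℂ) * τ + y)) * ex (D * τ) =
        ex (D * ((leadExp 0 : ℚ) * τ + y)) := by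
      rw [← ex_add, leadExp, if_pos rfl]; congr 1; push_cast; ring
    have e3 : ex (D * (((0 : ℚ) : ℂ) * τ + y)) = ex (D * y) := by congr 1; push_cast; ring
    rw [qPoch_succ _ hQ, e2, e3, mul_pow, one_sub_pow_twelve h3, siegelLogConst, if_pos rfl,
      if_pos rfl, ← ofReal_exp, Real.exp_log (norm_pos_iff.2 h2), ← ex_nat_mul]
    have e4 : ex (D * (τ - 6 * (((0 : ℚ) : ℂ) * τ + y) + ((6 * y : ℚ) : ℂ))) =
        ex ((12 : ℕ) * (D * τ / 12 - D * (((0 : ℚ) : ℂ) * τ + y) / 2)) * ex ((6 : ℕ) * (D * y)) := by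
      rw [← ex_add]; congr 1; push_cast; ring
    rw [e4]; ring
  · have e4 : ex (D * (τ - 6 * (x * τ + y))) =
        ex ((12 : ℕ) * (D * τ / 12 - D * (x * τ + y) / 2)) := by
      congr 1; push_cast; ring
    rw [if_neg hx0, Rat.cast_zero, add_zero, e4, siegelLogConst, if_neg hx0, leadExp, if_neg hx0,
      Complex.ofReal_zero, Complex.exp_zero, one_pow]
    ring

theorem ex_siegelLogFn (hn : IsBal(n, N)) (hx : 0 ≤ x) (hx1 : x < 1) (h : SiegelPoint N x y)
    (hτ : 0 < τ.im) : ex (siegelLogFn N n x y τ) = (siegelFn N n x y τ)⁻¹ := by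
  have h1 : siegelFn N n x y τ =
      ∏ D ∈ N.divisors, (Complex.exp (siegelLogTerm D x y τ + siegelLogConst D x y) ^ 12) ^ n D := by
    rw [← prod_ex_mul_zpow hn (τ - 6 * (x * τ + y) + if x = 0 then 6 * y else 0)]
    refine prod_congr rfl fun D hD => ?_
    rw [Theta_pow_eq (pos_of_mem_divisors hD) hx hx1 (fun h0 => h D hD ⟨⟨0, by simpa using h0.1⟩, h0.2⟩) hτ]
  have h2 : ∀ D, (Complex.exp (siegelLogTerm D x y τ + siegelLogConst D x y) ^ 12) ^ n D =
      Complex.exp (12 * ((n D : ℂ) * (siegelLogTerm D x y τ + siegelLogConst D x y))) := fun D => by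
    rw [← exp_nat_mul, ← Complex.exp_int_mul]; congr 1; push_cast; ring
  simp only [h1, h2]
  rw [← Complex.exp_sum, ← exp_neg, ex, siegelLogFn, ← mul_sum]
  congr 1
  have := two_pi_I_ne_zero
  generalize ∑ D ∈ N.divisors, (n D : ℂ) * (siegelLogTerm D x y τ + siegelLogConst D x y) = s
  field_simp

theorem re_siegelLogFn (N : ℕ) (n : ℕ → ℤ) (x y : ℚ) (τ : ℂ) : (siegelLogFn N n x y τ).re =
      -(12 / (2 * π)) * ∑ D ∈ N.divisors, (n D : ℝ) * (siegelLogTerm D x y τ).im := by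
  have e : -(12 / (2 * π * I)) = ((12 / (2 * π) : ℝ) : ℂ) * I := by
    push_cast; rw [div_mul_eq_div_div, Complex.div_I]; ring
  rw [siegelLogFn, e, mul_assoc, re_ofReal_mul, Complex.I_mul_re, im_sum, neg_mul, mul_neg]
  congr 2
  refine sum_congr rfl fun D _ => ?_
  have : (n D : ℂ) = ((n D : ℝ) : ℂ) := by push_cast; rfl
  rw [this, im_ofReal_mul, add_im, ofReal_im, add_zero]

theorem tendsto_exp_neg (hD : 0 < D) {a : ℝ} (ha : 0 < a) :
    Tendsto (fun t : ℝ => exp (-(2 * π * (D * a * t)))) atTop (𝓝 0) := by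
  have hD' : (0 : ℝ) < D := mod_cast hD
  have := pi_pos
  have h : (fun t : ℝ => -(2 * π * (D * a * t))) = fun t => -((2 * π * D * a) * t) := by
    funext t; ring
  rw [show (fun t : ℝ => exp (-(2 * π * (D * a * t)))) =
    exp ∘ fun t => -((2 * π * D * a) * t) by funext t; simp only [comp]; ring_nf]
  exact Real.tendsto_exp_atBot.comp (Filter.tendsto_neg_atTop_atBot.comp
    (tendsto_id.const_mul_atTop (by positivity)))

theorem tendsto_logPoch {X Q : ℝ → ℂ} (hX : Tendsto (fun t => ‖X t‖) atTop (𝓝 0))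
    (hQ : Tendsto (fun t => ‖Q t‖) atTop (𝓝 0)) : Tendsto (fun t => logPoch (X t) (Q t)) atTop (𝓝 0) := by
  have h1 := (hX.mul ((hX.const_sub 1).inv₀ (by norm_num))).div (hQ.const_sub 1) (by norm_num)
  refine squeeze_zero_norm' ?_ (by simpa using h1)
  filter_upwards [hX.eventually_lt_const one_pos, hQ.eventually_lt_const one_pos] with t ht ht'
  simpa using norm_logPoch_le ht ht'

theorem exists_siegelLog (hn : IsBal(n, N)) (hx : 0 ≤ x) (hx1 : x < 1) (h : SiegelPoint N x y) :
    ∃ F : Hol, F ∈ reVanishing ∧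
      expHom F = -siegelUnit N n x y ∧ ∀ τ : ℍ, F.1 τ = siegelLogFn N n x y τ := by
  refine ⟨⟨fun τ => siegelLogFn N n x y τ,
    mdifferentiable_of_differentiableOn (differentiableOn_siegelLogFn N n hx hx1 y)⟩,
    fun r => ?_, ?_, fun τ => rfl⟩
  · have h1 : ∀ D ∈ N.divisors, Tendsto
        (fun t => (siegelLogTerm D x y (vert r t)).im) atTop (𝓝 0) := fun D hD => by
      have hD0 := pos_of_mem_divisors hD
      have hx1' : (0 : ℝ) < 1 - x := sub_pos.2 (mod_cast hx1)
      have hl : (0 : ℝ) < leadExp x := mod_cast leadExp_pos hx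
      have him : ∀ᶠ t : ℝ in atTop, (vert r t : ℂ).im = t := by
        filter_upwards [Filter.eventually_gt_atTop 0] with t ht using im_vert r ht
      have hQ : Tendsto (fun t => ‖ex (D * (vert r t : ℂ))‖) atTop (𝓝 0) := by
        refine (tendsto_exp_neg hD0 one_pos).congr' ?_
        filter_upwards [him] with t ht
        rw [norm_ex, mul_one]; have : (D : ℂ) = ((D : ℝ) : ℂ) := by push_cast; rfl
        rw [this, im_ofReal_mul, ht]
      have := (tendsto_logPoch
        (X := fun t => ex (D * (leadExp x * (vert r t : ℂ) + y))) (by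
          refine (tendsto_exp_neg hD0 hl).congr' ?_
          filter_upwards [him] with t ht
          rw [norm_ex_lead, ht]) hQ).add (tendsto_logPoch
        (X := fun t => ex (D * ((1 - x) * (vert r t : ℂ) - y))) (by
          refine (tendsto_exp_neg hD0 hx1').congr' ?_
          filter_upwards [him] with t ht
          rw [norm_ex_trail, ht]) hQ)
      rw [add_zero] at this; exact (continuous_im.tendsto 0).comp this
    have h2 := (tendsto_finsetSum N.divisors fun D hD => (h1 D hD).const_mul (n D : ℝ)).const_mul
      (-(12 / (2 * π)))
    simp only [mul_zero, Finset.sum_const_zero] at h2; refine h2.congr fun t => ?_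
    exact (re_siegelLogFn N n x y _).symm
  · refine HolUnits.ext fun τ => ?_
    have h1 : (-siegelUnit N n x y).fn.1 τ = ((siegelUnit N n x y).fn.1 τ)⁻¹ := by
      refine eq_inv_of_mul_eq_one_left ?_
      rw [← HolUnits.fn_add, neg_add_cancel, HolUnits.fn_zero]
    rw [expHom_fn, h1, siegelUnit_fn n h]; exact ex_siegelLogFn hn hx hx1 h τ.im_pos

/-! A summation kernel -/

open Filter Finset in
theorem abs_sum_sub_le {a : ℕ → ℝ} {A C ε : ℝ} {M : ℕ} (hε : 0 ≤ ε)
    (hC : ∀ K, |∑ m ∈ range K, a m - A| ≤ C) (hM : ∀ K ≥ M, |∑ m ∈ range K, a m - A| ≤ ε)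
    {ψ : ℕ → ℝ} (hψ : Antitone ψ) (h0 : ∀ m, 0 ≤ ψ m) {K : ℕ} (hK : M ≤ K) :
    |∑ m ∈ range (K + 1), a m * ψ m - A * ψ 0| ≤ C * (ψ 0 - ψ M) + 2 * ε * ψ 0 := by
  set B : ℕ → ℝ := fun K => ∑ m ∈ range K, a m - A
  have hC0 : 0 ≤ C := (abs_nonneg _).trans (hC 0)
  have h1 : ∀ K, ∑ m ∈ range (K + 1), a m * ψ m - A * ψ 0 =
      B (K + 1) * ψ K + ∑ m ∈ range K, B (m + 1) * (ψ m - ψ (m + 1)) := fun K => by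
    induction K with
    | zero => simp [B]; ring
    | succ K ih =>
      rw [sum_range_succ _ (K + 1), sum_range_succ (fun m => B (m + 1) * (ψ m - ψ (m + 1))) K]
      have e : B (K + 1 + 1) = B (K + 1) + a (K + 1) := by
        simp only [B]; rw [sum_range_succ _ (K + 1)]; ring
      rw [e]
      linear_combination ih
  have h2 : ∀ K, ∑ m ∈ range K, |B (m + 1)| * (ψ m - ψ (m + 1)) ≤
      C * (ψ 0 - ψ (min K M)) + ε * (ψ 0 - ψ K) := fun K => by
    induction K with
    | zero => simp
    | succ K ih =>
      rw [sum_range_succ]; have hd : 0 ≤ ψ K - ψ (K + 1) := sub_nonneg.2 (hψ (Nat.le_succ K))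
      rcases lt_or_ge K M with h | h
      · have e1 : min (K + 1) M = K + 1 := min_eq_left h
        have e2 : min K M = K := min_eq_left h.le
        rw [e1]; rw [e2] at ih; have := mul_le_mul_of_nonneg_right (hC (K + 1)) hd
        have h3 : 0 ≤ ε * (ψ K - ψ (K + 1)) := mul_nonneg hε hd
        simp only [B] at ih ⊢; linarith
      · have e1 : min (K + 1) M = M := min_eq_right (by omega)
        have e2 : min K M = M := min_eq_right h
        rw [e1]; rw [e2] at ih; have := mul_le_mul_of_nonneg_right (hM (K + 1) (by omega)) hd
        simp only [B] at ih ⊢; linarith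
  rw [h1]
  refine (abs_add_le _ _).trans ?_
  have h3 : |B (K + 1) * ψ K| ≤ ε * ψ 0 := by
    rw [abs_mul, abs_of_nonneg (h0 K)]
    exact mul_le_mul (hM _ (by omega)) (hψ (Nat.zero_le K)) (h0 K) hε
  have h4 : |∑ m ∈ range K, B (m + 1) * (ψ m - ψ (m + 1))| ≤
      ∑ m ∈ range K, |B (m + 1)| * (ψ m - ψ (m + 1)) := by
    refine (abs_sum_le_sum_abs _ _).trans (sum_le_sum fun m _ => ?_)
    rw [abs_mul, abs_of_nonneg (sub_nonneg.2 (hψ (Nat.le_succ m)))]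
  have h5 := h2 K
  rw [min_eq_right hK] at h5
  have h6 : 0 ≤ ε * ψ K := mul_nonneg hε (h0 K)
  linarith

open Filter Finset in
theorem tendsto_sum_mul_of_antitone {a : ℕ → ℝ} {A c : ℝ}
    (hA : Tendsto (fun K => ∑ m ∈ range K, a m) atTop (𝓝 A)) {ψ : ℝ → ℕ → ℝ}
    (hψ : ∀ s > 0, Antitone (ψ s)) (h0 : ∀ s > 0, ∀ m, 0 ≤ ψ s m)
    (hc : ∀ m, Tendsto (fun s => ψ s m) (𝓝[>] 0) (𝓝 c)) {F : ℝ → ℝ}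
    (hF : ∀ s > 0, HasSum (fun m : ℕ => a m * ψ s m) (F s)) : Tendsto F (𝓝[>] 0) (𝓝 (A * c)) := by
  have hc0 : 0 ≤ c := ge_of_tendsto (hc 0) (by
    filter_upwards [self_mem_nhdsWithin] with s hs using h0 s hs 0)
  have hB := hA.sub_const A
  rw [sub_self] at hB
  obtain ⟨C, hC⟩ := hB.abs.bddAbove_range
  have hC' : ∀ K, |∑ m ∈ range K, a m - A| ≤ C := fun K => hC ⟨K, rfl⟩
  have key : Tendsto (fun s => F s - A * ψ s 0) (𝓝[>] 0) (𝓝 0) := by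
    rw [Metric.tendsto_nhds]; intro ε hε
    set ε' := ε / (2 * (2 * c + 1)) with hε'
    have hε'0 : 0 < ε' := by positivity
    obtain ⟨M, hM⟩ := (Metric.tendsto_atTop.1 hB ε' hε'0)
    have hM' : ∀ K ≥ M, |∑ m ∈ range K, a m - A| ≤ ε' := fun K hK => by
      have := hM K hK; rw [Real.dist_eq, sub_zero] at this; exact this.le
    have hb : Tendsto (fun s => C * (ψ s 0 - ψ s M) + 2 * ε' * ψ s 0)
        (𝓝[>] 0) (𝓝 (C * (c - c) + 2 * ε' * c)) :=
      (((hc 0).sub (hc M)).const_mul C).add ((hc 0).const_mul _)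
    have hlt : C * (c - c) + 2 * ε' * c < ε := by
      rw [sub_self, mul_zero, zero_add, hε']; rw [div_eq_mul_inv, mul_inv]
      have h1 : c * (2 * c + 1)⁻¹ < 1 := by
        rw [← div_eq_mul_inv, div_lt_one (by positivity)]; linarith
      have : 2 * (ε * (2⁻¹ * (2 * c + 1)⁻¹)) * c = ε * (c * (2 * c + 1)⁻¹) := by ring
      rw [this]; nlinarith
    filter_upwards [hb.eventually_lt_const hlt, self_mem_nhdsWithin] with s hs hs0
    have hs0 : (0 : ℝ) < s := hs0
    rw [Real.dist_eq, sub_zero]; refine lt_of_le_of_lt ?_ hs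
    have hT := ((hF s hs0).tendsto_sum_nat.comp (tendsto_add_atTop_nat 1)).sub_const (A * ψ s 0)
    refine le_of_tendsto hT.abs ?_
    filter_upwards [eventually_ge_atTop M] with K hK
    exact abs_sum_sub_le hε'0.le hC' hM' (hψ s hs0) (h0 s hs0) hK
  have := key.add ((hc 0).const_mul A)
  simpa using this

open Filter Finset in
theorem tendsto_sum_mul_antitone {a : ℕ → ℝ} {A c : ℝ}
    (hA : Tendsto (fun K => ∑ m ∈ range K, a m) atTop (𝓝 A)) {ψ : ℝ → ℝ}
    (hψ : AntitoneOn ψ (Ioi 0)) (h0 : ∀ s > 0, 0 ≤ ψ s) (hc : Tendsto ψ (𝓝[>] 0) (𝓝 c)) {F : ℝ → ℝ}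
    (hF : ∀ s > 0, HasSum (fun m : ℕ => a m * ψ ((m + 1) * s)) (F s)) :
    Tendsto F (𝓝[>] 0) (𝓝 (A * c)) := by
  have hpos : ∀ (m : ℕ) {s : ℝ}, 0 < s → 0 < ((m : ℝ) + 1) * s := fun m s hs => by positivity
  refine tendsto_sum_mul_of_antitone hA (ψ := fun s m => ψ ((m + 1) * s))
    (fun s hs i j hij => hψ (hpos i hs) (hpos j hs) (mul_le_mul_of_nonneg_right
      (mod_cast Nat.succ_le_succ hij) hs.le)) (fun s hs m => h0 _ (hpos m hs))
    (fun m => hc.comp (tendsto_nhdsWithin_of_tendsto_nhds_of_eventually_within _ ?_ ?_)) hF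
  · have : Tendsto (fun s : ℝ => ((m : ℝ) + 1) * s) (𝓝 0) (𝓝 ((m + 1) * 0)) :=
      tendsto_id.const_mul _
    rw [mul_zero] at this; exact this.mono_left nhdsWithin_le_nhds
  · filter_upwards [self_mem_nhdsWithin] with s hs using hpos m hs

/-- The kernel `(e^{-sξ} - e^{-s(1-ξ)}) / (1 - e^{-s})`. -/
def lambertKernel (ξ s : ℝ) : ℝ := (exp (-(s * ξ)) - exp (-(s * (1 - ξ)))) / (1 - exp (-s))

theorem lambertKernel_eq (ξ : ℝ) {s : ℝ} (hs : 0 < s) :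
    lambertKernel ξ s = sinh ((1 / 2 - ξ) * s) / sinh (s / 2) := by
  have h1 : 1 - exp (-s) ≠ 0 := by
    have : exp (-s) < 1 := by rw [Real.exp_lt_one_iff]; linarith
    linarith
  have h2 : sinh (s / 2) ≠ 0 := (Real.sinh_pos_iff.2 (by linarith)).ne'
  rw [lambertKernel, div_eq_div_iff h1 h2, Real.sinh_eq, Real.sinh_eq]
  have e : ∀ x y : ℝ, exp x * exp y = exp (x + y) := fun x y => (Real.exp_add x y).symm
  ring_nf
  simp only [e]
  ring_nf

theorem lambertKernel_one_sub (ξ s : ℝ) : lambertKernel (1 - ξ) s = -lambertKernel ξ s := by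
  rw [lambertKernel, lambertKernel, ← neg_div]; ring_nf

theorem antitoneOn_lambertKernel {ξ : ℝ} (h0 : 0 ≤ ξ) (h1 : ξ ≤ 1 / 2) :
    AntitoneOn (lambertKernel ξ) (Ioi 0) := by
  set α := 1 / 2 - ξ with hα
  have hα0 : 0 ≤ α := by linarith
  have hα1 : α ≤ 1 / 2 := by linarith
  have hd : ∀ s : ℝ, HasDerivAt (fun s => α * cosh (α * s) * sinh (s / 2) -
      1 / 2 * sinh (α * s) * cosh (s / 2))
      ((α ^ 2 - 1 / 4) * (sinh (α * s) * sinh (s / 2))) s := fun s => by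
    have e1 := (hasDerivAt_id s).const_mul α
    have e2 := (hasDerivAt_id s).div_const 2
    have := (((e1.cosh).const_mul α).mul e2.sinh).sub (((e1.sinh).const_mul (1 / 2)).mul e2.cosh)
    refine this.congr_deriv ?_
    simp only [id]; ring
  have hle : ∀ s : ℝ, 0 < s → α * cosh (α * s) * sinh (s / 2) -
      1 / 2 * sinh (α * s) * cosh (s / 2) ≤ 0 := fun s hs => by
    have := antitoneOn_of_deriv_nonpos (convex_Ici (0 : ℝ))
      (f := fun s => α * cosh (α * s) * sinh (s / 2) - 1 / 2 * sinh (α * s) * cosh (s / 2))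
      (fun s _ => (hd s).continuousAt.continuousWithinAt)
      (fun s _ => (hd s).differentiableAt.differentiableWithinAt) (fun s hs => by
        rw [interior_Ici, Set.mem_Ioi] at hs; rw [(hd s).deriv]
        have e1 := Real.sinh_nonneg_iff.2 (mul_nonneg hα0 hs.le)
        have e2 := Real.sinh_nonneg_iff.2 (half_pos hs).le
        exact mul_nonpos_of_nonpos_of_nonneg (by nlinarith) (mul_nonneg e1 e2))
    have := this (Set.mem_Ici.2 le_rfl) (Set.mem_Ici.2 hs.le) hs.le; simpa using this
  have hd2 : ∀ s : ℝ, 0 < s → HasDerivAt (fun s => sinh (α * s) / sinh (s / 2))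
      ((α * cosh (α * s) * sinh (s / 2) - 1 / 2 * sinh (α * s) * cosh (s / 2)) /
        sinh (s / 2) ^ 2) s := fun s hs => by
    have e1 := (hasDerivAt_id s).const_mul α
    have e2 := (hasDerivAt_id s).div_const 2
    refine (e1.sinh.div e2.sinh (Real.sinh_pos_iff.2 (by simpa using half_pos hs)).ne').congr_deriv ?_
    simp only [id]; ring
  have : AntitoneOn (fun s => sinh (α * s) / sinh (s / 2)) (Ioi 0) := by
    refine antitoneOn_of_deriv_nonpos (convex_Ioi 0)
      (fun s hs => (hd2 s hs).continuousAt.continuousWithinAt)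
      (fun s hs => (hd2 s (interior_subset hs)).differentiableAt.differentiableWithinAt) fun s hs => ?_
    rw [(hd2 s (interior_subset hs)).deriv]
    exact div_nonpos_of_nonpos_of_nonneg (hle s (interior_subset hs)) (sq_nonneg _)
  exact this.congr fun s hs => (lambertKernel_eq ξ hs).symm

theorem lambertKernel_nonneg {ξ : ℝ} (h1 : ξ ≤ 1 / 2) {s : ℝ} (hs : 0 < s) : 0 ≤ lambertKernel ξ s := by
  rw [lambertKernel_eq ξ hs]
  exact div_nonneg (Real.sinh_nonneg_iff.2 (mul_nonneg (by linarith) hs.le))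
    (Real.sinh_nonneg_iff.2 (by linarith))

theorem tendsto_lambertKernel (ξ : ℝ) : Tendsto (lambertKernel ξ) (𝓝[>] 0) (𝓝 (1 - 2 * ξ)) := by
  have key : ∀ α : ℝ, Tendsto (fun s => s⁻¹ * sinh (α * s)) (𝓝[>] 0) (𝓝 α) := fun α => by
    have h := ((hasDerivAt_id (0 : ℝ)).const_mul α).sinh
    have h2 := h.tendsto_slope_zero_right
    simpa using h2
  have h := (key (1 / 2 - ξ)).div (key (1 / 2)) (by norm_num)
  have e : (1 / 2 - ξ) / (1 / 2) = 1 - 2 * ξ := by ring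
  rw [e] at h
  refine h.congr' ?_
  filter_upwards [self_mem_nhdsWithin] with s hs
  have hs : (0 : ℝ) < s := hs
  have h2 : sinh (s / 2) ≠ 0 := (Real.sinh_pos_iff.2 (by linarith)).ne'
  rw [lambertKernel_eq ξ hs, Pi.div_apply, show (1 : ℝ) / 2 * s = s / 2 by ring]
  field_simp

/-! The sawtooth function -/

/-- The sawtooth function, the periodic first Bernoulli function. -/
def sawtooth (x : ℚ) : ℚ := if fract x = 0 then 0 else fract x - 1 / 2

theorem sawtooth_add_int (x : ℚ) (z : ℤ) : sawtooth (x + z) = sawtooth x := by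
  rw [sawtooth, sawtooth, Int.fract_add_intCast]

theorem sawtooth_of_mem (h0 : 0 < x) (h1 : x < 1) : sawtooth x = x - 1 / 2 := by
  have : fract x = x := Int.fract_eq_self.2 ⟨h0.le, h1⟩
  rw [sawtooth, this, if_neg h0.ne']

theorem sawtooth_zero : sawtooth 0 = 0 := by simp [sawtooth]

theorem log_one_sub_ex {η : ℝ} (h0 : 0 < η) (h1 : η < 1) :
    0 < (1 - ex η).re ∧ (log (1 - ex η)).im = π * (η - 1 / 2) := by
  have hs : 0 < sin (π * η) := Real.sin_pos_of_pos_of_lt_pi (by positivity) (by nlinarith [pi_pos])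
  have e : (1 - ex η) = ((2 * sin (π * η) : ℝ) : ℂ) *
      (Complex.cos ((π * (η - 1 / 2) : ℝ) : ℂ) + Complex.sin ((π * (η - 1 / 2) : ℝ) : ℂ) * I) := by
    have e1 : ex η = Complex.exp ((2 * (π * η) : ℝ) * I) := by rw [ex]; congr 1; push_cast; ring
    have e2 : π * (η - 1 / 2) = π * η - π / 2 := by ring
    rw [e1, Complex.exp_mul_I, ← ofReal_cos, ← ofReal_sin, ← ofReal_cos,
      ← ofReal_sin, e2, Real.cos_sub_pi_div_two, Real.sin_sub_pi_div_two, Real.cos_two_mul,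
      Real.sin_two_mul]
    have := Real.sin_sq_add_cos_sq (π * η)
    have h3 : ((sin (π * η) : ℝ) : ℂ) ^ 2 + ((Real.cos (π * η) : ℝ) : ℂ) ^ 2 = 1 := by
      exact_mod_cast this
    push_cast at h3 ⊢
    linear_combination -2 * h3
  constructor
  · rw [e, re_ofReal_mul, ← ofReal_cos, ← ofReal_sin]
    have e2 : π * (η - 1 / 2) = π * η - π / 2 := by ring
    rw [e2, Real.cos_sub_pi_div_two]
    rw [Complex.add_re, Complex.ofReal_re, Complex.mul_I_re, ofReal_im, neg_zero, add_zero]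
    positivity
  · rw [Complex.log_im, e, Complex.arg_mul_cos_add_sin_mul_I (by positivity)]
    constructor <;> nlinarith [pi_pos]

open Filter in
/-- The Fourier series of the sawtooth function. -/
theorem tendsto_sum_sin_div (η : ℚ) :
    Tendsto (fun K => ∑ m ∈ range K, (ex ((m + 1) * η)).im / (m + 1)) atTop (𝓝 (-(π * sawtooth η))) := by
  have hper : ∀ m : ℕ, ex ((m + 1) * η) = ex ((m + 1) * (fract η : ℚ)) := fun m => by
    have : (η : ℂ) = (⌊η⌋ : ℂ) + (fract η : ℚ) := by
      have := Int.floor_add_fract η; exact_mod_cast this.symm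
    have e : (m + 1 : ℂ) * η = (m + 1) * (fract η : ℚ) + (((m + 1) * ⌊η⌋ : ℤ) : ℂ) := by
      rw [this]; push_cast; ring
    rw [e, ex_add, ex_int, mul_one]
  simp only [hper]
  rw [sawtooth]
  split_ifs with h0
  · simp [h0, ex_zero]
  set θ : ℝ := ((fract η : ℚ) : ℝ) with hθ
  have hθc : ((fract η : ℚ) : ℂ) = (θ : ℂ) := by rw [hθ, Complex.ofReal_ratCast]
  have hθ0 : 0 < θ := by rw [hθ]; exact_mod_cast lt_of_le_of_ne (Int.fract_nonneg η) (Ne.symm h0)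
  have hθ1 : θ < 1 := by rw [hθ]; exact_mod_cast Int.fract_lt_one η
  obtain ⟨hre, him⟩ := log_one_sub_ex hθ0 hθ1
  set w := ex (θ : ℂ) with hw
  have hw1 : w ≠ 1 := fun h => by rw [h] at hre; simp at hre
  have hwn : ‖w‖ = 1 := by rw [hw, norm_ex]; simp
  have hpow : ∀ m : ℕ, ex ((m + 1) * (fract η : ℚ)) = w ^ (m + 1) := fun m => by
    rw [hθc, hw, ← ex_nat_mul]; push_cast; rfl
  simp only [hpow]
  have hcau : CauchySeq fun K => ∑ m ∈ range K, ((m + 1 : ℝ)⁻¹) • w ^ (m + 1) := by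
    refine Antitone.cauchySeq_series_mul_of_tendsto_zero_of_bounded (b := 2 / ‖w - 1‖) ?_ ?_ ?_
    · intro i j hij; have : (i : ℝ) ≤ j := mod_cast hij
      exact inv_anti₀ (by positivity) (by linarith)
    · exact (tendsto_one_div_add_atTop_nhds_zero_nat (𝕜 := ℝ)).congr fun m => by rw [one_div]
    · intro K
      have : ∑ i ∈ range K, w ^ (i + 1) = w * ((w ^ K - 1) / (w - 1)) := by
        rw [← geom_sum_eq hw1, mul_sum]; exact sum_congr rfl fun i _ => by rw [pow_succ']
      rw [this, norm_mul, hwn, one_mul, norm_div]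
      refine div_le_div_of_nonneg_right ?_ (norm_nonneg _)
      refine (norm_sub_le _ _).trans ?_
      rw [norm_pow, hwn, one_pow, norm_one]; norm_num
  obtain ⟨l, hl⟩ := cauchySeq_tendsto_of_complete hcau
  have hl2 : Tendsto (fun K => ∑ m ∈ range K, w ^ m / (m : ℂ)) atTop (𝓝 l) := by
    refine (tendsto_add_atTop_iff_nat 1).1 (hl.congr fun K => ?_)
    rw [sum_range_succ']; simp only [cast_zero, div_zero, add_zero]
    refine sum_congr rfl fun m _ => ?_
    rw [Complex.real_smul]; push_cast; rw [div_eq_inv_mul]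
  have habel := Complex.tendsto_tsum_powerSeries_nhdsWithin_lt hl2
  rw [tendsto_map'_iff] at habel
  have hlim : Tendsto (fun x : ℝ => -log (1 - w * x)) (nhdsWithin 1 (Set.Iio 1))
      (𝓝 (-log (1 - w))) := by
    have hc : ContinuousAt (fun x : ℝ => -log (1 - w * x)) 1 := by
      refine ContinuousAt.neg (ContinuousAt.clog (by fun_prop) ?_)
      rw [Complex.ofReal_one, mul_one]; exact Or.inl hre
    have := hc.tendsto; simp only [Complex.ofReal_one, mul_one] at this
    exact this.mono_left nhdsWithin_le_nhds
  have hl3 : l = -log (1 - w) := by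
    refine tendsto_nhds_unique habel (hlim.congr' ?_)
    have h01 : ∀ᶠ x : ℝ in nhdsWithin 1 (Set.Iio 1), 0 < x :=
      (eventually_gt_nhds one_pos).filter_mono nhdsWithin_le_nhds
    filter_upwards [self_mem_nhdsWithin, h01] with x hx hx0
    have hx : x < 1 := hx
    have hnorm : ‖w * x‖ < 1 := by
      rw [norm_mul, hwn, one_mul, norm_real, norm_eq_abs, abs_of_pos hx0]; exact hx
    rw [← (Complex.hasSum_taylorSeries_neg_log hnorm).tsum_eq]; refine tsum_congr fun m => ?_
    rw [mul_pow]; ring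
  have h5 := (continuous_im.tendsto l).comp hl
  rw [hl3, neg_im, him] at h5
  have e : -(π * ((fract η - 1 / 2 : ℚ) : ℝ)) = -(π * (θ - 1 / 2)) := by
    rw [hθ, Rat.cast_sub]; norm_num
  rw [e]
  refine h5.congr fun K => ?_
  simp only [comp, im_sum]
  refine sum_congr rfl fun m _ => ?_
  rw [Complex.smul_im, smul_eq_mul, div_eq_inv_mul]

/-! The Siegel units at the cusps -/

theorem sum_logPoch_mul_pow (hX : ‖X‖ < 1) (hQ : ‖Q‖ < 1) (hk : 0 < k) :
    ∑ h ∈ range k, logPoch (X * Q ^ h) (Q ^ k) = logPoch X Q := by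
  have hXh : ∀ h : ℕ, ‖X * Q ^ h‖ < 1 := fun h => by
    rw [norm_mul, norm_pow]
    exact mul_lt_one_of_nonneg_of_lt_one_left (norm_nonneg _) hX (pow_le_one₀ (norm_nonneg _) hQ.le)
  have hQk := norm_pow_lt_one hQ hk
  simp only [logPoch]
  rw [sum_neg_distrib, ← Summable.tsum_finsetSum fun h _ => summable_logPoch (hXh h) hQk]
  congr 1
  refine tsum_congr fun m => ?_
  have hm : (m + 1 : ℂ) ≠ 0 := mod_cast succ_ne_zero m
  have hne : ∀ j : ℕ, 0 < j → 1 - Q ^ j ≠ 0 := fun j hj h => by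
    have h6 := norm_pow_lt_one hQ hj
    rw [← sub_eq_zero.1 h] at h6; simp at h6
  have h1 := hne (m + 1) (succ_pos m)
  have h2 := hne (k * (m + 1)) (Nat.mul_pos hk (succ_pos m))
  have h3 := mul_neg_geom_sum (Q ^ (m + 1)) k
  rw [← pow_mul, mul_comm (m + 1) k] at h3
  have h4 : ∀ h : ℕ, (X * Q ^ h) ^ (m + 1) / ((m + 1) * (1 - (Q ^ k) ^ (m + 1))) =
      (Q ^ (m + 1)) ^ h * (X ^ (m + 1) / ((m + 1) * (1 - Q ^ (k * (m + 1))))) := fun h => by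
    rw [mul_pow, ← pow_mul, ← pow_mul, ← pow_mul, mul_comm (m + 1) h]; ring
  simp only [h4]
  rw [← sum_mul, ← mul_div_assoc, div_eq_div_iff (mul_ne_zero hm h2) (mul_ne_zero hm h1)]
  linear_combination X ^ (m + 1) * (m + 1) * h3

/-- The Lambert series with argument `e(η) e^{-sξ}` and parameter `e^{-s}`. -/
def lambert (η ξ : ℚ) (s : ℝ) : ℂ := logPoch (ex η * exp (-(s * ξ))) (exp (-s))

theorem lambert_add_int (η ξ : ℚ) (s : ℝ) (z : ℤ) : lambert (η + z) ξ s = lambert η ξ s := by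
  rw [lambert, Rat.cast_add, ex_add, Rat.cast_intCast, ex_int, mul_one, lambert]

/-- The contribution of a pair of opposite Lambert series to the argument of a Siegel unit. -/
def pairArg (η ξ : ℚ) (s : ℝ) : ℝ := (lambert η ξ s + lambert (-η) (1 - ξ) s).im

theorem norm_ex_ratCast (η : ℚ) : ‖ex η‖ = 1 := by
  rw [norm_ex, ← Complex.ofReal_ratCast, ofReal_im]; simp

theorem conj_ex_ratCast (η : ℚ) : (starRingEnd ℂ) (ex η) = ex (-η) := by
  rw [ex, ex, ← Complex.exp_conj]
  congr 1
  simp only [map_mul, Complex.conj_ofReal, Complex.conj_I, map_ratCast, map_ofNat]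
  ring

theorem norm_ex_mul_exp_lt_one (η : ℚ) {x : ℝ} (hx : 0 < x) : ‖ex η * exp (-x)‖ < 1 := by
  rw [norm_mul, norm_ex_ratCast, one_mul, norm_real, norm_eq_abs, Real.abs_exp, Real.exp_lt_one_iff]
  linarith

theorem norm_exp_lt_one {s : ℝ} (hs : 0 < s) : ‖((exp (-s) : ℝ) : ℂ)‖ < 1 := by
  simpa [ex_zero] using norm_ex_mul_exp_lt_one 0 hs

theorem im_logPoch_term (η : ℚ) (x s : ℝ) (m : ℕ) :
    ((ex η * exp (-x)) ^ (m + 1) / ((m + 1) * (1 - (exp (-s) : ℂ) ^ (m + 1)))).im =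
      (ex ((m + 1) * η)).im / (m + 1) * (exp (-((m + 1) * x)) / (1 - exp (-((m + 1) * s)))) := by
  have e : ∀ x : ℝ, (exp (-x) : ℂ) ^ (m + 1) = ((exp (-((m + 1) * x)) : ℝ) : ℂ) := fun x => by
    rw [← ofReal_pow, ← Real.exp_nat_mul]; congr 2; push_cast; ring
  have e2 : ex η ^ (m + 1) = ex ((m + 1) * η) := by rw [← ex_nat_mul]; push_cast; rfl
  rw [mul_pow, e, e, e2]
  have : ex ((m + 1) * η) * ((exp (-((m + 1) * x)) : ℝ) : ℂ) /
      ((m + 1) * (1 - ((exp (-((m + 1) * s)) : ℝ) : ℂ))) =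
      ex ((m + 1) * η) * ((exp (-((m + 1) * x)) / ((m + 1) * (1 - exp (-((m + 1) * s)))) : ℝ) : ℂ) := by
    push_cast; ring
  rw [this, Complex.im_mul_ofReal]
  rw [div_mul_div_comm]; ring

theorem hasSum_pairArg (η : ℚ) {ξ : ℚ} (h0 : 0 < ξ) (h1 : ξ < 1) {s : ℝ} (hs : 0 < s) :
    HasSum (fun m : ℕ => (ex ((m + 1) * η)).im / (m + 1) * lambertKernel ξ ((m + 1) * s))
      (-pairArg η ξ s) := by
  have h0' : (0 : ℝ) < ξ := mod_cast h0
  have h1' : (0 : ℝ) < 1 - ξ := sub_pos.2 (mod_cast h1)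
  have hX := norm_ex_mul_exp_lt_one η (mul_pos hs h0')
  have hY := norm_ex_mul_exp_lt_one (-η) (mul_pos hs h1')
  have hq := norm_exp_lt_one hs
  have h2 := Complex.hasSum_im ((summable_logPoch hX hq).hasSum.add (summable_logPoch hY hq).hasSum)
  have e : (∑' m : ℕ, (ex η * exp (-(s * ξ))) ^ (m + 1) /
      ((m + 1) * (1 - (exp (-s) : ℂ) ^ (m + 1))) + ∑' m : ℕ,
      (ex ((-η : ℚ)) * exp (-(s * (1 - ξ)))) ^ (m + 1) /
      ((m + 1) * (1 - (exp (-s) : ℂ) ^ (m + 1)))).im = -pairArg η ξ s := by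
    rw [pairArg, lambert, lambert, logPoch, logPoch, ← neg_add, neg_im, neg_neg,
      Rat.cast_sub, Rat.cast_one]
  rw [e] at h2
  refine h2.congr_fun ?_ |> fun h => h
  intro m
  rw [add_im, im_logPoch_term, im_logPoch_term, lambertKernel]
  have e3 : (ex ((m + 1) * ((-η : ℚ) : ℂ))).im = -(ex ((m + 1) * η)).im := by
    have h := conj_ex_ratCast ((m + 1) * η)
    have e4 : (((m + 1) * η : ℚ) : ℂ) = (m + 1) * η := by push_cast; ring
    rw [e4] at h; rw [Rat.cast_neg, mul_neg, ← h, Complex.conj_im]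
  rw [e3, mul_assoc (m + 1 : ℝ) s ξ, mul_assoc (m + 1 : ℝ) s (1 - ξ)]
  ring

theorem tendsto_pairArg (η : ℚ) {ξ : ℚ} (h0 : 0 < ξ) (h1 : ξ < 1) : Tendsto (pairArg η ξ) (𝓝[>] 0)
      (𝓝 (-(2 * π) * (sawtooth ξ * sawtooth η : ℚ))) := by
  have e : -(2 * π) * ((sawtooth ξ * sawtooth η : ℚ) : ℝ) = -(-(π * sawtooth η) * (1 - 2 * ξ)) := by
    rw [sawtooth_of_mem h0 h1]; push_cast; ring
  rw [e]
  rcases le_or_gt ξ (1 / 2) with h | h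
  · have h' : (ξ : ℝ) ≤ 1 / 2 := by
      have : ((1 / 2 : ℚ) : ℝ) = 1 / 2 := by norm_num
      rw [← this]; exact_mod_cast h
    have := tendsto_sum_mul_antitone (tendsto_sum_sin_div η)
      (antitoneOn_lambertKernel (mod_cast h0.le) h')
      (fun s hs => lambertKernel_nonneg h' hs) (tendsto_lambertKernel ξ)
      (fun s hs => hasSum_pairArg η h0 h1 hs)
    simpa using this.neg
  · have h' : (1 - ξ : ℝ) ≤ 1 / 2 := by
      have : ((1 / 2 : ℚ) : ℝ) < ξ := mod_cast h
      push_cast at this; linarith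
    have := tendsto_sum_mul_antitone (tendsto_sum_sin_div η)
      (antitoneOn_lambertKernel (ξ := 1 - ξ) (sub_nonneg.2 (mod_cast h1.le)) h')
      (fun s hs => lambertKernel_nonneg h' hs) (tendsto_lambertKernel (1 - ξ))
      (F := pairArg η ξ)
      (fun s hs => by
        have := (hasSum_pairArg η h0 h1 hs).neg
        simpa [lambertKernel_one_sub] using this)
    convert this using 2
    ring

theorem logPoch_conj (X : ℂ) (q : ℝ) : logPoch ((starRingEnd ℂ) X) q = (starRingEnd ℂ) (logPoch X q) := by
  rw [logPoch, logPoch, map_neg, Complex.conj_tsum]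
  congr 1
  refine tsum_congr fun m => ?_
  simp [map_div₀]

theorem lambert_neg_im (η ξ : ℚ) (s : ℝ) : (lambert (-η) ξ s).im = -(lambert η ξ s).im := by
  rw [lambert, lambert, Rat.cast_neg, ← conj_ex_ratCast, ← Complex.conj_im, ← logPoch_conj, map_mul,
    Complex.conj_ofReal]

theorem ex_on_line {b : ℕ} {a : ℤ} (hb : 0 < b) {w ζ : ℚ} (h : (D : ℚ) * w = b * ζ) (ht : 0 < t) :
    ex (D * (w * (vert ((a : ℝ) / b) t : ℂ) + y)) =
      ex ((a * ζ + D * y : ℚ)) * exp (-(2 * π * b * t * ζ)) := by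
  have hb0 : (b : ℂ) ≠ 0 := mod_cast hb.ne'
  have h' : (D : ℂ) * w = b * ζ := mod_cast congrArg (Rat.cast : ℚ → ℂ) h
  have e : (D : ℂ) * (w * (vert ((a : ℝ) / b) t : ℂ) + y) =
      ((a * ζ + D * y : ℚ) : ℂ) + I * (b * t * ζ) := by
    rw [coe_vert _ ht, mul_add, ← mul_assoc, h']; push_cast; field_simp; ring
  rw [e, ex_add]
  congr 1
  rw [ex, ofReal_exp]
  congr 1
  push_cast
  linear_combination (2 * π * b * t * ζ : ℂ) * Complex.I_mul_I

theorem tendsto_two_pi_mul {b : ℕ} (hb : 0 < b) :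
    Tendsto (fun t : ℝ => 2 * π * b * t) (𝓝[>] 0) (𝓝[>] 0) := by
  have hb' : (0 : ℝ) < b := mod_cast hb
  have hpi := pi_pos
  refine tendsto_nhdsWithin_of_tendsto_nhds_of_eventually_within _ ?_ ?_
  · have : Tendsto (fun t : ℝ => 2 * π * b * t) (𝓝 0) (𝓝 (2 * π * b * 0)) := tendsto_id.const_mul _
    rw [mul_zero] at this; exact this.mono_left nhdsWithin_le_nhds
  · filter_upwards [self_mem_nhdsWithin] with t ht
    have : (0 : ℝ) < t := ht
    exact Set.mem_Ioi.2 (by positivity)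

theorem tendsto_sum_pairArg {b : ℕ} (hb : 0 < b) {B : ℕ} {η ξ : ℕ → ℚ}
    (hξ : ∀ h < B, 0 < ξ h ∧ ξ h < 1) :
    Tendsto (fun t => ∑ h ∈ range B, pairArg (η h) (ξ h) (2 * π * b * t)) (𝓝[>] 0)
      (𝓝 (-(2 * π) * (∑ h ∈ range B, sawtooth (ξ h) * sawtooth (η h) : ℚ))) := by
  rw [cast_sum, mul_sum]
  refine tendsto_finsetSum _ fun h hh => ?_
  obtain ⟨h0, h1⟩ := hξ h (mem_range.1 hh)
  exact (tendsto_pairArg (η h) h0 h1).comp (tendsto_two_pi_mul hb)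

theorem tendsto_siegelLogTerm {B b : ℕ} (hD : 0 < D) (hB : 0 < B) (hb : b = D * B) (a : ℤ)
    (hx : 0 ≤ x) (hx1 : x < 1) : Tendsto (fun t => (siegelLogTerm D x y (vert ((a : ℝ) / b) t)).im)
      (𝓝[>] 0) (𝓝 (-(2 * π) * (∑ h ∈ range B,
      sawtooth ((h + x) / B) * sawtooth (a * ((h + x) / B) + D * y) : ℚ))) := by
  have hb0 : 0 < b := hb ▸ Nat.mul_pos hD hB
  have hBq : (0 : ℚ) < B := mod_cast hB
  have hbq : (b : ℚ) = D * B := by rw [hb]; push_cast; rfl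
  have split : ∀ t : ℝ, 0 < t → siegelLogTerm D x y (vert ((a : ℝ) / b) t) =
      ∑ h ∈ range B, lambert (a * ((h + leadExp x) / B) + D * y) ((h + leadExp x) / B)
        (2 * π * b * t) +
      ∑ h ∈ range B, lambert (a * ((h + (1 - x)) / B) + D * (-y)) ((h + (1 - x)) / B)
        (2 * π * b * t) := by
    intro t ht
    set τ := vert ((a : ℝ) / b) t with hτ
    have hQB : ex (D * (τ : ℂ)) ^ B = exp (-(2 * π * b * t)) := by
      have := ex_on_line (D := D * B) (b := b) (a := a) hb0 (w := 1) (ζ := 1) (y := 0)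
        (by rw [hbq]; push_cast; ring) ht
      rw [← ex_nat_mul]; have e1 : ((a * 1 + (D * B : ℕ) * 0 : ℚ) : ℂ) = a := by push_cast; ring
      rw [e1, ex_int, one_mul, Rat.cast_one, Rat.cast_one, mul_one] at this; rw [← this]
      congr 1; push_cast; ring
    rw [siegelLogTerm, ← sum_logPoch_mul_pow (norm_lead_lt_one hD hx y τ.im_pos)
      (norm_ex_mul_lt_one hD τ.im_pos) hB, ← sum_logPoch_mul_pow (norm_trail_lt_one hD hx1 y τ.im_pos)
      (norm_ex_mul_lt_one hD τ.im_pos) hB, hQB]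
    congr 1
    · refine sum_congr rfl fun h _ => ?_
      rw [lambert, ← ex_on_line (D := D) (b := b) (a := a) hb0 (w := h + leadExp x)
        (by rw [hbq]; field_simp) ht, ← ex_nat_mul, ← ex_add]
      congr 2; push_cast; ring
    · refine sum_congr rfl fun h _ => ?_
      rw [lambert, ← ex_on_line (D := D) (b := b) (a := a) hb0 (w := h + (1 - x))
        (by rw [hbq]; field_simp) ht, ← ex_nat_mul, ← ex_add]
      congr 2; push_cast; ring
  by_cases hx0 : x = 0
  · subst hx0; obtain ⟨B, rfl⟩ : ∃ B', B = B' + 1 := ⟨B - 1, by omega⟩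
    rw [sum_range_succ']
    have e0 : sawtooth (((0 : ℕ) + 0 : ℚ) / (B + 1 : ℕ)) = 0 := by simp [sawtooth_zero]
    rw [e0, zero_mul, add_zero]
    refine (tendsto_sum_pairArg hb0 fun h hh => ⟨by positivity, ?_⟩).congr' ?_
    · rw [div_lt_one hBq]; have : (h : ℚ) < B := mod_cast hh; push_cast; linarith
    · filter_upwards [self_mem_nhdsWithin] with t ht
      rw [split t ht, sum_range_succ, sum_range_succ, leadExp, if_pos rfl,
        add_add_add_comm, add_im _ (_ + _), add_im (lambert _ _ _)]
      have e1 : (((B : ℕ) : ℚ) + 1) / (B + 1 : ℕ) = 1 := by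
        push_cast; exact div_self (by positivity)
      have e2 : (a : ℚ) * 1 + D * -y = -(a * 1 + D * y) + ((2 * a : ℤ) : ℚ) := by push_cast; ring
      rw [sub_zero, e1, e2, lambert_add_int, lambert_neg_im, add_neg_cancel, add_zero,
        ← Finset.sum_range_reflect (fun h => lambert (a * ((h + 1) / (B + 1 : ℕ)) + D * -y) _ _),
        ← sum_add_distrib, im_sum]
      refine sum_congr rfl fun h hh => ?_
      have hh' := mem_range.1 hh
      rw [pairArg]
      have e3 : ((B - 1 - h : ℕ) : ℚ) + 1 = B - h := by
        rw [cast_sub (by omega), cast_sub (by omega)]; push_cast; ring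
      have e4 : ((B : ℚ) - h) / (B + 1 : ℕ) = 1 - (((h + 1 : ℕ) : ℚ) + 0) / (B + 1 : ℕ) := by
        field_simp; push_cast; ring
      rw [e3, e4]
      have e5 : (a : ℚ) * (1 - (((h + 1 : ℕ) : ℚ) + 0) / (B + 1 : ℕ)) + D * -y =
        -(a * ((((h + 1 : ℕ) : ℚ) + 0) / (B + 1 : ℕ)) + D * y) + (a : ℤ) := by ring
      rw [e5, lambert_add_int]; push_cast; rw [add_zero]
  · have hx' : 0 < x := lt_of_le_of_ne hx (Ne.symm hx0)
    refine (tendsto_sum_pairArg hb0 fun h hh => ⟨by positivity, ?_⟩).congr' ?_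
    · rw [div_lt_one hBq]; have : (h : ℚ) + 1 ≤ B := mod_cast hh; linarith
    · filter_upwards [self_mem_nhdsWithin] with t ht
      rw [split t ht, leadExp, if_neg hx0,
        ← Finset.sum_range_reflect (fun h => lambert (a * ((h + (1 - x)) / B) + D * -y) _ _),
        ← sum_add_distrib, im_sum]
      refine sum_congr rfl fun h hh => ?_
      have hh' := mem_range.1 hh
      rw [pairArg]
      have e4 : (((B - 1 - h : ℕ) : ℚ) + (1 - x)) / B = 1 - ((h : ℚ) + x) / B := by
        rw [cast_sub (by omega), cast_sub (by omega)]; field_simp; push_cast; ring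
      have e5 : (a : ℚ) * (1 - ((h : ℚ) + x) / B) + D * -y =
        -(a * (((h : ℚ) + x) / B) + D * y) + (a : ℤ) := by ring
      rw [e4, e5, lambert_add_int]

/-! The logarithm of the distribution of Siegel units and its cocycle -/

open Classical in
/-- The logarithm of the inverse of the Siegel unit at `(x, y)` whose real part tends to `0` at
`i∞`, divided by `2πi`. -/
def siegelLog (N : ℕ) (n : ℕ → ℤ) (x y : ℚ) : Hol :=
  if h : ∃ F ∈ reVanishing, expHom F = -siegelUnit N n x y ∧
    ∀ τ : ℍ, F.1 τ = siegelLogFn N n (fract x) y τ then h.choose else 0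

section SiegelLog

variable (hn : IsBal(n, N))

theorem siegelPoint_fract : SiegelPoint N (fract x) y ↔ SiegelPoint N x y := by
  have h := siegelPoint_add_int (N := N) (a := fract x) (b := y) (i := ⌊x⌋) (j := 0)
  rw [Int.fract_add_floor, Int.cast_zero, add_zero] at h
  exact h.symm

theorem siegelLog_mem (N : ℕ) (n : ℕ → ℤ) (x y : ℚ) : siegelLog N n x y ∈ reVanishing := by
  rw [siegelLog]
  split_ifs with h
  · exact h.choose_spec.1
  · exact zero_mem _

include hn

theorem siegelUnit_fract (x y : ℚ) : siegelUnit N n (fract x) y = siegelUnit N n x y := by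
  have h := (normCompatible_siegelUnit hn (L := ∅) (by simp)).periodic (fract x) y ⌊x⌋ 0
  rw [Int.fract_add_floor, Int.cast_zero, add_zero] at h
  exact h.symm

theorem exists_siegelLog_fract (h : SiegelPoint N x y) :
    ∃ F ∈ reVanishing, expHom F = -siegelUnit N n x y ∧
      ∀ τ : ℍ, F.1 τ = siegelLogFn N n (fract x) y τ := by
  have := exists_siegelLog hn (Int.fract_nonneg x) (Int.fract_lt_one x) ((siegelPoint_fract).2 h)
  rwa [siegelUnit_fract hn] at this

theorem siegelLog_apply (h : SiegelPoint N x y) (τ : ℍ) :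
    (siegelLog N n x y).1 τ = siegelLogFn N n (fract x) y τ := by
  have h' := exists_siegelLog_fract hn h
  rw [siegelLog, dif_pos h']
  exact h'.choose_spec.2.2 τ

theorem expHom_siegelLog (x y : ℚ) : expHom (siegelLog N n x y) = -siegelUnit N n x y := by
  rw [siegelLog]
  split_ifs with h
  · exact h.choose_spec.2.1
  · rw [map_zero, siegelUnit_of_not n fun h' => h (exists_siegelLog_fract hn h'), neg_zero]

theorem normCompatible_siegelLog (hL : ∀ k ∈ L, 0 < k ∧ k.Coprime N) :
    NormCompatible L (siegelLog N n) where
  periodic a b i j := eq_of_expHom_eq (siegelLog_mem _ _ _ _) (siegelLog_mem _ _ _ _) (by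
    rw [expHom_siegelLog hn, expHom_siegelLog hn, (normCompatible_siegelUnit hn hL).periodic])
  norm k hk d hd a b ha hb hab := eq_of_expHom_eq
    (sum_mem fun _ _ => sum_mem fun _ _ => siegelLog_mem _ _ _ _) (siegelLog_mem _ _ _ _) (by
    simp only [map_sum, expHom_siegelLog hn, sum_neg_distrib]
    rw [(normCompatible_siegelUnit hn hL).norm k hk d hd a b ha hb hab])

end SiegelLog

/-- The `p`-adic distribution of the logarithms of the inverses of the Siegel units. -/
def siegelLogDist (hpN : ¬ p.1 ∣ N) (hn : IsBal(n, N)) : Dist Z_[p] Hol :=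
  (levelSystem_padic p).distOf (normCompatible_siegelLog hn (pPowers_pos_coprime hpN))

section

variable (hpN : ¬ p.1 ∣ N) (hn : IsBal(n, N))

theorem siegelLogDist_mem (f : TestFn Z_[p]) : siegelLogDist hpN hn f ∈ reVanishing := by
  obtain ⟨m, hm, hf⟩ := (levelSystem_padic p).exists_level f
  rw [siegelLogDist, LevelSystem.distOf_apply _ _ hm hf, levelSum_apply]
  exact sum_mem fun _ _ => sum_mem fun _ _ => zsmul_mem (siegelLog_mem _ _ _ _) _

theorem mapValues_siegelLogDist :
    Dist.mapValues _ expHom (siegelLogDist hpN hn) = -siegelDist hpN hn := by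
  refine DFunLike.ext _ _ fun f => ?_
  obtain ⟨m, hm, hf⟩ := (levelSystem_padic p).exists_level f
  change expHom (siegelLogDist hpN hn f) = -(siegelDist hpN hn f)
  rw [siegelLogDist, siegelDist, LevelSystem.distOf_apply _ _ hm hf,
    LevelSystem.distOf_apply _ _ hm hf, levelSum_apply, levelSum_apply]
  simp only [map_sum, map_zsmul, expHom_siegelLog hn, smul_neg, sum_neg_distrib]

theorem siegelLogDist_cellFn (hm : m ∈ pPowers p) (hd : d ∈ pPowers p)
    (ha : ∃ z : ℤ, (d : ℚ) * a = z) (hb : ∃ z : ℤ, (d : ℚ) * b = z)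
    (h0 : (0 : Fin 2 → ℚ_[p]) ∉ cell Z_[p] m a b) :
    siegelLogDist hpN hn (cellFn Z_[p] m a b) = siegelLog N n (a / m) (b / m) :=
  (levelSystem_padic p).distOf_cellFn _ hm hd ha hb h0

theorem exists_siegelCocycle (hN : 0 < N) : ∃ C : Z1 (GSN (primesNe p) N) (Dist Z_[p] ℤ), ∀ g₀ g₁,
      Dist.mapValues _ constHom (C.1 g₀ g₁) =
      (g₁ : GQ) • siegelLogDist hpN hn - (g₀ : GQ) • siegelLogDist hpN hn := by
  refine exists_cocycle_of_lift mapValues_constHom_injective mapValues_constHom_smul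
    (fun μ => exists_mapValues_constHom) (fun γ μ => DFunLike.ext _ _ fun f => expHom_smul γ _)
    (x := -siegelDist hpN hn) (fun γ hγ => ?_) (mapValues_siegelLogDist hpN hn)
  rw [smul_neg, siegelDist_invariant hN hpN hn γ hγ]

/-- The cocycle of periods of the logarithms of the Siegel units. -/
def siegelCocycle (hN : 0 < N) : Z1 (GSN (primesNe p) N) (Dist Z_[p] ℤ) :=
  (exists_siegelCocycle hpN hn hN).choose

theorem siegelCocycle_spec (hN : 0 < N) (g₀ g₁ : GSN (primesNe p) N) :
    Dist.mapValues _ constHom ((siegelCocycle hpN hn hN).1 g₀ g₁) =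
      (g₁ : GQ) • siegelLogDist hpN hn - (g₀ : GQ) • siegelLogDist hpN hn :=
  (exists_siegelCocycle hpN hn hN).choose_spec g₀ g₁

theorem siegelCocycle_one (hN : 0 < N) (g : GSN (primesNe p) N) (f : TestFn Z_[p]) (τ : ℍ) :
    (((siegelCocycle hpN hn hN).1 1 g f : ℤ) : ℝ) =
      ((siegelLogDist hpN hn (slash _ (g : GQ) f)).1 (toReal (g : GQ)⁻¹ • τ)).re -
      ((siegelLogDist hpN hn f).1 τ).re := by
  have h := congrArg (fun ρ : Dist Z_[p] Hol => ((ρ f).1 τ).re) (siegelCocycle_spec hpN hn hN 1 g)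
  have h1 : ((1 : GSN (primesNe p) N) : GQ) • siegelLogDist hpN hn = siegelLogDist hpN hn :=
    one_smul _ _
  rw [h1] at h
  change ((constHom ((siegelCocycle hpN hn hN).1 1 g f)).1 τ).re =
    ((siegelLogDist hpN hn (slash _ (g : GQ) f)).1 (toReal (g : GQ)⁻¹ • τ) -
      (siegelLogDist hpN hn f).1 τ).re at h
  rw [constHom_apply, Complex.intCast_re, sub_re] at h
  exact h

end

/-- An element with lower left entry zero permutes the vertical lines. -/
theorem inv_smul_vert_of_eq_zero (g : GQ) (h : mat g 1 0 = 0) (ht : 0 < t) : toReal g⁻¹ • vert 0 t =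
      vert (-(mat g 0 1 : ℝ) / mat g 0 0) ((mat g 1 1 : ℝ) / mat g 0 0 * t) := by
  have hdet : 0 < mat g 0 0 * mat g 1 1 := by
    have := show 0 < (mat g).det from g.2
    rwa [det_fin_two, h, mul_zero, sub_zero] at this
  have hq : 0 < mat g 1 1 / mat g 0 0 := by
    rcases pos_and_pos_or_neg_and_neg_of_mul_pos hdet with ⟨h1, h2⟩ | ⟨h1, h2⟩
    · exact div_pos h2 h1
    · exact div_pos_of_neg_of_neg h2 h1
  have hq' : 0 < (mat g 1 1 : ℝ) / mat g 0 0 := mod_cast hq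
  have h0 : (mat g 0 0 : ℂ) ≠ 0 := mod_cast left_ne_zero_of_mul hdet.ne'
  have h1 : (mat g 1 1 : ℂ) ≠ 0 := mod_cast right_ne_zero_of_mul hdet.ne'
  rw [map_inv, inv_smul_eq_iff]
  apply ext_iff.2
  rw [coe_toReal_smul, coe_vert _ (mul_pos hq' ht), coe_vert _ ht, h]
  push_cast
  field_simp
  ring

/-- The limit at a finite cusp along a vertical line corresponds to the limit at `i∞`. -/
theorem inv_smul_vert_of_ne_zero (g : GQ) (h : mat g 1 0 ≠ 0) (ht : 0 < t) :
    toReal g⁻¹ • vert ((mat g 0 0 : ℝ) / mat g 1 0) t =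
      vert (-(mat g 1 1 : ℝ) / mat g 1 0) ((((mat g).det / mat g 1 0 ^ 2 : ℚ) : ℝ) / t) := by
  obtain ⟨d, hd, hdet⟩ : ∃ d, (mat g).det = d ∧ 0 < d := ⟨_, rfl, g.2⟩
  rw [hd]
  have hdc : (mat g 0 0 : ℂ) * mat g 1 1 - mat g 0 1 * mat g 1 0 = d := by
    rw [det_fin_two] at hd; exact_mod_cast hd
  have hq : (0 : ℝ) < ((d / mat g 1 0 ^ 2 : ℚ) : ℝ) / t :=
    div_pos (mod_cast div_pos hdet (sq_pos_of_ne_zero h)) ht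
  have h0 : (mat g 1 0 : ℂ) ≠ 0 := mod_cast h
  have htc : (t : ℂ) ≠ 0 := mod_cast ht.ne'
  have hd0 : (d : ℂ) ≠ 0 := mod_cast hdet.ne'
  rw [map_inv, inv_smul_eq_iff]
  apply ext_iff.2
  rw [coe_toReal_smul, coe_vert _ hq, coe_vert _ ht]
  push_cast
  rw [eq_div_iff]
  · rw [← hdc]; field_simp; ring_nf; simp only [I_sq]; ring
  · intro h'; field_simp at h'; exact mul_ne_zero hd0 Complex.I_ne_zero (by simpa using h')

section

variable (hpN : ¬ p.1 ∣ N) (hn : IsBal(n, N)) (hN : 0 < N)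

theorem siegelCocycle_one_eq_zero (g : GSN (primesNe p) N) (h : mat (g : GQ) 1 0 = 0) :
    (siegelCocycle hpN hn hN).1 1 g = 0 := by
  refine DFunLike.ext _ _ fun f => ?_
  change (siegelCocycle hpN hn hN).1 1 g f = 0
  have hdet : 0 < mat (g : GQ) 0 0 * mat (g : GQ) 1 1 := by
    have := show 0 < (mat (g : GQ)).det from (g : GQ).2
    rwa [det_fin_two, h, mul_zero, sub_zero] at this
  have hq : 0 < mat (g : GQ) 1 1 / mat (g : GQ) 0 0 := by
    rcases pos_and_pos_or_neg_and_neg_of_mul_pos hdet with ⟨h1, h2⟩ | ⟨h1, h2⟩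
    · exact div_pos h2 h1
    · exact div_pos_of_neg_of_neg h2 h1
  have hq' : 0 < (mat (g : GQ) 1 1 : ℝ) / mat (g : GQ) 0 0 := mod_cast hq
  have h1 := siegelLogDist_mem hpN hn (slash _ (g : GQ) f)
    (-(mat (g : GQ) 0 1 : ℝ) / mat (g : GQ) 0 0)
  have h2 := siegelLogDist_mem hpN hn f 0
  have h3 := (h1.comp (Tendsto.const_mul_atTop hq' tendsto_id)).sub h2
  rw [sub_zero] at h3
  have h4 : Tendsto (fun _ : ℝ => (((siegelCocycle hpN hn hN).1 1 g f : ℤ) : ℝ)) atTop (𝓝 0) := by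
    refine h3.congr' ?_
    filter_upwards [Filter.eventually_gt_atTop (0 : ℝ)] with t ht
    rw [siegelCocycle_one hpN hn hN g f (vert 0 t), inv_smul_vert_of_eq_zero _ h ht]; rfl
  exact_mod_cast tendsto_nhds_unique tendsto_const_nhds h4

theorem tendsto_siegelCocycle_one (g : GSN (primesNe p) N) (h : mat (g : GQ) 1 0 ≠ 0)
    (f : TestFn Z_[p]) : Tendsto (fun t => -((siegelLogDist hpN hn f).1
      (vert ((mat (g : GQ) 0 0 : ℝ) / mat (g : GQ) 1 0) t)).re) (𝓝[>] 0)
      (𝓝 ((siegelCocycle hpN hn hN).1 1 g f : ℤ)) := by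
  have hdet : 0 < (mat (g : GQ)).det := (g : GQ).2
  have hq : (0 : ℝ) < (((mat (g : GQ)).det / mat (g : GQ) 1 0 ^ 2 : ℚ) : ℝ) := by
    exact_mod_cast div_pos hdet (sq_pos_of_ne_zero h)
  have h1 := siegelLogDist_mem hpN hn (slash _ (g : GQ) f)
    (-(mat (g : GQ) 1 1 : ℝ) / mat (g : GQ) 1 0)
  have h3 := (h1.comp (Tendsto.const_mul_atTop hq tendsto_inv_nhdsGT_zero)).const_sub
    (((siegelCocycle hpN hn hN).1 1 g f : ℤ) : ℝ)
  rw [sub_zero] at h3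
  refine h3.congr' ?_
  filter_upwards [self_mem_nhdsWithin] with t ht
  rw [siegelCocycle_one hpN hn hN g f (vert ((mat (g : GQ) 0 0 : ℝ) / mat (g : GQ) 1 0) t),
    inv_smul_vert_of_ne_zero _ h ht]
  simp only [comp_apply, div_eq_mul_inv]
  ring

theorem dvd_den_of_mem_GSN {g : GQ} (hg : g ∈ GSN (primesNe p) N) (h : mat g 1 0 ≠ 0)
    (hpN : ¬ p.1 ∣ N) : N ∣ (mat g 0 0 / mat g 1 0).den := by
  obtain ⟨hg, x, hx, hgx⟩ := hg
  obtain ⟨-, hdet⟩ := mat_det_mem_ZS hg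
  have hdet0 : (mat g).det ≠ 0 := (show 0 < (mat g).det from g.2).ne'
  set r := mat g 0 0 / mat g 1 0 with hr
  have hr' : (r.den : ℚ) * mat g 0 0 = r.num * mat g 1 0 := by
    rw [← den_mul_eq_num r, mul_assoc]; congr 1; rw [hr, div_mul_cancel₀ _ h]
  have := natCast_dvd_of_mem_ZS hpN (x := r.den) (y := (mat g).det⁻¹ *
      ((r.num : ℚ) * x * mat g 1 1 - r.den * mat g 0 1 * x))
    (mul_mem hdet (sub_mem (mul_mem (mul_mem (intCast_mem _ _) hx) (hg 1 1).1)
      (mul_mem (mul_mem (natCast_mem _ _) (hg 0 1).1) hx))) (by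
    rw [← mul_assoc, mul_comm (N : ℚ), mul_assoc, eq_inv_mul_iff_mul_eq₀ hdet0, det_fin_two]
    push_cast; rw [hgx] at hr' ⊢
    linear_combination mat g 1 1 * hr')
  exact_mod_cast this

/-- The generalized Dedekind sum `∑_D n_D ∑_h ((h + x)/b_D)) ((a (h + x)/b_D + D y))`, with
`b = D b_D`. -/
def dedekindSum (N : ℕ) (n : ℕ → ℤ) (a : ℤ) (b : ℕ) (x y : ℚ) : ℚ :=
  ∑ D ∈ N.divisors, n D * ∑ h ∈ range (b / D),
    sawtooth ((h + x) / (b / D : ℕ)) * sawtooth (a * ((h + x) / (b / D : ℕ)) + D * y)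

theorem siegelCocycle_cellFn (g : GSN (primesNe p) N) (h : mat (g : GQ) 1 0 ≠ 0)
    (hm : m ∈ pPowers p) (hd : d ∈ pPowers p) (ha : ∃ z : ℤ, (d : ℚ) * a = z)
    (hb : ∃ z : ℤ, (d : ℚ) * b = z) (h0 : (0 : Fin 2 → ℚ_[p]) ∉ cell Z_[p] m a b) :
    (((siegelCocycle hpN hn hN).1 1 g (cellFn Z_[p] m a b) : ℤ) : ℚ) =
      -12 * dedekindSum N n (mat (g : GQ) 0 0 / mat (g : GQ) 1 0).num
      (mat (g : GQ) 0 0 / mat (g : GQ) 1 0).den (fract (a / m)) (b / m) := by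
  have hpt := siegelPoint_div hpN hm hd hb h0
  have hlim := tendsto_siegelCocycle_one hpN hn hN g h (cellFn Z_[p] m a b)
  have hdvd := dvd_den_of_mem_GSN g.2 h hpN
  set r := mat (g : GQ) 0 0 / mat (g : GQ) 1 0 with hr
  have hrr : (mat (g : GQ) 0 0 : ℝ) / mat (g : GQ) 1 0 = (r.num : ℝ) / (r.den : ℕ) := by
    have : (r : ℝ) = (r.num : ℝ) / (r.den : ℕ) := mod_cast (Rat.num_div_den r).symm
    rw [← this, hr]; push_cast; rfl
  rw [siegelLogDist_cellFn hpN hn hm hd ha hb h0, hrr] at hlim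
  have hlim2 : Tendsto (fun t => -((siegelLog N n (a / m) (b / m)).1
      (vert ((r.num : ℝ) / (r.den : ℕ)) t)).re) (𝓝[>] 0)
      (𝓝 (((12 / (2 * π)) * ∑ D ∈ N.divisors, (n D : ℝ) * (-(2 * π) *
        ((∑ h ∈ range (r.den / D), sawtooth ((h + fract (a / m)) / (r.den / D : ℕ)) *
          sawtooth (r.num * ((h + fract (a / m)) / (r.den / D : ℕ)) + D * (b / m)) : ℚ) :
            ℝ)) : ℝ))) := by
    simp only [siegelLog_apply hn hpt, re_siegelLogFn, neg_mul, neg_neg]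
    refine Tendsto.const_mul _ (tendsto_finsetSum _ fun D hD => Tendsto.const_mul _ ?_)
    have hDd : D ∣ r.den := (dvd_of_mem_divisors hD).trans hdvd
    have := tendsto_siegelLogTerm (pos_of_mem_divisors hD)
      (Nat.div_pos (Nat.le_of_dvd r.den_pos hDd) (pos_of_mem_divisors hD))
      (Nat.mul_div_cancel' hDd).symm r.num (y := b / m) (Int.fract_nonneg (a / m))
      (Int.fract_lt_one (a / m))
    rwa [neg_mul] at this
  have he := tendsto_nhds_unique hlim hlim2
  have hpi : π ≠ 0 := pi_ne_zero
  have : (((siegelCocycle hpN hn hN).1 1 g (cellFn Z_[p] m a b) : ℤ) : ℝ) =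
      ((-12 * dedekindSum N n r.num r.den (fract (a / m)) (b / m) : ℚ) : ℝ) := by
    rw [he, dedekindSum]; push_cast; rw [mul_sum, mul_sum]
    have key : ∀ u S : ℝ, 12 / (2 * π) * (u * (-(2 * π) * S)) = -12 * (u * S) :=
      fun u S => by field_simp
    exact sum_congr rfl fun D _ => key _ _
  exact_mod_cast this

end

/-! Periodic Bernoulli functions -/

theorem sum_range_periodic_affine {f : ℚ → ℚ} (hf : ∀ x (z : ℤ), f (x + z) = f x) (hm : 0 < m)
    {a : ℤ} (ha : IsCoprime a (m : ℤ)) (c : ℤ) (x : ℚ) :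
    ∑ j ∈ range m, f ((x + (a * j + c)) / m) = ∑ j ∈ range m, f ((x + j) / m) := by
  have hm0 : (m : ℤ) ≠ 0 := mod_cast hm.ne'
  have hmq : (m : ℚ) ≠ 0 := mod_cast hm.ne'
  have hnn : ∀ j : ℕ, 0 ≤ (a * j + c) % (m : ℤ) := fun j => Int.emod_nonneg _ hm0
  have hlt : ∀ j : ℕ, (a * j + c) % (m : ℤ) < m := fun j => Int.emod_lt_of_pos _ (mod_cast hm)
  have hmaps : ∀ j ∈ range m, ((a * j + c) % (m : ℤ)).toNat ∈ range m := fun j _ => by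
    rw [mem_range]; have := hlt j; have := hnn j; omega
  have hinj : Set.InjOn (fun j : ℕ => ((a * j + c) % (m : ℤ)).toNat) (range m) := by
    intro i hi j hj h
    have h1 : (a * i + c) % (m : ℤ) = (a * j + c) % (m : ℤ) := by
      have h2 := hnn i; have h3 := hnn j
      simp only at h
      omega
    have h2 : (m : ℤ) ∣ a * (j - i) := by
      have := Int.ModEq.dvd h1
      convert this using 1
      ring
    have h3 := ha.symm.dvd_of_dvd_mul_left h2
    rw [Finset.coe_range, Set.mem_Iio] at hi hj
    have h4 := Int.eq_zero_of_abs_lt_dvd h3 (by rw [abs_lt]; omega)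
    omega
  refine Finset.sum_nbij (fun j => ((a * j + c) % (m : ℤ)).toNat) hmaps hinj
    (Finset.surjOn_of_injOn_of_card_le _ hmaps hinj le_rfl) fun j _ => ?_
  have h1 : ((((a * j + c) % (m : ℤ)).toNat : ℕ) : ℚ) = (((a * j + c) % (m : ℤ) : ℤ) : ℚ) := by
    exact_mod_cast congrArg (Int.cast : ℤ → ℚ) (toNat_of_nonneg (hnn j))
  have h2 : ((a * j + c : ℤ) : ℚ) =
      (((a * j + c) % (m : ℤ) : ℤ) : ℚ) + m * ((a * j + c) / (m : ℤ) : ℤ) := by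
    exact_mod_cast (Int.emod_add_mul_ediv (a * j + c) m).symm
  push_cast at h2
  have h3 : ∀ r q : ℚ, (x + (r + m * q)) / m = (x + r) / m + q := fun r q => by field_simp; ring
  rw [h1, h2, h3, hf]

/-- The multiplication theorem for Bernoulli polynomials. -/
theorem sum_bernoulli_eval_div (k : ℕ) (hm : 0 < m) (x : ℚ) :
    (m : ℚ) ^ k * ∑ j ∈ range m, (bernP k).eval ((x + j) / m) = m * (bernP k).eval x := by
  have hmq : (m : ℚ) ≠ 0 := mod_cast hm.ne'
  let G : ℕ → Polynomial ℚ := fun k => Polynomial.C ((m : ℚ) ^ k) * ∑ j ∈ range m,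
    (bernP k).comp (Polynomial.C (m : ℚ)⁻¹ * (Polynomial.X + Polynomial.C (j : ℚ))) -
      Polynomial.C (m : ℚ) * bernP k
  have heval : ∀ k x, (G k).eval x = (m : ℚ) ^ k * ∑ j ∈ range m,
      (bernP k).eval ((x + j) / m) - m * (bernP k).eval x := by
    intro k x
    simp only [G, eval_sub, eval_mul, eval_C, eval_finsetSum, eval_comp, eval_add, eval_X]
    simp only [div_eq_inv_mul]
  have hper : ∀ x, (G (k + 1)).eval (x + 1) = (G (k + 1)).eval x := by
    intro x; rw [heval, heval]
    have h1 := sum_range_succ (fun j : ℕ => (bernP (k + 1)).eval ((x + j) / m)) m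
    rw [sum_range_succ'] at h1; have h2 : (x + m) / m = 1 + x / m := by field_simp; ring
    rw [h2, Polynomial.bernoulli_eval_one_add] at h1
    have h3 : ∑ j ∈ range m, (bernP (k + 1)).eval ((x + 1 + j) / m) =
        ∑ j ∈ range m, (bernP (k + 1)).eval ((x + (j + 1 : ℕ)) / m) :=
      sum_congr rfl fun j _ => by push_cast; congr 2; ring
    rw [h3, add_comm x 1, Polynomial.bernoulli_eval_one_add]
    simp only [cast_zero, add_zero, add_tsub_cancel_right] at h1 ⊢
    have h4 : (m : ℚ) ^ (k + 1) * (x / m) ^ k = m * x ^ k := by rw [div_pow, pow_succ]; field_simp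
    push_cast at h1 ⊢
    linear_combination (m : ℚ) ^ (k + 1) * h1 + (k + 1 : ℚ) * h4
  have hconst : G (k + 1) = Polynomial.C ((G (k + 1)).eval 0) := by
    refine Polynomial.eq_of_infinite_eval_eq _ _
      ((Set.infinite_range_of_injective (Nat.cast_injective (R := ℚ))).mono ?_)
    rintro _ ⟨r, rfl⟩
    change (G (k + 1)).eval (r : ℚ) = (Polynomial.C ((G (k + 1)).eval 0)).eval (r : ℚ)
    rw [eval_C]
    induction r with
    | zero => simp
    | succ r ih => rw [Nat.cast_succ, hper, ih]
  have hder : (k + 1 : ℚ) * (G k).eval x = (Polynomial.derivative (G (k + 1))).eval x := by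
    rw [heval]
    simp only [G, Polynomial.derivative_sub, Polynomial.derivative_C_mul,
      Polynomial.derivative_sum, Polynomial.derivative_comp, Polynomial.derivative_add,
      Polynomial.derivative_X, derivative_C, add_zero, mul_one,
      Polynomial.derivative_bernoulli_add_one, eval_sub, eval_mul,
      eval_C, eval_finsetSum, eval_comp, eval_add,
      eval_X, Polynomial.eval_one, Polynomial.eval_natCast, Polynomial.mul_comp,
      Polynomial.add_comp, Polynomial.natCast_comp, Polynomial.one_comp]
    rw [← mul_sum, ← mul_sum]; simp only [div_eq_inv_mul]; rw [pow_succ]; field_simp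
  rw [hconst, derivative_C, Polynomial.eval_zero, heval] at hder
  have hk : (k + 1 : ℚ) ≠ 0 := by positivity
  rcases mul_eq_zero.1 hder with h | h
  · exact absurd h hk
  · exact sub_eq_zero.1 h

theorem sum_bernoulli_eval_fract (k : ℕ) (hm : 0 < m) (x : ℚ) :
    (m : ℚ) ^ k * ∑ j ∈ range m, (bernP k).eval (fract ((x + j) / m)) = m * (bernP k).eval (fract x) := by
  have hmq : (0 : ℚ) < m := mod_cast hm
  have h := sum_range_periodic_affine (f := fun x => (bernP k).eval (fract x))
    (fun x z => by simp only [Int.fract_add_intCast]) hm isCoprime_one_left ⌊x⌋ (fract x)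
  rw [← sum_bernoulli_eval_div k hm (fract x)]
  congr 1
  refine Eq.trans (sum_congr rfl fun j _ => ?_) (h.trans (sum_congr rfl fun j hj => ?_))
  · simp only [Int.cast_one, one_mul]; congr 3; rw [← Int.fract_add_floor x, Int.fract_add_floor]
    linear_combination -(Int.fract_add_floor x)
  · have hj' : (j : ℚ) + 1 ≤ m := mod_cast mem_range.1 hj
    rw [Int.fract_eq_self.2]
    refine ⟨div_nonneg (add_nonneg (Int.fract_nonneg _) (cast_nonneg _)) hmq.le, ?_⟩
    rw [div_lt_one hmq]; linarith [Int.fract_lt_one x]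

/-- The periodic Bernoulli function `B̃_{e+1}(x)/(e+1)`, the sawtooth function for `e = 0`. -/
def bernFn (e : ℕ) (x : ℚ) : ℚ :=
  if e = 0 then sawtooth x else (bernP (e + 1)).eval (fract x) / (e + 1)

theorem bernFn_zero : bernFn 0 = sawtooth := funext fun _ => if_pos rfl

theorem bernFn_of_ne_zero {e : ℕ} (he : e ≠ 0) (x : ℚ) :
    bernFn e x = (bernP (e + 1)).eval (fract x) / (e + 1) := if_neg he

theorem bernFn_add_int (e : ℕ) (x : ℚ) (z : ℤ) : bernFn e (x + z) = bernFn e x := by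
  rw [bernFn, bernFn, sawtooth_add_int, Int.fract_add_intCast]

theorem sawtooth_eq_half_sub (x : ℚ) : sawtooth x = ((bernP 1).eval (fract x) -
      (bernP 1).eval (fract (-x))) / 2 := by
  rw [sawtooth, Polynomial.bernoulli_one]
  simp only [eval_sub, eval_X, eval_C]
  split_ifs with h
  · rw [h, Int.fract_neg_eq_zero.2 h]; ring
  · rw [Int.fract_neg h]; ring

theorem sum_bernFn (e : ℕ) (hm : 0 < m) (x : ℚ) :
    (m : ℚ) ^ e * ∑ j ∈ range m, bernFn e ((x + j) / m) = bernFn e x := by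
  have hmq : (m : ℚ) ≠ 0 := mod_cast hm.ne'
  by_cases he : e = 0
  · subst he; rw [bernFn_zero]; simp only [sawtooth_eq_half_sub]
    have h1 := sum_bernoulli_eval_fract 1 hm x
    have h2 := sum_bernoulli_eval_fract 1 hm (-x)
    have h3 := sum_range_periodic_affine (f := fun x => (bernP 1).eval (fract x))
      (fun x z => by simp only [Int.fract_add_intCast]) hm (a := -1)
      (isCoprime_one_left.neg_left) 0 (-x)
    have h4 : ∀ j : ℕ, -((x + j) / m) = (-x + ((-1 : ℤ) * j + (0 : ℤ))) / m := fun j => by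
      push_cast; ring
    simp only [h4]; rw [← Finset.sum_div, sum_sub_distrib, h3]; rw [pow_one] at h1 h2
    have h1' := mul_left_cancel₀ hmq h1
    have h2' := mul_left_cancel₀ hmq h2
    rw [pow_zero, one_mul, h1', h2']
  · simp only [bernFn_of_ne_zero he]; have h1 := sum_bernoulli_eval_fract (e + 1) hm x
    rw [pow_succ', mul_assoc] at h1; rw [← Finset.sum_div, ← mul_div_assoc, mul_left_cancel₀ hmq h1]

theorem sum_bernFn_affine (e : ℕ) (hm : 0 < m) {a : ℤ} (ha : IsCoprime a (m : ℤ)) (x : ℚ) :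
    (m : ℚ) ^ e * ∑ j ∈ range m, bernFn e ((x + a * j) / m) = bernFn e x := by
  have := sum_range_periodic_affine (bernFn_add_int e) hm ha 0 x
  simp only [Int.cast_zero, add_zero] at this
  rw [this, sum_bernFn e hm]

/-! Integrality of higher Dedekind sums -/

theorem exists_bernoulli_eval_congr (e : ℕ) : ∃ C : ℕ, 0 < C ∧ ∀ (M : ℕ) (t : ℤ), 0 < M → ∃ z : ℤ,
    (C : ℚ) * ((M : ℚ) ^ e * (bernP (e + 1)).eval ((t : ℚ) / M) -
      (t : ℚ) ^ (e + 1) / M + (e + 1) / 2 * (t : ℚ) ^ e) = M * z := by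
  refine ⟨∏ i ∈ range e, (bernoulli (i + 2)).den, Finset.prod_pos fun i _ => Rat.den_pos _,
    fun M t hM => ?_⟩
  have hM0 : (M : ℚ) ≠ 0 := mod_cast hM.ne'
  set C := ∏ i ∈ range e, (bernoulli (i + 2)).den with hC
  have h1 : ∀ i ∈ range e, ∃ z : ℤ, (C : ℚ) * bernoulli (i + 2) = z := fun i hi => by
    obtain ⟨k, hk⟩ := Finset.dvd_prod_of_mem (fun i => (bernoulli (i + 2)).den) hi
    refine ⟨k * (bernoulli (i + 2)).num, ?_⟩
    rw [hC, hk]; push_cast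
    linear_combination (k : ℚ) * den_mul_eq_num (bernoulli (i + 2))
  choose! z hz using h1
  refine ⟨∑ i ∈ range e, z i * (e + 1).choose (i + 2) * t ^ (e - 1 - i) * M ^ i, ?_⟩
  have h2 : (bernP (e + 1)).eval ((t : ℚ) / M) = ((t : ℚ) / M) ^ (e + 1) -
      (e + 1) / 2 * ((t : ℚ) / M) ^ e + ∑ i ∈ range e,
        bernoulli (i + 2) * (e + 1).choose (i + 2) * ((t : ℚ) / M) ^ (e - 1 - i) := by
    rw [Polynomial.bernoulli, eval_finsetSum, sum_range_succ', sum_range_succ']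
    simp only [Polynomial.eval_monomial, zero_add, bernoulli_one, bernoulli_zero, Nat.choose_one_right,
      Nat.choose_zero_right, Nat.sub_zero, Nat.add_sub_cancel]
    push_cast; have : ∀ i, e - 1 - i = e - (i + 1) := fun i => by omega
    simp only [this]; ring
  have h3 : (M : ℚ) ^ e * ((t : ℚ) / M) ^ (e + 1) = (t : ℚ) ^ (e + 1) / M := by
    rw [div_pow, pow_succ (M : ℚ)]; field_simp
  have h4 : (M : ℚ) ^ e * ((t : ℚ) / M) ^ e = (t : ℚ) ^ e := by rw [div_pow]; field_simp
  have h5 : (C : ℚ) * ((M : ℚ) ^ e * ∑ i ∈ range e,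
      bernoulli (i + 2) * (e + 1).choose (i + 2) * ((t : ℚ) / M) ^ (e - 1 - i)) =
      M * ∑ i ∈ range e, (z i : ℚ) * (e + 1).choose (i + 2) * t ^ (e - 1 - i) * M ^ i := by
    rw [mul_sum, mul_sum, mul_sum]; refine sum_congr rfl fun i hi => ?_
    rw [← hz i hi]; have hi' := mem_range.1 hi
    have : (M : ℚ) ^ e = M ^ (e - 1 - i) * M ^ i * M := by
      rw [← pow_add, ← pow_succ]; congr 1; omega
    rw [this, div_pow]; field_simp
  rw [h2]
  push_cast
  linear_combination h5 + (C : ℚ) * h3 - (C : ℚ) * (e + 1) / 2 * h4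

theorem exists_sawtooth_div (B P : ℕ) (hB : 0 < B) (hP : 0 < P) (K h : ℤ) : ∃ t u : ℤ,
    t = K - P * u ∧ fract ((K + P * h : ℚ) / (B * P)) = t / (B * P : ℕ) ∧
    sawtooth ((K + P * h : ℚ) / (B * P)) = t / (B * P) - 1 / 2 + (if t = 0 then 1 else 0) / 2 := by
  have hBq : (B : ℚ) ≠ 0 := mod_cast hB.ne'
  have hPq : (P : ℚ) ≠ 0 := mod_cast hP.ne'
  have hM : (0 : ℤ) < (B * P : ℕ) := mod_cast Nat.mul_pos hB hP
  have hfr : fract ((K + P * h : ℚ) / (B * P)) = ((K + P * h) % (B * P : ℕ) : ℤ) / (B * P : ℕ) := by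
    have := Int.emod_add_mul_ediv (K + P * h) (B * P : ℕ)
    have h1 : (K + P * h : ℚ) = ((K + P * h) % (B * P : ℕ) : ℤ) +
        (B * P) * ((K + P * h) / (B * P : ℕ) : ℤ) := mod_cast this.symm
    have h2 : (K + P * h : ℚ) / (B * P) = ((K + P * h) % (B * P : ℕ) : ℤ) / (B * P : ℕ) +
        ((K + P * h) / (B * P : ℕ) : ℤ) := by
      rw [h1]; push_cast; field_simp
    rw [h2, Int.fract_add_intCast, Int.fract_eq_self]
    have hMq : (0 : ℚ) < (B * P : ℕ) := mod_cast hM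
    refine ⟨div_nonneg (mod_cast Int.emod_nonneg _ hM.ne') hMq.le, ?_⟩
    rw [div_lt_one hMq]; exact_mod_cast Int.emod_lt_of_pos _ hM
  refine ⟨(K + P * h) % (B * P : ℕ), B * ((K + P * h) / (B * P : ℕ)) - h, ?_, hfr, ?_⟩
  · have := Int.emod_add_mul_ediv (K + P * h) (B * P : ℕ); push_cast at this ⊢
    linear_combination this
  · rw [sawtooth, hfr]; have hMq : ((B * P : ℕ) : ℚ) ≠ 0 := mod_cast hM.ne'
    by_cases h0 : (K + P * h) % (B * P : ℕ) = 0
    · rw [h0]; simp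
    · have h0' : (((K + P * h) % (B * P : ℕ) : ℤ) : ℚ) ≠ 0 := mod_cast h0
      rw [if_neg (div_ne_zero h0' hMq), if_neg h0]; push_cast; ring

theorem exists_sawtooth_integral (B P : ℕ) (hB : 0 < B) (hP : 0 < P) (K h : ℤ) : ∃ z : ℤ,
    2 * (B : ℚ) * (bernFn 0 ((K + P * h : ℚ) / (B * P)) - K / (P * B)) = z := by
  obtain ⟨t, u, htu, -, hs⟩ := exists_sawtooth_div B P hB hP K h
  have hBq : (B : ℚ) ≠ 0 := mod_cast hB.ne'
  have hPq : (P : ℚ) ≠ 0 := mod_cast hP.ne'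
  refine ⟨-2 * u - B + B * (if t = 0 then 1 else 0), ?_⟩
  have htu' : (t : ℚ) = K - P * u := mod_cast htu
  rw [bernFn_zero, hs, htu']
  push_cast
  field_simp
  ring

theorem exists_bernFn_congr (e B : ℕ) (hB : 0 < B) : ∃ C : ℕ, 0 < C ∧
    ∀ (P : ℕ) (K h : ℤ), 0 < P → ∃ z : ℤ,
      (C : ℚ) * (((B : ℚ) * P) ^ e * bernFn e ((K + P * h : ℚ) / (B * P)) -
      K ^ (e + 1) / ((e + 1) * P) / B -
      K ^ e * (bernFn 0 ((K + P * h : ℚ) / (B * P)) - K / (P * B))) = P * z := by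
  have hBq : (B : ℚ) ≠ 0 := mod_cast hB.ne'
  by_cases he : e = 0
  · subst he; refine ⟨1, one_pos, fun P K h hP => ⟨0, ?_⟩⟩
    have hPq : (P : ℚ) ≠ 0 := mod_cast hP.ne'
    push_cast; field_simp; ring
  obtain ⟨C, hC, hcong⟩ := exists_bernoulli_eval_congr e
  refine ⟨2 * B * C * (e + 1), by positivity, fun P K h hP => ?_⟩
  have hPq : (P : ℚ) ≠ 0 := mod_cast hP.ne'
  have heq : (e + 1 : ℚ) ≠ 0 := by positivity
  obtain ⟨t, u, htu, hf, hs⟩ := exists_sawtooth_div B P hB hP K h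
  obtain ⟨z, hz⟩ := hcong (B * P) t (Nat.mul_pos hB hP)
  obtain ⟨w, hw⟩ := Polynomial.powAddExpansion K (t - K) (e + 1)
  obtain ⟨v, hv⟩ := sub_dvd_pow_sub_pow t K e
  have hy : ∃ y : ℤ, K ^ e * (if t = 0 then 1 else 0) = P * y := by
    split_ifs with h0
    · have hK : K = P * u := by rw [h0] at htu; linarith
      refine ⟨u * K ^ (e - 1), ?_⟩
      rw [mul_one, ← mul_assoc, ← hK, ← pow_succ']; congr 1; omega
    · exact ⟨0, by simp⟩
  obtain ⟨y, hy⟩ := hy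
  refine ⟨2 * C * w * u ^ 2 + (e + 1) * B * C * v * u + 2 * B ^ 2 * z - (e + 1) * B * C * y, ?_⟩
  have htu' : (t : ℚ) = K - P * u := mod_cast htu
  have hw' : (t : ℚ) ^ (e + 1) = K ^ (e + 1) + (e + 1) * K ^ e * (t - K) + w * (t - K) ^ 2 := by
    have := congrArg (Int.cast : ℤ → ℚ) hw; push_cast at this; simpa using this
  have hv' : (t : ℚ) ^ e - K ^ e = (t - K) * v := mod_cast hv
  have hy' : (K : ℚ) ^ e * (if t = 0 then 1 else 0) = P * y := mod_cast hy
  rw [bernFn_zero, hs, bernFn_of_ne_zero he, hf]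
  set Q := (bernP (e + 1)).eval ((t : ℚ) / (B * P : ℕ))
  set ε : ℚ := if t = 0 then 1 else 0
  push_cast at hz ⊢
  have e1 : (t : ℚ) - K = -(P * u) := by rw [htu']; ring
  rw [e1] at hw' hv'
  have key : (C : ℚ) * (((B : ℚ) * P) ^ e * Q) = B * P * z + C * (t ^ (e + 1) / (B * P)) -
      C * ((e + 1) / 2 * t ^ e) := by linear_combination hz
  have e2 : 2 * (B : ℚ) * C * (e + 1) * (((B : ℚ) * P) ^ e * (Q / (e + 1)) -
      K ^ (e + 1) / ((e + 1) * P) / B - K ^ e * (t / (B * P) - 1 / 2 + ε / 2 - K / (P * B))) =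
      2 * B * (C * (((B : ℚ) * P) ^ e * Q)) - 2 * C * K ^ (e + 1) / P -
        2 * B * C * (e + 1) * K ^ e * (-(P * u)  / (B * P) - 1 / 2) -
          B * C * (e + 1) * (K ^ e * ε) := by
    rw [← e1]; field_simp; ring
  rw [e2, key, hy', hw']
  have e3 : (t : ℚ) ^ e = K ^ e - P * u * v := by linear_combination hv'
  rw [e3]
  field_simp
  ring

/-! Higher Dedekind sums -/

/-- The distribution of the higher Dedekind sums of weight `(i, l)`, on the cells of level `P`. -/
def bernSum (N : ℕ) (n : ℕ → ℤ) (a : ℤ) (b i l P : ℕ) (x y : ℤ) : ℚ :=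
  ∑ D ∈ N.divisors, n D * ∑ h ∈ range (b / D),
    (((b / D : ℕ) * P : ℚ) ^ i * bernFn i ((x + P * (h : ℤ) : ℚ) / ((b / D : ℕ) * P))) *
    (((b / D : ℕ) * P : ℚ) ^ l *
      bernFn l (((a * x + b * y : ℤ) + P * (a * h : ℤ) : ℚ) / ((b / D : ℕ) * P)))

section BernSum

variable (hn : IsBal(n, N)) {a : ℤ} {b : ℕ} (hb : 0 < b) (hNb : N ∣ b) (hab : IsCoprime a (b : ℤ))

include hb hNb in
theorem div_pos_of_mem (hD : D ∈ N.divisors) : 0 < b / D ∧ D * (b / D) = b :=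
  ⟨Nat.div_pos (Nat.le_of_dvd hb ((dvd_of_mem_divisors hD).trans hNb))
    (pos_of_mem_divisors hD), Nat.mul_div_cancel' ((dvd_of_mem_divisors hD).trans hNb)⟩

include hn hb hNb hab in
theorem bernSum_eq (i l P : ℕ) (hP : 0 < P) (x y : ℤ) (κ κ' : ℚ) :
    bernSum N n a b i l P x y = ∑ D ∈ N.divisors, n D * ∑ h ∈ range (b / D),
    (((b / D : ℕ) * P : ℚ) ^ i * bernFn i ((x + P * (h : ℤ) : ℚ) / ((b / D : ℕ) * P)) -
      κ / (b / D : ℕ)) * (((b / D : ℕ) * P : ℚ) ^ l *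
      bernFn l (((a * x + b * y : ℤ) + P * (a * h : ℤ) : ℚ) / ((b / D : ℕ) * P)) - κ' / (b / D : ℕ)) := by
  have hPq : (P : ℚ) ≠ 0 := mod_cast hP.ne'
  have hbq : (b : ℚ) ≠ 0 := mod_cast hb.ne'
  rw [bernSum, ← sub_eq_zero, ← sum_sub_distrib]
  set u := (P : ℚ) ^ i * bernFn i ((x : ℚ) / P)
  set v := (P : ℚ) ^ l * bernFn l (((a * x + b * y : ℤ) : ℚ) / P)
  have key : ∀ D ∈ N.divisors, ∀ e : ℕ, ∀ (K c : ℤ), IsCoprime c (b : ℤ) →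
      ∑ h ∈ range (b / D), ((b / D : ℕ) * P : ℚ) ^ e *
        bernFn e ((K + P * (c * h : ℤ) : ℚ) / ((b / D : ℕ) * P)) =
      (P : ℚ) ^ e * bernFn e ((K : ℚ) / P) := by
    intro D hD e K c hc; obtain ⟨hB, hDB⟩ := div_pos_of_mem hb hNb hD
    have hBq : ((b / D : ℕ) : ℚ) ≠ 0 := mod_cast hB.ne'
    have hc' : IsCoprime c ((b / D : ℕ) : ℤ) :=
      hc.of_isCoprime_of_dvd_right (mod_cast Nat.div_dvd_of_dvd ⟨_, hDB.symm⟩)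
    rw [← sum_bernFn_affine e hB hc' ((K : ℚ) / P), mul_pow, ← mul_sum, mul_comm (_ ^ e), mul_assoc]
    congr 3
    funext h
    congr 1
    push_cast; field_simp
  have hterm : ∀ D ∈ N.divisors, (n D : ℚ) * (∑ h ∈ range (b / D),
      (((b / D : ℕ) * P : ℚ) ^ i * bernFn i ((x + P * (h : ℤ) : ℚ) / ((b / D : ℕ) * P))) *
      (((b / D : ℕ) * P : ℚ) ^ l *
        bernFn l (((a * x + b * y : ℤ) + P * (a * h : ℤ) : ℚ) / ((b / D : ℕ) * P)))) -
      n D * (∑ h ∈ range (b / D),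
    (((b / D : ℕ) * P : ℚ) ^ i * bernFn i ((x + P * (h : ℤ) : ℚ) / ((b / D : ℕ) * P)) -
      κ / (b / D : ℕ)) *
    (((b / D : ℕ) * P : ℚ) ^ l *
      bernFn l (((a * x + b * y : ℤ) + P * (a * h : ℤ) : ℚ) / ((b / D : ℕ) * P)) -
      κ' / (b / D : ℕ))) = (κ' * u + κ * v - κ * κ') / b * ((n D : ℚ) * D) := by
    intro D hD; obtain ⟨hB, hDB⟩ := div_pos_of_mem hb hNb hD
    have hBq : ((b / D : ℕ) : ℚ) ≠ 0 := mod_cast hB.ne'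
    have hu := key D hD i x 1 isCoprime_one_left
    have hv := key D hD l (a * x + b * y) a hab
    simp only [one_mul] at hu; have hDB' : (D : ℚ) * (b / D : ℕ) = b := mod_cast hDB
    rw [← mul_sub, ← sum_sub_distrib]
    have : ∀ U V B : ℚ, U * V - (U - κ / B) * (V - κ' / B) =
        κ' / B * U + κ / B * V - κ * κ' / (B * B) := fun U V B => by ring
    simp only [this]
    rw [sum_sub_distrib, sum_add_distrib, ← mul_sum, hu, ← mul_sum, hv,
      sum_const, card_range, nsmul_eq_mul, ← hDB']
    have hD0 : (D : ℚ) ≠ 0 := mod_cast (pos_of_mem_divisors hD).ne'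
    field_simp; ring
  rw [sum_congr rfl hterm, ← mul_sum]
  have : ∑ D ∈ N.divisors, (n D : ℚ) * D = 0 := mod_cast hn
  rw [this, mul_zero]

theorem mul_sub_mul_of_congr {c d B P z₁ z₂ z₃ z₄ U V α β R R' X Y : ℚ}
    (h1 : c * (U - α - X * R) = P * z₁) (h2 : d * (V - β - Y * R') = P * z₂) (h3 : 2 * B * R = z₃)
    (h4 : 2 * B * R' = z₄) : c * d * (2 * B) * ((U - α) * (V - β) - X * Y * (R * R')) =
      P * (z₁ * (d * Y * z₄ + 2 * B * P * z₂) + X * z₃ * c * z₂) := by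
  subst h3 h4
  linear_combination (2 * B * d * (V - β)) * h1 + (P * z₁ * 2 * B + X * 2 * B * R * c) * h2

include hn hb hNb hab in
theorem exists_bernSum_congr (i l : ℕ) : ∃ C : ℕ, 0 < C ∧ ∀ (P : ℕ) (x y : ℤ), 0 < P → ∃ z : ℤ,
    (C : ℚ) * (bernSum N n a b i l P x y -
      x ^ i * (a * x + b * y) ^ l * bernSum N n a b 0 0 P x y) = P * z := by
  have h1 : ∀ D : ℕ, ∃ C : ℕ, 0 < C ∧ (D ∈ N.divisors → ∀ (P : ℕ) (K h : ℤ), 0 < P → ∃ z : ℤ,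
      (C : ℚ) * ((((b / D : ℕ) : ℚ) * P) ^ i * bernFn i ((K + P * h : ℚ) / ((b / D : ℕ) * P)) -
          K ^ (i + 1) / ((i + 1) * P) / (b / D : ℕ) -
        K ^ i * (bernFn 0 ((K + P * h : ℚ) / ((b / D : ℕ) * P)) - K / (P * (b / D : ℕ)))) =
          P * z) := fun D => by
    by_cases hD : D ∈ N.divisors
    · obtain ⟨C, h0, h⟩ := exists_bernFn_congr i _ (div_pos_of_mem hb hNb hD).1
      exact ⟨C, h0, fun _ => h⟩
    · exact ⟨1, one_pos, fun h => absurd h hD⟩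
  have h2 : ∀ D : ℕ, ∃ C : ℕ, 0 < C ∧ (D ∈ N.divisors → ∀ (P : ℕ) (K h : ℤ), 0 < P → ∃ z : ℤ,
      (C : ℚ) * ((((b / D : ℕ) : ℚ) * P) ^ l * bernFn l ((K + P * h : ℚ) / ((b / D : ℕ) * P)) -
          K ^ (l + 1) / ((l + 1) * P) / (b / D : ℕ) -
        K ^ l * (bernFn 0 ((K + P * h : ℚ) / ((b / D : ℕ) * P)) - K / (P * (b / D : ℕ)))) =
          P * z) := fun D => by
    by_cases hD : D ∈ N.divisors
    · obtain ⟨C, h0, h⟩ := exists_bernFn_congr l _ (div_pos_of_mem hb hNb hD).1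
      exact ⟨C, h0, fun _ => h⟩
    · exact ⟨1, one_pos, fun h => absurd h hD⟩
  choose c hc0 hc using h1
  choose d hd0 hd using h2
  let C := ∏ D ∈ N.divisors, c D * d D * (2 * (b / D))
  refine ⟨C, Finset.prod_pos fun D hD => ?_, fun P x y hP => ?_⟩
  · have := (div_pos_of_mem hb hNb hD).1; have := hc0 D; have := hd0 D; positivity
  have hPq : (P : ℚ) ≠ 0 := mod_cast hP.ne'
  rw [bernSum_eq hn hb hNb hab i l P hP x y ((x : ℚ) ^ (i + 1) / ((i + 1) * P))
      (((a * x + b * y : ℤ) : ℚ) ^ (l + 1) / ((l + 1) * P)),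
    bernSum_eq hn hb hNb hab 0 0 P hP x y ((x : ℚ) / P) (((a * x + b * y : ℤ) : ℚ) / P),
    mul_sum, ← sum_sub_distrib, mul_sum]
  suffices h : ∀ D ∈ N.divisors, ∀ h : ℕ, ∃ z : ℤ, (c D * d D * (2 * (b / D : ℕ)) : ℚ) *
      ((((b / D : ℕ) * P : ℚ) ^ i * bernFn i ((x + P * (h : ℤ) : ℚ) / ((b / D : ℕ) * P)) -
        (x : ℚ) ^ (i + 1) / ((i + 1) * P) / (b / D : ℕ)) *
      (((b / D : ℕ) * P : ℚ) ^ l *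
        bernFn l (((a * x + b * y : ℤ) + P * (a * h : ℤ) : ℚ) / ((b / D : ℕ) * P)) -
        ((a * x + b * y : ℤ) : ℚ) ^ (l + 1) / ((l + 1) * P) / (b / D : ℕ)) -
      (x : ℚ) ^ i * (a * x + b * y) ^ l *
      ((((b / D : ℕ) * P : ℚ) ^ 0 * bernFn 0 ((x + P * (h : ℤ) : ℚ) / ((b / D : ℕ) * P)) -
        (x : ℚ) / P / (b / D : ℕ)) *
      (((b / D : ℕ) * P : ℚ) ^ 0 *
        bernFn 0 (((a * x + b * y : ℤ) + P * (a * h : ℤ) : ℚ) / ((b / D : ℕ) * P)) -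
        ((a * x + b * y : ℤ) : ℚ) / P / (b / D : ℕ)))) = P * z by
    choose! w hw using h
    have hdvd : ∀ D ∈ N.divisors, ∃ k : ℕ, C = c D * d D * (2 * (b / D)) * k := fun D hD =>
      Finset.dvd_prod_of_mem (fun D => c D * d D * (2 * (b / D))) hD
    choose! k hk using hdvd
    refine ⟨∑ D ∈ N.divisors, k D * n D * ∑ h ∈ range (b / D), w D h, ?_⟩
    push_cast; rw [mul_sum]; refine sum_congr rfl fun D hD => ?_
    rw [mul_left_comm ((x : ℚ) ^ i * _), ← mul_sub, mul_sum, ← sum_sub_distrib,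
      hk D hD, mul_left_comm (P : ℚ), mul_sum, mul_sum, mul_sum,
      mul_sum]
    refine sum_congr rfl fun h _ => ?_
    rw [← hw D hD h]; push_cast; ring
  intro D hD h
  obtain ⟨hB, -⟩ := div_pos_of_mem hb hNb hD
  obtain ⟨z₁, h1⟩ := hc D hD P x h hP
  obtain ⟨z₂, h2⟩ := hd D hD P (a * x + b * y) (a * h) hP
  obtain ⟨z₃, h3⟩ := exists_sawtooth_integral _ P hB hP x h
  obtain ⟨z₄, h4⟩ := exists_sawtooth_integral _ P hB hP (a * x + b * y) (a * h)
  generalize b / D = B at h1 h2 h3 h4 ⊢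
  refine ⟨z₁ * (d D * (a * x + b * y) ^ l * z₄ + 2 * B * P * z₂) + x ^ i * z₃ * c D * z₂, ?_⟩
  have := mul_sub_mul_of_congr h1 h2 h3 h4
  push_cast at this ⊢
  rw [div_div (x : ℚ), div_div (a * x + b * y : ℚ)]
  simp only [pow_zero, one_mul]
  rw [← this]

end BernSum

/-! Moments of the higher Dedekind sums -/

theorem sum_range_mul {A : Type*} [AddCommMonoid A] (g : ℕ → A) (B P : ℕ) :
    ∑ t ∈ range (B * P), g t = ∑ h ∈ range B, ∑ x ∈ range P, g (x + P * h) := by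
  induction B with
  | zero => simp
  | succ B ih =>
    rw [Nat.succ_mul, Finset.sum_range_add, ih, sum_range_succ]; simp only [add_comm, mul_comm]

/-- The value on all of `ℤ_p²` of the distribution of higher Dedekind sums. -/
def bernMoment (N : ℕ) (n : ℕ → ℤ) (a : ℤ) (b i l : ℕ) : ℚ :=
  ∑ D ∈ N.divisors, n D * (((b / D : ℕ) : ℚ) ^ (i + l) * ∑ h ∈ range (b / D),
    bernFn i ((h : ℚ) / (b / D : ℕ)) * bernFn l (a * (h : ℚ) / (b / D : ℕ)))

theorem sum_bernSum (n : ℕ → ℤ) (a : ℤ) {b : ℕ} (hb : 0 < b) (hNb : N ∣ b) (i l : ℕ) {P : ℕ}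
    (hP : 0 < P) (hPN : P.Coprime N) :
    ∑ x ∈ range P, ∑ u ∈ range P, bernSum N n a b i l P x (-(u : ℤ)) = bernMoment N n a b i l := by
  have hPq : (P : ℚ) ≠ 0 := mod_cast hP.ne'
  have h1 : ∀ D ∈ N.divisors, ∀ x h : ℕ, ∑ u ∈ range P,
      ((b / D : ℕ) * P : ℚ) ^ l * bernFn l (((a * x + b * (-(u : ℤ)) : ℤ) + P * (a * h : ℤ) : ℚ) /
        ((b / D : ℕ) * P)) =
      ((b / D : ℕ) : ℚ) ^ l * bernFn l (a * ((x + P * h : ℕ) : ℚ) / (b / D : ℕ)) := by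
    intro D hD x h; obtain ⟨hB, hDB⟩ := div_pos_of_mem hb hNb hD
    have hBq : ((b / D : ℕ) : ℚ) ≠ 0 := mod_cast hB.ne'
    have hc : IsCoprime (-(D : ℤ)) (P : ℤ) := by
      rw [IsCoprime.neg_left_iff, Nat.isCoprime_iff_coprime]
      exact (hPN.coprime_dvd_right (dvd_of_mem_divisors hD)).symm
    rw [← sum_bernFn_affine l hP hc (a * ((x + P * h : ℕ) : ℚ) / (b / D : ℕ)), mul_pow,
      ← mul_sum, mul_assoc]
    congr 3
    funext u
    congr 1
    have hDB' : (b : ℚ) = D * (b / D : ℕ) := mod_cast hDB.symm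
    push_cast; rw [hDB']; field_simp; ring
  have h2 : ∀ D ∈ N.divisors, ∑ x ∈ range P, ∑ h ∈ range (b / D),
      (((b / D : ℕ) * P : ℚ) ^ i * bernFn i (((x + P * h : ℕ) : ℚ) / ((b / D : ℕ) * P))) *
      (((b / D : ℕ) : ℚ) ^ l * bernFn l (a * ((x + P * h : ℕ) : ℚ) / (b / D : ℕ))) =
      ((b / D : ℕ) : ℚ) ^ (i + l) * ∑ h ∈ range (b / D),
        bernFn i ((h : ℚ) / (b / D : ℕ)) * bernFn l (a * (h : ℚ) / (b / D : ℕ)) := by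
    intro D hD; obtain ⟨hB, hDB⟩ := div_pos_of_mem hb hNb hD
    have hBq : ((b / D : ℕ) : ℚ) ≠ 0 := mod_cast hB.ne'
    rw [sum_comm, ← sum_range_mul (fun t : ℕ =>
      (((b / D : ℕ) * P : ℚ) ^ i * bernFn i ((t : ℚ) / ((b / D : ℕ) * P))) *
      (((b / D : ℕ) : ℚ) ^ l * bernFn l (a * (t : ℚ) / (b / D : ℕ)))), mul_comm (b / D),
      sum_range_mul, sum_comm, mul_sum]
    refine sum_congr rfl fun h _ => ?_
    rw [← sum_bernFn i hP ((h : ℚ) / (b / D : ℕ)), mul_sum, sum_mul, mul_sum]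
    refine sum_congr rfl fun s _ => ?_
    have e1 : a * ((h + b / D * s : ℕ) : ℚ) / (b / D : ℕ) =
        a * (h : ℚ) / (b / D : ℕ) + ((a * s : ℤ) : ℚ) := by
      push_cast; field_simp
    have e2 : ((h + b / D * s : ℕ) : ℚ) / ((b / D : ℕ) * P) = ((h : ℚ) / (b / D : ℕ) + s) / P := by
      push_cast; field_simp
    rw [e1, e2, bernFn_add_int]; ring
  simp only [bernSum]
  rw [bernMoment]
  refine (sum_congr rfl fun x _ => sum_comm).trans (sum_comm.trans ?_)
  refine sum_congr rfl fun D hD => ?_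
  rw [← h2 D hD, mul_sum]
  refine sum_congr rfl fun x _ => ?_
  rw [← mul_sum, sum_comm]
  congr 1
  refine sum_congr rfl fun h _ => ?_
  rw [← mul_sum, ← h1 D hD x h]
  push_cast
  rfl

theorem bernSum_scale (n : ℕ → ℤ) (a : ℤ) (b : ℕ) {P : ℕ} (hk : 0 < k) (x y : ℤ) :
    bernSum N n a b 0 0 (k * P) (k * x) (k * y) = bernSum N n a b 0 0 P x y := by
  have hkq : (k : ℚ) ≠ 0 := mod_cast hk.ne'
  simp only [bernSum, pow_zero, one_mul]
  refine sum_congr rfl fun D _ => ?_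
  congr 1
  refine sum_congr rfl fun h _ => ?_
  congr 2
  · push_cast; rw [← mul_div_mul_left (x + P * h : ℚ) _ hkq]; congr 1 <;> ring
  · push_cast; rw [← mul_div_mul_left (a * x + b * y + P * (a * h) : ℚ) _ hkq]; congr 1 <;> ring

theorem dedekindSum_eq_bernSum (n : ℕ → ℤ) (a : ℤ) {b : ℕ} (hb : 0 < b) (hNb : N ∣ b) {P : ℕ}
    (hP : 0 < P) {x : ℕ} (hx : x < P) (y : ℤ) :
    dedekindSum N n a b (fract ((x : ℚ) / P)) ((y : ℚ) / P) = bernSum N n a b 0 0 P x y := by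
  have hPq : (0 : ℚ) < P := mod_cast hP
  have hf : fract ((x : ℚ) / P) = (x : ℚ) / P := Int.fract_eq_self.2
    ⟨by positivity, by rw [div_lt_one hPq]; exact_mod_cast hx⟩
  rw [hf, dedekindSum, bernSum]
  refine sum_congr rfl fun D hD => ?_
  obtain ⟨hB, hDB⟩ := div_pos_of_mem hb hNb hD
  have hBq : ((b / D : ℕ) : ℚ) ≠ 0 := mod_cast hB.ne'
  have hDB' : (b : ℚ) = D * (b / D : ℕ) := mod_cast hDB.symm
  congr 1
  refine sum_congr rfl fun h _ => ?_
  rw [pow_zero, one_mul, one_mul, bernFn_zero]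
  congr 2
  · push_cast; field_simp; ring
  · push_cast; rw [hDB']; field_simp; ring

theorem tendsto_bernMoment (hn : IsBal(n, N)) (hpN : ¬ p.1 ∣ N) {a : ℤ} {b : ℕ} (hb : 0 < b)
    (hNb : N ∣ b) (hab : IsCoprime a (b : ℤ)) (i l : ℕ) :
    Tendsto (fun j : ℕ => ((∑ x ∈ range (p.1 ^ j),
      ∑ u ∈ range (p.1 ^ j), (x : ℚ) ^ i * (a * x - b * u) ^ l *
      bernSum N n a b 0 0 (p.1 ^ j) x (-(u : ℤ)) : ℚ) : ℚ_[p])) atTop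
      (𝓝 (bernMoment N n a b i l : ℚ)) := by
  obtain ⟨C, hC, h⟩ := exists_bernSum_congr hn hb hNb hab i l
  have hCp : (C : ℚ_[p]) ≠ 0 := mod_cast hC.ne'
  have key : ∀ j : ℕ, ∃ z : ℤ, (C : ℚ) * (bernMoment N n a b i l - ∑ x ∈ range (p.1 ^ j),
      ∑ u ∈ range (p.1 ^ j), (x : ℚ) ^ i * (a * x - b * u) ^ l *
        bernSum N n a b 0 0 (p.1 ^ j) x (-(u : ℤ))) = p.1 ^ j * z := by
    intro j; have hP : 0 < p.1 ^ j := pow_pos p.2.pos j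
    choose z hz using fun x u : ℕ => h _ (x : ℤ) (-(u : ℤ)) hP
    refine ⟨∑ x ∈ range (p.1 ^ j), ∑ u ∈ range (p.1 ^ j), z x u, ?_⟩
    rw [← sum_bernSum n a hb hNb i l hP (Coprime.pow_left j (p.2.coprime_iff_not_dvd.2 hpN)),
      ← sum_sub_distrib, mul_sum]
    push_cast; rw [mul_sum]; refine sum_congr rfl fun x _ => ?_
    rw [← sum_sub_distrib, mul_sum, mul_sum]; refine sum_congr rfl fun u _ => ?_
    have := hz x u; push_cast at this; rw [← this]; ring
  rw [tendsto_iff_norm_sub_tendsto_zero]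
  have h0 : Tendsto (fun j : ℕ => ‖(p.1 : ℚ_[p])‖ ^ j * ‖(C : ℚ_[p])‖⁻¹) atTop (𝓝 0) := by
    rw [← zero_mul ‖(C : ℚ_[p])‖⁻¹]
    exact (tendsto_pow_atTop_nhds_zero_of_lt_one (norm_nonneg _) Padic.norm_p_lt_one).mul_const _
  refine squeeze_zero (fun _ => norm_nonneg _) (fun j => ?_) h0
  obtain ⟨z, hz⟩ := key j
  have hz' := congrArg (Rat.cast : ℚ → ℚ_[p]) hz
  rw [cast_mul, Rat.cast_sub, Rat.cast_natCast] at hz'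
  rw [norm_sub_rev, ← div_eq_mul_inv, le_div_iff₀ (norm_pos_iff.2 hCp), mul_comm, ← norm_mul, hz']
  push_cast
  rw [norm_mul, norm_pow]
  exact mul_le_of_le_one_right (by positivity) (Padic.norm_int_le_one z)

/-- The sum over primitive pairs is a difference of sums over all pairs. -/
theorem sum_primitive {A : Type*} [AddCommGroup A] (g : ℕ → ℕ → A) {q : ℕ} (hq : 0 < q) (P : ℕ) :
    ∑ x ∈ (range (q * P) ×ˢ range (q * P)) with ¬ (q ∣ x.1 ∧ q ∣ x.2), g x.1 x.2 =
      ∑ x ∈ range (q * P), ∑ u ∈ range (q * P), g u x -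
      ∑ x ∈ range P, ∑ u ∈ range P, g (q * u) (q * x) := by
  rw [eq_sub_iff_add_eq, sum_comm (s := range (q * P)),
    ← Finset.sum_product' (f := fun u x => g u x), sum_comm (s := range P),
    ← Finset.sum_product' (f := fun u x => g (q * u) (q * x)), add_comm,
    ← Finset.sum_filter_add_sum_filter_not (range (q * P) ×ˢ range (q * P))
      (fun x => q ∣ x.1 ∧ q ∣ x.2)]
  congr 1
  refine Finset.sum_nbij' (fun x => (q * x.1, q * x.2)) (fun x => (x.1 / q, x.2 / q)) ?_ ?_ ?_ ?_ ?_
  · rintro ⟨u, x⟩ h; simp only [mem_product, mem_range, mem_filter] at h ⊢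
    exact ⟨⟨(Nat.mul_lt_mul_left hq).2 h.1, (Nat.mul_lt_mul_left hq).2 h.2⟩, dvd_mul_right _ _,
      dvd_mul_right _ _⟩
  · rintro ⟨u, x⟩ h; simp only [mem_product, mem_range, mem_filter] at h ⊢
    exact ⟨Nat.div_lt_of_lt_mul h.1.1, Nat.div_lt_of_lt_mul h.1.2⟩
  · rintro ⟨u, x⟩ _; simp only [Nat.mul_div_cancel_left _ hq]
  · rintro ⟨u, x⟩ h; simp only [mem_product, mem_range, mem_filter] at h
    simp only [Nat.mul_div_cancel' h.2.1, Nat.mul_div_cancel' h.2.2]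
  · rintro ⟨u, x⟩ _; rfl

theorem tendsto_primitive_moment (hn : IsBal(n, N)) (hpN : ¬ p.1 ∣ N) {a : ℤ} {b : ℕ} (hb : 0 < b)
    (hNb : N ∣ b) (hab : IsCoprime a (b : ℤ)) (i l : ℕ) :
    Tendsto (fun j : ℕ => ((∑ x ∈ (range (p.1 ^ (j + 1)) ×ˢ
      range (p.1 ^ (j + 1))) with ¬ (p.1 ∣ x.1 ∧ p.1 ∣ x.2),
      (x.2 : ℚ) ^ i * (a * x.2 - b * x.1) ^ l *
      bernSum N n a b 0 0 (p.1 ^ (j + 1)) x.2 (-(x.1 : ℤ)) : ℚ) : ℚ_[p])) atTop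
      (𝓝 (((1 - p.1 ^ (i + l)) * bernMoment N n a b i l : ℚ) : ℚ_[p])) := by
  have h := tendsto_bernMoment (p := p) hn hpN hb hNb hab i l
  have h1 := ((Filter.tendsto_add_atTop_iff_nat 1).2 h).sub (h.const_mul ((p.1 : ℚ_[p]) ^ (i + l)))
  have e : ((bernMoment N n a b i l : ℚ) : ℚ_[p]) - (p.1 : ℚ_[p]) ^ (i + l) *
      (bernMoment N n a b i l : ℚ) = ((1 - p.1 ^ (i + l)) * bernMoment N n a b i l : ℚ) := by
    push_cast; ring
  rw [e] at h1
  refine h1.congr fun j => ?_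
  rw [pow_succ' p.1 j, sum_primitive (fun u x => (x : ℚ) ^ i * (a * x - b * u) ^ l *
        bernSum N n a b 0 0 (p.1 * p.1 ^ j) x (-(u : ℤ))) p.2.pos, Rat.cast_sub]
  congr 1
  rw [← Rat.cast_natCast, ← Rat.cast_pow, ← cast_mul, mul_sum]
  congr 1
  refine sum_congr rfl fun x _ => ?_
  rw [mul_sum]
  refine sum_congr rfl fun u _ => ?_
  have := bernSum_scale (N := N) n a b (P := p.1 ^ j) p.2.pos x (-(u : ℤ))
  rw [← this]
  have e : (a : ℚ) * (p.1 * x : ℕ) - b * (p.1 * u : ℕ) = p.1 * (a * x - b * u) := by push_cast; ring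
  rw [e, mul_pow]
  push_cast
  rw [mul_neg, pow_add]
  ring

/-! Transport to column vectors -/

theorem rowToCol_rowToCol (v : Fin 2 → ℚ_[p]) : rowToCol (rowToCol v) = -v := by
  funext i
  fin_cases i <;> simp [rowToCol]

theorem neg_mem_iff_of_isTestWith {O : Subring ℚ_[p]} (v : Fin 2 → ℚ_[p]) (h : ∀ i, v i ∈ O) :
    ∀ i, rowToCol v i ∈ O := fun i => by
  fin_cases i
  · exact neg_mem (h 1)
  · exact h 0

/-- Pullback of test functions on column vectors to row vectors. -/
def colHom (p : Primes) : TestFn Z_[p] →+ TestFn Z_[p] where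
  toFun f := ⟨fun v => f.1 (rowToCol v), by
    obtain ⟨f, hf0, m, hm, hf⟩ := f; refine ⟨?_, m, hm, fun v hv i => ?_, fun v w hw => ?_⟩
    · have : rowToCol (0 : Fin 2 → ℚ_[p]) = 0 := by funext i; fin_cases i <;> simp [rowToCol]
      simp only [this, hf0]
    · have h := hf.1 _ hv
      fin_cases i
      · exact h 1
      · have := neg_mem (h 0); simpa [rowToCol] using this
    · simp only
      rw [← hf.2 (rowToCol v) (rowToCol w) (neg_mem_iff_of_isTestWith w hw)]; congr 1
      funext i
      fin_cases i <;> simp [rowToCol, add_comm]⟩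
  map_zero' := rfl
  map_add' _ _ := rfl

/-- Transport of a distribution to column vectors. -/
def colDist (ν : Dist Z_[p] ℤ) : Dist Z_[p] ℤ := (show TestFn Z_[p] →+ ℤ from ν).comp (colHom p)

theorem colDist_apply (ν : Dist Z_[p] ℤ) (f : TestFn Z_[p]) : colDist ν f = ν (colHom p f) := rfl

theorem colDist_eq (ν : Dist Z_[p] ℤ) {f f' : TestFn Z_[p]} (h : ∀ v, f'.1 (rowToCol v) = f.1 v) :
    colDist ν f' = ν f := by
  rw [colDist_apply]
  congr 1
  exact Subtype.ext (funext h)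

theorem mem_cell_pow_iff {a b : ℤ} {v : Fin 2 → ℚ_[p]} : v ∈ cell Z_[p] (p.1 ^ j) a b ↔
      ‖v 0 - a‖ ≤ ((p.1 : ℝ) ^ j)⁻¹ ∧ ‖v 1 - b‖ ≤ ((p.1 : ℝ) ^ j)⁻¹ := by
  have hp0 : (p.1 : ℚ_[p]) ^ j ≠ 0 := pow_ne_zero _ (mod_cast p.2.ne_zero)
  have hn : ‖(p.1 : ℚ_[p]) ^ j‖ = ((p.1 : ℝ) ^ j)⁻¹ := by rw [norm_pow, Padic.norm_p, inv_pow]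
  have hpos : 0 < ((p.1 : ℝ) ^ j)⁻¹ := by rw [← hn]; exact norm_pos_iff.2 hp0
  have key : ∀ (x : ℚ_[p]) (a : ℤ), (∃ w ∈ Z_[p],
      x = algebraMap ℚ ℚ_[p] a + (p.1 ^ j : ℕ) * w) ↔ ‖x - a‖ ≤ ((p.1 : ℝ) ^ j)⁻¹ := by
    intro x a; rw [eq_ratCast, Rat.cast_intCast]; push_cast
    constructor
    · rintro ⟨w, hw, rfl⟩; rw [add_sub_cancel_left, norm_mul, hn]
      exact mul_le_of_le_one_right hpos.le ((mem_subring_iff _).1 hw)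
    · intro h; refine ⟨(x - a) / p.1 ^ j, (mem_subring_iff _).2 ?_, ?_⟩
      · rw [norm_div, hn]; exact div_le_one_of_le₀ h hpos.le
      · field_simp; ring
  exact and_congr (key _ _) (key _ _)

theorem zero_notMem_cell_of_primitive (hj : 0 < j) {u x : ℤ}
    (h : ¬ ((p.1 : ℤ) ∣ u ∧ (p.1 : ℤ) ∣ x)) : (0 : Fin 2 → ℚ_[p]) ∉ cell Z_[p] (p.1 ^ j) x u := by
  rw [mem_cell_pow_iff]
  simp only [Pi.zero_apply, zero_sub, norm_neg]
  have key : ∀ y : ℤ, ‖(y : ℚ_[p])‖ ≤ ((p.1 : ℝ) ^ j)⁻¹ → (p.1 : ℤ) ∣ y := fun y hy => by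
    have : ‖(y : ℚ_[p])‖ ≤ (p.1 : ℝ) ^ (-(j : ℕ) : ℤ) := by rwa [zpow_neg, zpow_natCast]
    have h1 := (Padic.norm_int_le_pow_iff_dvd y j).1 this
    exact (dvd_pow_self _ hj.ne').trans (mod_cast h1)
  exact fun h' => h ⟨key _ h'.2, key _ h'.1⟩

theorem mass_ball_eq (ν : Dist Z_[p] ℤ) (j u x : ℕ) :
    ν.mass (ball p j u x) = ν (cellFn _ (p.1 ^ j) (u : ℤ) (x : ℤ)) := by
  rw [← mass_cell]
  congr 1
  ext w
  rw [mem_cell_pow_iff]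
  simp [ball]

theorem colDist_mass_ball (ν : Dist Z_[p] ℤ) (hj : 0 < j) {u x : ℕ} (h : ¬ (p.1 ∣ u ∧ p.1 ∣ x)) :
    (colDist ν).mass (ball p j u x) = ν (cellFn Z_[p] (p.1 ^ j) x (-(u : ℤ) : ℤ)) := by
  have h1 := zero_notMem_cell_of_primitive hj (u := x) (x := u) fun h' =>
    h ⟨mod_cast h'.2, mod_cast h'.1⟩
  have h2 := zero_notMem_cell_of_primitive hj (u := -u) (x := x) fun h' =>
    h ⟨by exact_mod_cast (dvd_neg.1 h'.1), mod_cast h'.2⟩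
  rw [mass_ball_eq, ← cast_natCast (R := ℚ) x]
  refine colDist_eq ν fun v => ?_
  rw [cellFn_apply _ (pow_pos p.2.pos j) _ _ h1, cellFn_apply _ (pow_pos p.2.pos j) _ _ h2]
  refine indicator_congr ?_
  rw [mem_cell_pow_iff, mem_cell_pow_iff, and_comm, ← norm_neg (rowToCol v 0 - _)]
  simp [rowToCol, add_comm]

/-! Moments of the cocycle -/

/-- The integral of `z^s dz` against the Eisenstein series from the cusp `a/b` to `i∞`, for the
weight `s + r + 2`. -/
def cuspMoment (N : ℕ) (n : ℕ → ℤ) (a : ℤ) (b s r : ℕ) : ℚ :=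
  12 * ((b : ℚ) ^ s)⁻¹ * ∑ t ∈ range (s + 1),
    (a : ℚ) ^ (s - t) * (-1) ^ t * (s.choose t) * bernMoment N n a b (s - t + r) t

theorem tendsto_moment_siegelCocycle (hpN : ¬ p.1 ∣ N) (hn : IsBal(n, N)) (hN : 0 < N)
    (g : GSN (primesNe p) N) (h : mat (g : GQ) 1 0 ≠ 0) (s r : ℕ) :
    Tendsto (fun j : ℕ => ∑ x ∈ (range (p.1 ^ j) ×ˢ range (p.1 ^ j)) with ¬ (p.1 ∣ x.1 ∧ p.1 ∣ x.2),
      ((x.1 : ℚ_[p]) ^ s * (x.2 : ℚ_[p]) ^ r) *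
      ((colDist ((siegelCocycle hpN hn hN).1 1 g)).mass (ball p j x.1 x.2) : ℚ_[p])) atTop
      (𝓝 ((-((1 - p.1 ^ (s + r)) * cuspMoment N n (mat (g : GQ) 0 0 / mat (g : GQ) 1 0).num
      (mat (g : GQ) 0 0 / mat (g : GQ) 1 0).den s r) : ℚ) : ℚ_[p])) := by
  have hdvd := dvd_den_of_mem_GSN g.2 h hpN
  set ρ := mat (g : GQ) 0 0 / mat (g : GQ) 1 0 with hρ
  have hab : IsCoprime ρ.num (ρ.den : ℤ) := Rat.isCoprime_num_den ρ
  rw [← Filter.tendsto_add_atTop_iff_nat 1]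
  have hbq : (ρ.den : ℚ) ≠ 0 := mod_cast ρ.den_nz
  have hlim := (tendsto_finsetSum (range (s + 1)) fun t _ =>
    (tendsto_primitive_moment (p := p) hn hpN ρ.den_pos hdvd hab (s - t + r) t).const_mul
      ((((-12) * ((ρ.den : ℚ) ^ s)⁻¹ * ((ρ.num : ℚ) ^ (s - t) * (-1) ^ t * (s.choose t)) : ℚ)) :
        ℚ_[p]))
  have e : ∑ t ∈ range (s + 1),
      ((((-12) * ((ρ.den : ℚ) ^ s)⁻¹ * ((ρ.num : ℚ) ^ (s - t) * (-1) ^ t * (s.choose t)) : ℚ)) :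
        ℚ_[p]) * (((1 - p.1 ^ (s - t + r + t)) *
          bernMoment N n ρ.num ρ.den (s - t + r) t : ℚ) : ℚ_[p]) =
      ((-((1 - p.1 ^ (s + r)) * cuspMoment N n ρ.num ρ.den s r) : ℚ) : ℚ_[p]) := by
    rw [cuspMoment]; simp only [← cast_mul, ← cast_sum]; congr 1
    rw [mul_sum, mul_sum, ← sum_neg_distrib]; refine sum_congr rfl fun t ht => ?_
    have : s - t + r + t = s + r := by have := mem_range.1 ht; omega
    rw [this]; ring
  rw [e] at hlim
  refine hlim.congr fun j => ?_
  simp only [← cast_mul, ← cast_sum]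
  simp only [mul_sum]
  rw [sum_comm, cast_sum]
  refine sum_congr rfl fun x hx => ?_
  simp only [mem_product, mem_range, mem_filter] at hx
  have hP : 0 < p.1 ^ (j + 1) := pow_pos p.2.pos _
  have h0 := zero_notMem_cell_of_primitive (p := p) (j := j + 1) (succ_pos j)
    (u := -(x.1 : ℤ)) (x := x.2) fun h' => hx.2 ⟨by exact_mod_cast (dvd_neg.1 h'.1), mod_cast h'.2⟩
  have hc := siegelCocycle_cellFn hpN hn hN g h (m := p.1 ^ (j + 1)) (d := 1)
    (a := ((x.2 : ℤ) : ℚ)) (b := ((-(x.1 : ℤ) : ℤ) : ℚ))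
    (pow_mem_primeProducts p (j + 1)) (by simpa using pow_mem_primeProducts p 0)
    ⟨x.2, by simp⟩ ⟨-x.1, by simp⟩ h0
  rw [← hρ, cast_natCast, dedekindSum_eq_bernSum n ρ.num ρ.den_pos hdvd hP hx.1.2] at hc
  have hc' := congrArg (Rat.cast : ℚ → ℚ_[p]) hc
  rw [Rat.cast_intCast] at hc'
  rw [colDist_mass_ball _ (j := j + 1) (succ_pos j) hx.2, hc']
  have e2 : ((x.1 : ℚ_[p]) ^ s * (x.2 : ℚ_[p]) ^ r) =
      (((x.1 : ℚ) ^ s * (x.2 : ℚ) ^ r : ℚ) : ℚ_[p]) := by push_cast; ring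
  rw [e2, ← cast_mul]
  congr 1
  have e3 : (x.1 : ℚ) ^ s = ((ρ.den : ℚ) ^ s)⁻¹ * ∑ t ∈ range (s + 1),
      (-(ρ.num * x.2 - ρ.den * x.1 : ℚ)) ^ t * (ρ.num * x.2 : ℚ) ^ (s - t) * s.choose t := by
    rw [← add_pow, eq_inv_mul_iff_mul_eq₀ (pow_ne_zero _ hbq), ← mul_pow]; congr 1; ring
  rw [e3, mul_sum, sum_mul, sum_mul]
  refine sum_congr rfl fun t ht => ?_
  rw [neg_pow (ρ.num * x.2 - ρ.den * x.1 : ℚ), mul_pow, pow_add]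
  ring

/-! Special values of zeta functions -/

open HurwitzZeta Filter

theorem sinZeta_one (y : ℚ) : sinZeta ((y : ℝ) : UnitAddCircle) 1 = -(π * sawtooth y : ℝ) := by
  have hex : ∀ m : ℕ, (ex ((m + 1) * y)).im = sin (2 * π * (y : ℝ) * (m + 1 : ℕ)) :=
    fun m => by
      have : (ex ((m + 1) * y)) = Complex.exp ((2 * π * (y : ℝ) * (m + 1 : ℕ) : ℝ) * I) := by
        rw [ex]; congr 1; push_cast; ring
      rw [this, Complex.exp_ofReal_mul_I_im]
  have hs : ∀ σ : ℝ, 0 < σ → HasSum (fun m : ℕ => (((ex ((m + 1) * y)).im / (m + 1) *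
      ((m : ℝ) + 1) ^ (-σ) : ℝ) : ℂ)) (sinZeta ((y : ℝ) : UnitAddCircle) (1 + σ)) := fun σ hσ => by
    have h := hasSum_nat_sinZeta (y : ℝ) (s := 1 + σ) (by simpa using hσ)
    rw [← hasSum_nat_add_iff' 1] at h
    simp only [Finset.sum_range_one, cast_zero, mul_zero, Real.sin_zero, Complex.ofReal_zero,
      zero_div, sub_zero] at h
    refine h.congr_fun fun m => ?_
    have hp : (0 : ℝ) < m + 1 := by positivity
    rw [hex, ofReal_mul, Complex.ofReal_div, Complex.ofReal_cpow hp.le,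
      Complex.cpow_add _ _ (mod_cast hp.ne'), Complex.cpow_one]
    push_cast; rw [cpow_neg]; field_simp
  have hre : ∀ σ : ℝ, 0 < σ → ((sinZeta ((y : ℝ) : UnitAddCircle) (1 + σ)).re : ℂ) =
      sinZeta ((y : ℝ) : UnitAddCircle) (1 + σ) := fun σ hσ => by
    refine Complex.ext rfl ?_
    have := Complex.hasSum_im (hs σ hσ); simp only [ofReal_im] at this ⊢
    exact hasSum_zero.unique this
  have hlim := tendsto_sum_mul_of_antitone (c := 1) (tendsto_sum_sin_div y)
    (ψ := fun σ m => ((m : ℝ) + 1) ^ (-σ))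
    (fun σ hσ i j hij => Real.rpow_le_rpow_of_nonpos (by positivity)
      (mod_cast Nat.succ_le_succ hij) (by linarith)) (fun σ _ m => by positivity)
    (fun m => by
      have : Tendsto (fun σ : ℝ => ((m : ℝ) + 1) ^ (-σ)) (𝓝 0) (𝓝 (((m : ℝ) + 1) ^ (-0 : ℝ))) :=
        (Real.continuousAt_const_rpow (by positivity)).tendsto.comp tendsto_id.neg
      simp only [neg_zero, Real.rpow_zero] at this
      exact this.mono_left nhdsWithin_le_nhds)
    (F := fun σ => (sinZeta ((y : ℝ) : UnitAddCircle) (1 + σ)).re)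
    (fun σ hσ => Complex.hasSum_re (hs σ hσ))
  have h1 : Tendsto (fun σ : ℝ => sinZeta ((y : ℝ) : UnitAddCircle) (1 + σ))
      (𝓝[>] 0) (𝓝 (sinZeta ((y : ℝ) : UnitAddCircle) 1)) := by
    have : Continuous fun σ : ℝ => sinZeta ((y : ℝ) : UnitAddCircle) (1 + σ) :=
      (differentiableAt_sinZeta _).continuous.comp (by fun_prop)
    simpa using (this.tendsto 0).mono_left nhdsWithin_le_nhds
  refine tendsto_nhds_unique h1 (((Complex.continuous_ofReal.tendsto _).comp hlim).congr' ?_) |>.trans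
    (by simp)
  filter_upwards [self_mem_nhdsWithin] with σ hσ using hre σ hσ

theorem coe_fract_circle (y : ℚ) : ((y : ℝ) : UnitAddCircle) = (((fract y : ℚ) : ℝ) : UnitAddCircle) := by
  have : (y : ℝ) = ((fract y : ℚ) : ℝ) + (⌊y⌋ : ℝ) := by exact_mod_cast (Int.fract_add_floor y).symm
  rw [this, AddCircle.coe_add, (AddCircle.coe_eq_zero_iff (1 : ℝ) (x := (⌊y⌋ : ℝ))).2 ⟨⌊y⌋, by simp⟩,
    add_zero]

theorem bernoulli_map_eval (m : ℕ) (y : ℚ) : ((bernP m).map (algebraMap ℚ ℂ)).eval ((y : ℝ) : ℂ) =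
      ((bernP m).eval y : ℚ) := by
  have : ((y : ℝ) : ℂ) = algebraMap ℚ ℂ y := by simp
  rw [this, Polynomial.eval_map_apply]
  rfl

theorem fract_mem_Icc (y : ℚ) : ((fract y : ℚ) : ℝ) ∈ Set.Icc (0 : ℝ) 1 :=
  ⟨mod_cast Int.fract_nonneg y, mod_cast (Int.fract_lt_one y).le⟩

theorem hurwitzZeta_neg_nat_eq (i : ℕ) (y : ℚ) : hurwitzZeta ((y : ℝ) : UnitAddCircle) (-i) =
    -(bernFn i y : ℂ) - if i = 0 ∧ ((y : ℝ) : UnitAddCircle) = 0 then 1 / 2 else 0 := by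
  rcases eq_or_ne i 0 with rfl | hi
  · have h := hurwitzZetaOdd_one_sub ((y : ℝ) : UnitAddCircle) (s := 1) (fun n h => by
      have : (1 : ℝ) = -n := mod_cast congrArg Complex.re h
      have : (0 : ℝ) ≤ n := cast_nonneg n
      linarith)
    rw [sub_self, sinZeta_one, Complex.Gamma_one, mul_one, mul_one, Complex.sin_pi_div_two,
      Complex.cpow_neg_one] at h
    have hpi : (π : ℂ) ≠ 0 := mod_cast pi_ne_zero
    rw [cast_zero, neg_zero, hurwitzZeta, hurwitzZetaEven_apply_zero, h, bernFn_zero]; push_cast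
    split_ifs with h1 h2 h2
    · field_simp; ring
    · exact absurd ⟨trivial, h1⟩ h2
    · exact absurd h2.2 h1
    · field_simp; ring
  · rw [if_neg (fun h => hi h.1), sub_zero, coe_fract_circle,
      hurwitzZeta_neg_nat hi (fract_mem_Icc y), bernoulli_map_eval, bernFn_of_ne_zero hi]
    push_cast; ring

/-- The real part of `i^{l+1} e^{2πix}`. -/
def trigCoeff (l : ℕ) (x : ℝ) : ℝ := (I ^ (l + 1) * ex x).re

/-- The analytic continuation of `∑ trigCoeff l (n x) / n^s`. -/
def trigZeta (l : ℕ) (x : UnitAddCircle) (s : ℂ) : ℂ :=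
  if Even l then (-1) ^ (l / 2 + 1) * sinZeta x s else (-1) ^ ((l + 1) / 2) * cosZeta x s

theorem trigCoeff_eq (l : ℕ) (x : ℝ) : trigCoeff l x = if Even l then
    (-1) ^ (l / 2 + 1) * sin (2 * π * x) else (-1) ^ ((l + 1) / 2) * Real.cos (2 * π * x) := by
  have hx : ex x = Complex.exp ((2 * π * x : ℝ) * I) := by rw [ex]; congr 1; push_cast; ring
  rw [trigCoeff, hx]
  obtain ⟨m, rfl | rfl⟩ := Nat.even_or_odd' l
  · rw [if_pos (even_two_mul m), Nat.mul_div_cancel_left _ two_pos, pow_succ, pow_mul, I_sq]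
    have : ((-1 : ℂ) ^ m) = (((-1) ^ m : ℝ) : ℂ) := by push_cast; rfl
    rw [this, mul_assoc, re_ofReal_mul, Complex.I_mul_re, Complex.exp_ofReal_mul_I_im]; ring
  · rw [if_neg (by simp), show 2 * m + 1 + 1 = 2 * (m + 1) by ring,
      Nat.mul_div_cancel_left _ two_pos, pow_mul, I_sq]
    have : ((-1 : ℂ) ^ (m + 1)) = (((-1) ^ (m + 1) : ℝ) : ℂ) := by push_cast; rfl
    rw [this, re_ofReal_mul, Complex.exp_ofReal_mul_I_re]

theorem hasSum_trigZeta (l : ℕ) (x : ℝ) {s : ℂ} (hs : 1 < s.re) :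
    HasSum (fun n : ℕ => (trigCoeff l (x * n) : ℂ) / (n : ℂ) ^ s) (trigZeta l x s) := by
  simp only [trigCoeff_eq, trigZeta]
  split_ifs
  · refine ((hasSum_nat_sinZeta x hs).mul_left _).congr_fun fun n => ?_
    push_cast; ring_nf
  · refine ((hasSum_nat_cosZeta x hs).mul_left _).congr_fun fun n => ?_
    push_cast; ring_nf

theorem trigZeta_nat (l : ℕ) (y : ℚ) : trigZeta l ((y : ℝ) : UnitAddCircle) (l + 1) =
    (-1) ^ l * (2 * π) ^ (l + 1) / (2 * l.factorial) * bernFn l y := by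
  have hsq : ∀ m : ℕ, ((-1 : ℂ) ^ m) * (-1) ^ m = 1 := fun m => by rw [← mul_pow]; norm_num
  rw [trigZeta]
  obtain ⟨m, rfl | rfl⟩ := Nat.even_or_odd' l
  · rw [if_pos (even_two_mul m), Nat.mul_div_cancel_left _ two_pos, (even_two_mul m).neg_one_pow]
    rcases eq_or_ne m 0 with rfl | hm
    · simp only [mul_zero, cast_zero, zero_add, sinZeta_one, bernFn_zero, Nat.factorial_zero]
      push_cast; ring
    · have h := sinZeta_two_mul_nat_add_one hm (fract_mem_Icc y)
      rw [bernoulli_map_eval, ← coe_fract_circle] at h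
      have hf : ((2 * m).factorial : ℂ) ≠ 0 := mod_cast Nat.factorial_ne_zero _
      have hm1 : (2 * (m : ℂ) + 1) ≠ 0 := mod_cast succ_ne_zero (2 * m)
      rw [bernFn_of_ne_zero (by omega)]; push_cast; rw [h, Nat.factorial_succ]; push_cast
      field_simp
      linear_combination (((bernP (2 * m + 1)).eval (fract y) : ℚ) : ℂ) * (hsq (m + 1))
  · rw [if_neg (by simp), show 2 * m + 1 + 1 = 2 * (m + 1) by ring,
      Nat.mul_div_cancel_left _ two_pos, (odd_two_mul_add_one m).neg_one_pow]
    have h := cosZeta_two_mul_nat (succ_ne_zero m) (fract_mem_Icc y)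
    rw [bernoulli_map_eval, ← coe_fract_circle] at h
    have hf : ((2 * m + 1).factorial : ℂ) ≠ 0 := mod_cast Nat.factorial_ne_zero _
    have hm1 : (2 * (m : ℂ) + 1 + 1) ≠ 0 := mod_cast succ_ne_zero (2 * m + 1)
    have e : ((2 * m + 1 : ℕ) : ℂ) + 1 = 2 * ((m + 1 : ℕ) : ℂ) := by push_cast; ring
    rw [bernFn_of_ne_zero (by omega), e, h, show 2 * m.succ = 2 * m + 1 + 1 by omega,
      Nat.factorial_succ]
    push_cast; rw [Nat.succ_eq_add_one]; field_simp
    linear_combination -(((bernP (2 * m + 1 + 1)).eval (fract y) : ℚ) : ℂ) * (hsq (m + 1))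

theorem differentiableAt_trigZeta (l : ℕ) (x : UnitAddCircle) {s : ℂ} (h : s ≠ 1 ∨ Even l) :
    DifferentiableAt ℂ (trigZeta l x) s := by
  unfold trigZeta
  split_ifs with hl
  · exact ((differentiableAt_sinZeta x) s).const_mul _
  · exact (differentiableAt_cosZeta x (Or.inl (h.resolve_right hl))).const_mul _

theorem trigZeta_zero_of_even (hl : Even l) (s : ℂ) : trigZeta l 0 s = 0 := by
  have := sinZeta_neg 0 s
  rw [neg_zero, self_eq_neg] at this
  rw [trigZeta, if_pos hl, this, mul_zero]

/-! Eisenstein series on vertical lines -/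

open Filter Asymptotics Topology

/-- The Eisenstein series without its constant term. -/
def eisensteinTail (k : ℕ) (z : ℂ) : ℂ :=
  ∑' m : ℕ, (ArithmeticFunction.sigma (k - 1) (m + 1) : ℂ) * Complex.exp (2 * π * I * (m + 1) * z)

theorem eisenstein_eq_add_tail (k : ℕ) (z : ℂ) :
    eisenstein k z = -(bernoulli k : ℂ) / (2 * k) + eisensteinTail k z := rfl

theorem eisensteinTail_eq_tsum_pnat (k : ℕ) (z : ℂ) : eisensteinTail k z =
    ∑' m : ℕ+, (ArithmeticFunction.sigma (k - 1) m : ℂ) * ex z ^ (m : ℕ) := by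
  rw [tsum_pnat_eq_tsum_succ (f := fun m : ℕ =>
    (ArithmeticFunction.sigma (k - 1) m : ℂ) * ex z ^ m), eisensteinTail]
  refine tsum_congr fun m => ?_
  rw [ex, ← exp_nat_mul]
  push_cast
  ring_nf

theorem hasSum_eisensteinTail (k : ℕ) (z : ℍ) :
    HasSum (fun c : ℕ+ × ℕ+ => (c.2 : ℂ) ^ (k - 1) * ex z ^ (c.1 * c.2 : ℕ)) (eisensteinTail k z) := by
  have h := summable_prod_mul_pow (k - 1) (norm_ex_lt_one z.im_pos)
  rw [eisensteinTail_eq_tsum_pnat, ← tsum_prod_pow_eq_tsum_sigma (k - 1) (norm_ex_lt_one z.im_pos),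
    ← h.tsum_prod]
  exact h.hasSum

theorem bernoulli_ne_zero_of_even (hk : k ≠ 0) (h : Even k) : bernoulli k ≠ 0 := by
  obtain ⟨m, rfl⟩ := h.two_dvd
  intro h0
  have := riemannZeta_two_mul_nat (k := m) (by omega)
  rw [h0] at this
  refine riemannZeta_ne_zero_of_one_lt_re (s := 2 * m) ?_ (by simpa using this)
  have : (1 : ℝ) ≤ m := mod_cast (show 1 ≤ m by omega)
  simp
  linarith

theorem eisenstein_eq_E (hk : 3 ≤ k) (hk2 : Even k) (z : ℍ) :
    eisenstein k z = -(bernoulli k : ℂ) / (2 * k) * ModularForm.E hk z := by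
  have hB : (bernoulli k : ℂ) ≠ 0 := mod_cast bernoulli_ne_zero_of_even (by omega) hk2
  have hk0 : (k : ℂ) ≠ 0 := mod_cast (by omega : k ≠ 0)
  rw [EisensteinSeries.q_expansion_bernoulli hk hk2, eisenstein_eq_add_tail,
    eisensteinTail_eq_tsum_pnat]
  simp only [zpow_natCast, ex]
  field_simp
  ring

theorem exists_norm_eisensteinTail_le (k : ℕ) : ∃ C, 0 ≤ C ∧ ∀ z : ℂ, 1 ≤ z.im →
    ‖eisensteinTail k z‖ ≤ C * exp (-(2 * π) * z.im) := by
  have h1 := (hasSum_eisensteinTail k UpperHalfPlane.I).summable.norm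
  have hnorm : ∀ z : ℂ, ‖ex z‖ = exp (-(2 * π) * z.im) := fun z => by
    rw [ex, Complex.norm_exp]; congr 1; simp
  refine ⟨(∑' c : ℕ+ × ℕ+, ‖(c.2 : ℂ) ^ (k - 1) * ex (UpperHalfPlane.I : ℍ) ^ (c.1 * c.2 : ℕ)‖) *
    exp (2 * π), mul_nonneg (tsum_nonneg fun _ => norm_nonneg _) (Real.exp_nonneg _),
    fun z hz => ?_⟩
  have h2 := hasSum_eisensteinTail k ⟨z, by linarith⟩
  rw [← (show _ = eisensteinTail k z from h2.tsum_eq), mul_assoc, ← Real.exp_add, ← tsum_mul_right]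
  refine tsum_of_norm_bounded (h1.mul_right _).hasSum fun c => ?_
  rw [norm_mul, norm_mul, mul_assoc]
  refine mul_le_mul_of_nonneg_left ?_ (norm_nonneg _)
  rw [norm_pow, norm_pow]
  change ‖ex z‖ ^ _ ≤ ‖ex (UpperHalfPlane.I : ℍ)‖ ^ _ * _
  rw [hnorm, hnorm, ← Real.exp_nat_mul, ← Real.exp_nat_mul, ← Real.exp_add, Real.exp_le_exp]
  have hm : (1 : ℝ) ≤ (c.1 * c.2 : ℕ) := by
    exact_mod_cast Nat.one_le_iff_ne_zero.2 (Nat.mul_ne_zero c.1.ne_zero c.2.ne_zero)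
  have hI : (UpperHalfPlane.I : ℂ).im = 1 := by simp
  rw [hI]
  nlinarith [mul_nonneg (mul_nonneg pi_pos.le (sub_nonneg.2 hm)) (sub_nonneg.2 hz)]

theorem eisenstein_vertical (hk : 3 ≤ k) (hk2 : Even k) {a : ℤ} {B : ℕ} (hB : 0 < B)
    (hab : IsCoprime a (B : ℤ)) : ∃ r : ℝ, ∀ t : ℝ, 0 < t → eisenstein k (a / B + t * I) =
      (I * (B * t)) ^ (-(k : ℤ)) * eisenstein k (r + (1 / (B ^ 2 * t) : ℝ) * I) := by
  obtain ⟨u, v, huv⟩ := hab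
  refine ⟨-(u / B), fun t ht => ?_⟩
  have hBr : (0 : ℝ) < B := mod_cast hB
  have hBc : (B : ℂ) ≠ 0 := mod_cast hB.ne'
  have htc : (t : ℂ) ≠ 0 := mod_cast ht.ne'
  obtain ⟨γ, hγ⟩ : ∃ γ : SL(2, ℤ), γ.1 = !![-u, -v; (B : ℤ), -a] :=
    ⟨⟨_, by rw [Matrix.det_fin_two_of]; linear_combination huv⟩, rfl⟩
  have hent : ∀ i j, (mapGL ℝ γ) i j =
      ((!![-u, -v; (B : ℤ), -a] i j : ℤ) : ℝ) := fun i j => by rw [← hγ]; simp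
  have hγz := SlashInvariantForm.slash_action_eqn'' (ModularForm.E hk)
    (γ := mapGL ℝ γ) (MonoidHom.mem_range.2 ⟨γ, rfl⟩) (vert (a / B) t)
  have hd : denom (mapGL ℝ γ) (vert (a / B) t) = I * (B * t) := by
    rw [denom, coe_vert _ ht, hent, hent]; simp; field_simp; ring
  have hz : (((mapGL ℝ γ) • vert (a / B) t : ℍ) : ℂ) =
      ((-(u / B) : ℝ) : ℂ) + (1 / (B ^ 2 * t) : ℝ) * I := by
    have huv' : (u : ℂ) * a + v * B = 1 := mod_cast huv
    rw [coe_smul_of_det_pos (by simp), hd, num, coe_vert _ ht, hent, hent]; simp; field_simp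
    ring_nf; rw [I_sq]
    linear_combination -huv'
  have h1 := eisenstein_eq_E hk hk2 (vert (a / B) t)
  have h2 := eisenstein_eq_E hk hk2 ((mapGL ℝ γ) • vert (a / B) t)
  rw [hγz, hd, hz, zpow_natCast] at h2
  rw [coe_vert _ ht] at h1
  have : (I * (B * t)) ^ k ≠ 0 := pow_ne_zero _ (by simp [hBc, htc])
  push_cast at h1 h2 ⊢
  rw [h1, h2, zpow_neg, zpow_natCast]
  generalize (I * ((B : ℂ) * t)) ^ k = x at *
  field_simp

theorem continuousOn_eisenstein_vertical (hk : 3 ≤ k) (hk2 : Even k) (r : ℝ) (hD : 0 < D) :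
    ContinuousOn (fun t : ℝ => eisenstein k (D * (r + t * I))) (Ioi 0) := by
  have hE : Continuous (ModularForm.E hk) := (ModularForm.E hk).holo'.continuous
  have hD' : (0 : ℝ) < D := mod_cast hD
  rw [continuousOn_iff_continuous_domRestrict]
  have : (Ioi (0 : ℝ)).domRestrict (fun t : ℝ => eisenstein k (D * (r + t * I))) = fun t : Ioi (0 : ℝ) =>
      -(bernoulli k : ℂ) / (2 * k) * ModularForm.E hk ⟨D * (r + (t : ℝ) * I), by
        simpa using mul_pos hD' t.2⟩ := by
    funext t
    rw [← eisenstein_eq_E hk hk2]; rfl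
  rw [this]
  refine continuous_const.mul (hE.comp ?_)
  rw [UpperHalfPlane.isEmbedding_coe.continuous_iff]
  change Continuous fun t : Ioi (0 : ℝ) => (D : ℂ) * (r + (t : ℝ) * I)
  fun_prop

open Filter Asymptotics Topology

section decay

variable {a : ℤ} {b : ℕ}

theorem natCast_mul_vertical (hb : 0 < b) (hNb : N ∣ b) (hD : D ∈ N.divisors) (a : ℤ) (t : ℝ) :
    (D : ℂ) * (a / b + t * I) = a / (b / D : ℕ) + ((D * t : ℝ) : ℂ) * I := by
  obtain ⟨hB, he⟩ := div_pos_of_mem hb hNb hD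
  have hb' : (b : ℂ) ≠ 0 := mod_cast hb.ne'
  have hB' : ((b / D : ℕ) : ℂ) ≠ 0 := mod_cast hB.ne'
  have he' : (D : ℂ) * (b / D : ℕ) = b := mod_cast he
  generalize b / D = B at *
  have hD' : (D : ℂ) ≠ 0 := fun h => hb' (by rw [← he', h, zero_mul])
  rw [← he']
  push_cast
  field_simp

theorem isCoprime_div (hb : 0 < b) (hNb : N ∣ b) (hD : D ∈ N.divisors) (hab : IsCoprime a (b : ℤ)) :
    IsCoprime a ((b / D : ℕ) : ℤ) := by
  obtain ⟨-, he⟩ := div_pos_of_mem hb hNb hD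
  refine hab.of_isCoprime_of_dvd_right ⟨D, ?_⟩
  exact_mod_cast (by rw [mul_comm]; exact he.symm : b = b / D * D)

theorem eisensteinDelta_eq_tail (hn : IsBal(n, N)) (z : ℂ) : eisensteinDelta N n k z =
      ∑ D ∈ N.divisors, (-24 * ((n D : ℂ) * D)) * eisensteinTail k (D * z) := by
  have h : ∑ D ∈ N.divisors, (n D : ℂ) * D = 0 := mod_cast hn
  simp only [eisensteinDelta, eisenstein_eq_add_tail, mul_add, sum_add_distrib]
  rw [← sum_mul, h, zero_mul, mul_zero, zero_add, mul_sum]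
  simp only [mul_assoc]

theorem continuousOn_eisensteinDelta (hk : 3 ≤ k) (hk2 : Even k) (r : ℝ) :
    ContinuousOn (fun t : ℝ => eisensteinDelta N n k (r + t * I)) (Ioi 0) := by
  unfold eisensteinDelta
  exact continuousOn_const.mul (continuousOn_finsetSum _ fun D hD => continuousOn_const.mul
    (continuousOn_eisenstein_vertical hk hk2 r (pos_of_mem_divisors hD)))

theorem isBigO_atTop_eisensteinDelta (hn : IsBal(n, N)) (r : ℝ) :
    (fun t : ℝ => eisensteinDelta N n k (r + t * I)) =O[atTop] fun t => exp (-(2 * π) * t) := by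
  obtain ⟨C, hC0, hC⟩ := exists_norm_eisensteinTail_le k
  simp only [eisensteinDelta_eq_tail hn]
  refine IsBigO.fun_sum fun D hD => ?_
  refine IsBigO.const_mul_left (IsBigO.of_bound C ?_) _
  have hD1 : (1 : ℝ) ≤ D := mod_cast pos_of_mem_divisors hD
  filter_upwards [eventually_ge_atTop 1] with t ht
  have him : (D * (r + t * I) : ℂ).im = D * t := by simp
  refine (hC _ (by rw [him]; nlinarith)).trans ?_
  rw [him, norm_eq_abs, abs_of_pos (Real.exp_pos _)]
  refine mul_le_mul_of_nonneg_left (Real.exp_le_exp.2 ?_) hC0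
  nlinarith [mul_nonneg pi_pos.le (mul_nonneg (sub_nonneg.2 hD1) (zero_le_one.trans ht))]

theorem isBigO_zero_eisensteinDelta (hn : IsBal(n, N)) (hk : 3 ≤ k) (hk2 : Even k) (hb : 0 < b)
    (hNb : N ∣ b) (hab : IsCoprime a (b : ℤ)) (A : ℝ) :
    (fun t : ℝ => eisensteinDelta N n k (a / b + t * I)) =O[𝓝[>] 0] (· ^ (-A)) := by
  obtain ⟨C, hC0, hC⟩ := exists_norm_eisensteinTail_le k
  have hbr : (0 : ℝ) < b := mod_cast hb
  have h1 : ∀ D ∈ N.divisors, ∃ r : ℝ, ∀ t : ℝ, 0 < t → eisenstein k (D * (a / b + t * I)) =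
      (I * (b * t)) ^ (-(k : ℤ)) *
        eisenstein k (r + (1 / ((b / D : ℕ) * b * t) : ℝ) * I) := fun D hD => by
    obtain ⟨hB, he⟩ := div_pos_of_mem hb hNb hD
    obtain ⟨r, hr⟩ := eisenstein_vertical hk hk2 hB (isCoprime_div hb hNb hD hab)
    refine ⟨r, fun t ht => ?_⟩
    rw [natCast_mul_vertical hb hNb hD, hr _ (mul_pos (mod_cast pos_of_mem_divisors hD) ht)]
    have he' : ((b / D : ℕ) : ℝ) * (D * t) = b * t := by
      rw [← mul_assoc, mul_comm _ (D : ℝ)]; congr 1; exact_mod_cast he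
    have he2 : ((b / D : ℕ) : ℝ) ^ 2 * (D * t) = (b / D : ℕ) * b * t := by
      rw [pow_two, mul_assoc, he', mul_assoc]
    rw [he2]; congr 3; exact_mod_cast he'
  choose! r hr using h1
  have h2 : ∀ t : ℝ, 0 < t → eisensteinDelta N n k (a / b + t * I) =
      (I * (b * t)) ^ (-(k : ℤ)) * ∑ D ∈ N.divisors, (-24 * ((n D : ℂ) * D)) *
        eisensteinTail k (r D + (1 / ((b / D : ℕ) * b * t) : ℝ) * I) := fun t ht => by
    have h : ∑ D ∈ N.divisors, (n D : ℂ) * D = 0 := mod_cast hn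
    have e : ∀ D ∈ N.divisors, (n D : ℂ) * D * eisenstein k (D * (a / b + t * I)) =
        (n D : ℂ) * D * ((I * (b * t)) ^ (-(k : ℤ)) * (-(bernoulli k : ℂ) / (2 * k))) +
        (n D : ℂ) * D * ((I * (b * t)) ^ (-(k : ℤ)) *
          eisensteinTail k (r D + (1 / ((b / D : ℕ) * b * t) : ℝ) * I)) := fun D hD => by
      rw [hr D hD t ht, eisenstein_eq_add_tail]; ring
    rw [eisensteinDelta, sum_congr rfl e, sum_add_distrib, ← sum_mul, h,
      zero_mul, zero_add, mul_sum, mul_sum]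
    exact sum_congr rfl fun D _ => by ring
  have hc : (0 : ℝ) < 2 * π / b ^ 2 := by have := pi_pos; positivity
  have h3 : (fun t : ℝ => ∑ D ∈ N.divisors, (-24 * ((n D : ℂ) * D)) *
      eisensteinTail k (r D + (1 / ((b / D : ℕ) * b * t) : ℝ) * I)) =O[𝓝[>] 0]
      fun t => exp (-(2 * π / b ^ 2) * t⁻¹) := by
    refine IsBigO.fun_sum fun D hD => ?_
    refine IsBigO.const_mul_left (IsBigO.of_bound C ?_) _
    obtain ⟨hB, he⟩ := div_pos_of_mem hb hNb hD
    have hle : ((b / D : ℕ) : ℝ) ≤ b := mod_cast Nat.div_le_self b D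
    have hBr : (0 : ℝ) < (b / D : ℕ) := mod_cast hB
    filter_upwards [Ioo_mem_nhdsGT (show (0 : ℝ) < 1 / b ^ 2 by positivity)] with t ht
    have ht0 : 0 < t := ht.1
    have him : ((r D : ℂ) + (1 / ((b / D : ℕ) * b * t) : ℝ) * I).im =
        1 / ((b / D : ℕ) * b * t) := by
      rw [add_im, ofReal_im, im_ofReal_mul, I_im, mul_one, zero_add]
    have hge : 1 / (b ^ 2 * t) ≤ 1 / ((b / D : ℕ) * b * t) := by
      refine one_div_le_one_div_of_le (by positivity) ?_
      rw [pow_two]; gcongr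
    have h1le : 1 ≤ 1 / (b ^ 2 * t) := by
      rw [le_div_iff₀ (by positivity), one_mul]
      have := (lt_div_iff₀ (by positivity : (0 : ℝ) < b ^ 2)).1 ht.2; linarith
    refine (hC _ (by rw [him]; exact h1le.trans hge)).trans ?_
    rw [him, norm_eq_abs, abs_of_pos (Real.exp_pos _)]
    refine mul_le_mul_of_nonneg_left (Real.exp_le_exp.2 ?_) hC0
    have e : -(2 * π / b ^ 2) * t⁻¹ = -(2 * π) * (1 / (b ^ 2 * t)) := by field_simp
    rw [e]; exact mul_le_mul_of_nonpos_left hge (by linarith [pi_pos])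
  have h4 : (fun t : ℝ => (I * (b * t)) ^ (-(k : ℤ))) =O[𝓝[>] 0] fun t => t ^ (-(k : ℝ)) := by
    refine IsBigO.of_bound (b ^ (-(k : ℝ))) ?_
    filter_upwards [self_mem_nhdsWithin] with t ht
    have ht : 0 < t := ht
    rw [norm_zpow, norm_mul, norm_I, one_mul, norm_mul, Complex.norm_natCast,
      norm_real, mul_zpow, norm_eq_abs, abs_of_pos ht, norm_eq_abs,
      abs_of_pos (Real.rpow_pos_of_pos ht _), ← Real.rpow_intCast, ← Real.rpow_intCast]
    simp
  have h5 := ((isLittleO_exp_neg_mul_rpow_atTop hc (A - k)).comp_tendsto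
    tendsto_inv_nhdsGT_zero).isBigO
  refine ((h4.mul (h3.trans h5)).congr' ?_ ?_)
  · filter_upwards [self_mem_nhdsWithin] with t ht using (h2 t ht).symm
  · filter_upwards [self_mem_nhdsWithin] with t ht
    have ht : 0 < t := ht
    simp only [comp]; rw [Real.inv_rpow ht.le, ← Real.rpow_neg ht.le, ← Real.rpow_add ht]; congr 1
    ring

end decay

open Filter Asymptotics Topology HurwitzZeta

theorem hasSum_prod_fintype {ι β : Type*} [Fintype ι] {f : β → ι → ℂ} {s : ι → ℂ}
    (h : ∀ i, HasSum (fun x => f x i) (s i)) : HasSum (fun x : β × ι => f x.1 x.2) (∑ i, s i) := by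
  classical
  have h1 : ∀ i, HasSum (fun x : β × ι => if x.2 = i then f x.1 x.2 else 0) (s i) := fun i => by
    have hinj : Injective fun x : β => (x, i) := fun x y h => congrArg Prod.fst h
    rw [← hinj.hasSum_iff]
    · simpa [Function.comp_def] using h i
    · intro x hx; refine if_neg fun e => hx ⟨x.1, ?_⟩
      rw [← e]
  refine (hasSum_sum fun i (_ : i ∈ Finset.univ) => h1 i).congr_fun fun x => ?_
  simp

theorem trigCoeff_add_int (l : ℕ) (x : ℝ) (z : ℤ) : trigCoeff l (x + z) = trigCoeff l x := by
  rw [trigCoeff, trigCoeff]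
  push_cast
  rw [ex_add, ex_int, mul_one]

theorem hasSum_residueClasses {B : ℕ} [NeZero B] {f : ℕ → ℕ → ℂ} {g : Fin B → ℂ}
    (h : ∀ r : Fin B, HasSum (fun x : ℕ × ℕ => f x.1 (x.2 * B + r)) (g r)) :
    HasSum (fun x : ℕ × ℕ => f x.1 x.2) (∑ r, g r) := by
  have h2 := hasSum_prod_fintype h
  rw [← ((Equiv.prodCongr (Equiv.refl ℕ) (Nat.divModEquiv B)).trans
    (Equiv.prodAssoc ℕ ℕ (Fin B)).symm).hasSum_iff] at h2
  refine h2.congr_fun fun x => ?_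
  have := (Nat.divModEquiv B).symm_apply_apply x.2
  exact congrArg (f x.1) this.symm

theorem hasSum_pnat_prod {f : ℕ × ℕ → ℂ} {a : ℂ} (h1 : ∀ u, f (0, u) = 0) (h2 : ∀ v, f (v, 0) = 0)
    (h : HasSum f a) : HasSum (fun c : ℕ+ × ℕ+ => f (c.1, c.2)) a := by
  have hinj : Injective fun c : ℕ+ × ℕ+ => ((c.1 : ℕ), (c.2 : ℕ)) := fun x y h =>
    Prod.ext (PNat.eq (congrArg Prod.fst h)) (PNat.eq (congrArg Prod.snd h))
  refine (hinj.hasSum_iff fun x hx => ?_).2 h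
  obtain ⟨v, u⟩ := x
  rcases Nat.eq_zero_or_pos v with rfl | hv
  · exact h1 u
  rcases Nat.eq_zero_or_pos u with rfl | hu
  · exact h2 v
  exact (hx ⟨(⟨v, hv⟩, ⟨u, hu⟩), rfl⟩).elim

theorem twisted_term (l : ℕ) (a : ℤ) {B : ℕ} (hB : 0 < B) (s w : ℂ) (v m h : ℕ) :
    (trigCoeff l (a / B * (v * (m * B + h) : ℕ)) / (v : ℂ) ^ s) * (1 / ((m * B + h : ℕ) : ℂ) ^ w) =
      ((trigCoeff l (((a * h / B : ℚ) : ℝ) * v) : ℂ) / (v : ℂ) ^ s) *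
      ((B : ℂ) ^ (-w) * (1 / (m + (((h : ℚ) / B : ℚ) : ℝ) : ℂ) ^ w)) := by
  have hBr : (0 : ℝ) < B := mod_cast hB
  have e1 : (a / B * (v * (m * B + h) : ℕ) : ℝ) =
      ((a * h / B : ℚ) : ℝ) * v + ((a * v * m : ℤ) : ℝ) := by
    push_cast; field_simp; ring
  have e2 : ((m * B + h : ℕ) : ℂ) = ((B : ℝ) : ℂ) * ((m + ((h / B : ℚ) : ℝ) : ℝ) : ℂ) := by
    have : ((m * B + h : ℕ) : ℝ) = B * (m + ((h / B : ℚ) : ℝ)) := by push_cast; field_simp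
    exact_mod_cast congrArg (fun x : ℝ => (x : ℂ)) this
  rw [e1, trigCoeff_add_int, e2, Complex.mul_cpow_ofReal_nonneg hBr.le (by positivity), cpow_neg]
  push_cast
  ring

theorem hasSum_mul_norm {ι κ : Type*} {f : ι → ℂ} {g : κ → ℂ} {x y : ℂ} (hf : HasSum f x)
    (hg : HasSum g y) : HasSum (fun c : ι × κ => f c.1 * g c.2) (x * y) :=
  hf.mul hg (summable_mul_of_summable_norm hf.summable.norm hg.summable.norm)

theorem hasSum_twisted (l : ℕ) (a : ℤ) {B : ℕ} (hB : 0 < B) {s : ℂ} (hk : 1 ≤ k)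
    (hs : (k : ℝ) < s.re) :
    HasSum (fun c : ℕ+ × ℕ+ => (c.2 : ℂ) ^ (k - 1) * trigCoeff l (a / B * (c.1 * c.2 : ℕ)) /
      ((c.1 * c.2 : ℕ) : ℂ) ^ s) (∑ h ∈ range B, (B : ℂ) ^ (-(s - k + 1)) *
      hurwitzZeta (((h / B : ℚ) : ℝ) : UnitAddCircle) (s - k + 1) *
      trigZeta l (((a * h / B : ℚ) : ℝ) : UnitAddCircle) s) := by
  have hBr : (0 : ℝ) < B := mod_cast hB
  have : NeZero B := ⟨hB.ne'⟩
  have hk1 : (1 : ℝ) ≤ k := mod_cast hk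
  obtain ⟨w, hw⟩ : ∃ w, w = s - k + 1 := ⟨_, rfl⟩
  have hwre : 1 < w.re := by rw [hw]; simp; linarith
  have hw0 : w ≠ 0 := Complex.ne_zero_of_one_lt_re hwre
  have hs1 : 1 < s.re := by linarith
  have hs0 : s ≠ 0 := Complex.ne_zero_of_one_lt_re hs1
  rw [← hw]
  have h1 : ∀ h : Fin B, HasSum (fun x : ℕ × ℕ =>
      ((trigCoeff l (((a * (h : ℕ) / B : ℚ) : ℝ) * x.1) : ℂ) / (x.1 : ℂ) ^ s) *
        ((B : ℂ) ^ (-w) * (1 / (x.2 + ((((h : ℕ) : ℚ) / B : ℚ) : ℝ) : ℂ) ^ w)))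
      (trigZeta l (((a * (h : ℕ) / B : ℚ) : ℝ) : UnitAddCircle) s *
        ((B : ℂ) ^ (-w) * hurwitzZeta ((((h : ℕ) / B : ℚ) : ℝ) : UnitAddCircle) w)) := fun h => by
    have hmem : ((((h : ℕ) : ℚ) / B : ℚ) : ℝ) ∈ Set.Icc (0 : ℝ) 1 := by
      rw [Rat.cast_div, Rat.cast_natCast, Rat.cast_natCast]
      exact ⟨div_nonneg (cast_nonneg _) hBr.le, div_le_one_of_le₀ (Nat.cast_le.2 h.2.le) hBr.le⟩
    have e1 := hasSum_trigZeta l ((a * (h : ℕ) / B : ℚ) : ℝ) hs1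
    have e2 := (hasSum_hurwitzZeta_of_one_lt_re hmem hwre).mul_left ((B : ℂ) ^ (-w))
    have e3 := hasSum_mul_norm e1 e2
    exact e3
  have h2 := hasSum_pnat_prod (by simp [hs0]) (by simp [hw0]) (hasSum_residueClasses
    (f := fun v u => (trigCoeff l (a / B * (v * u : ℕ)) / (v : ℂ) ^ s) * (1 / (u : ℂ) ^ w))
    fun h => (h1 h).congr_fun fun x => twisted_term l a hB s w x.1 x.2 h)
  rw [Finset.sum_range fun h : ℕ => (B : ℂ) ^ (-w) *
    hurwitzZeta (((h / B : ℚ) : ℝ) : UnitAddCircle) w *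
    trigZeta l (((a * h / B : ℚ) : ℝ) : UnitAddCircle) s]
  have hsum : ∀ x y z : ℂ, x * y * z = z * (x * y) := fun x y z => by ring
  simp only [hsum]
  refine h2.congr_fun fun c => ?_
  have hc2 : ((c.2 : ℕ) : ℂ) ≠ 0 := mod_cast c.2.ne_zero
  have e : ((c.2 : ℕ) : ℂ) ^ s = ((c.2 : ℕ) : ℂ) ^ w * ((c.2 : ℕ) : ℂ) ^ (k - 1) := by
    rw [← cpow_natCast, ← Complex.cpow_add _ _ hc2, cast_sub hk, hw]; congr 1; push_cast; ring
  have e' : ((c.1 * c.2 : ℕ) : ℂ) ^ s = ((c.1 : ℕ) : ℂ) ^ s *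
      (((c.2 : ℕ) : ℂ) ^ w * ((c.2 : ℕ) : ℂ) ^ (k - 1)) := by
    rw [Nat.cast_mul, ← ofReal_natCast (c.1 : ℕ), ← ofReal_natCast (c.2 : ℕ),
      Complex.mul_cpow_ofReal_nonneg (cast_nonneg _) (cast_nonneg _),
      ofReal_natCast, ofReal_natCast, e]
  rw [e']
  have h5 : ((c.2 : ℕ) : ℂ) ^ (k - 1) ≠ 0 := pow_ne_zero _ hc2
  generalize ((c.2 : ℕ) : ℂ) ^ (k - 1) = X at *
  generalize trigCoeff l _ = Y
  field_simp

open Filter Asymptotics Topology HurwitzZeta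

variable {a : ℤ} {b : ℕ}

/-- The component of `E_k^δ` on the vertical line above `a/b` which enters the `l`-th moment. -/
def verticalPart (N : ℕ) (n : ℕ → ℤ) (k : ℕ) (a : ℤ) (b l : ℕ) (t : ℝ) : ℂ :=
  ((I ^ (l + 1) * eisensteinDelta N n k (a / b + t * I)).re : ℝ)

/-- The quotient of the Mellin transform of `verticalPart` by the Gamma function. -/
def verticalZeta (N : ℕ) (n : ℕ → ℤ) (k : ℕ) (a : ℤ) (b l : ℕ) (s : ℂ) : ℂ :=
  ∑ D : N.divisors, (-24 * ((n D : ℂ) * (D : ℕ))) * ((2 * π * (D : ℕ) : ℝ) : ℂ) ^ (-s) *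
    ∑ h ∈ range (b / D), ((b / D : ℕ) : ℂ) ^ (-(s - k + 1)) *
      hurwitzZeta (((h / (b / D : ℕ) : ℚ) : ℝ) : UnitAddCircle) (s - k + 1) *
      trigZeta l (((a * h / (b / D : ℕ) : ℚ) : ℝ) : UnitAddCircle) s

theorem hasSum_verticalTail (hb : 0 < b) (hNb : N ∣ b) (l : ℕ) (hD : D ∈ N.divisors) (ht : 0 < t) :
    HasSum (fun c : ℕ+ × ℕ+ => ((c.2 : ℂ) ^ (k - 1) *
      trigCoeff l (a / (b / D : ℕ) * (c.1 * c.2 : ℕ))) *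
      exp (-((2 * π * D : ℝ) * (c.1 * c.2 : ℕ)) * t))
      ((I ^ (l + 1) * eisensteinTail k (D * (a / b + t * I))).re : ℂ) := by
  have hD0 : (0 : ℝ) < D := mod_cast pos_of_mem_divisors hD
  have hz := natCast_mul_vertical hb hNb hD a t
  have h1 := (hasSum_eisensteinTail k ⟨D * (a / b + t * I), by
    rw [hz]; have : ((a : ℂ) / (b / D : ℕ)) = ((a / (b / D : ℕ) : ℝ) : ℂ) := by push_cast; rfl
    rw [this, add_im, ofReal_im, im_ofReal_mul, I_im]
    simpa using mul_pos hD0 ht⟩).mul_left (I ^ (l + 1))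
  have h3 := Complex.hasSum_ofReal.2 (Complex.hasSum_re h1)
  refine h3.congr_fun fun c => ?_
  have e : ex (D * (a / b + t * I)) ^ (c.1 * c.2 : ℕ) =
      (exp (-((2 * π * D : ℝ) * (c.1 * c.2 : ℕ)) * t) : ℝ) *
        ex ((a / (b / D : ℕ) * (c.1 * c.2 : ℕ) : ℝ)) := by
    rw [hz, ex, ex, ← exp_nat_mul, ofReal_exp, ← exp_add]; congr 1
    generalize b / D = B
    push_cast
    linear_combination (c.1 * c.2 : ℂ) * (2 * π * D * t) * I_sq
  change _ = (((I ^ (l + 1) * ((c.2 : ℂ) ^ (k - 1) *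
    ex (D * (a / b + t * I)) ^ (c.1 * c.2 : ℕ))).re : ℝ) : ℂ)
  rw [e]
  have e2 : I ^ (l + 1) * ((c.2 : ℂ) ^ (k - 1) *
      ((exp (-((2 * π * D : ℝ) * (c.1 * c.2 : ℕ)) * t) : ℝ) *
        ex ((a / (b / D : ℕ) * (c.1 * c.2 : ℕ) : ℝ)))) =
      (((c.2 : ℝ) ^ (k - 1) * exp (-((2 * π * D : ℝ) * (c.1 * c.2 : ℕ)) * t) : ℝ) : ℂ)
        * (I ^ (l + 1) * ex ((a / (b / D : ℕ) * (c.1 * c.2 : ℕ) : ℝ))) := by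
    rw [ofReal_mul ((c.2 : ℝ) ^ (k - 1)), ofReal_pow, ofReal_natCast]; ring
  rw [e2, re_ofReal_mul, ← trigCoeff]
  simp only [ofReal_mul, ofReal_pow, ofReal_natCast]
  ring

theorem verticalPart_eq_sum (hn : IsBal(n, N)) (l : ℕ) (t : ℝ) :
    verticalPart N n k a b l t = ∑ D : N.divisors, (-24 * ((n D : ℂ) * (D : ℕ))) *
      ((I ^ (l + 1) * eisensteinTail k ((D : ℕ) * (a / b + t * I))).re : ℂ) := by
  rw [verticalPart, eisensteinDelta_eq_tail hn, Finset.sum_coe_sort N.divisors fun D =>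
    (-24 * ((n D : ℂ) * D)) * ((I ^ (l + 1) * eisensteinTail k (D * (a / b + t * I))).re : ℂ),
    mul_sum, re_sum, Complex.ofReal_sum]
  refine sum_congr rfl fun D _ => ?_
  have hc : I ^ (l + 1) * (-24 * ((n D : ℂ) * D) *
      eisensteinTail k (D * (a / b + t * I))) = ((-24 * (n D * D) : ℝ) : ℂ) *
      (I ^ (l + 1) * eisensteinTail k (D * (a / b + t * I))) := by
    push_cast; ring
  rw [hc, re_ofReal_mul]
  push_cast
  rfl

theorem hasSum_verticalPart (hn : IsBal(n, N)) (hb : 0 < b) (hNb : N ∣ b) (l : ℕ) (ht : 0 < t) :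
    HasSum (fun x : (ℕ+ × ℕ+) × N.divisors => (-24 * ((n x.2 : ℂ) * (x.2 : ℕ))) *
      ((x.1.2 : ℂ) ^ (k - 1) * trigCoeff l (a / (b / (x.2 : ℕ) : ℕ) * (x.1.1 * x.1.2 : ℕ))) *
      exp (-((2 * π * (x.2 : ℕ) : ℝ) * (x.1.1 * x.1.2 : ℕ)) * t)) (verticalPart N n k a b l t) := by
  have h := hasSum_prod_fintype fun D : N.divisors => (hasSum_verticalTail (k := k) (a := a) hb hNb l
    D.2 ht).mul_left (-24 * ((n D : ℂ) * (D : ℕ)))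
  rw [← verticalPart_eq_sum hn] at h
  exact h.congr_fun fun x => mul_assoc _ _ _

theorem mellin_verticalPart_of_lt (hn : IsBal(n, N)) (hk : 3 ≤ k) (hb : 0 < b) (hNb : N ∣ b)
    (l : ℕ) {s : ℂ} (hs : (k : ℝ) < s.re) :
    mellin (verticalPart N n k a b l) s = Gamma s * verticalZeta N n k a b l s := by
  have hk0 : (0 : ℝ) ≤ k := cast_nonneg k
  have hs0 : 0 < s.re := hk0.trans_lt hs
  have hp : ∀ x : (ℕ+ × ℕ+) × N.divisors,
      0 < (2 * π * (x.2 : ℕ) : ℝ) * (x.1.1 * x.1.2 : ℕ) := fun x => by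
    have hD : (0 : ℝ) < (x.2 : ℕ) := mod_cast pos_of_mem_divisors x.2.2
    have h1 : (0 : ℝ) < (x.1.1 * x.1.2 : ℕ) := mod_cast Nat.mul_pos x.1.1.pos x.1.2.pos
    have := pi_pos; positivity
  have hZ := (hasSum_prod_fintype fun D : N.divisors => (hasSum_twisted l a
    (div_pos_of_mem hb hNb D.2).1 (by omega : 1 ≤ k) hs).mul_left
    ((-24 * ((n D : ℂ) * (D : ℕ))) * ((2 * π * (D : ℕ) : ℝ) : ℂ) ^ (-s))).mul_left (Gamma s)
  have hterm : ∀ x : (ℕ+ × ℕ+) × N.divisors, Gamma s * ((-24 * ((n x.2 : ℂ) * (x.2 : ℕ))) *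
      ((2 * π * (x.2 : ℕ) : ℝ) : ℂ) ^ (-s) * ((x.1.2 : ℂ) ^ (k - 1) *
        trigCoeff l (a / (b / (x.2 : ℕ) : ℕ) * (x.1.1 * x.1.2 : ℕ)) / ((x.1.1 * x.1.2 : ℕ) : ℂ) ^ s)) =
      Gamma s * ((-24 * ((n x.2 : ℂ) * (x.2 : ℕ))) * ((x.1.2 : ℂ) ^ (k - 1) *
        trigCoeff l (a / (b / (x.2 : ℕ) : ℕ) * (x.1.1 * x.1.2 : ℕ)))) /
        (((2 * π * (x.2 : ℕ) : ℝ) * (x.1.1 * x.1.2 : ℕ) : ℝ) : ℂ) ^ s := fun x => by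
    have := pi_pos
    rw [ofReal_mul (2 * π * (x.2 : ℕ)),
      Complex.mul_cpow_ofReal_nonneg (by positivity) (cast_nonneg _),
      cpow_neg, ofReal_natCast]
    generalize (((2 * π * (x.2 : ℕ) : ℝ) : ℂ)) ^ s = X
    generalize ((x.1.1 * x.1.2 : ℕ) : ℂ) ^ s = Y
    generalize (trigCoeff l _ : ℂ) = Z
    rw [div_eq_mul_inv, div_eq_mul_inv, mul_inv]; ring
  have hZ' := hZ.congr_fun fun x => (hterm x).symm
  have hsum : Summable fun x : (ℕ+ × ℕ+) × N.divisors => ‖(-24 * ((n x.2 : ℂ) * (x.2 : ℕ))) *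
      ((x.1.2 : ℂ) ^ (k - 1) * trigCoeff l (a / (b / (x.2 : ℕ) : ℕ) * (x.1.1 * x.1.2 : ℕ)))‖ /
      ((2 * π * (x.2 : ℕ) : ℝ) * (x.1.1 * x.1.2 : ℕ)) ^ s.re := by
    have hG := norm_ne_zero_iff.2 (Complex.Gamma_ne_zero_of_re_pos hs0)
    refine (hZ'.summable.norm.mul_left ‖Gamma s‖⁻¹).congr fun x => ?_
    rw [norm_div, norm_mul (Gamma s), Complex.norm_cpow_eq_rpow_re_of_pos (hp x)]; field_simp
  exact (hasSum_mellin (fun x => Or.inr (hp x)) hs0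
    (fun t ht => hasSum_verticalPart hn hb hNb l ht) hsum).unique hZ'

open Filter Asymptotics Topology HurwitzZeta MeasureTheory

variable {a : ℤ} {b : ℕ}

theorem isBigO_verticalPart (l : ℕ) (F : Filter ℝ) :
    verticalPart N n k a b l =O[F] fun t : ℝ => eisensteinDelta N n k (a / b + t * I) := by
  refine IsBigO.of_bound 1 (Eventually.of_forall fun t => ?_)
  rw [verticalPart, norm_real, one_mul]
  refine (Complex.abs_re_le_norm _).trans ?_
  rw [norm_mul, norm_pow, norm_I, one_pow, one_mul]

theorem continuousOn_vertical (hk : 3 ≤ k) (hk2 : Even k) (a : ℤ) (b : ℕ) :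
    ContinuousOn (fun t : ℝ => eisensteinDelta N n k (a / b + t * I)) (Ioi 0) := by
  simpa using continuousOn_eisensteinDelta (N := N) (n := n) hk hk2 (a / b : ℝ)

theorem differentiable_mellin_verticalPart (hn : IsBal(n, N)) (hk : 3 ≤ k) (hk2 : Even k)
    (hb : 0 < b) (hNb : N ∣ b) (hab : IsCoprime a (b : ℤ)) (l : ℕ) :
    Differentiable ℂ (mellin (verticalPart N n k a b l)) := fun s => by
  have hc : ContinuousOn (verticalPart N n k a b l) (Ioi 0) :=
    Complex.continuous_ofReal.comp_continuousOn (continuous_re.comp_continuousOn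
      (continuousOn_const.mul (continuousOn_vertical hk hk2 a b)))
  refine mellin_differentiableAt_of_isBigO_rpow_exp (a := 2 * π) (b := s.re - 1)
    (by have := pi_pos; positivity) (hc.locallyIntegrableOn measurableSet_Ioi)
    ((isBigO_verticalPart l _).trans ?_)
    ((isBigO_verticalPart l _).trans (isBigO_zero_eisensteinDelta hn hk hk2 hb hNb hab _))
    (by linarith)
  simpa using isBigO_atTop_eisensteinDelta (k := k) hn (a / b : ℝ)

theorem integrableOn_pow_mul_eisensteinDelta (hn : IsBal(n, N)) (hk : 3 ≤ k) (hk2 : Even k)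
    (hb : 0 < b) (hNb : N ∣ b) (hab : IsCoprime a (b : ℤ)) (l : ℕ) :
    IntegrableOn (fun t : ℝ => (t : ℂ) ^ l * eisensteinDelta N n k (a / b + t * I)) (Ioi 0) := by
  have h := mellinConvergent_of_isBigO_rpow_exp (a := 2 * π) (b := l) (s := l + 1)
    (by have := pi_pos; positivity)
    ((continuousOn_vertical (N := N) (n := n) hk hk2 a b).locallyIntegrableOn measurableSet_Ioi)
    (by simpa using isBigO_atTop_eisensteinDelta (k := k) hn (a / b : ℝ))
    (isBigO_zero_eisensteinDelta hn hk hk2 hb hNb hab _) (by simp)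
  simpa [MellinConvergent] using h

theorem differentiableAt_verticalZeta (hb : 0 < b) (hNb : N ∣ b) {s : ℂ} (h1 : s ≠ k)
    (h2 : s ≠ 1 ∨ Even l) : DifferentiableAt ℂ (verticalZeta N n k a b l) s := by
  unfold verticalZeta
  refine DifferentiableAt.fun_sum fun D _ => ?_
  have hD : (D : ℕ) ≠ 0 := (pos_of_mem_divisors D.2).ne'
  have hB := (div_pos_of_mem hb hNb D.2).1.ne'
  have hpi : ((2 * π * (D : ℕ) : ℝ) : ℂ) ≠ 0 := by
    exact_mod_cast mul_ne_zero (mul_ne_zero two_ne_zero pi_ne_zero) (Nat.cast_ne_zero.2 hD)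
  refine ((DifferentiableAt.const_cpow (by fun_prop) (Or.inl hpi)).const_mul _).mul
    (DifferentiableAt.fun_sum fun h _ => ((DifferentiableAt.const_cpow (by fun_prop)
      (Or.inl (Nat.cast_ne_zero.2 hB))).mul ?_).mul (differentiableAt_trigZeta l _ h2))
  refine (differentiableAt_hurwitzZeta _ fun h => h1 ?_).comp s
    (f := fun s : ℂ => s - k + 1) (by fun_prop)
  linear_combination h

theorem mellin_verticalPart_eq (hn : IsBal(n, N)) (hk : 3 ≤ k) (hk2 : Even k) (hb : 0 < b)
    (hNb : N ∣ b) (hab : IsCoprime a (b : ℤ)) {s : ℂ} (h1 : s ≠ k) (h2 : s ≠ 1 ∨ Even l)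
    (hs : 0 < s.re) : mellin (verticalPart N n k a b l) s = Gamma s * verticalZeta N n k a b l s := by
  set T : Set ℂ := {s | s = k ∨ (s = 1 ∧ ¬ Even l)} with hT
  have hTf : T.Finite := (Set.toFinite {(k : ℂ), 1}).subset fun s hs => by
    rcases hs with h | h
    · exact Or.inl h
    · exact Or.inr h.1
  have hTm : ∀ s, s ∈ Tᶜ ↔ s ≠ k ∧ (s ≠ 1 ∨ Even l) := fun s => by
    rw [Set.mem_compl_iff, hT, mem_ofPred_eq]; tauto
  have hconn : IsPreconnected Tᶜ :=
    (hTf.countable.isConnected_compl_of_one_lt_rank (by simp)).isPreconnected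
  have hopen : IsOpen Tᶜ := hTf.isClosed.isOpen_compl
  have hf : AnalyticOnNhd ℂ (fun s => (Gamma s)⁻¹ * mellin (verticalPart N n k a b l) s) Tᶜ :=
    DifferentiableOn.analyticOnNhd (fun s _ => (Complex.differentiable_one_div_Gamma.mul
      (differentiable_mellin_verticalPart hn hk hk2 hb hNb hab l) s).differentiableWithinAt) hopen
  have hg : AnalyticOnNhd ℂ (verticalZeta N n k a b l) Tᶜ :=
    DifferentiableOn.analyticOnNhd (fun s hs => (differentiableAt_verticalZeta hb hNb ((hTm s).1 hs).1
      ((hTm s).1 hs).2).differentiableWithinAt) hopen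
  have hk3 : (3 : ℝ) ≤ k := mod_cast hk
  have hne : ∀ z : ℂ, (k : ℝ) < z.re → z ∈ Tᶜ := fun z hz => (hTm z).2
    ⟨fun h => by rw [h] at hz; simp at hz, Or.inl fun h => by rw [h] at hz; simp at hz; linarith⟩
  have hz0 : (k : ℝ) < ((k : ℂ) + 1).re := by simp
  have heq := hf.eqOn_of_preconnected_of_eventuallyEq hg hconn (hne (k + 1) hz0) (by
    filter_upwards [(isOpen_lt continuous_const continuous_re).mem_nhds hz0] with z hz
    have hG : Gamma z ≠ 0 := Complex.Gamma_ne_zero_of_re_pos (by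
      have : (k : ℝ) < z.re := hz
      linarith)
    rw [mellin_verticalPart_of_lt hn hk hb hNb l hz, inv_mul_cancel_left₀ hG])
  have := heq ((hTm s).2 ⟨h1, h2⟩)
  simp only at this
  rw [← this, mul_inv_cancel_left₀ (Complex.Gamma_ne_zero_of_re_pos hs)]

theorem pow_mul_mellin_verticalPart (hn : IsBal(n, N)) {i : ℕ} (hk : 3 ≤ l + i + 2)
    (hk2 : Even (l + i + 2)) (hb : 0 < b) (hNb : N ∣ b) (hab : IsCoprime a (b : ℤ)) :
    (b : ℂ) ^ l * mellin (verticalPart N n (l + i + 2) a b l) (l + 1) =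
      12 * (-1) ^ l * (bernMoment N n a b i l : ℂ) := by
  rw [mellin_verticalPart_eq hn hk hk2 hb hNb hab (fun h => by
      have : l + 1 = l + i + 2 := mod_cast h
      omega) (by
      rcases Nat.eq_zero_or_pos l with rfl | hl
      · exact Or.inr Even.zero
      · refine Or.inl fun h => hl.ne' ?_
        have : l + 1 = 1 := mod_cast h
        omega) (by simp; positivity), Complex.Gamma_nat_eq_factorial, verticalZeta, bernMoment,
    Finset.sum_coe_sort N.divisors fun D => (-24 * ((n D : ℂ) * D)) *
      ((2 * π * D : ℝ) : ℂ) ^ (-((l : ℂ) + 1)) *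
    ∑ h ∈ range (b / D), ((b / D : ℕ) : ℂ) ^ (-((l : ℂ) + 1 - (l + i + 2 : ℕ) + 1)) *
      hurwitzZeta (((h / (b / D : ℕ) : ℚ) : ℝ) : UnitAddCircle) ((l : ℂ) + 1 - (l + i + 2 : ℕ) + 1) *
      trigZeta l (((a * h / (b / D : ℕ) : ℚ) : ℝ) : UnitAddCircle) ((l : ℂ) + 1),
    cast_sum, mul_sum, mul_sum, mul_sum]
  refine sum_congr rfl fun D hD => ?_
  obtain ⟨hB, he⟩ := div_pos_of_mem hb hNb hD
  have he' : (b : ℂ) = D * (b / D : ℕ) := mod_cast he.symm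
  have hD0 : (D : ℂ) ≠ 0 := mod_cast (pos_of_mem_divisors hD).ne'
  have hpi : (π : ℂ) ≠ 0 := mod_cast pi_ne_zero
  rw [he']
  generalize b / D = B at *
  have e1 : (-((l : ℂ) + 1 - (l + i + 2 : ℕ) + 1)) = (i : ℕ) := by push_cast; ring
  have e2 : ((l : ℂ) + 1 - (l + i + 2 : ℕ) + 1) = -(i : ℕ) := by push_cast; ring
  have e3 : ((2 * π * D : ℝ) : ℂ) ^ (-((l : ℂ) + 1)) = ((2 * π * D : ℂ) ^ (l + 1))⁻¹ := by
    rw [cpow_neg, ← Nat.cast_add_one, cpow_natCast]; push_cast; rfl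
  have e4 : ∀ h ∈ range B, (B : ℂ) ^ (-((l : ℂ) + 1 - (l + i + 2 : ℕ) + 1)) *
      hurwitzZeta (((h / B : ℚ) : ℝ) : UnitAddCircle) ((l : ℂ) + 1 - (l + i + 2 : ℕ) + 1) *
      trigZeta l (((a * h / B : ℚ) : ℝ) : UnitAddCircle) ((l : ℂ) + 1) =
      (B : ℂ) ^ i * (-((-1) ^ l * (2 * π) ^ (l + 1) / (2 * l.factorial))) *
        ((bernFn i (h / B) : ℂ) * bernFn l (a * h / B)) := fun h hh => by
    rw [e1, e2, cpow_natCast, hurwitzZeta_neg_nat_eq]; have e5 := trigZeta_nat l (a * h / B)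
    split_ifs with h0
    · have hc : (((a * h / B : ℚ) : ℝ) : UnitAddCircle) = a • (((h / B : ℚ) : ℝ) : UnitAddCircle) := by
        rw [← AddCircle.coe_zsmul]; congr 1; push_cast; rw [zsmul_eq_mul]; ring
      have hz : trigZeta l (((a * h / B : ℚ) : ℝ) : UnitAddCircle) (l + 1) = 0 := by
        rw [hc, h0.2, smul_zero]; refine trigZeta_zero_of_even ?_ _; have := h0.1; subst this
        simpa [Nat.even_add] using hk2
      rw [hz] at e5 ⊢
      linear_combination ((B : ℂ) ^ i * bernFn i (h / B)) * -e5
    · rw [e5]; ring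
  rw [e3, sum_congr rfl e4, ← mul_sum]
  have hf : (l.factorial : ℂ) ≠ 0 := mod_cast Nat.factorial_ne_zero _
  rw [cast_mul, cast_mul, cast_sum]
  simp only [cast_mul]
  generalize ∑ x ∈ range B, (bernFn i (x / B) : ℂ) * bernFn l (a * x / B) = S
  push_cast
  field_simp
  ring

theorem eisensteinDelta_moment (hn : IsBal(n, N)) {s r : ℕ} (hk : 3 ≤ s + r + 2)
    (hk2 : Even (s + r + 2)) (hb : 0 < b) (hNb : N ∣ b) (hab : IsCoprime a (b : ℤ)) :
    IntegrableOn (fun t : ℝ => (a / b + t * I) ^ s *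
      eisensteinDelta N n (s + r + 2) (a / b + t * I) * I) (Ioi 0) ∧
    (∫ t in Ioi (0 : ℝ), (a / b + t * I) ^ s *
      eisensteinDelta N n (s + r + 2) (a / b + t * I) * I).re = cuspMoment N n a b s r := by
  have hbc : (b : ℂ) ≠ 0 := mod_cast hb.ne'
  set f : ℝ → ℂ := fun t => eisensteinDelta N n (s + r + 2) (a / b + t * I) with hf
  have hint : ∀ l, IntegrableOn (fun t : ℝ => (t : ℂ) ^ l * f t) (Ioi 0) := fun l =>
    integrableOn_pow_mul_eisensteinDelta hn hk hk2 hb hNb hab l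
  have hexp : ∀ t : ℝ, (a / b + t * I) ^ s * f t * I = ∑ l ∈ range (s + 1),
      (((b : ℂ) ^ s)⁻¹ * (a ^ (s - l) * (s.choose l) * b ^ l * I ^ (l + 1))) *
        ((t : ℂ) ^ l * f t) := fun t => by
    have : (a / b + t * I : ℂ) = (b : ℂ)⁻¹ * (t * I * b + a) := by field_simp; ring
    rw [this, mul_pow, add_pow, mul_sum, sum_mul, sum_mul]; refine sum_congr rfl fun l _ => ?_
    rw [mul_pow, mul_pow, inv_pow, pow_succ]; ring
  have hsumint : IntegrableOn (fun t : ℝ => ∑ l ∈ range (s + 1),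
      (((b : ℂ) ^ s)⁻¹ * (a ^ (s - l) * (s.choose l) * b ^ l * I ^ (l + 1))) *
        ((t : ℂ) ^ l * f t)) (Ioi 0) :=
    integrable_finsetSum _ fun l _ => (hint l).const_mul _
  rw [show (fun t : ℝ => (a / b + t * I) ^ s *
    eisensteinDelta N n (s + r + 2) (a / b + t * I) * I) = _ from funext hexp]
  refine ⟨hsumint, ?_⟩
  rw [integral_finsetSum _ fun l _ => (hint l).const_mul _, re_sum, cuspMoment,
    cast_mul, cast_mul, cast_sum, mul_sum]
  refine sum_congr rfl fun l hl => ?_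
  obtain ⟨i, hi⟩ : ∃ i, l + i + 2 = s + r + 2 := ⟨s + r - l, by have := mem_range.1 hl; omega⟩
  have hm := pow_mul_mellin_verticalPart (a := a) (i := i) (l := l) hn (hi ▸ hk) (hi ▸ hk2) hb hNb hab
  rw [hi] at hm
  have hmel : mellin (verticalPart N n (s + r + 2) a b l) (l + 1) =
      ((∫ t in Ioi (0 : ℝ), I ^ (l + 1) * ((t : ℂ) ^ l * f t)).re : ℝ) := by
    have h1 := integral_re ((hint l).const_mul (I ^ (l + 1)))
    simp only [RCLike.re_to_complex] at h1; rw [← h1, ← integral_complex_ofReal, mellin]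
    refine setIntegral_congr_fun measurableSet_Ioi fun t ht => ?_
    simp only [add_sub_cancel_right, cpow_natCast, smul_eq_mul, verticalPart]
    have e : I ^ (l + 1) * ((t : ℂ) ^ l * f t) =
        ((t ^ l : ℝ) : ℂ) * (I ^ (l + 1) * f t) := by push_cast; ring
    rw [e, re_ofReal_mul, ofReal_mul, ofReal_pow]
  have hre : (∫ t in Ioi (0 : ℝ), (((b : ℂ) ^ s)⁻¹ * (a ^ (s - l) * (s.choose l) * b ^ l *
      I ^ (l + 1))) * ((t : ℂ) ^ l * f t)).re = ((b : ℝ) ^ s)⁻¹ * (a ^ (s - l) *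
      (s.choose l)) * ((b : ℝ) ^ l *
      (∫ t in Ioi (0 : ℝ), I ^ (l + 1) * ((t : ℂ) ^ l * f t)).re) := by
    rw [integral_const_mul, integral_const_mul]
    generalize ∫ t in Ioi (0 : ℝ), (t : ℂ) ^ l * f t = X
    have e : ((b : ℂ) ^ s)⁻¹ * (a ^ (s - l) * (s.choose l) * b ^ l * I ^ (l + 1)) * X =
        ((((b : ℝ) ^ s)⁻¹ * (a ^ (s - l) * (s.choose l)) * (b : ℝ) ^ l : ℝ) : ℂ) *
          (I ^ (l + 1) * X) := by push_cast; ring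
    rw [e, re_ofReal_mul]; ring
  rw [hmel] at hm
  have hm' : (b : ℝ) ^ l * (∫ t in Ioi (0 : ℝ), I ^ (l + 1) * ((t : ℂ) ^ l * f t)).re =
      12 * (-1) ^ l * bernMoment N n a b i l := mod_cast hm
  rw [hre, hm', show s - l + r = i by have := mem_range.1 hl; omega]
  push_cast
  ring

/-! The Darmon–Dasgupta family -/

theorem scalar_p_mem (p : Primes) (N : ℕ) :
    scalar p (Nat.cast_ne_zero.2 p.2.ne_zero) ∈ GSN (primesNe p) N := by
  have h1 : (p.1 : ℚ) ∈ ZS (primesNe p) := natCast_mem _ _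
  have h2 : (p.1 : ℚ)⁻¹ ∈ ZS (primesNe p) := fun ℓ hℓ h => hℓ (Subtype.ext (by
    rw [Rat.inv_natCast_den_of_pos p.2.pos] at h
    exact (Nat.prime_dvd_prime_iff_eq ℓ.2 p.2).1 h))
  refine ⟨fun i j => ?_, 0, zero_mem _, by rw [mat_scalar]; simp⟩
  rw [mat_scalar, mat_scalar_inv]
  fin_cases i <;> fin_cases j <;> simp [h1, h2, zero_mem]

/-- An element of `Γ₀^p(N)` as an element of `G_𝒫(N)`. -/
abbrev toGSN (γ : Gamma0p p N) : GSN (primesNe p) N := Subgroup.inclusion inf_le_left γ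

theorem det_of_mem_Gamma0p (γ : Gamma0p p N) : (mat (γ : GQ)).det = 1 := by
  exact congrArg Units.val (MonoidHom.mem_ker.1 γ.2.2)

theorem mat_inv_eq_of_det_one {g : GQ} (h : (mat g).det = 1) :
    mat g⁻¹ = !![mat g 1 1, -mat g 0 1; -mat g 1 0, mat g 0 0] := by
  rw [← Matrix.adjugate_fin_two, ← one_mul (Matrix.adjugate _), ← mat_inv_mul g, mul_assoc,
    Matrix.mul_adjugate, h, one_smul, mul_one]

theorem cusp_eq_infty_iff (γ : Gamma0p p N) :
    γ • (infty : OnePoint ℚ) = infty ↔ mat (γ : GQ) 1 0 = 0 := by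
  change ((γ : GQ) : GL (Fin 2) ℚ) • (infty : OnePoint ℚ) = _ ↔ _
  rw [OnePoint.smul_infty_eq_ite]
  split_ifs with h
  · exact ⟨fun _ => h, fun _ => rfl⟩
  · exact ⟨fun h' => absurd h' (OnePoint.coe_ne_infty _), fun h' => absurd h' h⟩

theorem cusp_eq_coe (γ : Gamma0p p N) (h : mat (γ : GQ) 1 0 ≠ 0) :
    γ • (infty : OnePoint ℚ) = ((mat (γ : GQ) 0 0 / mat (γ : GQ) 1 0 : ℚ) : OnePoint ℚ) := by
  exact (OnePoint.smul_infty_eq_ite _).trans (if_neg h)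

theorem Z1.diag {M : Type} [AddCommGroup M] [DistribMulAction GQ M] (z : Z1 H M) (g : H) :
    z.1 g g = 0 := by
  simpa using z.2.2 g g g

theorem Z1.add {M : Type} [AddCommGroup M] [DistribMulAction GQ M] (z : Z1 H M) (g₀ g₁ g₂ : H) :
    z.1 g₀ g₂ = z.1 g₀ g₁ + z.1 g₁ g₂ := by
  rw [← sub_eq_zero, ← neg_eq_zero, ← z.2.2 g₀ g₁ g₂]; abel

theorem Z1.eq_smul_one {M : Type} [AddCommGroup M] [DistribMulAction GQ M] (z : Z1 H M)
    (g₀ g₁ : H) : z.1 g₀ g₁ = (g₀ : GQ) • z.1 1 (g₀⁻¹ * g₁) := by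
  rw [← z.2.1, mul_one, mul_inv_cancel_left]

theorem Dist.mass_sub {A : Type} [AddCommGroup A] (μ ν : Dist O A) (U : Set (Fin 2 → R)) :
    (μ - ν).mass U = μ.mass U - ν.mass U := by
  unfold Dist.mass
  split_ifs
  · rfl
  · rw [sub_zero]

/-- The monomial expansion of the moments at the cusp `a / b`. -/
def cuspMomentPoly (N : ℕ) (n : ℕ → ℤ) (ρ : ℚ) (h : MvPolynomial (Fin 2) ℤ) : ℚ :=
  ∑ d ∈ h.support, h.coeff d * cuspMoment N n ρ.num ρ.den (d 0) (d 1)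

theorem period_eq_cuspMomentPoly (hn : IsBal(n, N)) (hk : 3 ≤ k) (hk2 : Even k)
    {h : MvPolynomial (Fin 2) ℤ} (hh : h.IsHomogeneous (k - 2)) {ρ : ℚ} (hρ : N ∣ ρ.den) :
    (periodToInfty N n k h (ρ : OnePoint ℚ)).re = cuspMomentPoly N n ρ h := by
  have hd : ∀ d ∈ h.support, d 0 + d 1 + 2 = k := fun d hd => by
    have := hh (mem_support_iff.1 hd)
    rw [Finsupp.weight_apply, Finsupp.sum_fintype _ _ (by simp)] at this; simp at this; omega
  have hcop : IsCoprime ρ.num (ρ.den : ℤ) := Int.isCoprime_iff_nat_coprime.2 (by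
    simpa using ρ.reduced)
  have hm : ∀ d ∈ h.support, _ := fun d hdd => eisensteinDelta_moment (s := d 0) (r := d 1) hn
    (by rw [hd d hdd]; exact hk) (by rw [hd d hdd]; exact hk2) ρ.pos hρ hcop
  have e : ∀ t : ℝ, aeval ![(ρ : ℂ) + t * I, 1] h *
      eisensteinDelta N n k ((ρ : ℂ) + t * I) * I = ∑ d ∈ h.support,
      ((h.coeff d : ℤ) : ℂ) * ((ρ.num / ρ.den + t * I) ^ (d 0) *
        eisensteinDelta N n (d 0 + d 1 + 2) (ρ.num / ρ.den + t * I) * I) := fun t => by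
    rw [MvPolynomial.aeval_def, MvPolynomial.eval₂_eq', sum_mul, sum_mul, Rat.cast_def]
    refine sum_congr rfl fun d hdd => ?_
    rw [hd d hdd, Fin.prod_univ_two]; simp; ring
  change (∫ t in Ioi (0 : ℝ), aeval ![(ρ : ℂ) + t * I, 1] h *
        eisensteinDelta N n k ((ρ : ℂ) + t * I) * I).re = _
  simp only [e]
  rw [MeasureTheory.integral_finsetSum _ fun d hdd => (hm d hdd).1.const_mul _, re_sum,
    cuspMomentPoly, cast_sum]
  refine sum_congr rfl fun d hdd => ?_
  rw [MeasureTheory.integral_const_mul, ← Complex.ofReal_intCast, re_ofReal_mul, (hm d hdd).2]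
  push_cast
  rfl

theorem exists_moment (hpN : ¬ p.1 ∣ N) (hn : IsBal(n, N)) (hN : 0 < N) (γ : Gamma0p p N)
    (hk2 : Even k) (hk : 2 ≤ k) {h : MvPolynomial (Fin 2) ℤ} (hh : h.IsHomogeneous (k - 2)) :
    ∃ q : ℚ, (q : ℝ) = -((1 - (p : ℂ) ^ (k - 2)) * periodToInfty N n k h (γ • infty)).re ∧
      HasPadicIntegral p (colDist ((siegelCocycle hpN hn hN).1 1 (toGSN γ))) h q := by
  have hd : ∀ d ∈ h.support, d 0 + d 1 = k - 2 := fun d hd => by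
    have := hh (mem_support_iff.1 hd)
    rw [Finsupp.weight_apply, Finsupp.sum_fintype _ _ (by simp)] at this; simpa using this
  by_cases h0 : mat (γ : GQ) 1 0 = 0
  · refine ⟨0, ?_, ?_⟩
    · rw [(cusp_eq_infty_iff γ).2 h0]; simp [periodToInfty]
    · have hz : colDist ((siegelCocycle hpN hn hN).1 1 (toGSN γ)) = 0 := by
        rw [siegelCocycle_one_eq_zero hpN hn hN (toGSN γ) h0]; rfl
      have hm : ∀ U, (0 : Dist Z_[p] ℤ).mass U = 0 := fun U => by rw [Dist.mass]; split_ifs <;> rfl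
      rw [HasPadicIntegral, hz]; simp [hm]
  · rw [cusp_eq_coe γ h0]
    set ρ : ℚ := mat (γ : GQ) 0 0 / mat (γ : GQ) 1 0 with hρ
    refine ⟨-((1 - p.1 ^ (k - 2)) * cuspMomentPoly N n ρ h), ?_, ?_⟩
    · have e : (1 - (p : ℂ) ^ (k - 2)) = ((1 - (p : ℝ) ^ (k - 2) : ℝ) : ℂ) := by push_cast; rfl
      rw [e, re_ofReal_mul]; rcases hk.eq_or_lt with rfl | hk3
      · simp
      · rw [period_eq_cuspMomentPoly (ρ := ρ) hn hk3 hk2 hh (dvd_den_of_mem_GSN (toGSN γ).2 h0 hpN)]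
        push_cast; rfl
    · have ht := tendsto_finsetSum h.support fun d _ => (tendsto_moment_siegelCocycle hpN hn hN
        (toGSN γ) h0 (d 0) (d 1)).const_mul ((h.coeff d : ℤ) : ℚ_[p])
      unfold HasPadicIntegral
      convert ht using 2
      · rename_i j
        rw [sum_congr rfl fun d _ => mul_sum _ _ _, sum_comm]
        refine sum_congr rfl fun x _ => ?_
        rw [MvPolynomial.eval_eq', Int.cast_sum, sum_mul]; refine sum_congr rfl fun d _ => ?_
        rw [Fin.prod_univ_two]; simp; ring
      · rw [cuspMomentPoly, mul_sum, ← sum_neg_distrib, cast_sum]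
        refine sum_congr rfl fun d hdd => ?_
        rw [hd d hdd, show mat (toGSN γ : GQ) 0 0 / mat (toGSN γ : GQ) 1 0 = ρ from rfl]; push_cast
        ring

theorem exists_gamma (r : Cusps p N) : ∃ γ : Gamma0p p N, γ • (infty : OnePoint ℚ) = r := r.2

theorem siegelCocycle_isDarmonDasguptaCocycle (hpN : ¬ p.1 ∣ N) (hn : IsBal(n, N)) (hN : 0 < N) :
    IsDarmonDasguptaCocycle p N n (siegelCocycle hpN hn hN) := by
  set C := siegelCocycle hpN hn hN with hC
  choose ρ hρ using exists_gamma (p := p) (N := N)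
  have hzero : ∀ γ γ' : Gamma0p p N, γ • (infty : OnePoint ℚ) = γ' • infty →
      C.1 (toGSN γ) (toGSN γ') = 0 := fun γ γ' h => by
    rw [Z1.eq_smul_one, hC]
    have h1 : (γ⁻¹ * γ') • (infty : OnePoint ℚ) = infty := by rw [mul_smul, ← h, inv_smul_smul]
    rw [siegelCocycle_one_eq_zero hpN hn hN ((toGSN γ)⁻¹ * toGSN γ')
      ((cusp_eq_infty_iff (γ⁻¹ * γ')).1 h1), smul_zero]
  have hwd : ∀ γ₁ γ₂ γ₁' γ₂' : Gamma0p p N, γ₁ • (infty : OnePoint ℚ) = γ₁' • infty →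
      γ₂ • (infty : OnePoint ℚ) = γ₂' • infty →
      C.1 (toGSN γ₁) (toGSN γ₂) = C.1 (toGSN γ₁') (toGSN γ₂') := fun γ₁ γ₂ γ₁' γ₂' h1 h2 => by
    rw [Z1.add C _ (toGSN γ₁'), hzero _ _ h1, zero_add, Z1.add C _ (toGSN γ₂') (toGSN γ₂),
      hzero _ _ h2.symm, add_zero]
  refine ⟨fun r s => colDist (C.1 (toGSN (ρ r)) (toGSN (ρ s))), ⟨?_, ?_, ?_⟩, ?_⟩
  · intro r s k hk2 hk h hh; obtain ⟨q₁, h1, h1'⟩ := exists_moment hpN hn hN (ρ r) hk2 hk hh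
    obtain ⟨q₂, h2, h2'⟩ := exists_moment hpN hn hN (ρ s) hk2 hk hh; refine ⟨q₂ - q₁, ?_, ?_⟩
    · rw [period, ← hρ r, ← hρ s, mul_sub, sub_re, Rat.cast_sub, h1, h2]; ring
    · have e : colDist (C.1 (toGSN (ρ r)) (toGSN (ρ s))) =
          colDist (C.1 1 (toGSN (ρ s))) - colDist (C.1 1 (toGSN (ρ r))) := by
        rw [Z1.add C 1 (toGSN (ρ r)) (toGSN (ρ s))]
        exact (add_sub_cancel_left (colDist (C.1 1 (toGSN (ρ r)))) _).symm
      simp only [HasPadicIntegral] at h1' h2' ⊢; rw [e, Rat.cast_sub]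
      refine (h2'.sub h1').congr fun j => ?_
      rw [← sum_sub_distrib]; refine sum_congr rfl fun x _ => ?_
      rw [Dist.mass_sub, Int.cast_sub, mul_sub]
  · intro γ r s f f' hf
    have e : C.1 (toGSN (ρ (γ • r))) (toGSN (ρ (γ • s))) =
        (γ : GQ) • C.1 (toGSN (ρ r)) (toGSN (ρ s)) := by
      have hr : ∀ r : Cusps p N, ρ (γ • r) • (infty : OnePoint ℚ) = (γ * ρ r) • infty := fun r => by
        rw [hρ, mul_smul, hρ]; rfl
      rw [hwd _ _ _ _ (hr r) (hr s)]; exact C.2.1 (toGSN γ) (toGSN (ρ r)) (toGSN (ρ s))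
    simp only [e]
    refine congrArg (C.1 (toGSN (ρ r)) (toGSN (ρ s))) (Subtype.ext (funext fun v => ?_))
    refine Eq.trans ?_ (hf (rowToCol v))
    change f'.1 (rowToCol (actVec _ (γ : GQ) v)) = f'.1 (mulCol p γ (rowToCol v))
    have hinv := mat_inv_eq_of_det_one (det_of_mem_Gamma0p γ)
    refine congrArg f'.1 (funext fun i => ?_)
    fin_cases i <;> simp [rowToCol, actVec, mulCol, hinv, Matrix.vecMul, Matrix.mulVec, dotProduct] <;> ring
  · intro r s f f' hf
    obtain ⟨z, hzv⟩ : ∃ z : GSN (primesNe p) N, (z : GQ) = (scalar p _)⁻¹ :=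
      ⟨⟨_, inv_mem (scalar_p_mem p N)⟩, rfl⟩
    have hz : ∀ g : GSN (primesNe p) N, C.1 g (z * g) = 0 := fun g => by
      have hg : z * g = g * z := Subtype.ext (by
        change (z : GQ) * (g : GQ) = g * (z : GQ)
        rw [hzv, inv_mul_eq_iff_eq_mul, ← mul_assoc, scalar_comm, mul_inv_cancel_right])
      rw [hg, Z1.eq_smul_one, inv_mul_cancel_left, hC,
        siegelCocycle_one_eq_zero hpN hn hN z (by rw [hzv, mat_scalar_inv]; rfl), smul_zero]
    have hz' : ∀ g : GSN (primesNe p) N, C.1 (z * g) g = 0 := fun g => by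
      have := Z1.add C g (z * g) g
      rwa [Z1.diag, hz, zero_add, eq_comm] at this
    have e := C.2.1 z (toGSN (ρ r)) (toGSN (ρ s))
    rw [Z1.add C _ (toGSN (ρ s)), Z1.add C _ (toGSN (ρ r)) (toGSN (ρ s)), hz, hz', add_zero,
      zero_add, hzv] at e
    refine (congrArg (fun ν => colDist ν f') e).trans
      (congrArg (C.1 (toGSN (ρ r)) (toGSN (ρ s))) (Subtype.ext (funext fun v => ?_)))
    refine Eq.trans ?_ (hf (rowToCol v))
    refine congrArg f'.1 (funext fun i => ?_)
    fin_cases i <;> simp [rowToCol, actVec, mat_scalar, Matrix.vecMul, dotProduct, mul_comm]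
  · intro γ₁ γ₂ f f' hf; rw [colDist_eq _ hf]
    exact congrArg (fun ν : Dist Z_[p] ℤ => ν f) (hwd _ _ _ _
      (hρ ⟨γ₁ • infty, MulAction.mem_orbit _ γ₁⟩).symm
      (hρ ⟨γ₂ • infty, MulAction.mem_orbit _ γ₂⟩).symm)

section

variable {R R' : Type} [CommRing R] [Algebra ℚ R] [CommRing R'] [Algebra ℚ R']

open Classical in
theorem extend_cellFn {O : Subring R} {O' : Subring R'} {q : R' →+* R} {T : Subring R'}
    {h : ∀ x, x ∈ O' ↔ q x ∈ O ∧ x ∈ T} (hm : 0 < m) {a b : ℚ}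
    (hmT : algebraMap ℚ R' (m : ℚ)⁻¹ ∈ T) (ha : algebraMap ℚ R' a ∈ T)
    (hb : algebraMap ℚ R' b ∈ T) : extend O O' q T h (cellFn O m a b) = cellFn O' m a b := by
  have hm' : algebraMap ℚ R' (m : ℚ)⁻¹ * (m : R') = 1 := by
    rw [← map_natCast (algebraMap ℚ R'), ← map_mul, inv_mul_cancel₀ (mod_cast hm.ne'), map_one]
  have hq : ∀ x : ℚ, q (algebraMap ℚ R' x) = algebraMap ℚ R x := fun x =>
    congrArg (fun φ : ℚ →+* R => φ x) (Subsingleton.elim (q.comp (algebraMap ℚ R')) _)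
  have key : ∀ (x : R') (a : ℚ), algebraMap ℚ R' a ∈ T →
      ((x ∈ T ∧ ∃ w ∈ O, q x = algebraMap ℚ R a + m * w) ↔
        ∃ w ∈ O', x = algebraMap ℚ R' a + m * w) := by
    refine fun x a ha => ⟨?_, ?_⟩
    · rintro ⟨hx, w, hw, e⟩
      refine ⟨algebraMap ℚ R' (m : ℚ)⁻¹ * (x - algebraMap ℚ R' a),
        (h _).2 ⟨?_, mul_mem hmT (sub_mem hx ha)⟩, by linear_combination (algebraMap ℚ R' a - x) * hm'⟩
      have hm'' := congrArg q hm'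
      rw [map_mul, map_natCast, map_one] at hm''
      rw [map_mul, map_sub, hq, e, hq, add_sub_cancel_left, ← mul_assoc, ← hq, hm'', one_mul]
      exact hw
    · rintro ⟨w, hw, rfl⟩
      exact ⟨add_mem ha (mul_mem (natCast_mem T m) ((h w).1 hw).2), q w, ((h w).1 hw).1, by
        rw [map_add, map_mul, map_natCast, hq]⟩
  have hcell : ∀ v : Fin 2 → R', ((∀ i, v i ∈ T) ∧ (fun i => q (v i)) ∈ cell O m a b) ↔
      v ∈ cell O' m a b := fun v => by
    simp only [cell, mem_ofPred_eq, Fin.forall_fin_two, ← key _ _ ha, ← key _ _ hb]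
    tauto
  have h00 : (fun i : Fin 2 => q ((0 : Fin 2 → R') i)) = 0 := funext fun _ => map_zero q
  by_cases h0 : (0 : Fin 2 → R) ∈ cell O m a b
  · rw [cellFn_eq_zero _ _ _ h0, map_zero, cellFn_eq_zero]
    exact (hcell 0).1 ⟨fun _ => zero_mem T, by rwa [h00]⟩
  · refine testFn_eq_cellFn fun v => ?_
    change (if ∀ i, v i ∈ T then (cellFn O m a b).1 (fun i => q (v i)) else 0) = _
    rw [cellFn_apply O hm _ _ h0]; simp only [Set.indicator_apply, ← hcell, ite_and]

end

/-- Evaluation at a test function. -/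
def Dist.eval (f : TestFn O) : Dist O A →+ A where
  toFun μ := μ f
  map_zero' := rfl
  map_add' _ _ := rfl

theorem Dist.eval_apply {A : Type}
    [AddCommGroup A] (f : TestFn O) (μ : Dist O A) : Dist.eval f μ = μ f := rfl

theorem HolUnits.fn_zsmul (k : ℤ) (u : HolUnits) (τ : ℍ) : (k • u).fn.1 τ = u.fn.1 τ ^ k := by
  let φ : Additive Holˣ →+ Additive ℂˣ :=
    (Units.map (((Pi.evalRingHom (fun _ : ℍ => ℂ) τ).comp Hol.subtype : Hol →+* ℂ) :
      Hol →* ℂ)).toAdditive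
  have h := congrArg (fun x : Additive ℂˣ => ((Additive.toMul x : ℂˣ) : ℂ)) (map_zsmul φ k u)
  simp only [toMul_zsmul, Units.val_zpow_eq_zpow_val] at h
  exact h

theorem not_dvd_of_notMem_primesOf (hp : p ∉ primesOf (c * N)) : ¬ p.1 ∣ c ∧ ¬ p.1 ∣ N :=
  ⟨fun h => hp (h.mul_right N), fun h => hp (h.mul_left c)⟩

theorem inv_mem_ZS_of_mem_pPowers (hp : p ∉ S) (hm : m ∈ pPowers p) : ((m : ℚ)⁻¹) ∈ ZS S := by
  refine inv_natCast_mem_ZS hm.1 fun ℓ hℓ h => hp ?_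
  obtain ⟨e, rfl⟩ := eq_pow_of_mem_primeProducts hm
  have := (Nat.prime_dvd_prime_iff_eq ℓ.2 p.2).1 (ℓ.2.dvd_of_dvd_pow h)
  exact (Subtype.ext this : ℓ = p) ▸ hℓ

theorem toPadic_LR_smul_cellFn (hc6 : c.Coprime 6) (hp : p ∉ primesOf (c * N))
    (hD : D ∈ N.divisors) (hD0 : 0 < (D : ℚ)) (hm : m ∈ pPowers p) (i j : ℕ) :
    toPadic p hp HolUnits (LR D hD0 • toAdele primesOf_subset HolUnits (katoSiegel hc6))
      (cellFn Z_[p] m ((i : ℚ) / m) ((j : ℚ) / m)) =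
    LR D hD0 • ksUnit c ((i : ℚ) / m / m) ((j : ℚ) / m * D / m) := by
  have hpc : p ∉ primesOf c := fun h => hp (primesOf_subset h)
  have hm1 := inv_mem_ZS_of_mem_pPowers hp hm
  have hdiv : ∀ i : ℕ, (i : ℚ) / m ∈ ZS (primesOf (c * N)) := fun i => by
    rw [div_eq_mul_inv]; exact mul_mem (natCast_mem _ i) hm1
  have hint : ∀ {x : ℚ}, x ∈ ZS (primesNe p) →
      algebraMap ℚ (Adele (primesOf (c * N))) x ∈ integralAt (primesOf (c * N)) (· ≠ p) :=
    fun hx ℓ hℓ => rat_mem_padicInt (hx ℓ.1 hℓ)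
  have hm2 : ((m : ℚ)⁻¹) ∈ ZS (primesNe p) :=
    inv_mem_ZS_of_mem_pPowers (fun h : p ∈ primesNe p => absurd rfl h) hm
  have hdiv2 : ∀ i : ℕ, (i : ℚ) / m ∈ ZS (primesNe p) := fun i => by
    rw [div_eq_mul_inv]; exact mul_mem (natCast_mem _ i) hm2
  have hDS : ∀ ℓ : Primes, ℓ ∉ primesOf (c * N) → ¬ (ℓ : ℕ) ∣ D := fun ℓ hℓ h =>
    hℓ ((h.trans (dvd_of_mem_divisors hD)).mul_left c)
  change LR D hD0 • katoSiegel hc6 (extend _ _ _ _ (integral_iff_adele primesOf_subset)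
    (slash _ (LR D hD0) (extend _ _ _ _ (integral_iff_padic p hp) (cellFn _ m _ _)))) = _
  rw [extend_cellFn hm.1 (hint hm2) (hint (hdiv2 i)) (hint (hdiv2 j)), slash_cellFn hm.1, mat_LR]
  · simp only [of_apply, Matrix.cons_val', Matrix.cons_val_zero, Matrix.cons_val_one,
      Matrix.cons_val_fin_one, mul_one, mul_zero, add_zero, zero_add]
    have hjD := mul_mem (hdiv j) (natCast_mem _ D)
    rw [extend_cellFn hm.1 (algebraMap_mem_integralAt hm1) (algebraMap_mem_integralAt (hdiv i))
      (algebraMap_mem_integralAt hjD), katoSiegel_cellFn hc6 _ (ZS_anti primesOf_subset (hdiv i))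
      (ZS_anti primesOf_subset hjD)]
    refine mem_coprimeLevels.2 ⟨hm.1, ?_⟩
    exact coprime_of_mem_pPowers (not_dvd_of_notMem_primesOf hp).1 hm
  · have h1 := natCast_mem (integral (primesOf (c * N))) D
    have h2 := algebraMap_inv_mem_integral hDS
    intro i j; rw [mat_LR_inv, mat_LR]
    fin_cases i <;> fin_cases j <;> simp [h1, h2, zero_mem, one_mem]

theorem thetaC_zpow_pow (u τ : ℂ) (k : ℤ) : (thetaC c u τ ^ k) ^ 12 * (Theta (c * u) τ ^ 12) ^ k =
      (((Theta u τ ^ 12) ^ k) ^ (c ^ 2)) * ((Theta (c * u) τ)⁻¹ ^ 12 * Theta (c * u) τ ^ 12) ^ k := by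
  have h1 : ((-1 : ℂ) ^ ((c - 1) / 2)) ^ 12 = 1 := by rw [← pow_mul, mul_comm, pow_mul]; norm_num
  have e : ∀ (z : ℂ) (m : ℕ), (z ^ k) ^ m = (z ^ m) ^ k := fun z m => by
    rw [← zpow_natCast, ← zpow_natCast, ← zpow_mul, ← zpow_mul, mul_comm]
  rw [e, e, ← mul_zpow, ← mul_zpow, thetaC, mul_pow, mul_pow, h1]
  congr 1
  ring

theorem twelve_smul_katoSiegel (hc6 : c.Coprime 6) (hc : (c : ℚ) ≠ 0) (hN : 0 < N)
    (hp : p ∉ primesOf (c * N)) (hpN : ¬ p.1 ∣ N) (hn : IsBal(n, N)) :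
    (12 : ℤ) • (∑ D ∈ N.divisors.attach, n D.1 • toPadic p hp HolUnits
      (LR (D.1 : ℕ) (mod_cast pos_of_mem_divisors D.2) •
      toAdele primesOf_subset HolUnits (katoSiegel hc6))) + scalar c hc • siegelDist hpN hn =
      ((c : ℤ) ^ 2) • siegelDist hpN hn := by
  have hpc := (not_dvd_of_notMem_primesOf hp).1
  have hO : algebraMap ℚ ℚ_[p] (c : ℚ)⁻¹ ∈ Z_[p] := by
    rw [eq_ratCast, Rat.cast_inv, Rat.cast_natCast]; exact natCast_inv_mem_padicInt p hpc
  have hO' : algebraMap ℚ ℚ_[p] (c : ℚ) ∈ Z_[p] := by rw [map_natCast]; exact natCast_mem _ c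
  refine (levelSystem_padic p).dist_ext fun m hm i j => ?_
  have hm0 : (m : ℚ) ≠ 0 := mod_cast hm.1.ne'
  have hden : ∀ i : ℕ, ∃ z : ℤ, (m : ℚ) * ((i : ℚ) / m) = z := fun i =>
    ⟨i, by push_cast; field_simp⟩
  have hdenc : ∀ i : ℕ, ∃ z : ℤ, (m : ℚ) * ((i : ℚ) / m * c) = z := fun i =>
    ⟨i * c, by push_cast; field_simp⟩
  by_cases h0 : (0 : Fin 2 → ℚ_[p]) ∈ cell Z_[p] m ((i : ℚ) / m) ((j : ℚ) / m)
  · rw [cellFn_eq_zero _ _ _ h0, map_zero, map_zero]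
  have h0c : (0 : Fin 2 → ℚ_[p]) ∉ cell Z_[p] m ((i : ℚ) / m * c) ((j : ℚ) / m * c) := by
    have key : ∀ a : ℚ, (∃ w ∈ Z_[p], (0 : ℚ_[p]) = algebraMap ℚ _ (a * c) + m * w) →
        ∃ w ∈ Z_[p], (0 : ℚ_[p]) = algebraMap ℚ _ a + m * w := by
      rintro a ⟨w, hw, e⟩; refine ⟨algebraMap ℚ _ (c : ℚ)⁻¹ * w, mul_mem hO hw, ?_⟩
      have e1 : algebraMap ℚ ℚ_[p] c * algebraMap ℚ _ (c : ℚ)⁻¹ = 1 := by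
        rw [← map_mul, mul_inv_cancel₀ hc, map_one]
      rw [map_mul] at e
      linear_combination algebraMap ℚ _ (c : ℚ)⁻¹ * e + algebraMap ℚ ℚ_[p] a * e1
    exact fun h => h0 ⟨key _ h.1, key _ h.2⟩
  have hS := siegelPoint_div hpN hm hm (a := (i : ℚ) / m) (hden j) h0
  have hSc := siegelPoint_div hpN hm hm (a := (i : ℚ) / m * c) (hdenc j) h0c
  have hsc : (scalar c hc • siegelDist hpN hn) (cellFn _ m ((i : ℚ) / m) ((j : ℚ) / m)) =
      siegelUnit N n ((i : ℚ) / m * c / m) ((j : ℚ) / m * c / m) := by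
    rw [Dist.smul_apply, HolUnits.scalar_smul hc (siegelDist hpN hn _), slash_cellFn hm.1]
    · simp only [mat_scalar, of_apply, Matrix.cons_val', Matrix.cons_val_zero,
        Matrix.cons_val_one, Matrix.cons_val_fin_one, mul_zero, add_zero, zero_add]
      exact siegelDist_cellFn hN hpN hn hm hm (hdenc i) (hdenc j)
    · intro i j; rw [mat_scalar_inv, mat_scalar]
      fin_cases i <;> fin_cases j <;> simp [zero_mem] <;> simpa using hO
  rw [← Dist.eval_apply, ← Dist.eval_apply, map_add, map_zsmul, map_zsmul, map_sum]
  simp only [map_zsmul]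
  rw [sum_congr rfl fun D _ => congrArg (n D.1 • ·)
    (toPadic_LR_smul_cellFn hc6 hp D.2 _ hm i j), Dist.eval_apply, Dist.eval_apply, hsc, siegelDist_cellFn hN hpN hn hm hm (hden i) (hden j)]
  refine HolUnits.ext fun τ => ?_
  rw [HolUnits.fn_add, HolUnits.fn_zsmul, HolUnits.fn_zsmul, siegelUnit_fn n hS,
    siegelUnit_fn n hSc, HolUnits.fn_sum, siegelFn, siegelFn]
  have hD : ∀ D : {x // x ∈ N.divisors}, (n D.1 •
      (LR (D.1 : ℕ) (mod_cast pos_of_mem_divisors D.2) •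
          ksUnit c ((i : ℚ) / m / m) ((j : ℚ) / m * D.1 / m))).fn.1 τ =
      (thetaC c (D.1 * (((i / m / m : ℚ) : ℂ) * τ + ((j / m / m : ℚ) : ℂ))) (D.1 * τ)) ^ n D.1 := by
    intro D
    have hk : KSPoint c ((i : ℚ) / m / m) ((j : ℚ) / m * D.1 / m) := by
      have hm1 := inv_mem_ZS_of_mem_pPowers (fun h => hp (primesOf_subset h)) hm (S := primesOf c)
      simp only [div_eq_mul_inv]
      refine ⟨mul_mem (mul_mem (natCast_mem _ _) hm1) hm1,
        mul_mem (mul_mem (mul_mem (natCast_mem _ _) hm1) (natCast_mem _ _)) hm1, ?_⟩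
      rintro ⟨h1, z, h2⟩; exact hS D.1 D.2 ⟨h1, z, by rw [← h2]; ring⟩
    rw [HolUnits.fn_zsmul, HolUnits.fn_smul, ksUnit_fn hk, coe_LR_inv_smul]; congr 2; push_cast
    ring
  rw [prod_congr rfl fun D _ => hD D, Finset.prod_attach N.divisors
    fun D => (thetaC c (D * (((i / m / m : ℚ) : ℂ) * τ + ((j / m / m : ℚ) : ℂ))) (D * τ)) ^ n D]
  rw [show (12 : ℤ) = ((12 : ℕ) : ℤ) from rfl, ← Nat.cast_pow, zpow_natCast, zpow_natCast,
    ← prod_pow, ← prod_pow, ← prod_mul_distrib]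
  refine prod_congr rfl fun D hD => ?_
  have hne := Theta_ne_zero_of_siegelPoint hSc τ.im_pos hD
  have e : (D : ℂ) * (((i / m * c / m : ℚ) : ℂ) * τ + ((j / m * c / m : ℚ) : ℂ)) =
      c * (D * (((i / m / m : ℚ) : ℂ) * τ + ((j / m / m : ℚ) : ℂ))) := by
    push_cast; ring
  rw [e] at hne ⊢
  have := thetaC_zpow_pow (c := c) (D * (((i / m / m : ℚ) : ℂ) * τ + ((j / m / m : ℚ) : ℂ)))
    (D * τ) (n D)
  rw [← mul_pow, inv_mul_cancel₀ hne, one_pow, one_zpow, mul_one] at this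
  exact this

theorem sum_support_delta (hNc : N.Coprime c) {M : Type} [AddCommGroup M]
    (φ : GS (primesOf c) → M) : ∑ g ∈ (delta c N hNc n).support, delta c N hNc n g • φ g =
      ∑ D ∈ N.divisors.attach, n D.1 • φ ⟨LR (D.1 : ℕ) (mod_cast pos_of_mem_divisors D.2),
      LR_mem_GS (pos_of_mem_divisors D.2) (not_dvd_of_coprime hNc D.2)⟩ := by
  classical
  let ψ : (GS (primesOf c) →₀ ℤ) →+ M := Finsupp.liftAddHom fun g => (zmultiplesHom M (φ g))
  have h : ∀ x, ψ x = ∑ g ∈ x.support, x g • φ g := fun x => rfl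
  rw [← h, delta, map_sum]
  refine sum_congr rfl fun D _ => ?_
  rw [Finsupp.liftAddHom_apply_single]
  rfl

/-- The potential of the smoothed and restricted cocycle. -/
def restrictedPotential {A : Type} [AddCommGroup A] [DistribMulAction GQ A] (hNc : N.Coprime c) (n : ℕ → ℤ)
    (hp : p ∉ primesOf (c * N)) (e : Dist (integral (primesOf c)) A) : Dist Z_[p] A :=
  ∑ g ∈ (delta c N hNc n).support, delta c N hNc n g •
    toPadic p hp A ((g : GQ) • toAdele primesOf_subset A ((g : GQ)⁻¹ • e))

theorem smoothZ1_single_one {G' : Subgroup GQ} {M M' : Type} [AddCommGroup M] [DistribMulAction GQ M]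
    [AddCommGroup M'] [DistribMulAction GQ M'] (hH : H ≤ G') (η : M' →+ M)
    (hη : ∀ h ∈ H, ∀ x, η (h • x) = h • η x) (z : Z1 G' M') (k₀ k₁) :
    (smoothZ1 H hH (Finsupp.single 1 1) η hη z).1 k₀ k₁ =
      η (z.1 (Subgroup.inclusion ((Hδ_le H _).trans hH) k₀)
      (Subgroup.inclusion ((Hδ_le H _).trans hH) k₁)) := by
  change ∑ g ∈ (Finsupp.single (1 : G') (1 : ℤ)).support, _ = _
  rw [Finsupp.support_single (1 : G') (one_ne_zero (α := ℤ)), Finset.sum_singleton, Finsupp.single_eq_same,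
    one_smul, inv_one, one_mul, one_mul]
  exact one_smul _ _

theorem mapValues_toPadic_smul_toAdele (hp : p ∉ primesOf (c * N)) (g : GQ)
    (μ : Dist (integral (primesOf c)) ℤ) :
    Dist.mapValues _ constHom (toPadic p hp ℤ (g • toAdele primesOf_subset ℤ μ)) =
      toPadic p hp Hol (g • toAdele primesOf_subset Hol (Dist.mapValues _ constHom μ)) :=
  DFunLike.ext _ _ fun _ => constHom_smul g _

theorem toPadic_smul_toAdele_conj {A : Type} [AddCommGroup A] [DistribMulAction GQ A]
    (hp : p ∉ primesOf (c * N)) {g k : GQ} (hk : k ∈ GS (primesNe p))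
    (hg : g⁻¹ * k * g ∈ GS (primesOf (c * N))) (e : Dist (integral (primesOf c)) A) :
    toPadic p hp A (g • toAdele primesOf_subset A ((g⁻¹ * k) • e)) =
      k • toPadic p hp A (g • toAdele primesOf_subset A (g⁻¹ • e)) := by
  rw [← toPadic_smul p hp A k hk, ← mul_smul, show g⁻¹ * k = (g⁻¹ * k * g) * g⁻¹ by group, mul_smul _ g⁻¹ e,
    toAdele_smul _ _ _ hg, ← mul_smul]
  simp only [mul_assoc, mul_inv_cancel_left]

theorem exists_restricted_cocycle (hNc : N.Coprime c) (hp : p ∉ primesOf (c * N))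
    {e : Dist (integral (primesOf c)) Hol}
    {z : Z1 (GS (primesOf c)) (Dist (integral (primesOf c)) ℤ)}
    (hz : ∀ g₀ g₁, Dist.mapValues _ constHom (z.1 g₀ g₁) = (g₁ : GQ) • e - (g₀ : GQ) • e) :
    ∃ Z : Z1 (GSN (primesNe p) N) (Dist Z_[p] ℤ),
      cls Z = restrictPadic c N p hp (smoothDelta c N hNc n (cls z)) ∧
      ∀ k₀ k₁, Dist.mapValues _ constHom (Z.1 k₀ k₁) =
      (k₁ : GQ) • restrictedPotential hNc n hp e - (k₀ : GQ) • restrictedPotential hNc n hp e := by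
  refine ⟨_, rfl, fun k₀ k₁ => ?_⟩
  let W := resZ1 (GSN_le_Hδ c N hNc n) (smoothZ1 (GS (primesOf (c * N))) (GS_anti primesOf_subset)
    (delta c N hNc n) (toAdele primesOf_subset ℤ)
    (fun γ hγ μ => toAdele_smul primesOf_subset ℤ γ hγ μ) z)
  let i := Subgroup.inclusion (GSN_anti (primesOf_subset_primesNe hp) N)
  let i' := Subgroup.inclusion ((GSN_le _ N).trans (GS_anti (primesOf_subset (c := c) (N := N))))
  refine (congrArg (Dist.mapValues _ constHom) (smoothZ1_single_one
    (GSN_anti (primesOf_subset_primesNe hp) N) (toPadic p hp ℤ)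
    (fun γ hγ μ => toPadic_smul p hp ℤ γ (GSN_le _ _ hγ) μ) W _ _)).trans ?_
  have hW : W.1 (i k₀) (i k₁) = ∑ g ∈ (delta c N hNc n).support, delta c N hNc n g •
      ((g : GQ) • toAdele primesOf_subset ℤ (z.1 (g⁻¹ * i' (i k₀)) (g⁻¹ * i' (i k₁)))) := rfl
  change Dist.mapValues _ constHom (toPadic p hp ℤ (W.1 (i k₀) (i k₁))) = _
  rw [hW, restrictedPotential, map_sum, map_sum, smul_sum, smul_sum, ← sum_sub_distrib]
  refine sum_congr rfl fun g hg => ?_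
  rw [map_zsmul, map_zsmul, mapValues_toPadic_smul_toAdele, hz, map_sub, smul_sub, map_sub,
    smul_comm (k₁ : GQ), smul_comm (k₀ : GQ), ← smul_sub]
  have key : ∀ k : GSN (primesNe p) N, (g : GQ)⁻¹ * k * g ∈ GS (primesOf (c * N)) := fun k =>
    (mem_Hδ.1 (GSN_le_Hδ c N hNc n (i k).2)).1 g hg
  rw [← toPadic_smul_toAdele_conj hp k₁.2.1 (key k₁), ← toPadic_smul_toAdele_conj hp k₀.2.1 (key k₀)]
  rfl

theorem mapValues_exp_restrictedPotential (hc6 : c.Coprime 6) (hNc : N.Coprime c)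
    (hp : p ∉ primesOf (c * N)) {e : Dist (integral (primesOf c)) Hol}
    (he : Dist.mapValues _ expHom e = katoSiegel hc6) :
    Dist.mapValues _ expHom (restrictedPotential hNc n hp e) =
      ∑ D ∈ N.divisors.attach, n D.1 • toPadic p hp HolUnits
      (LR (D.1 : ℕ) (mod_cast pos_of_mem_divisors D.2) •
      toAdele primesOf_subset HolUnits (katoSiegel hc6)) := by
  rw [restrictedPotential, map_sum, ← sum_support_delta hNc fun g : GS (primesOf c) =>
    toPadic p hp HolUnits ((g : GQ) • toAdele primesOf_subset HolUnits (katoSiegel hc6))]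
  refine sum_congr rfl fun g _ => ?_
  rw [map_zsmul, ← katoSiegel_invariant hc6 _ (inv_mem g.2), ← he]
  rfl

theorem cls_neg_smoothC_siegelCocycle (hc6 : c.Coprime 6) (hc : (c : ℚ) ≠ 0) (hN : 0 < N)
    (hNc : N.Coprime c) (hp : p ∉ primesOf (c * N)) (hpN : ¬ p.1 ∣ N) (hn : IsBal(n, N))
    {ξ : H1 (GS (primesOf c)) (Dist (integral (primesOf c)) ℤ)}
    (hξ : IsDedekindRademacherClass c ξ) : cls (-smoothC c hc (siegelCocycle hpN hn hN)) =
      12 • restrictPadic c N p hp (smoothDelta c N hNc n ξ) := by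
  obtain ⟨κ, hκ, e, he, z, hz, rfl⟩ := hξ
  rw [hκ.eq hc6] at he
  obtain ⟨Z, hZ, hZE⟩ := exists_restricted_cocycle (n := n) hNc hp hz
  rw [← hZ]
  set E := restrictedPotential hNc n hp e with hE
  set w := siegelLogDist hpN hn with hw
  have hexp : Dist.mapValues _ expHom ((12 : ℤ) • E + ((c : ℤ) ^ 2 • w - scalar c hc • w)) = 0 := by
    have h1 := twelve_smul_katoSiegel hc6 hc hN hp hpN hn
    rw [← mapValues_exp_restrictedPotential hc6 hNc hp he] at h1
    have h2 : Dist.mapValues _ expHom (scalar c hc • w) =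
        scalar c hc • Dist.mapValues _ expHom w := DFunLike.ext _ _ fun f => expHom_smul _ _
    rw [map_add, map_sub, map_zsmul, map_zsmul, h2, hw, mapValues_siegelLogDist, smul_neg, smul_neg,
      ← h1]
    abel
  obtain ⟨a, ha⟩ := exists_mapValues_constHom hexp
  refine cls_eq_of_potential (z' := 12 • Z) mapValues_constHom_injective mapValues_constHom_smul
    (e := scalar c hc • w - (c : ℤ) ^ 2 • w) (e' := (12 : ℤ) • E) (a := a) (by rw [ha]; abel)
    (fun g₀ g₁ => ?_) fun g₀ g₁ => ?_
  · change Dist.mapValues _ constHom (-((c : ℤ) ^ 2 • (siegelCocycle hpN hn hN).1 g₀ g₁ -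
      scalar c hc • (siegelCocycle hpN hn hN).1 g₀ g₁)) = _
    rw [map_neg, map_sub, map_zsmul, mapValues_constHom_smul, siegelCocycle_spec, ← hw]
    simp only [smul_sub, smul_comm _ ((c : ℤ) ^ 2), ← mul_smul, scalar_comm]; abel
  · change Dist.mapValues _ constHom ((12 : ℕ) • Z.1 g₀ g₁) = _
    rw [map_nsmul, hZE, smul_comm _ (12 : ℤ), smul_comm _ (12 : ℤ), ← smul_sub]; rfl

/-! Uniqueness of the Darmon–Dasgupta cocycle -/

theorem LevelSystem.eq_sum_cellFn (hL : LevelSystem O L) (hm : m ∈ L) (hf : IsTestWith O m f.1)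
    (hs : ∀ v, f.1 v ≠ 0 → ∀ i, v i ∈ O) : f = ∑ y ∈ range m ×ˢ range m,
      f.1 (ratVec R (y.1 : ℤ) (y.2 : ℤ)) • cellFn O m (y.1 : ℤ) (y.2 : ℤ) := by
  have iff : ∀ (x : R) (i₀ i : ℕ), i₀ < m → i < m → (∃ w ∈ O, x = i₀ + m * w) →
      ((∃ w ∈ O, x = algebraMap ℚ R (i : ℤ) + m * w) ↔ i = i₀) := by
    rintro x i₀ i hi₀ hi ⟨w, hw, rfl⟩; rw [map_intCast, cast_natCast]
    refine ⟨?_, fun h => h ▸ ⟨w, hw, rfl⟩⟩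
    rintro ⟨w', hw', e⟩; exact hL.eq_of_sub_eq hm hi hi₀ (sub_mem hw hw') (by linear_combination -e)
  apply Subtype.ext; funext v
  have e : (∑ y ∈ range m ×ˢ range m,
      f.1 (ratVec R (y.1 : ℤ) (y.2 : ℤ)) • cellFn O m (y.1 : ℤ) (y.2 : ℤ)).1 v =
      ∑ y ∈ range m ×ˢ range m, f.1 (ratVec R (y.1 : ℤ) (y.2 : ℤ)) *
        (cellFn O m (y.1 : ℤ) (y.2 : ℤ)).1 v := by simp [Finset.sum_apply]
  rw [e]
  simp only [smul_cellFn_apply (hL.pos hm) hf, ← mul_sum]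
  by_cases hv : f.1 v = 0
  · rw [hv, zero_mul]
  obtain ⟨i₀, hi₀, hw₀⟩ := hL.approx hm _ (hs v hv 0)
  obtain ⟨j₀, hj₀, hw₁⟩ := hL.approx hm _ (hs v hv 1)
  rw [sum_eq_single_of_mem (i₀, j₀) (by simp [hi₀, hj₀]), indicator_of_mem, mul_one]
  · exact ⟨(iff _ _ _ hi₀ hi₀ hw₀).2 rfl, (iff _ _ _ hj₀ hj₀ hw₁).2 rfl⟩
  · rintro ⟨i, j⟩ hy hne; rw [mem_product, mem_range, mem_range] at hy
    exact indicator_of_notMem (fun h => hne (Prod.ext ((iff _ _ _ hi₀ hy.1 hw₀).1 h.1)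
      ((iff _ _ _ hj₀ hy.2 hw₁).1 h.2))) _

/-- The pairs of residues modulo `p ^ j` that are not both divisible by `p`. -/
abbrev primitivePairs (p : Primes) (j : ℕ) : Finset (ℕ × ℕ) :=
  (range (p.1 ^ j) ×ˢ range (p.1 ^ j)).filter fun x => ¬ ((p : ℕ) ∣ x.1 ∧ (p : ℕ) ∣ x.2)

/-- The characteristic function of a residue class modulo `p ^ m`. -/
def residueInd (p : Primes) (m : ℕ) (u a : ℤ) : ℤ := if (p.1 ^ m : ℤ) ∣ a - u then 1 else 0

theorem mem_cell_int_iff {u x a b : ℤ} : ratVec ℚ_[p] a b ∈ cell Z_[p] (p.1 ^ m) u x ↔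
      (p.1 ^ m : ℤ) ∣ a - u ∧ (p.1 ^ m : ℤ) ∣ b - x := by
  have key : ∀ a u : ℤ, ‖(a : ℚ_[p]) - u‖ ≤ ((p.1 : ℝ) ^ m)⁻¹ ↔
      (p.1 ^ m : ℤ) ∣ a - u := fun a u => by
    rw [← Int.cast_sub, ← zpow_natCast, ← zpow_neg, Padic.norm_int_le_pow_iff_dvd]
  rw [mem_cell_pow_iff, ← key, ← key]
  simp [ratVec]

open Classical in
theorem apply_cellFn_eq_sum (ν : Dist Z_[p] ℤ) (hj : m ≤ j) {u x : ℤ}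
    (h0 : (0 : Fin 2 → ℚ_[p]) ∉ cell Z_[p] (p.1 ^ m) u x) : ν (cellFn _ (p.1 ^ m) u x) =
      ∑ y ∈ range (p.1 ^ j) ×ˢ range (p.1 ^ j), residueInd p m u y.1 * residueInd p m x y.2 *
      ν (cellFn _ (p.1 ^ j) (y.1 : ℤ) (y.2 : ℤ)) := by
  have hcell := cellFn_apply Z_[p] (pow_pos p.2.pos m) _ _ h0
  have hval : ∀ y : ℕ × ℕ, (cellFn Z_[p] (p.1 ^ m) u x).1
      (ratVec _ (y.1 : ℤ) (y.2 : ℤ)) = residueInd p m u y.1 * residueInd p m x y.2 := fun y => by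
    rw [hcell, Set.indicator_apply, mem_cell_int_iff, residueInd, residueInd]
    split_ifs <;> simp_all
  have hf := (isTestWith_cell Z_[p] (m := p.1 ^ m) (d := 1) (u : ℚ) x
    ⟨u, by simp⟩ ⟨x, by simp⟩).mul (p.1 ^ (j - m))
  rw [mul_one, ← pow_add, Nat.add_sub_cancel' hj] at hf
  have := (levelSystem_padic p).eq_sum_cellFn (pow_mem_primeProducts p j) hf fun v hv => by
    rw [hcell, Set.indicator_apply_ne_zero] at hv
    have key : ∀ (y : ℚ_[p]) (a : ℤ), (∃ w ∈ Z_[p],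
        y = algebraMap ℚ ℚ_[p] a + (p.1 ^ m : ℕ) * w) → y ∈ Z_[p] := by
      rintro _ a ⟨w, hw, rfl⟩; rw [map_intCast]
      exact add_mem (intCast_mem _ _) (mul_mem (natCast_mem _ _) hw)
    exact Fin.forall_fin_two.2 ⟨key _ _ hv.1.1, key _ _ hv.1.2⟩
  conv_lhs => rw [this]
  rw [map_sum]
  exact sum_congr rfl fun y _ => by rw [map_zsmul, hval, smul_eq_mul]

theorem apply_cellFn_eq_sum_mass (ν : Dist Z_[p] ℤ) (hm : 0 < m) (hj : m ≤ j) {u x : ℤ}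
    (h : ¬ ((p.1 : ℤ) ∣ u ∧ (p.1 : ℤ) ∣ x)) : ν (cellFn _ (p.1 ^ m) u x) = ∑ y ∈ primitivePairs p j,
      residueInd p m u y.1 * residueInd p m x y.2 * ν.mass (ball p j y.1 y.2) := by
  rw [apply_cellFn_eq_sum ν hj (zero_notMem_cell_of_primitive hm fun h' => h h'.symm),
    Finset.sum_filter_of_ne]
  · exact sum_congr rfl fun y _ => by rw [mass_ball_eq]
  · rintro y - hy ⟨h1, h2⟩; refine hy ?_; rw [residueInd, residueInd]
    split_ifs with h3 h4
    · have key : ∀ {a : ℕ} {u : ℤ}, p.1 ∣ a → (p.1 ^ m : ℤ) ∣ a - u → (p.1 : ℤ) ∣ u :=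
        fun h1 h2 => (dvd_sub_right (Int.natCast_dvd_natCast.2 h1)).1
          ((dvd_pow_self _ hm.ne').trans h2)
      exact absurd ⟨key h1 h3, key h2 h4⟩ h
    all_goals simp

theorem exists_polynomial_residueInd (p : Primes) (m : ℕ) (u : ℤ) {ε : ℝ} (hε : 0 < ε) :
    ∃ P : Polynomial ℚ_[p], ∀ a : ℤ, ‖P.eval (a : ℚ_[p]) - residueInd p m u a‖ ≤ ε := by
  classical
  have hcl : IsClopen (Metric.closedBall (u : ℤ_[p]) ((p.1 : ℝ) ^ (-m : ℤ))) :=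
    IsUltrametricDist.isClopen_closedBall _ (zpow_pos (mod_cast p.2.pos : (0 : ℝ) < p.1) _).ne'
  let f : C(ℤ_[p], ℤ_[p]) := 
    ⟨(Metric.closedBall (u : ℤ_[p]) ((p.1 : ℝ) ^ (-m : ℤ))).indicator fun _ => 1,
    continuous_indicator (by rw [hcl.frontier_eq]; exact fun _ h => h.elim) continuousOn_const⟩
  have hf : ∀ a : ℤ, ((f (a : ℤ_[p]) : ℤ_[p]) : ℚ_[p]) = residueInd p m u a := fun a => by
    change ((Set.indicator _ _ _ : ℤ_[p]) : ℚ_[p]) = _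
    rw [residueInd, Set.indicator_apply, Metric.mem_closedBall, dist_eq_norm, ← Int.cast_sub,
      PadicInt.norm_int_le_pow_iff_dvd]
    push_cast
    split_ifs <;> simp
  obtain ⟨s, hs⟩ := ((PadicInt.hasSum_mahler f).eventually (Metric.closedBall_mem_nhds f hε)).exists
  rw [dist_eq_norm] at hs
  refine ⟨∑ i ∈ s, Polynomial.C ((((fwdDiff 1)^[i] f 0 : ℤ_[p]) : ℚ_[p]) *
    ((i.factorial : ℚ_[p]))⁻¹) * (descPochhammer ℤ i).map (castRingHom _), fun a => ?_⟩
  have hc : ∀ i : ℕ, ((i.factorial : ℚ_[p]))⁻¹ *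
      ((descPochhammer ℤ i).map (castRingHom ℚ_[p])).eval (a : ℚ_[p]) =
      ((Ring.choose (a : ℤ_[p]) i : ℤ_[p]) : ℚ_[p]) := fun i => by
    have h := congrArg (fun x : ℤ_[p] => (x : ℚ_[p]))
      (Ring.descPochhammer_eq_factorial_smul_choose (a : ℤ_[p]) i)
    rw [inv_mul_eq_iff_eq_mul₀ (mod_cast i.factorial_ne_zero)]
    simp only [nsmul_eq_mul, PadicInt.coe_mul, coe_natCast] at h
    rw [← h, ← Polynomial.aeval_eq_smeval, ← eq_intCast (castRingHom ℚ_[p]) a,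
      Polynomial.eval_map, Polynomial.eval₂_at_apply, ← eq_intCast (algebraMap ℤ ℤ_[p]) a,
      Polynomial.aeval_algebraMap_apply, eq_intCast, eq_intCast,
      PadicInt.coe_intCast, Polynomial.coe_aeval_eq_eval]
  have h := (ContinuousMap.norm_coe_le_norm (∑ i ∈ s, PadicInt.mahlerTerm ((fwdDiff 1)^[i] f 0) i - f)
    (a : ℤ_[p])).trans hs
  rw [ContinuousMap.sub_apply, ContinuousMap.sum_apply, PadicInt.norm_def] at h
  rw [← hf, eval_finsetSum]
  refine (congrArg norm ?_).trans_le h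
  rw [coe_sub, PadicInt.coe_sum]
  congr 1
  refine sum_congr rfl fun i _ => ?_
  rw [PadicInt.mahlerTerm_apply, mahler_apply, smul_eq_mul, PadicInt.coe_mul, ← hc,
    eval_mul, eval_C]
  ring

theorem norm_int_mul_le (x : ℚ_[p]) (k : ℤ) : ‖x * k‖ ≤ ‖x‖ := by
  rw [norm_mul]
  exact mul_le_of_le_one_right (norm_nonneg _) (Padic.norm_int_le_one k)

theorem norm_mul_sub_mul_le {ε : ℝ} (h1 : ε ≤ 1) {x y : ℚ_[p]} {k l : ℤ} (hx : ‖x - k‖ ≤ ε)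
    (hy : ‖y - l‖ ≤ ε) : ‖x * y - k * l‖ ≤ ε := by
  have hy1 : ‖y‖ ≤ 1 := by
    rw [← sub_add_cancel y (l : ℚ_[p])]
    exact (nonarchimedean _ _).trans (max_le (hy.trans h1) (Padic.norm_int_le_one l))
  rw [show x * y - k * l = (x - k) * y + (y - l) * k by ring]
  refine (nonarchimedean _ _).trans (max_le ?_ ((norm_int_mul_le _ _).trans hy))
  rw [norm_mul]
  exact (mul_le_of_le_one_right (norm_nonneg _) hy1).trans hx

theorem apply_cellFn_eq_zero_of_moments {ν : Dist Z_[p] ℤ} (hν : ∀ s r, Even (s + r) →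
      HasPadicIntegral p ν (MvPolynomial.X 0 ^ s * MvPolynomial.X 1 ^ r) 0) (hm : 0 < m) {u x : ℤ}
    (h : ¬ ((p.1 : ℤ) ∣ u ∧ (p.1 : ℤ) ∣ x))
    (hneg : ν (cellFn _ (p.1 ^ m) (-u : ℤ) (-x : ℤ)) = ν (cellFn _ (p.1 ^ m) u x)) :
    ν (cellFn _ (p.1 ^ m) u x) = 0 := by
  have hpoly : ∀ P Q : Polynomial ℚ_[p], Tendsto (fun j => ∑ y ∈ primitivePairs p j,
      (P.eval ((y.1 : ℤ) : ℚ_[p]) * Q.eval ((y.2 : ℤ) : ℚ_[p]) +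
        P.eval ((-y.1 : ℤ) : ℚ_[p]) * Q.eval ((-y.2 : ℤ) : ℚ_[p])) *
        (ν.mass (ball p j y.1 y.2) : ℚ_[p])) atTop (𝓝 0) := by
    intro P Q
    have e : ∀ (j : ℕ), (∑ y ∈ primitivePairs p j,
      (P.eval ((y.1 : ℤ) : ℚ_[p]) * Q.eval ((y.2 : ℤ) : ℚ_[p]) +
        P.eval ((-y.1 : ℤ) : ℚ_[p]) * Q.eval ((-y.2 : ℤ) : ℚ_[p])) *
        (ν.mass (ball p j y.1 y.2) : ℚ_[p])) = ∑ s ∈ range (P.natDegree + 1),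
        ∑ r ∈ range (Q.natDegree + 1), P.coeff s * Q.coeff r * (1 + (-1) ^ (s + r)) *
          ∑ y ∈ primitivePairs p j, (MvPolynomial.eval ![(y.1 : ℤ), (y.2 : ℤ)]
            (MvPolynomial.X 0 ^ s * MvPolynomial.X 1 ^ r) : ℚ_[p]) *
              (ν.mass (ball p j y.1 y.2) : ℚ_[p]) := fun j => by
      simp only [mul_sum (primitivePairs p j)]; rw [sum_congr rfl fun s _ => sum_comm, sum_comm]
      refine sum_congr rfl fun y _ => ?_
      simp only [Polynomial.eval_eq_sum_range]
      rw [sum_mul_sum, sum_mul_sum, ← sum_add_distrib, sum_mul]; refine sum_congr rfl fun s _ => ?_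
      rw [← sum_add_distrib, sum_mul]; refine sum_congr rfl fun r _ => ?_
      push_cast; rw [neg_pow (y.1 : ℚ_[p]), neg_pow (y.2 : ℚ_[p]), pow_add]; simp; ring
    simp only [e]
    have key := fun s r => show Tendsto (fun j => P.coeff s * Q.coeff r * (1 + (-1) ^ (s + r)) *
          ∑ y ∈ primitivePairs p j, (MvPolynomial.eval ![(y.1 : ℤ), (y.2 : ℤ)]
            (MvPolynomial.X 0 ^ s * MvPolynomial.X 1 ^ r) : ℚ_[p]) *
              (ν.mass (ball p j y.1 y.2) : ℚ_[p])) atTop (𝓝 0) by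
      rcases Nat.even_or_odd (s + r) with hsr | hsr
      · have := (hν s r hsr).const_mul (P.coeff s * Q.coeff r * (1 + (-1) ^ (s + r)))
        rwa [mul_zero] at this
      · simp [hsr.neg_one_pow]
    simpa only [Finset.sum_const_zero] using tendsto_finsetSum (range (P.natDegree + 1))
      fun s _ => tendsto_finsetSum (range (Q.natDegree + 1)) fun r _ => key s r
  have hres : ∀ u a : ℤ, residueInd p m (-u) a = residueInd p m u (-a) := fun u a => by
    simp only [residueInd, show a - -u = -(-a - u) by ring, dvd_neg]
  have hsmall : ∀ ε : ℝ, 0 < ε → ε ≤ 1 → ‖((2 * ν (cellFn _ (p.1 ^ m) u x) : ℤ) : ℚ_[p])‖ ≤ ε := by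
    intro ε hε hε1; obtain ⟨P, hP⟩ := exists_polynomial_residueInd p m u hε
    obtain ⟨Q, hQ⟩ := exists_polynomial_residueInd p m x hε
    obtain ⟨j, hj, hjm⟩ := (((hpoly P Q).eventually (Metric.closedBall_mem_nhds 0 hε)).and
      (Filter.eventually_ge_atTop m)).exists
    rw [dist_zero_right] at hj
    have e : ((2 * ν (cellFn _ (p.1 ^ m) u x) : ℤ) : ℚ_[p]) = ∑ y ∈ primitivePairs p j,
        ((residueInd p m u y.1 : ℚ_[p]) * residueInd p m x y.2 +
          residueInd p m u (-y.1) * residueInd p m x (-y.2)) *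
          (ν.mass (ball p j y.1 y.2) : ℚ_[p]) := by
      have e1 := apply_cellFn_eq_sum_mass ν hm hjm (u := -u) (x := -x) (by rwa [dvd_neg, dvd_neg])
      rw [hneg] at e1; rw [two_mul]
      nth_rewrite 1 [apply_cellFn_eq_sum_mass ν hm hjm h]
      rw [e1, ← sum_add_distrib]; push_cast; refine sum_congr rfl fun y _ => ?_
      rw [hres, hres]; ring
    rw [e, ← sub_add_cancel (∑ y ∈ primitivePairs p j, _) (∑ y ∈ primitivePairs p j,
      (P.eval ((y.1 : ℤ) : ℚ_[p]) * Q.eval ((y.2 : ℤ) : ℚ_[p]) +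
        P.eval ((-y.1 : ℤ) : ℚ_[p]) * Q.eval ((-y.2 : ℤ) : ℚ_[p])) *
        (ν.mass (ball p j y.1 y.2) : ℚ_[p]))]
    refine (nonarchimedean _ _).trans (max_le ?_ hj)
    rw [← sum_sub_distrib]
    refine IsUltrametricDist.norm_sum_le_of_forall_le_of_nonneg hε.le fun y _ => ?_
    rw [← sub_mul]; refine (norm_int_mul_le _ _).trans ?_; rw [add_sub_add_comm]
    refine (nonarchimedean _ _).trans (max_le ?_ ?_) <;> rw [← norm_neg, neg_sub]
    · exact norm_mul_sub_mul_le hε1 (hP _) (hQ _)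
    · exact norm_mul_sub_mul_le hε1 (hP _) (hQ _)
  have h0 : ((2 * ν (cellFn _ (p.1 ^ m) u x) : ℤ) : ℚ_[p]) = 0 :=
    norm_le_zero_iff.1 (le_of_forall_gt_imp_ge_of_dense fun ε hε =>
      (hsmall (min ε 1) (lt_min hε one_pos) (min_le_right _ _)).trans (min_le_left _ _))
  have := Int.cast_eq_zero.1 h0
  omega

theorem sum_residueInd (hj : m ≤ j) (b : ℤ) :
    ∑ y ∈ range (p.1 ^ j), residueInd p m b y = (p : ℤ) ^ (j - m) := by
  have hq := pow_pos p.2.pos m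
  obtain ⟨b₀, hb⟩ : ∃ b₀ : ℕ, ((p.1 ^ m : ℕ) : ℤ) ∣ b - b₀ :=
    ⟨(b % (p.1 ^ m : ℕ)).toNat, by
      rw [toNat_of_nonneg (Int.emod_nonneg _ (mod_cast hq.ne'))]
      exact Int.dvd_self_sub_emod⟩
  have e : ∀ y : ℕ, residueInd p m b y = if y ≡ b₀ [MOD p.1 ^ m] then 1 else 0 := fun y => by
    rw [residueInd]; refine if_congr ?_ rfl rfl
    rw [← Int.natCast_modEq_iff, Int.modEq_comm, Int.modEq_iff_dvd,
      show (y : ℤ) - b₀ = y - b + (b - b₀) by ring, dvd_add_left hb]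
    push_cast; rfl
  simp only [e]
  rw [Finset.sum_boole, ← Nat.count_eq_card_filter_range, Nat.count_modEq_card _ hq,
    Nat.pow_div hj p.2.pos, Nat.mod_eq_zero_of_dvd (pow_dvd_pow _ hj)]
  simp

theorem exists_mul_sub_dvd (hpN : ¬ p.1 ∣ N) (j : ℕ) {a : ℤ} (ha : ¬ (p.1 ^ m : ℤ) ∣ a) :
    ∃ s : ℤ, (p.1 ^ j : ℤ) ∣ N * s * a - p.1 ^ m := by
  obtain ⟨k, -, hk⟩ := (Nat.dvd_prime_pow p.2).1 (show Int.gcd (N * a) (p.1 ^ j : ℕ) ∣ p.1 ^ j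
    from Int.gcd_dvd_natAbs_right _ _)
  have hkm : k ≤ m := by
    by_contra hlt
    refine ha ?_
    have h1 : ((p.1 ^ k : ℕ) : ℤ) ∣ N * a := hk ▸ Int.gcd_dvd_left _ _
    have h2 : (p.1 ^ m : ℤ) ∣ N * a := (pow_dvd_pow _ (not_le.1 hlt).le).trans (mod_cast h1)
    refine IsCoprime.dvd_of_dvd_mul_left (IsCoprime.pow_left ?_) h2
    exact Nat.isCoprime_iff_coprime.2 ((Nat.Prime.coprime_iff_not_dvd p.2).2 hpN)
  obtain ⟨t, ht⟩ := pow_dvd_pow (p.1 : ℤ) hkm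
  have hb := Int.gcd_eq_gcd_ab (N * a) (p.1 ^ j : ℕ)
  rw [hk] at hb
  refine ⟨Int.gcdA (N * a) (p.1 ^ j : ℕ) * t, -Int.gcdB (N * a) (p.1 ^ j : ℕ) * t, ?_⟩
  push_cast at hb ⊢
  rw [ht]
  linear_combination -t * hb

/-- A finitely additive function on balls with values in `ℤ` that is invariant under a family of
unipotent matrices vanishes. -/
theorem eq_zero_of_shear_invariant (hpN : ¬ p.1 ∣ N) {F : ℕ → ℤ → ℤ → ℤ} {a b : ℤ}
    (hper : ∀ j a b c, ((p : ℕ) ^ j : ℤ) ∣ b - c → F j a b = F j a c)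
    (hinv : ∀ j a b s, F j a (b + N * s * a) = F j a b)
    (hsum : ∀ j, m ≤ j → F m a b = ∑ y ∈ range ((p : ℕ) ^ j), ∑ z ∈ range ((p : ℕ) ^ j),
      residueInd p m a y * residueInd p m b z * F j y z) (ha : ¬ (p.1 ^ m : ℤ) ∣ a) : F m a b = 0 := by
  have hdvd : ∀ k : ℕ, (p : ℤ) ^ k ∣ F m a b := fun k => by
    refine ⟨∑ y ∈ range (p.1 ^ (m + k)), residueInd p m a y * F (m + k) y b, ?_⟩
    rw [hsum (m + k) (Nat.le_add_right _ _), ← Nat.add_sub_cancel_left (n := m) (m := k),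
      ← sum_residueInd (Nat.le_add_right m k) b, sum_mul_sum, sum_comm,
      Nat.add_sub_cancel_left]
    refine sum_congr rfl fun z _ => sum_congr rfl fun y _ => ?_
    by_cases hy : (p.1 ^ m : ℤ) ∣ y - a
    swap
    · simp [residueInd, hy]
    by_cases hz : (p.1 ^ m : ℤ) ∣ z - b
    swap
    · simp [residueInd, hz]
    obtain ⟨t, ht⟩ := hz
    obtain ⟨s, hs⟩ := exists_mul_sub_dvd hpN (m + k) (a := y) fun h => ha ((dvd_sub_right h).1 hy)
    have : F (m + k) y z = F (m + k) y b := by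
      rw [← hinv (m + k) y b (t * s)]; refine hper _ _ _ _ ?_
      have e : (z : ℤ) - (b + N * (t * s) * y) = -t * (N * s * y - p.1 ^ m) := by
        linear_combination ht
      rw [e]; exact hs.mul_left _
    rw [this]; ring
  by_contra h0
  obtain ⟨k, hk⟩ := pow_unbounded_of_one_lt (|F m a b|) (mod_cast p.2.one_lt : (1 : ℤ) < p)
  exact h0 (Int.eq_zero_of_abs_lt_dvd (hdvd k) hk)

theorem cellFn_congr {a a' b b' : ℤ} (ha : (p.1 ^ m : ℤ) ∣ a - a') (hb : (p.1 ^ m : ℤ) ∣ b - b') :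
    cellFn Z_[p] (p.1 ^ m) a b = cellFn Z_[p] (p.1 ^ m) a' b' := by
  rw [← slash_one _ (cellFn _ _ (a : ℚ) b)]
  refine slash_cellFn_of_forall (pow_pos p.2.pos m) fun v => ?_
  rw [actVec_one]
  have key : ∀ {a a' : ℤ} (x : ℚ_[p]), (p.1 ^ m : ℤ) ∣ a - a' →
      (∃ w ∈ Z_[p], x = algebraMap ℚ _ (a : ℚ) + (p.1 ^ m : ℕ) * w) →
      ∃ w ∈ Z_[p], x = algebraMap ℚ _ (a' : ℚ) + (p.1 ^ m : ℕ) * w := by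
    rintro a a' x ⟨t, ht⟩ ⟨w, hw, rfl⟩; refine ⟨w + t, add_mem hw (intCast_mem _ t), ?_⟩
    rw [map_intCast, map_intCast, eq_add_of_sub_eq ht]; push_cast; ring
  have ha' := (dvd_sub_comm).1 ha
  have hb' := (dvd_sub_comm).1 hb
  exact ⟨fun h => ⟨key _ ha h.1, key _ hb h.2⟩, fun h => ⟨key _ ha' h.1, key _ hb' h.2⟩⟩

theorem ofSL_mem_Gamma0p (p : Primes) {σ : SL(2, ℤ)} (h : (N : ℤ) ∣ σ.1 1 0) : ofSL σ ∈ Gamma0p p N := by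
  obtain ⟨t, ht⟩ := h
  refine ⟨⟨fun i j => ?_, t, intCast_mem _ t, by rw [mat_ofSL, ht]; push_cast; ring⟩, ?_⟩
  · rw [← map_inv, mat_ofSL, mat_ofSL]; exact ⟨intCast_mem _ _, intCast_mem _ _⟩
  · refine MonoidHom.mem_ker.2 (Units.ext ?_)
    change (mat (ofSL σ)).det = 1
    rw [det_fin_two]; simp only [mat_ofSL]; have := σ.2; rw [det_fin_two] at this
    exact_mod_cast this

theorem apply_cellFn_int_eq_zero (hpN : ¬ p.1 ∣ N) {ν : Dist Z_[p] ℤ}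
    (hν : ∀ γ ∈ Gamma0p p N, γ • ν = ν) (m : ℕ) (a b : ℤ) : ν (cellFn _ (p.1 ^ m) a b) = 0 := by
  by_cases h0 : (0 : Fin 2 → ℚ_[p]) ∈ cell Z_[p] (p.1 ^ m) a b
  · rw [cellFn_eq_zero _ _ _ h0, map_zero]
  have hSL : ∀ (σ : SL(2, ℤ)) (j : ℕ) (a b : ℤ), (N : ℤ) ∣ σ.1 1 0 →
      ν (cellFn _ (p.1 ^ j) (a * σ.1 0 0 + b * σ.1 1 0 : ℤ) (a * σ.1 0 1 + b * σ.1 1 1 : ℤ)) =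
        ν (cellFn _ (p.1 ^ j) a b) := fun σ j a b hσ => by
    have h1 : (ofSL σ • ν) (cellFn _ (p.1 ^ j) a b) = ν (cellFn _ (p.1 ^ j) a b) := by
      rw [hν _ (ofSL_mem_Gamma0p p hσ)]
    rw [Dist.smul_apply, slash_ofSL_cellFn _ (pow_pos p.2.pos j)] at h1; push_cast; exact h1
  have hsum := fun j (hj : m ≤ j) =>  (apply_cellFn_eq_sum ν hj h0).trans (Finset.sum_product _ _ _)
  by_cases ha : (p.1 ^ m : ℤ) ∣ a
  · have hb : ¬ (p.1 ^ m : ℤ) ∣ b := fun hb => h0 (by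
      have := mem_cell_int_iff (p := p) (m := m) (u := a) (x := b) (a := 0) (b := 0)
      rw [zero_sub, zero_sub, dvd_neg, dvd_neg, Int.cast_zero, ratVec_zero] at this
      exact this.2 ⟨ha, hb⟩)
    refine eq_zero_of_shear_invariant (F := fun j b a => ν (cellFn _ ((p : ℕ) ^ j) (a : ℚ) (b : ℚ)))
      hpN (fun j a b c h => by rw [cellFn_congr (b := a) (b' := a) h (by simp)]) (fun j a b s => ?_) (fun j hj => ?_) hb
    · have := hSL ⟨!![1, 0; N * s, 1], by simp [det_fin_two]⟩ j b a (by simp)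
      simpa [mul_comm] using this
    · rw [hsum j hj, sum_comm]; simp only [mul_comm (residueInd p m a _)]
  · refine eq_zero_of_shear_invariant (F := fun j a b => ν (cellFn _ ((p : ℕ) ^ j) (a : ℚ) (b : ℚ)))
      hpN (fun j a b c h => by rw [cellFn_congr (a := a) (a' := a) (by simp) h]) (fun j a b s => ?_) hsum ha
    have := hSL ⟨!![1, N * s; 0, 1], by simp [det_fin_two]⟩ j a b (by simp)
    simpa [mul_comm, add_comm] using this

theorem eq_zero_of_Gamma0p_invariant (hpN : ¬ p.1 ∣ N) {ν : Dist Z_[p] ℤ}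
    (hν : ∀ γ ∈ Gamma0p p N, γ • ν = ν) : ν = 0 := by
  refine (levelSystem_padic p).dist_ext fun m hm i j => ?_
  obtain ⟨e, rfl⟩ := eq_pow_of_mem_primeProducts hm
  have hq : ((p.1 ^ e : ℕ) : ℚ) ≠ 0 := mod_cast hm.1.ne'
  have h := apply_cellFn_int_eq_zero hpN (ν := (scalar _ hq)⁻¹ • ν) (fun γ hγ => by
    have hc : γ * (scalar _ hq)⁻¹ = (scalar _ hq)⁻¹ * γ := by
      rw [mul_inv_eq_iff_eq_mul, mul_assoc, ← scalar_comm, inv_mul_cancel_left]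
    rw [← mul_smul, hc, mul_smul, hν γ hγ]) (e + e) i j
  have h2 := slash_scalar_cellFn Z_[p] hm.1 hq ((i : ℚ) / (p.1 ^ e : ℕ)) ((j : ℚ) / (p.1 ^ e : ℕ))
  rw [mul_div_cancel₀ _ hq, mul_div_cancel₀ _ hq, ← pow_add] at h2
  rw [cast_natCast, cast_natCast, ← h2] at h
  exact (congrArg (fun μ : Dist Z_[p] ℤ => μ (cellFn _ (p.1 ^ e) _ _))
    (smul_inv_smul (scalar _ hq) ν)).symm.trans h

theorem Dist.eq_zero_of_primitive {ν : Dist Z_[p] ℤ} (hscale : ∀ f f' : TestFn Z_[p],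
      (∀ w, f'.1 (fun i => ((p : ℕ) : ℚ_[p]) * w i) = f.1 w) → ν f' = ν f)
    (hprim : ∀ m, 0 < m → ∀ u x : ℤ, ¬ ((p.1 : ℤ) ∣ u ∧ (p.1 : ℤ) ∣ x) →
      ν (cellFn _ (p.1 ^ m) u x) = 0) : ν = 0 := by
  have hp0 : ((p.1 : ℕ) : ℚ) ≠ 0 := Nat.cast_ne_zero.2 p.2.ne_zero
  have hs : ∀ (m : ℕ) (a b : ℚ), ν (cellFn _ (p.1 ^ (m + 1)) (p * a) (p * b)) =
      ν (cellFn _ (p.1 ^ m) a b) := fun m a b => by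
    rw [pow_succ', ← slash_scalar_cellFn _ (pow_pos p.2.pos m) hp0]; refine hscale _ _ fun w => ?_
    change (cellFn _ (p.1 ^ m) a b).1 (actVec _ (scalar p hp0) _) = _
    refine congrArg _ (funext fun i => ?_)
    rw [actVec_scalar, ← mul_assoc, ← map_natCast (algebraMap ℚ ℚ_[p]), ← map_mul,
      inv_mul_cancel₀ hp0, map_one, one_mul]
  have hint : ∀ (m : ℕ) (a b : ℤ), ν (cellFn _ (p.1 ^ m) a b) = 0 := by
    intro m
    induction m with
    | zero =>
      intro a b
      have h0 : (0 : Fin 2 → ℚ_[p]) ∈ cell Z_[p] (p.1 ^ 0) a b := by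
        have := mem_cell_int_iff (p := p) (m := 0) (u := a) (x := b) (a := 0) (b := 0)
        rw [Int.cast_zero, ratVec_zero] at this; exact this.2 (by simp)
      rw [cellFn_eq_zero _ _ _ h0, map_zero]
    | succ m ih =>
      intro a b
      by_cases h : (p.1 : ℤ) ∣ a ∧ (p.1 : ℤ) ∣ b
      · obtain ⟨⟨a', rfl⟩, b', rfl⟩ := h; have := hs m a' b'; push_cast; rw [this, ih]
      · exact hprim _ m.succ_pos a b h
  refine (levelSystem_padic p).dist_ext fun m hm i j => ?_
  obtain ⟨e, rfl⟩ := eq_pow_of_mem_primeProducts hm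
  have hpow : ∀ (k : ℕ) (a b : ℚ), ν (cellFn _ (p.1 ^ (e + k)) ((p : ℚ) ^ k * a) ((p : ℚ) ^ k * b)) =
      ν (cellFn _ (p.1 ^ e) a b) := fun k a b => by
    induction k with
    | zero => simp
    | succ k ih => rw [← ih, ← hs (e + k), add_assoc, ← mul_assoc, ← mul_assoc, ← pow_succ']
  have h1 := hpow e ((i : ℚ) / (p.1 ^ e : ℕ)) ((j : ℚ) / (p.1 ^ e : ℕ))
  have hq : (p.1 : ℚ) ^ e ≠ 0 := pow_ne_zero _ hp0
  rw [Nat.cast_pow, mul_div_cancel₀ _ hq, mul_div_cancel₀ _ hq] at h1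
  rw [Nat.cast_pow, ← h1]
  exact hint (e + e) i j

theorem neg_one_mem_Gamma0p (p : Primes) (N : ℕ) : scalar (-1) (by norm_num) ∈ Gamma0p p N := by
  have h : ofSL (-1 : SL(2, ℤ)) = scalar (-1) (by norm_num) := mat_injective (by
    ext i j; rw [mat_ofSL, mat_scalar]
    fin_cases i <;> fin_cases j <;> simp)
  rw [← h]
  exact ofSL_mem_Gamma0p p (by simp)

theorem neg_one_smul_cusp (r : Cusps p N) : (⟨_, neg_one_mem_Gamma0p p N⟩ : Gamma0p p N) • r = r := by
  obtain ⟨γ, hγ⟩ := exists_gamma r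
  refine Subtype.ext ?_
  change (⟨_, neg_one_mem_Gamma0p p N⟩ : Gamma0p p N) • (r : OnePoint ℚ) = r
  rw [← hγ, ← mul_smul, show (⟨_, neg_one_mem_Gamma0p p N⟩ : Gamma0p p N) * γ =
    γ * ⟨_, neg_one_mem_Gamma0p p N⟩ from Subtype.ext (scalar_comm (-1) (by norm_num) (γ : GQ)), mul_smul]
  congr 1
  exact (cusp_eq_infty_iff _).2 (by
    change mat (scalar (-1) (by norm_num)) 1 0 = 0; rw [mat_scalar]; rfl)

theorem IsDarmonDasguptaFamily.eq {μ μ' : Cusps p N → Cusps p N → Dist Z_[p] ℤ}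
    (h : IsDarmonDasguptaFamily p N n μ) (h' : IsDarmonDasguptaFamily p N n μ') : μ = μ' := by
  funext r s
  rw [← sub_eq_zero]
  have hsub : ∀ f, (μ r s - μ' r s) f = μ r s f - μ' r s f := fun _ => rfl
  refine Dist.eq_zero_of_primitive (fun f f' hf => by
    rw [hsub, hsub, h.2.2 r s f f' hf, h'.2.2 r s f f' hf]) fun m hm u x hux => ?_
  refine apply_cellFn_eq_zero_of_moments (fun a b hab => ?_) hm hux ?_
  · have hh : (MvPolynomial.X 0 ^ a * MvPolynomial.X 1 ^ b : MvPolynomial (Fin 2) ℤ).IsHomogeneous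
        (a + b + 2 - 2) := by
      have := ((isHomogeneous_X ℤ (0 : Fin 2)).pow a).mul ((isHomogeneous_X ℤ (1 : Fin 2)).pow b)
      simpa using this
    obtain ⟨q, hq, hI⟩ := h.1 r s (a + b + 2) (hab.add even_two) (by omega) _ hh
    obtain ⟨q', hq', hI'⟩ := h'.1 r s (a + b + 2) (hab.add even_two) (by omega) _ hh
    have hqq : q = q' := mod_cast hq.trans hq'.symm
    rw [hqq] at hI; have := hI.sub hI'; rw [sub_self] at this; refine this.congr fun j => ?_
    rw [← sum_sub_distrib]; refine sum_congr rfl fun y _ => ?_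
    rw [Dist.mass_sub, Int.cast_sub, mul_sub]
  · have key : ∀ w, (cellFn Z_[p] ((p : ℕ) ^ m) (-u : ℤ) (-x : ℤ)).1
        (mulCol p ((⟨_, neg_one_mem_Gamma0p p N⟩ : Gamma0p p N) : GQ) w) =
        (cellFn Z_[p] (p.1 ^ m) u x).1 w := fun w => by
      have h1 : mulCol p ((⟨_, neg_one_mem_Gamma0p p N⟩ : Gamma0p p N) : GQ) w = -w := by
        change mulCol p (scalar (-1) (by norm_num)) w = _
        funext i
        fin_cases i <;> simp [mulCol, mat_scalar, Matrix.mulVec, dotProduct]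
      rw [h1, cellFn_apply _ (pow_pos p.2.pos m) _ _ (zero_notMem_cell_of_primitive hm fun h => hux h.symm),
        cellFn_apply _ (pow_pos p.2.pos m) _ _ (zero_notMem_cell_of_primitive hm fun h => hux
          ⟨dvd_neg.1 h.2, dvd_neg.1 h.1⟩)]
      have hmem : -w ∈ cell Z_[p] (p.1 ^ m) (-u : ℤ) (-x : ℤ) ↔ w ∈ cell Z_[p] (p.1 ^ m) u x := by
        rw [mem_cell_pow_iff, mem_cell_pow_iff, ← norm_neg (w 0 - _), ← norm_neg (w 1 - _)]
        simp [sub_eq_add_neg, add_comm]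
      exact indicator_congr hmem
    have h1 := h.2.1 _ r s _ _ key
    have h2 := h'.2.1 _ r s _ _ key
    rw [neg_one_smul_cusp, neg_one_smul_cusp] at h1 h2; rw [hsub, hsub, h1, h2]

theorem IsDarmonDasguptaCocycle.eq (hpN : ¬ p.1 ∣ N) {C C' : Z1 (GSN (primesNe p) N) (Dist Z_[p] ℤ)}
    (h : IsDarmonDasguptaCocycle p N n C) (h' : IsDarmonDasguptaCocycle p N n C') : C = C' := by
  obtain ⟨μ, hμ, hC⟩ := h
  obtain ⟨μ', hμ', hC'⟩ := h'
  rw [hμ'.eq hμ] at hC'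
  rw [← sub_eq_zero]
  set Δ := C - C' with hΔ
  have hΓ : ∀ γ₁ γ₂ : Gamma0p p N, Δ.1 (toGSN γ₁) (toGSN γ₂) = 0 := fun γ₁ γ₂ => by
    refine DFunLike.ext _ _ fun f => sub_eq_zero.2 ?_
    have hf : ∀ v, (colHom p (colHom p (colHom p f))).1 (rowToCol v) = f.1 v := fun v => by
      change f.1 (rowToCol (rowToCol (rowToCol (rowToCol v)))) = _
      rw [rowToCol_rowToCol, rowToCol_rowToCol, neg_neg]
    exact (hC γ₁ γ₂ f _ hf).trans (hC' γ₁ γ₂ f _ hf).symm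
  have hone : toGSN (1 : Gamma0p p N) = 1 := rfl
  have hd : ∀ g, Δ.1 1 g = 0 := fun g => eq_zero_of_Gamma0p_invariant hpN fun γ hγ => by
    have hconj : (g : GQ)⁻¹ * γ * g ∈ Gamma0p p N :=
      ⟨(GSN _ N).mul_mem ((GSN _ N).mul_mem ((GSN _ N).inv_mem g.2) hγ.1) g.2, MonoidHom.mem_ker.2 (by
        rw [map_mul, map_mul, map_inv, MonoidHom.mem_ker.1 hγ.2, mul_one, inv_mul_cancel])⟩
    have e : toGSN ⟨γ, hγ⟩ * g = g * toGSN ⟨_, hconj⟩ := Subtype.ext (by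
      change γ * (g : GQ) = g * ((g : GQ)⁻¹ * γ * g)
      group)
    have h1 := Δ.2.1 (toGSN ⟨γ, hγ⟩) 1 g
    have h2 := Δ.2.1 g 1 (toGSN ⟨_, hconj⟩)
    rw [← hone, hΓ, smul_zero, hone, mul_one] at h2
    rw [mul_one, Z1.add Δ _ 1, ← hone, hΓ, zero_add, hone, e, Z1.add Δ 1 g, h2, add_zero] at h1
    exact h1.symm
  refine Subtype.ext (funext fun g₀ => funext fun g₁ => ?_)
  rw [Z1.eq_smul_one, hd, smul_zero]
  rfl

end

end DedekindRademacher

open DedekindRademacher in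
theorem theorem2 (c N : ℕ) (p : Nat.Primes) (n : ℕ → ℤ) (hc : 1 < c) (hc6 : c.Coprime 6)
    (hN : 0 < N) (hNc : N.Coprime c) (hp : p ∉ primesOf (c * N))
    (hn : ∑ D ∈ N.divisors, n D * (D : ℤ) = 0) : (∃! ξ, IsDedekindRademacherClass c ξ) ∧
    (∃! C, IsDarmonDasguptaCocycle p N n C) ∧
    ∀ ξ, IsDedekindRademacherClass c ξ → ∀ C, IsDarmonDasguptaCocycle p N n C →
      cls (-smoothC c (Nat.cast_ne_zero.2 (Nat.ne_of_gt (Nat.lt_trans Nat.zero_lt_one hc))) C) =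
      12 • restrictPadic c N p hp (smoothDelta c N hNc n ξ) := by
  have hpN := (not_dvd_of_notMem_primesOf hp).2
  have hC := siegelCocycle_isDarmonDasguptaCocycle hpN hn hN
  refine ⟨existsUnique_dedekindRademacherClass hc6, ⟨_, hC, fun C' h => h.eq hpN hC⟩,
    fun ξ hξ C h => ?_⟩
  rw [h.eq hpN hC]
  exact cls_neg_smoothC_siegelCocycle hc6 _ hN hNc hp hpN hn hξ
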